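/- Let $\Bbbk$ be a field of characteristic zero. **The category.** Let $\mathcal H'$ be Khovanov's Heisenberg category over $\Bbbk$: the additive $\Bbbk$-linear monoidal category generated by two objects $Q_+$ (upward strand) and $Q_-$ (downward strand), whose morphisms between tensor words in $Q_\pm$ are $\Bbbk$-linear combinations of string diagrams, read from bottom to top, generated by the crossing $Q_+Q_+\to Q_+Q_+$ and the four oriented caps and cups $Q_+Q_-\to\mathbf 1$, $\mathbf 1\to Q_+Q_-$ (clockwise), $Q_-Q_+\to\mathbf 1$, $\mathbf 1\to Q_-Q_+$ (counterclockwise), modulo planar isotopy and the following local relations. The crossing of two strands with the same orientation squares to the identity and satisfies the braid relation (for upward and for downward strands). With the crossings $Q_+Q_-\to Q_-Q_+$ and $Q_-Q_+\to Q_+Q_-$ obtained by rotation, the double crossing $Q_+Q_-\to Q_-Q_+\to Q_+Q_-$ is the identity, and the double crossing $Q_-Q_+\to Q_+Q_-\to Q_-Q_+$ is the identity minus the composite $Q_-Q_+\to\mathbf 1\to Q_-Q_+$ of cap and cup. The counterclockwise circle equals $1$. An upward strand with a curl on its left equals $0$. Let $\mathcal H$ be the Karoubi envelope of $\mathcal H'$,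 and $\mathcal K(\mathcal H)$ the homotopy category of unbounded chain complexes in $\mathcal H$, with differentials lowering the homological degree by one. The shift is $A[s]_i=A_{i-s}$. The tensor product of complexes is the total complex formed with direct sums, with differential $d\otimes 1+(-1)^{p}\,1\otimes d$ on the summand whose first factor has degree $p$. **The complexes.** For $n\ge 0$ let $\mathsf P^{(n)}$ and $\mathsf P^{(n)^t}$ be the images in $\mathcal H$ of the symmetrizer $\frac1{n!}\sum_{\sigma\in S_n}\sigma$ and of the antisymmetrizer $\frac1{n!}\sum_{\sigma\in S_n}\operatorname{sgn}(\sigma)\sigma$ acting on $Q_+^{\otimes n}$ by crossings, and let $\mathsf Q^{(n)},\mathsf Q^{(n)^t}$ be the images of the symmetrizer and the antisymmetrizer acting on $Q_-^{\otimes n}$. For $a\in\mathbb Z$ put $$\mathsf B_a=\Big\{\bigoplus_{x-y=a}\mathsf P^{(x)}\mathsf Q^{(y)^t}[y],\ \mathsf d\Big\},\qquad \mathsf B_a^*=\Big\{\bigoplus_{y-x=a}\mathsf P^{(x)^t}\mathsf Q^{(y)}[-x],\ \mathsf d^*\Big\}\qquad(x,y\ge 0),$$ where $[s]$ places the object in homological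 degree $s$. The map $\mathsf d:\mathsf P^{(x)}\mathsf Q^{(y)^t}\to\mathsf P^{(x-1)}\mathsf Q^{(y-1)^t}$ joins the two innermost strands by the clockwise cap $Q_+Q_-\to\mathbf 1$, between the idempotents of the source and of the target. The map $\mathsf d^*:\mathsf P^{(x)^t}\mathsf Q^{(y)}\to\mathsf P^{(x+1)^t}\mathsf Q^{(y+1)}$ inserts the clockwise cup $\mathbf 1\to Q_+Q_-$ between the upward and the downward strands, again between the idempotents of the source and of the target. **Theorem.** For all $a,b\in\mathbb Z$, the following hold in $\mathcal K(\mathcal H)$: $$\mathsf B_{a-1}\otimes\mathsf B_a\simeq 0,\qquad \mathsf B_{a-1}\otimes\mathsf B_b\simeq\begin{cases}\mathsf B_{b-1}\otimes\mathsf B_a[1]&\text{if } a<b,\\ \mathsf B_{b-1}\otimes\mathsf B_a[-1]&\text{if } a>b,\end{cases}$$ $$\mathsf B^*_{a+1}\otimes\mathsf B^*_a\simeq 0,\qquad \mathsf B^*_{a+1}\otimes\mathsf B^*_b\simeq\begin{cases}\mathsf B^*_{b+1}\otimes\mathsf B^*_a[1]&\text{if } a<b,\\ \mathsf B^*_{b+1}\otimes\mathsf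 B^*_a[-1]&\text{if } a>b.\end{cases}$$ -/

import Mathlib

open CategoryTheory CategoryTheory.Limits MonoidalCategory

universe u

namespace Heis

/-! ### Khovanov's category: objects and formal diagrams -/

/-- Words in the two generating objects `Q_+` (`up`) and `Q_-` (`down`). Words are kept bracketed,
so that the tensor product is associative and unital only up to the isomorphisms
`Diagram.assoc`, `Diagram.lunit`, `Diagram.runit`. -/
inductive Word : Type
  | unit : Word
  | up : Word
  | down : Word
  | tensor (X Y : Word) : Word

open Word

/-- Formal `k`-linear combinations of formal string diagrams, built by vertical composition
(`comp f g` is `f` at the bottom, `g` on top) and horizontal composition (`tensor f g` is `f` on the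
left, `g` on the right) from the crossing of two upward strands, the four cups and caps, and the
structural isomorphisms of a monoidal category. -/
inductive Diagram (k : Type u) : Word → Word → Type u
  | id (X : Word) : Diagram k X X
  | comp {X Y Z : Word} (f : Diagram k X Y) (g : Diagram k Y Z) : Diagram k X Z
  | tensor {X Y X' Y' : Word} (f : Diagram k X Y) (g : Diagram k X' Y') :
      Diagram k (X.tensor X') (Y.tensor Y')
  | assoc (X Y Z : Word) : Diagram k ((X.tensor Y).tensor Z) (X.tensor (Y.tensor Z))
  | assocInv (X Y Z : Word) : Diagram k (X.tensor (Y.tensor Z)) ((X.tensor Y).tensor Z)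
  | lunit (X : Word) : Diagram k (unit.tensor X) X
  | lunitInv (X : Word) : Diagram k X (unit.tensor X)
  | runit (X : Word) : Diagram k (X.tensor unit) X
  | runitInv (X : Word) : Diagram k X (X.tensor unit)
  | zero (X Y : Word) : Diagram k X Y
  | add {X Y : Word} (f g : Diagram k X Y) : Diagram k X Y
  | smul {X Y : Word} (c : k) (f : Diagram k X Y) : Diagram k X Y
  | crossing : Diagram k (up.tensor up) (up.tensor up)
  | capUpDown : Diagram k (up.tensor down) unit
  | cupUpDown : Diagram k unit (up.tensor down)
  | capDownUp : Diagram k (down.tensor up) unit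
  | cupDownUp : Diagram k unit (down.tensor up)

namespace Diagram

variable {k : Type u}

local infixr:80 " ⊚ " => Diagram.comp
local infixr:85 " ⊠ " => Diagram.tensor

/-- Rotation of a diagram by bending its top left strand `Q_+` down on the left and its
bottom right strand `Q_+` up on the right. -/
def rotR {X Y : Word} (f : Diagram k (X.tensor up) (up.tensor Y)) :
    Diagram k (down.tensor X) (Y.tensor down) :=
  runitInv (down.tensor X) ⊚
  (id (down.tensor X) ⊠ cupUpDown) ⊚
  assocInv (down.tensor X) up down ⊚
  (assoc down X up ⊠ id down) ⊚
  ((id down ⊠ f) ⊠ id down) ⊚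
  (assocInv down up Y ⊠ id down) ⊚
  ((capDownUp ⊠ id Y) ⊠ id down) ⊚
  (lunit Y ⊠ id down)

/-- Rotation of a diagram by bending its top right strand `Q_+` down on the right and its
bottom left strand `Q_+` up on the left. -/
def rotL {X Y : Word} (f : Diagram k (up.tensor X) (Y.tensor up)) :
    Diagram k (X.tensor down) (down.tensor Y) :=
  lunitInv (X.tensor down) ⊚
  (cupDownUp ⊠ id (X.tensor down)) ⊚
  assoc down up (X.tensor down) ⊚
  (id down ⊠ assocInv up X down) ⊚
  (id down ⊠ (f ⊠ id down)) ⊚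
  (id down ⊠ assoc Y up down) ⊚
  (id down ⊠ (id Y ⊠ capUpDown)) ⊚
  (id down ⊠ runit Y)

/-- The crossing `Q_- Q_+ ⟶ Q_+ Q_-`. -/
def crossingDownUp : Diagram k (down.tensor up) (up.tensor down) := rotR crossing

/-- The crossing `Q_+ Q_- ⟶ Q_- Q_+`. -/
def crossingUpDown : Diagram k (up.tensor down) (down.tensor up) := rotL crossing

/-- The crossing of two downward strands. -/
def crossingDown : Diagram k (down.tensor down) (down.tensor down) := rotR crossingDownUp

/-- A diagram on three equally oriented strands: `f` on the left two strands. -/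
def onLeft {X : Word} (f : Diagram k (X.tensor X) (X.tensor X)) :
    Diagram k ((X.tensor X).tensor X) ((X.tensor X).tensor X) := f ⊠ id X

/-- A diagram on three equally oriented strands: `f` on the right two strands. -/
def onRight {X : Word} (f : Diagram k (X.tensor X) (X.tensor X)) :
    Diagram k ((X.tensor X).tensor X) ((X.tensor X).tensor X) :=
  assoc X X X ⊚ (id X ⊠ f) ⊚ assocInv X X X

/-- The relations between formal diagrams: the axioms of a `k`-linear monoidal category,
planar isotopy, and the local relations of Khovanov's category. -/
inductive Rel [CommRing k] : ∀ {X Y : Word}, Diagram k X Y → Diagram k X Y → Prop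
  -- congruence
  | refl {X Y : Word} (f : Diagram k X Y) : Rel f f
  | symm {X Y : Word} {f g : Diagram k X Y} : Rel f g → Rel g f
  | trans {X Y : Word} {f g h : Diagram k X Y} : Rel f g → Rel g h → Rel f h
  | comp {X Y Z : Word} {f f' : Diagram k X Y} {g g' : Diagram k Y Z} :
      Rel f f' → Rel g g' → Rel (f ⊚ g) (f' ⊚ g')
  | tensor {X Y X' Y' : Word} {f f' : Diagram k X Y} {g g' : Diagram k X' Y'} :
      Rel f f' → Rel g g' → Rel (f ⊠ g) (f' ⊠ g')
  | add {X Y : Word} {f f' g g' : Diagram k X Y} :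
      Rel f f' → Rel g g' → Rel (f.add g) (f'.add g')
  | smul {X Y : Word} (c : k) {f f' : Diagram k X Y} : Rel f f' → Rel (f.smul c) (f'.smul c)
  -- category
  | id_comp {X Y : Word} (f : Diagram k X Y) : Rel (id X ⊚ f) f
  | comp_id {X Y : Word} (f : Diagram k X Y) : Rel (f ⊚ id Y) f
  | comp_assoc {X Y Z W : Word} (f : Diagram k X Y) (g : Diagram k Y Z) (h : Diagram k Z W) :
      Rel ((f ⊚ g) ⊚ h) (f ⊚ g ⊚ h)
  -- monoidal category
  | tensor_id (X Y : Word) : Rel (id X ⊠ id Y) (id (X.tensor Y))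
  | tensor_comp {X Y Z X' Y' Z' : Word} (f : Diagram k X Y) (f' : Diagram k X' Y')
      (g : Diagram k Y Z) (g' : Diagram k Y' Z') :
      Rel ((f ⊠ f') ⊚ (g ⊠ g')) ((f ⊚ g) ⊠ (f' ⊚ g'))
  | assoc_assocInv (X Y Z : Word) : Rel (assoc X Y Z ⊚ assocInv X Y Z) (id _)
  | assocInv_assoc (X Y Z : Word) : Rel (assocInv X Y Z ⊚ assoc X Y Z) (id _)
  | assoc_naturality {X Y Z X' Y' Z' : Word} (f : Diagram k X X') (g : Diagram k Y Y')
      (h : Diagram k Z Z') :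
      Rel (((f ⊠ g) ⊠ h) ⊚ assoc X' Y' Z') (assoc X Y Z ⊚ (f ⊠ (g ⊠ h)))
  | lunit_lunitInv (X : Word) : Rel (lunit X ⊚ lunitInv X) (id _)
  | lunitInv_lunit (X : Word) : Rel (lunitInv X ⊚ lunit X) (id _)
  | lunit_naturality {X Y : Word} (f : Diagram k X Y) :
      Rel ((id unit ⊠ f) ⊚ lunit Y) (lunit X ⊚ f)
  | runit_runitInv (X : Word) : Rel (runit X ⊚ runitInv X) (id _)
  | runitInv_runit (X : Word) : Rel (runitInv X ⊚ runit X) (id _)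
  | runit_naturality {X Y : Word} (f : Diagram k X Y) :
      Rel ((f ⊠ id unit) ⊚ runit Y) (runit X ⊚ f)
  | pentagon (W X Y Z : Word) :
      Rel ((assoc W X Y ⊠ id Z) ⊚ assoc W (X.tensor Y) Z ⊚ (id W ⊠ assoc X Y Z))
        (assoc (W.tensor X) Y Z ⊚ assoc W X (Y.tensor Z))
  | triangle (X Y : Word) :
      Rel (assoc X unit Y ⊚ (id X ⊠ lunit Y)) (runit X ⊠ id Y)
  -- `k`-linearity
  | add_comm {X Y : Word} (f g : Diagram k X Y) : Rel (f.add g) (g.add f)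
  | add_assoc {X Y : Word} (f g h : Diagram k X Y) :
      Rel ((f.add g).add h) (f.add (g.add h))
  | zero_add {X Y : Word} (f : Diagram k X Y) : Rel ((zero X Y).add f) f
  | zero_smul {X Y : Word} (f : Diagram k X Y) : Rel (f.smul 0) (zero X Y)
  | one_smul {X Y : Word} (f : Diagram k X Y) : Rel (f.smul 1) f
  | mul_smul {X Y : Word} (c c' : k) (f : Diagram k X Y) :
      Rel (f.smul (c * c')) ((f.smul c').smul c)
  | smul_add {X Y : Word} (c : k) (f g : Diagram k X Y) :
      Rel ((f.add g).smul c) ((f.smul c).add (g.smul c))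
  | add_smul {X Y : Word} (c c' : k) (f : Diagram k X Y) :
      Rel (f.smul (c + c')) ((f.smul c).add (f.smul c'))
  | add_comp {X Y Z : Word} (f f' : Diagram k X Y) (g : Diagram k Y Z) :
      Rel ((f.add f') ⊚ g) ((f ⊚ g).add (f' ⊚ g))
  | comp_add {X Y Z : Word} (f : Diagram k X Y) (g g' : Diagram k Y Z) :
      Rel (f ⊚ (g.add g')) ((f ⊚ g).add (f ⊚ g'))
  | smul_comp {X Y Z : Word} (c : k) (f : Diagram k X Y) (g : Diagram k Y Z) :
      Rel ((f.smul c) ⊚ g) ((f ⊚ g).smul c)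
  | comp_smul {X Y Z : Word} (c : k) (f : Diagram k X Y) (g : Diagram k Y Z) :
      Rel (f ⊚ (g.smul c)) ((f ⊚ g).smul c)
  | add_tensor {X Y X' Y' : Word} (f f' : Diagram k X Y) (g : Diagram k X' Y') :
      Rel ((f.add f') ⊠ g) ((f ⊠ g).add (f' ⊠ g))
  | tensor_add {X Y X' Y' : Word} (f : Diagram k X Y) (g g' : Diagram k X' Y') :
      Rel (f ⊠ (g.add g')) ((f ⊠ g).add (f ⊠ g'))
  | smul_tensor {X Y X' Y' : Word} (c : k) (f : Diagram k X Y) (g : Diagram k X' Y') :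
      Rel ((f.smul c) ⊠ g) ((f ⊠ g).smul c)
  | tensor_smul {X Y X' Y' : Word} (c : k) (f : Diagram k X Y) (g : Diagram k X' Y') :
      Rel (f ⊠ (g.smul c)) ((f ⊠ g).smul c)
  -- planar isotopy: straightening of strands, and the two rotations of the crossing by a half
  -- turn agree
  | zigzag_up : Rel
      (lunitInv up ⊚ (cupUpDown ⊠ id up) ⊚ assoc up down up ⊚ (id up ⊠ capDownUp) ⊚ runit up)
      (id up)
  | zigzag_down : Rel
      (runitInv down ⊚ (id down ⊠ cupUpDown) ⊚ assocInv down up down ⊚ (capDownUp ⊠ id down) ⊚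
        lunit down)
      (id down)
  | zigzag_up' : Rel
      (runitInv up ⊚ (id up ⊠ cupDownUp) ⊚ assocInv up down up ⊚ (capUpDown ⊠ id up) ⊚ lunit up)
      (id up)
  | zigzag_down' : Rel
      (lunitInv down ⊚ (cupDownUp ⊠ id down) ⊚ assoc down up down ⊚ (id down ⊠ capUpDown) ⊚
        runit down)
      (id down)
  | cyclicity : Rel (rotR (rotR crossing)) (rotL (rotL crossing))
  -- symmetric group relations, for upward and for downward strands
  | double_up : Rel (crossing ⊚ crossing) (id _)
  | double_down : Rel (crossingDown ⊚ crossingDown) (id _)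
  | triple_up : Rel
      (onLeft crossing ⊚ onRight crossing ⊚ onLeft crossing)
      (onRight crossing ⊚ onLeft crossing ⊚ onRight crossing)
  | triple_down : Rel
      (onLeft crossingDown ⊚ onRight crossingDown ⊚ onLeft crossingDown)
      (onRight crossingDown ⊚ onLeft crossingDown ⊚ onRight crossingDown)
  -- the mixed double crossings
  | double_upDown : Rel (crossingUpDown ⊚ crossingDownUp) (id _)
  | double_downUp : Rel (crossingDownUp ⊚ crossingUpDown)
      ((id _).add ((capDownUp ⊚ cupDownUp).smul (-1)))
  -- the counterclockwise circle is `1`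
  | bubble : Rel (cupDownUp ⊚ capDownUp) (id unit)
  -- the left curl is `0`
  | curl : Rel
      (lunitInv up ⊚ (cupDownUp ⊠ id up) ⊚ assoc down up up ⊚ (id down ⊠ crossing) ⊚
        assocInv down up up ⊚ (capDownUp ⊠ id up) ⊚ lunit up)
      (zero up up)

/-- Equivalence of formal diagrams. -/
instance setoid (k : Type u) [CommRing k] (X Y : Word) : Setoid (Diagram k X Y) :=
  ⟨Rel, ⟨Rel.refl, Rel.symm, Rel.trans⟩⟩

end Diagram

/-- The `k`-linear monoidal category of words in `Q_+`, `Q_-` and diagrams modulo relations. -/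
def DiagCat (_k : Type u) : Type := Word

namespace DiagCat

variable (k : Type u) [CommRing k]

instance : Category.{u} (DiagCat k) where
  Hom X Y := Quotient (Diagram.setoid k X Y)
  id X := ⟦Diagram.id X⟧
  comp := Quotient.map₂ Diagram.comp fun _ _ h _ _ h' => Diagram.Rel.comp h h'
  id_comp := by rintro X Y ⟨f⟩; exact Quotient.sound (Diagram.Rel.id_comp f)
  comp_id := by rintro X Y ⟨f⟩; exact Quotient.sound (Diagram.Rel.comp_id f)
  assoc := by rintro X Y Z W ⟨f⟩ ⟨g⟩ ⟨h⟩; exact Quotient.sound (Diagram.Rel.comp_assoc f g h)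

variable {k} in
/-- The morphism given by a formal diagram. -/
def mk {X Y : Word} (f : Diagram k X Y) : @Quiver.Hom (DiagCat k) _ X Y := ⟦f⟧

instance (X Y : DiagCat k) : Zero (X ⟶ Y) := ⟨mk (Diagram.zero X Y)⟩

instance (X Y : DiagCat k) : Add (X ⟶ Y) :=
  ⟨Quotient.map₂ Diagram.add fun _ _ h _ _ h' => Diagram.Rel.add h h'⟩

instance (X Y : DiagCat k) : Neg (X ⟶ Y) :=
  ⟨Quotient.map (Diagram.smul (-1)) fun _ _ h => Diagram.Rel.smul (-1) h⟩

instance (X Y : DiagCat k) : AddCommGroup (X ⟶ Y) where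
  add_assoc := by rintro ⟨f⟩ ⟨g⟩ ⟨h⟩; exact Quotient.sound (Diagram.Rel.add_assoc f g h)
  zero_add := by rintro ⟨f⟩; exact Quotient.sound (Diagram.Rel.zero_add f)
  add_zero := by
    rintro ⟨f⟩
    exact Quotient.sound ((Diagram.Rel.add_comm _ _).trans (Diagram.Rel.zero_add f))
  add_comm := by rintro ⟨f⟩ ⟨g⟩; exact Quotient.sound (Diagram.Rel.add_comm f g)
  neg_add_cancel := by
    rintro ⟨f⟩
    have h := (Diagram.Rel.add_smul (-1) 1 f).symm
    rw [neg_add_cancel] at h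
    exact Quotient.sound ((Diagram.Rel.add (Diagram.Rel.refl _)
      (Diagram.Rel.one_smul f).symm).trans (h.trans (Diagram.Rel.zero_smul f)))
  nsmul := nsmulRec
  zsmul := zsmulRec

instance (X Y : DiagCat k) : Module k (X ⟶ Y) where
  smul c := Quotient.map (Diagram.smul c) fun _ _ h => Diagram.Rel.smul c h
  one_smul := by rintro ⟨f⟩; exact Quotient.sound (Diagram.Rel.one_smul f)
  mul_smul := by rintro c c' ⟨f⟩; exact Quotient.sound (Diagram.Rel.mul_smul c c' f)
  smul_add := by rintro c ⟨f⟩ ⟨g⟩; exact Quotient.sound (Diagram.Rel.smul_add c f g)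
  add_smul := by rintro c c' ⟨f⟩; exact Quotient.sound (Diagram.Rel.add_smul c c' f)
  zero_smul := by rintro ⟨f⟩; exact Quotient.sound (Diagram.Rel.zero_smul f)
  smul_zero := by
    intro c
    refine Quotient.sound ?_
    have h (c : k) := Diagram.Rel.smul c (Diagram.Rel.zero_smul (Diagram.zero X Y)).symm
    have h' := Diagram.Rel.mul_smul c 0 (Diagram.zero X Y)
    rw [mul_zero] at h'
    exact (h c).trans (h'.symm.trans (Diagram.Rel.zero_smul _))

instance : Preadditive (DiagCat k) where
  add_comp := by rintro X Y Z ⟨f⟩ ⟨f'⟩ ⟨g⟩; exact Quotient.sound (Diagram.Rel.add_comp f f' g)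
  comp_add := by rintro X Y Z ⟨f⟩ ⟨g⟩ ⟨g'⟩; exact Quotient.sound (Diagram.Rel.comp_add f g g')

instance : Linear k (DiagCat k) where
  smul_comp := by rintro X Y Z c ⟨f⟩ ⟨g⟩; exact Quotient.sound (Diagram.Rel.smul_comp c f g)
  comp_smul := by rintro X Y Z ⟨f⟩ c ⟨g⟩; exact Quotient.sound (Diagram.Rel.comp_smul c f g)

/-- Horizontal composition of morphisms. -/
def tensorHom {X Y X' Y' : DiagCat k} (f : X ⟶ Y) (g : X' ⟶ Y') :
    @Quiver.Hom (DiagCat k) _ (Word.tensor X X') (Word.tensor Y Y') :=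
  Quotient.map₂ Diagram.tensor (fun _ _ h _ _ h' => Diagram.Rel.tensor h h') f g

instance : MonoidalCategoryStruct (DiagCat k) where
  tensorObj := Word.tensor
  tensorUnit := Word.unit
  tensorHom f g := tensorHom k f g
  whiskerLeft X _ _ f := tensorHom k (𝟙 X) f
  whiskerRight f Y := tensorHom k f (𝟙 Y)
  associator X Y Z :=
    { hom := mk (Diagram.assoc X Y Z)
      inv := mk (Diagram.assocInv X Y Z)
      hom_inv_id := Quotient.sound (Diagram.Rel.assoc_assocInv X Y Z)
      inv_hom_id := Quotient.sound (Diagram.Rel.assocInv_assoc X Y Z) }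
  leftUnitor X :=
    { hom := mk (Diagram.lunit X)
      inv := mk (Diagram.lunitInv X)
      hom_inv_id := Quotient.sound (Diagram.Rel.lunit_lunitInv X)
      inv_hom_id := Quotient.sound (Diagram.Rel.lunitInv_lunit X) }
  rightUnitor X :=
    { hom := mk (Diagram.runit X)
      inv := mk (Diagram.runitInv X)
      hom_inv_id := Quotient.sound (Diagram.Rel.runit_runitInv X)
      inv_hom_id := Quotient.sound (Diagram.Rel.runitInv_runit X) }

instance : MonoidalCategory (DiagCat k) :=
  MonoidalCategory.ofTensorHom
    (id_tensorHom_id := fun X Y => Quotient.sound (Diagram.Rel.tensor_id X Y))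
    (id_tensorHom := fun _ _ _ _ => rfl)
    (tensorHom_id := fun _ _ => rfl)
    (tensorHom_comp_tensorHom := by
      rintro X Y Z X' Y' Z' ⟨f⟩ ⟨f'⟩ ⟨g⟩ ⟨g'⟩
      exact Quotient.sound (Diagram.Rel.tensor_comp f f' g g'))
    (associator_naturality := by
      rintro X Y Z X' Y' Z' ⟨f⟩ ⟨g⟩ ⟨h⟩
      exact Quotient.sound (Diagram.Rel.assoc_naturality f g h))
    (leftUnitor_naturality := by
      rintro X Y ⟨f⟩; exact Quotient.sound (Diagram.Rel.lunit_naturality f))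
    (rightUnitor_naturality := by
      rintro X Y ⟨f⟩; exact Quotient.sound (Diagram.Rel.runit_naturality f))
    (pentagon := fun W X Y Z => Quotient.sound (Diagram.Rel.pentagon W X Y Z))
    (triangle := fun X Y => Quotient.sound (Diagram.Rel.triangle X Y))

theorem tensorHom_add' {X Y X' Y' : DiagCat k} (f : X ⟶ Y) (g g' : X' ⟶ Y') :
    (f ⊗ₘ (g + g')) = f ⊗ₘ g + f ⊗ₘ g' := by
  revert f g g'
  rintro ⟨f⟩ ⟨g⟩ ⟨g'⟩
  exact Quotient.sound (Diagram.Rel.tensor_add f g g')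

theorem add_tensorHom' {X Y X' Y' : DiagCat k} (f f' : X ⟶ Y) (g : X' ⟶ Y') :
    (f + f') ⊗ₘ g = f ⊗ₘ g + f' ⊗ₘ g := by
  revert f f' g
  rintro ⟨f⟩ ⟨f'⟩ ⟨g⟩
  exact Quotient.sound (Diagram.Rel.add_tensor f f' g)

theorem tensorHom_smul' {X Y X' Y' : DiagCat k} (c : k) (f : X ⟶ Y) (g : X' ⟶ Y') :
    (f ⊗ₘ (c • g)) = c • (f ⊗ₘ g) := by
  revert f g
  rintro ⟨f⟩ ⟨g⟩
  exact Quotient.sound (Diagram.Rel.tensor_smul c f g)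

theorem smul_tensorHom' {X Y X' Y' : DiagCat k} (c : k) (f : X ⟶ Y) (g : X' ⟶ Y') :
    (c • f) ⊗ₘ g = c • (f ⊗ₘ g) := by
  revert f g
  rintro ⟨f⟩ ⟨g⟩
  exact Quotient.sound (Diagram.Rel.smul_tensor c f g)

instance : MonoidalPreadditive (DiagCat k) where
  whiskerLeft_add f g := tensorHom_add' k _ f g
  add_whiskerRight f g := add_tensorHom' k f g _
  whiskerLeft_zero {X Y Z} := by
    have h := tensorHom_add' k (𝟙 X) (0 : Y ⟶ Z) 0
    rw [add_zero] at h
    exact left_eq_add.mp h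
  zero_whiskerRight {X Y Z} := by
    have h := add_tensorHom' k (0 : Y ⟶ Z) 0 (𝟙 X)
    rw [add_zero] at h
    exact left_eq_add.mp h

instance : MonoidalLinear k (DiagCat k) where
  whiskerLeft_smul _ _ _ c f := tensorHom_smul' k c _ f
  smul_whiskerRight c _ _ f _ := smul_tensorHom' k c f _

/-- The generating object `Q_+`. -/
def Qp : DiagCat k := Word.up

/-- The generating object `Q_-`. -/
def Qm : DiagCat k := Word.down

/-- The crossing of two upward strands. -/
def crossUp : Qp k ⊗ Qp k ⟶ Qp k ⊗ Qp k := mk Diagram.crossing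

/-- The crossing of two downward strands. -/
def crossDown : Qm k ⊗ Qm k ⟶ Qm k ⊗ Qm k := mk Diagram.crossingDown

/-- The clockwise cap. -/
def cap : Qp k ⊗ Qm k ⟶ 𝟙_ (DiagCat k) := mk Diagram.capUpDown

/-- The clockwise cup. -/
def cup : 𝟙_ (DiagCat k) ⟶ Qp k ⊗ Qm k := mk Diagram.cupUpDown

/-- The counterclockwise cap. -/
def cap' : Qm k ⊗ Qp k ⟶ 𝟙_ (DiagCat k) := mk Diagram.capDownUp

/-- The counterclockwise cup. -/
def cup' : 𝟙_ (DiagCat k) ⟶ Qm k ⊗ Qp k := mk Diagram.cupDownUp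

theorem crossUp_sq : crossUp k ≫ crossUp k = 𝟙 _ := Quotient.sound Diagram.Rel.double_up

theorem crossDown_sq : crossDown k ≫ crossDown k = 𝟙 _ := Quotient.sound Diagram.Rel.double_down

/-- The braid relation for an endomorphism of `X ⊗ X`. -/
def Braid {C : Type*} [Category C] [MonoidalCategory C] {X : C} (s : X ⊗ X ⟶ X ⊗ X) : Prop :=
  s ▷ X ≫ ((α_ X X X).hom ≫ X ◁ s ≫ (α_ X X X).inv) ≫ s ▷ X =
    ((α_ X X X).hom ≫ X ◁ s ≫ (α_ X X X).inv) ≫ s ▷ X ≫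
      ((α_ X X X).hom ≫ X ◁ s ≫ (α_ X X X).inv)

theorem crossUp_braid : Braid (crossUp k) := Quotient.sound Diagram.Rel.triple_up

theorem crossDown_braid : Braid (crossDown k) := Quotient.sound Diagram.Rel.triple_down

theorem zigzag_cup_cap' : (ρ_ (Qm k)).inv ≫ Qm k ◁ cup k ≫ (α_ _ _ _).inv ≫ cap' k ▷ Qm k ≫
    (λ_ (Qm k)).hom = 𝟙 _ := Quotient.sound Diagram.Rel.zigzag_down

theorem zigzag_cup_cap'_up : (λ_ (Qp k)).inv ≫ cup k ▷ Qp k ≫ (α_ _ _ _).hom ≫ Qp k ◁ cap' k ≫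
    (ρ_ (Qp k)).hom = 𝟙 _ := Quotient.sound Diagram.Rel.zigzag_up

theorem zigzag_cup'_cap : (ρ_ (Qp k)).inv ≫ Qp k ◁ cup' k ≫ (α_ _ _ _).inv ≫ cap k ▷ Qp k ≫
    (λ_ (Qp k)).hom = 𝟙 _ := Quotient.sound Diagram.Rel.zigzag_up'

end DiagCat

section Slide

variable {C : Type*} [Category C] [MonoidalCategory C] {u d : C}

/-- Rotation to the right, in any monoidal category. -/
def rotR (coev : 𝟙_ C ⟶ u ⊗ d) (ev : d ⊗ u ⟶ 𝟙_ C) {x y : C} (f : x ⊗ u ⟶ u ⊗ y) :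
    d ⊗ x ⟶ y ⊗ d :=
  (ρ_ (d ⊗ x)).inv ≫ (d ⊗ x) ◁ coev ≫ (α_ (d ⊗ x) u d).inv ≫ (α_ d x u).hom ▷ d ≫
    (d ◁ f) ▷ d ≫ (α_ d u y).inv ▷ d ≫ (ev ▷ y) ▷ d ≫ (λ_ y).hom ▷ d

/-- Rotation to the left, in any monoidal category. -/
def rotL (coev : 𝟙_ C ⟶ d ⊗ u) (ev : u ⊗ d ⟶ 𝟙_ C) {x y : C} (f : u ⊗ x ⟶ y ⊗ u) :
    x ⊗ d ⟶ d ⊗ y :=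
  (λ_ (x ⊗ d)).inv ≫ coev ▷ (x ⊗ d) ≫ (α_ d u (x ⊗ d)).hom ≫ d ◁ (α_ u x d).inv ≫
    d ◁ (f ▷ d) ≫ d ◁ (α_ y u d).hom ≫ d ◁ (y ◁ ev) ≫ d ◁ (ρ_ y).hom

theorem cap_slide (coev : 𝟙_ C ⟶ d ⊗ u) (ev : u ⊗ d ⟶ 𝟙_ C)
    (zz : (ρ_ u).inv ≫ u ◁ coev ≫ (α_ _ _ _).inv ≫ ev ▷ u ≫ (λ_ u).hom = 𝟙 _)
    {x y : C} (f : u ⊗ x ⟶ y ⊗ u) :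
    u ◁ rotL coev ev f ≫ (α_ u d y).inv ≫ ev ▷ y ≫ (λ_ y).hom =
      (α_ u x d).inv ≫ f ▷ d ≫ (α_ y u d).hom ≫ y ◁ ev ≫ (ρ_ y).hom := by
  have h : u ◁ rotL coev ev f ≫ (α_ u d y).inv ≫ ev ▷ y ≫ (λ_ y).hom =
      ((ρ_ u).inv ≫ u ◁ coev ≫ (α_ _ _ _).inv ≫ ev ▷ u ≫ (λ_ u).hom) ▷ (x ⊗ d) ≫
      (α_ u x d).inv ≫ f ▷ d ≫ (α_ y u d).hom ≫ y ◁ ev ≫ (ρ_ y).hom := by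
    simp only [rotL]
    calc _ = 𝟙 _ ⊗≫ u ◁ coev ▷ x ▷ d ⊗≫ (((u ⊗ d) ◁ (f ▷ d ⊗≫ y ◁ ev)) ≫ ev ▷ _) ⊗≫ 𝟙 _ := by
          monoidal
      _ = _ := by rw [whisker_exchange]; monoidal
  rw [h, zz]; simp

theorem cup_slide (coev : 𝟙_ C ⟶ u ⊗ d) (ev : d ⊗ u ⟶ 𝟙_ C)
    (zz : (λ_ u).inv ≫ coev ▷ u ≫ (α_ _ _ _).hom ≫ u ◁ ev ≫ (ρ_ u).hom = 𝟙 _)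
    {x y : C} (f : x ⊗ u ⟶ u ⊗ y) :
    (λ_ x).inv ≫ coev ▷ x ≫ (α_ u d x).hom ≫ u ◁ rotR coev ev f =
      (ρ_ x).inv ≫ x ◁ coev ≫ (α_ x u d).inv ≫ f ▷ d ≫ (α_ u y d).hom := by
  have h : (λ_ x).inv ≫ coev ▷ x ≫ (α_ u d x).hom ≫ u ◁ rotR coev ev f =
      ((ρ_ x).inv ≫ x ◁ coev ≫ (α_ x u d).inv ≫ f ▷ d ≫ (α_ u y d).hom) ≫
      ((λ_ u).inv ≫ coev ▷ u ≫ (α_ _ _ _).hom ≫ u ◁ ev ≫ (ρ_ u).hom) ▷ (y ⊗ d) := by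
    simp only [rotR]
    calc _ = 𝟙 _ ⊗≫ (coev ▷ _ ≫ (u ⊗ d) ◁ (x ◁ coev ⊗≫ f ▷ d)) ⊗≫ u ◁ ev ▷ y ▷ d ⊗≫ 𝟙 _ := by
          monoidal
      _ = _ := by rw [← whisker_exchange]; monoidal
  rw [h, zz]; simp

end Slide
section Tower

variable (k : Type*) [Field k] {A : ℕ → Type*} [∀ n, Ring (A n)] [∀ n, Algebra k (A n)]
  (w : ∀ n, A n →ₐ[k] A (n + 1)) (x : ∀ n, A (n + 2))

/-! Here `A n` is an algebra acting on `n` strands, `w n : A n → A (n + 1)` adds a strand at the end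
and `x n` in `A (n + 2)` is the crossing of the last two strands, so that the simple transpositions
`s_1, …, s_{n-1}` of `S_n` are the images of `x 0, …, x (n - 2)` in `A n`. -/

/-- The sum `1 + s_n + s_n s_{n-1} + ⋯ + s_n ⋯ s_1` in `A (n + 1)`, over the minimal
representatives of the cosets of `S_n` in `S_{n+1}`. -/
def cosetSum : ∀ n, A n
  | 0 => 1
  | 1 => 1
  | n + 2 => 1 + x n * w (n + 1) (cosetSum (n + 1))

/-- The sum of the elements of `S_n` in `A n`: each element of `S_{n+1}` is, in exactly one way, the
product of an element of `S_n` and one of `1, s_n, s_n s_{n-1}, …, s_n ⋯ s_1`. -/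
def permSum : ∀ n, A n
  | 0 => 1
  | n + 1 => w n (permSum n) * cosetSum k w x (n + 1)

/-- The symmetrizer, the sum of the elements of `S_n` divided by `n!`. Replacing the crossings
`x n` by `-x n` turns it into the antisymmetrizer. -/
def symmetrizer (n : ℕ) : A n := (n.factorial : k)⁻¹ • permSum k w x n

/-- The relations between the simple transpositions in the symmetric groups. -/
structure CoxeterTower : Prop where
  sq (n : ℕ) : x n * x n = 1
  braid (n : ℕ) : x (n + 1) * w (n + 2) (x n) * x (n + 1) =
    w (n + 2) (x n) * x (n + 1) * w (n + 2) (x n)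
  comm (n : ℕ) (a : A n) : x n * w (n + 1) (w n a) = w (n + 1) (w n a) * x n

variable {k w x}

theorem CoxeterTower.neg (h : CoxeterTower k w x) : CoxeterTower k w (fun n => -x n) where
  sq n := by simp [h.sq]
  braid n := by simpa using h.braid n
  comm n a := by simpa using h.comm n a

theorem symmetrizer_zero : symmetrizer k w x 0 = 1 := by simp [symmetrizer, permSum]

theorem symmetrizer_one : symmetrizer k w x 1 = 1 := by simp [symmetrizer, permSum, cosetSum]

theorem absorb_left {R : Type*} [Ring R] [Algebra k R] {f g x y : R} {N M : k}
    (hf : N • f = g + M • (g * y * g)) (hgx : x * g = g * x) (hx : x * x = 1)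
    (hb : x * y * x = y * x * y) (hy : y * f = f) (hg : g * f = f) :
    x * (f + N • (f * x * f)) = f + N • (f * x * f) := by
  have e1 : N • (f * x * f) = x * f + M • (g * y * x * f) := by
    rw [← smul_mul_assoc, ← smul_mul_assoc, hf, add_mul, add_mul, ← hgx, mul_assoc x g f, hg,
      smul_mul_assoc, smul_mul_assoc, mul_assoc (g * y) g x, ← hgx]
    simp only [mul_assoc, hg]
  have e2 : g * x * y * (x * f) = g * y * (x * f) := by
    calc _ = g * (x * y * x) * f := by simp only [mul_assoc]
      _ = _ := by rw [hb]; simp only [mul_assoc, hy]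
  rw [e1, mul_add, mul_add, mul_smul_comm, ← mul_assoc, ← mul_assoc, hx, one_mul,
    ← mul_assoc, ← mul_assoc, hgx, mul_assoc _ x f, e2, mul_assoc _ x f]
  abel

theorem absorb_right {R : Type*} [Ring R] [Algebra k R] {f g x y : R} {N M : k}
    (hf : N • f = g + M • (g * y * g)) (hgx : x * g = g * x) (hx : x * x = 1)
    (hb : x * y * x = y * x * y) (hy : f * y = f) (hg : f * g = f) :
    (f + N • (f * x * f)) * x = f + N • (f * x * f) := by
  have h := absorb_left (k := k) (f := MulOpposite.op f) (g := MulOpposite.op g)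
    (x := MulOpposite.op x) (y := MulOpposite.op y) (N := N) (M := M)
    (by simpa only [← MulOpposite.op_mul, ← MulOpposite.op_smul, ← MulOpposite.op_add, mul_assoc]
      using congrArg MulOpposite.op hf)
    (by simpa only [← MulOpposite.op_mul] using congrArg MulOpposite.op hgx.symm)
    (by rw [← MulOpposite.op_mul, hx, MulOpposite.op_one])
    (by simpa only [← MulOpposite.op_mul, mul_assoc] using congrArg MulOpposite.op hb)
    (by simpa only [← MulOpposite.op_mul] using congrArg MulOpposite.op hy)
    (by simpa only [← MulOpposite.op_mul] using congrArg MulOpposite.op hg)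
  simp only [← MulOpposite.op_mul, ← MulOpposite.op_smul, ← MulOpposite.op_add, ← mul_assoc] at h
  exact MulOpposite.op_injective h

variable [CharZero k]

theorem smul_symmetrizer_succ (n : ℕ) : ((n : k) + 1) • symmetrizer k w x (n + 1) =
    w n (symmetrizer k w x n) * cosetSum k w x (n + 1) := by
  have h0 : (n.factorial : k) ≠ 0 := by exact_mod_cast n.factorial_ne_zero
  have h1 : (n : k) + 1 ≠ 0 := by exact_mod_cast n.succ_ne_zero
  simp only [symmetrizer, permSum, Nat.factorial_succ, Nat.cast_mul, Nat.cast_add, Nat.cast_one,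
    map_smul, smul_mul_assoc, smul_smul]
  congr 1
  field_simp

theorem CoxeterTower.rec_symmetrizer (h : CoxeterTower k w x) (n : ℕ)
    (h3 : symmetrizer k w x (n + 1) * w n (symmetrizer k w x n) = symmetrizer k w x (n + 1)) :
    ((n : k) + 2) • symmetrizer k w x (n + 2) = w (n + 1) (symmetrizer k w x (n + 1)) +
      ((n : k) + 1) • (w (n + 1) (symmetrizer k w x (n + 1)) * x n *
        w (n + 1) (symmetrizer k w x (n + 1))) := by
  have h4 := smul_symmetrizer_succ (k := k) (w := w) (x := x) (n + 1)
  have h5 := congrArg (w (n + 1)) (smul_symmetrizer_succ (k := k) (w := w) (x := x) n)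
  rw [map_smul, map_mul] at h5
  have h6 := congrArg (w (n + 1)) h3
  rw [map_mul] at h6
  rw [show ((n : k) + 2) = ((n + 1 : ℕ) : k) + 1 by push_cast; ring, h4, cosetSum, mul_add,
    mul_one, ← mul_smul_comm, h5]
  congr 1
  conv_lhs => rw [← h6]
  simp only [mul_assoc]
  rw [← mul_assoc (x n), h.comm, mul_assoc]

theorem CoxeterTower.aux (h : CoxeterTower k w x) (n : ℕ)
    (h1 : symmetrizer k w x (n + 1) * symmetrizer k w x (n + 1) = symmetrizer k w x (n + 1))
    (h3 : symmetrizer k w x (n + 1) * w n (symmetrizer k w x n) = symmetrizer k w x (n + 1))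
    (hl : x n * symmetrizer k w x (n + 2) = symmetrizer k w x (n + 2)) :
    (symmetrizer k w x (n + 2) * symmetrizer k w x (n + 2) = symmetrizer k w x (n + 2)) ∧
    (w (n + 1) (symmetrizer k w x (n + 1)) * symmetrizer k w x (n + 2) =
      symmetrizer k w x (n + 2)) ∧
    (symmetrizer k w x (n + 2) * w (n + 1) (symmetrizer k w x (n + 1)) =
      symmetrizer k w x (n + 2)) := by
  have e := h.rec_symmetrizer n h3
  have h0 : (n : k) + 2 ≠ 0 := by exact_mod_cast (n + 1).succ_ne_zero
  have hf : w (n + 1) (symmetrizer k w x (n + 1)) * w (n + 1) (symmetrizer k w x (n + 1)) =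
      w (n + 1) (symmetrizer k w x (n + 1)) := by rw [← map_mul, h1]
  generalize w (n + 1) (symmetrizer k w x (n + 1)) = f at *
  generalize symmetrizer k w x (n + 2) = E at *
  have a : f * E = E := by
    apply smul_right_injective _ h0
    dsimp only
    rw [← mul_smul_comm, e, mul_add, mul_smul_comm, ← mul_assoc, ← mul_assoc, hf]
  have b : E * f = E := by
    apply smul_right_injective _ h0
    dsimp only
    rw [← smul_mul_assoc, e, add_mul, smul_mul_assoc, mul_assoc _ f f, hf]
  refine ⟨?_, a, b⟩
  apply smul_right_injective _ h0
  dsimp only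
  rw [← smul_mul_assoc, e, add_mul, smul_mul_assoc, mul_assoc _ f E, a, mul_assoc f, hl, a, ← e]
  have : ((n : k) + 2) • E = E + ((n : k) + 1) • E := by
    rw [show (n : k) + 2 = 1 + ((n : k) + 1) by ring, add_smul, one_smul]
  rw [this]

theorem CoxeterTower.absorb (h : CoxeterTower k w x) (n : ℕ) :
    (symmetrizer k w x (n + 1) * symmetrizer k w x (n + 1) = symmetrizer k w x (n + 1)) ∧
    (w n (symmetrizer k w x n) * symmetrizer k w x (n + 1) = symmetrizer k w x (n + 1)) ∧
    (symmetrizer k w x (n + 1) * w n (symmetrizer k w x n) = symmetrizer k w x (n + 1)) ∧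
    (x n * symmetrizer k w x (n + 2) = symmetrizer k w x (n + 2)) ∧
    (symmetrizer k w x (n + 2) * x n = symmetrizer k w x (n + 2)) := by
  induction n with
  | zero =>
    have e := h.rec_symmetrizer 0 (by simp [symmetrizer_zero, symmetrizer_one])
    have e1 : w (0 + 1) (symmetrizer k w x (0 + 1)) = 1 :=
      (congrArg (w 1) symmetrizer_one).trans (map_one _)
    rw [e1] at e
    simp only [Nat.cast_zero, zero_add, one_mul, mul_one, one_smul] at e
    have h0 : (2 : k) ≠ 0 := two_ne_zero
    refine ⟨by simp [symmetrizer_one], by simp [symmetrizer_one, symmetrizer_zero],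
      by simp [symmetrizer_one, symmetrizer_zero], ?_, ?_⟩
    · apply smul_right_injective _ h0
      dsimp only
      rw [← mul_smul_comm, e, mul_add, h.sq, mul_one]; exact add_comm _ _
    · apply smul_right_injective _ h0
      dsimp only
      rw [← smul_mul_assoc, e, add_mul, h.sq, one_mul]; exact add_comm _ _
  | succ n ih =>
    obtain ⟨h1, -, h3, hl, hr⟩ := ih
    obtain ⟨h1', h2', h3'⟩ := h.aux n h1 h3 hl
    have e := h.rec_symmetrizer n h3
    have e' := h.rec_symmetrizer (n + 1) h3'
    have h0 : ((n + 1 : ℕ) : k) + 2 ≠ 0 := by exact_mod_cast (n + 2).succ_ne_zero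
    have hc : ((n + 1 : ℕ) : k) + 1 = (n : k) + 2 := by push_cast; ring
    rw [hc] at e'
    have f0 := congrArg (w (n + 2)) e
    have f1 := congrArg (w (n + 2)) h2'
    have f2 := congrArg (w (n + 2)) h3'
    have f3 := congrArg (w (n + 2)) hl
    have f4 := congrArg (w (n + 2)) hr
    simp only [map_mul, map_add, map_smul] at f0 f1 f2 f3 f4
    refine ⟨h1', h2', h3', ?_, ?_⟩
    · apply smul_right_injective _ h0
      dsimp only
      rw [← mul_smul_comm, e']
      exact absorb_left f0 (h.comm _ _) (h.sq _) (h.braid _) f3 f1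
    · apply smul_right_injective _ h0
      dsimp only
      rw [← smul_mul_assoc, e']
      exact absorb_right f0 (h.comm _ _) (h.sq _) (h.braid _) f4 f2

theorem CoxeterTower.symmetrizer_sq (h : CoxeterTower k w x) (n : ℕ) :
    symmetrizer k w x n * symmetrizer k w x n = symmetrizer k w x n := by
  cases n with
  | zero => simp [symmetrizer_zero]
  | succ n => exact (h.absorb n).1

end Tower
section Cross

variable {C : Type*} [Category C] [MonoidalCategory C]

/-- An endomorphism of `u ⊗ u`, applied to the two rightmost factors of `(A ⊗ u) ⊗ u`. -/
def onLastTwo (A : C) {u : C} (s : u ⊗ u ⟶ u ⊗ u) : (A ⊗ u) ⊗ u ⟶ (A ⊗ u) ⊗ u :=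
  (α_ A u u).hom ≫ A ◁ s ≫ (α_ A u u).inv

/-- An endomorphism of `u ⊗ u`, applied to the two leftmost factors of `u ⊗ (u ⊗ A)`. -/
def onFirstTwo (A : C) {u : C} (s : u ⊗ u ⟶ u ⊗ u) : u ⊗ (u ⊗ A) ⟶ u ⊗ (u ⊗ A) :=
  (α_ u u A).inv ≫ s ▷ A ≫ (α_ u u A).hom

variable {u : C} {s : u ⊗ u ⟶ u ⊗ u}

theorem onLastTwo_sq (A : C) (h : s ≫ s = 𝟙 _) : onLastTwo A s ≫ onLastTwo A s = 𝟙 _ := by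
  simp only [onLastTwo, Category.assoc, Iso.inv_hom_id_assoc]
  rw [← whiskerLeft_comp_assoc, h]; simp

theorem onFirstTwo_sq (A : C) (h : s ≫ s = 𝟙 _) : onFirstTwo A s ≫ onFirstTwo A s = 𝟙 _ := by
  simp only [onFirstTwo, Category.assoc, Iso.hom_inv_id_assoc]
  rw [← comp_whiskerRight_assoc, h]; simp

theorem onLastTwo_comm {A B : C} (a : A ⟶ B) (s : u ⊗ u ⟶ u ⊗ u) :
    (a ▷ u) ▷ u ≫ onLastTwo B s = onLastTwo A s ≫ (a ▷ u) ▷ u := by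
  simp only [onLastTwo]
  calc _ = 𝟙 _ ⊗≫ (a ▷ (u ⊗ u) ≫ B ◁ s) ⊗≫ 𝟙 _ := by monoidal
    _ = _ := by rw [← whisker_exchange]; monoidal

theorem onFirstTwo_comm {A B : C} (a : A ⟶ B) (s : u ⊗ u ⟶ u ⊗ u) :
    u ◁ (u ◁ a) ≫ onFirstTwo B s = onFirstTwo A s ≫ u ◁ (u ◁ a) := by
  simp only [onFirstTwo]
  calc _ = 𝟙 _ ⊗≫ ((u ⊗ u) ◁ a ≫ s ▷ B) ⊗≫ 𝟙 _ := by monoidal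
    _ = _ := by rw [whisker_exchange]; monoidal

theorem onLastTwo_braid (A : C) (h : DiagCat.Braid s) :
    onLastTwo (A ⊗ u) s ≫ onLastTwo A s ▷ u ≫ onLastTwo (A ⊗ u) s =
      onLastTwo A s ▷ u ≫ onLastTwo (A ⊗ u) s ≫ onLastTwo A s ▷ u := by
  unfold DiagCat.Braid at h
  simp only [onLastTwo]
  calc _ = 𝟙 _ ⊗≫ A ◁ (((α_ u u u).hom ≫ u ◁ s ≫ (α_ u u u).inv) ≫ s ▷ u ≫
        (α_ u u u).hom ≫ u ◁ s ≫ (α_ u u u).inv) ⊗≫ 𝟙 _ := by monoidal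
    _ = _ := by rw [← h]; monoidal

theorem onFirstTwo_braid (A : C) (h : DiagCat.Braid s) :
    onFirstTwo (u ⊗ A) s ≫ u ◁ onFirstTwo A s ≫ onFirstTwo (u ⊗ A) s =
      u ◁ onFirstTwo A s ≫ onFirstTwo (u ⊗ A) s ≫ u ◁ onFirstTwo A s := by
  unfold DiagCat.Braid at h
  simp only [onFirstTwo]
  calc _ = 𝟙 _ ⊗≫ (s ▷ u ≫ ((α_ u u u).hom ≫ u ◁ s ≫ (α_ u u u).inv) ≫ s ▷ u) ▷ A ⊗≫ 𝟙 _ := by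
        monoidal
    _ = _ := by rw [h]; monoidal

end Cross

section Powers

variable (k : Type u) [Field k]

/-- `Q_+^{⊗ n}`; the last strand to be added is the rightmost one. -/
def upPow : ℕ → DiagCat k
  | 0 => 𝟙_ _
  | n + 1 => upPow n ⊗ DiagCat.Qp k

/-- `Q_-^{⊗ n}`; the last strand to be added is the leftmost one. -/
def downPow : ℕ → DiagCat k
  | 0 => 𝟙_ _
  | n + 1 => DiagCat.Qm k ⊗ downPow n

/-- Adding a vertical strand on the right. -/
def addRight (n : ℕ) : End (upPow k n) →ₐ[k] End (upPow k (n + 1)) :=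
  AlgHom.ofLinearMap
    { toFun := fun f => MonoidalCategoryStruct.whiskerRight f (DiagCat.Qp k)
      map_add' := fun f g => MonoidalPreadditive.add_whiskerRight f g
      map_smul' := fun c f => MonoidalLinear.smul_whiskerRight c f _ }
    (MonoidalCategory.id_whiskerRight (upPow k n) (DiagCat.Qp k))
    (fun f g => MonoidalCategory.comp_whiskerRight g f _)

/-- Adding a vertical strand on the left. -/
def addLeft (n : ℕ) : End (downPow k n) →ₐ[k] End (downPow k (n + 1)) :=
  AlgHom.ofLinearMap
    { toFun := fun f => MonoidalCategoryStruct.whiskerLeft (DiagCat.Qm k) f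
      map_add' := fun f g => MonoidalPreadditive.whiskerLeft_add f g
      map_smul' := fun c f => MonoidalLinear.whiskerLeft_smul _ c f }
    (MonoidalCategory.whiskerLeft_id (DiagCat.Qm k) (downPow k n))
    (fun f g => MonoidalCategory.whiskerLeft_comp _ g f)

/-- The crossing of the two rightmost strands of `Q_+^{⊗ (n + 2)}`. -/
def crossRight (n : ℕ) : End (upPow k (n + 2)) := onLastTwo (upPow k n) (DiagCat.crossUp k)

/-- The crossing of the two leftmost strands of `Q_-^{⊗ (n + 2)}`. -/
def crossLeft (n : ℕ) : End (downPow k (n + 2)) := onFirstTwo (downPow k n) (DiagCat.crossDown k)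

theorem tower_up : CoxeterTower k (addRight k) (crossRight k) where
  sq _ := onLastTwo_sq _ (DiagCat.crossUp_sq k)
  braid _ := onLastTwo_braid _ (DiagCat.crossUp_braid k)
  comm _ a := onLastTwo_comm a _

theorem tower_down : CoxeterTower k (addLeft k) (crossLeft k) where
  sq _ := onFirstTwo_sq _ (DiagCat.crossDown_sq k)
  braid _ := onFirstTwo_braid _ (DiagCat.crossDown_braid k)
  comm _ a := onFirstTwo_comm a _

end Powers

section Contraction

variable {C : Type*} [Category C] [MonoidalCategory C] {u d : C}

/-- Contraction of the two innermost factors of `(A ⊗ u) ⊗ (d ⊗ B)`. -/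
def capIn (ev : u ⊗ d ⟶ 𝟙_ C) (A B : C) : (A ⊗ u) ⊗ (d ⊗ B) ⟶ A ⊗ B :=
  (α_ A u (d ⊗ B)).hom ≫ A ◁ ((α_ u d B).inv ≫ ev ▷ B ≫ (λ_ B).hom)

/-- Insertion of `u ⊗ d` between the two factors of `A ⊗ B`. -/
def cupIn (coev : 𝟙_ C ⟶ u ⊗ d) (A B : C) : A ⊗ B ⟶ (A ⊗ u) ⊗ (d ⊗ B) :=
  A ◁ ((λ_ B).inv ≫ coev ▷ B ≫ (α_ u d B).hom) ≫ (α_ A u (d ⊗ B)).inv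

theorem capIn_naturality (ev : u ⊗ d ⟶ 𝟙_ C) {A A' B B' : C} (a : A ⟶ A') (b : B ⟶ B') :
    ((a ▷ u) ⊗ₘ (d ◁ b)) ≫ capIn ev A' B' = capIn ev A B ≫ (a ⊗ₘ b) := by
  simp only [capIn, MonoidalCategory.tensorHom_def]
  calc _ = 𝟙 _ ⊗≫ a ▷ ((u ⊗ d) ⊗ B) ⊗≫ A' ◁ ((u ⊗ d) ◁ b ≫ ev ▷ B') ⊗≫ 𝟙 _ := by monoidal
    _ = 𝟙 _ ⊗≫ ((a ▷ ((u ⊗ d) ⊗ B) ≫ A' ◁ (ev ▷ B)) ⊗≫ A' ◁ b) ⊗≫ 𝟙 _ := by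
      rw [whisker_exchange]; monoidal
    _ = _ := by rw [← whisker_exchange]; monoidal

theorem cupIn_naturality (coev : 𝟙_ C ⟶ u ⊗ d) {A A' B B' : C} (a : A ⟶ A') (b : B ⟶ B') :
    cupIn coev A B ≫ ((a ▷ u) ⊗ₘ (d ◁ b)) = (a ⊗ₘ b) ≫ cupIn coev A' B' := by
  simp only [cupIn, MonoidalCategory.tensorHom_def]
  calc _ = 𝟙 _ ⊗≫ (A ◁ (coev ▷ B) ≫ a ▷ ((u ⊗ d) ⊗ B)) ⊗≫ A' ◁ ((u ⊗ d) ◁ b) ⊗≫ 𝟙 _ := by monoidal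
    _ = 𝟙 _ ⊗≫ a ▷ (𝟙_ C ⊗ B) ⊗≫ A' ◁ (coev ▷ B ≫ (u ⊗ d) ◁ b) ⊗≫ 𝟙 _ := by
      rw [whisker_exchange]; monoidal
    _ = _ := by rw [← whisker_exchange]; monoidal

theorem capIn_slide (ev : u ⊗ d ⟶ 𝟙_ C) {s : u ⊗ u ⟶ u ⊗ u} {r : u ⊗ d ⟶ d ⊗ u}
    {t : d ⊗ d ⟶ d ⊗ d}
    (h1 : u ◁ r ≫ (α_ u d u).inv ≫ ev ▷ u ≫ (λ_ u).hom =
      (α_ u u d).inv ≫ s ▷ d ≫ (α_ u u d).hom ≫ u ◁ ev ≫ (ρ_ u).hom)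
    (h2 : u ◁ t ≫ (α_ u d d).inv ≫ ev ▷ d ≫ (λ_ d).hom =
      (α_ u d d).inv ≫ r ▷ d ≫ (α_ d u d).hom ≫ d ◁ ev ≫ (ρ_ d).hom) (A B : C) :
    (onLastTwo A s ⊗ₘ 𝟙 (d ⊗ d ⊗ B)) ≫ capIn ev (A ⊗ u) (d ⊗ B) ≫ capIn ev A B =
      (𝟙 ((A ⊗ u) ⊗ u) ⊗ₘ onFirstTwo B t) ≫ capIn ev (A ⊗ u) (d ⊗ B) ≫ capIn ev A B := by
  simp only [capIn, onLastTwo, onFirstTwo, tensorHom_id, id_tensorHom]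
  calc _ = 𝟙 _ ⊗≫ A ◁ ((((α_ u u d).inv ≫ s ▷ d ≫ (α_ u u d).hom ≫ u ◁ ev ≫ (ρ_ u).hom) ▷ d)
          ≫ ev) ▷ B ⊗≫ 𝟙 _ := by monoidal
    _ = 𝟙 _ ⊗≫ A ◁ (u ◁ r ▷ d ⊗≫ (ev ▷ (u ⊗ d) ≫ 𝟙_ C ◁ ev)) ▷ B ⊗≫ 𝟙 _ := by
          rw [← h1]; monoidal
    _ = 𝟙 _ ⊗≫ A ◁ (u ◁ ((α_ u d d).inv ≫ r ▷ d ≫ (α_ d u d).hom ≫ d ◁ ev ≫ (ρ_ d).hom)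
          ≫ ev) ▷ B ⊗≫ 𝟙 _ := by rw [← whisker_exchange]; monoidal
    _ = _ := by rw [← h2]; monoidal

theorem cupIn_slide (coev : 𝟙_ C ⟶ u ⊗ d) {s : u ⊗ u ⟶ u ⊗ u} {r : d ⊗ u ⟶ u ⊗ d}
    {t : d ⊗ d ⟶ d ⊗ d}
    (h1 : (λ_ u).inv ≫ coev ▷ u ≫ (α_ u d u).hom ≫ u ◁ r =
      (ρ_ u).inv ≫ u ◁ coev ≫ (α_ u u d).inv ≫ s ▷ d ≫ (α_ u u d).hom)
    (h2 : (λ_ d).inv ≫ coev ▷ d ≫ (α_ u d d).hom ≫ u ◁ t =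
      (ρ_ d).inv ≫ d ◁ coev ≫ (α_ d u d).inv ≫ r ▷ d ≫ (α_ u d d).hom) (A B : C) :
    cupIn coev A B ≫ cupIn coev (A ⊗ u) (d ⊗ B) ≫ (onLastTwo A s ⊗ₘ 𝟙 (d ⊗ d ⊗ B)) =
      cupIn coev A B ≫ cupIn coev (A ⊗ u) (d ⊗ B) ≫ (𝟙 ((A ⊗ u) ⊗ u) ⊗ₘ onFirstTwo B t) := by
  simp only [cupIn, onLastTwo, onFirstTwo, tensorHom_id, id_tensorHom]
  calc _ = 𝟙 _ ⊗≫ A ◁ (coev ≫ (((ρ_ u).inv ≫ u ◁ coev ≫ (α_ u u d).inv ≫ s ▷ d ≫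
          (α_ u u d).hom) ▷ d)) ▷ B ⊗≫ 𝟙 _ := by monoidal
    _ = 𝟙 _ ⊗≫ A ◁ ((𝟙_ C ◁ coev ≫ coev ▷ (u ⊗ d)) ⊗≫ u ◁ r ▷ d) ▷ B ⊗≫ 𝟙 _ := by
          rw [← h1]; monoidal
    _ = 𝟙 _ ⊗≫ A ◁ (coev ≫ u ◁ ((ρ_ d).inv ≫ d ◁ coev ≫ (α_ d u d).inv ≫ r ▷ d ≫
          (α_ u d d).hom)) ▷ B ⊗≫ 𝟙 _ := by rw [whisker_exchange]; monoidal
    _ = _ := by rw [← h2]; monoidal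

end Contraction

section Envelopes

namespace MatTensor

variable {C : Type*} [Category C] [Preadditive C] [MonoidalCategory C]

/-- The tensor product of the families `(X_i)` and `(Y_j)` is the family `(X_i ⊗ Y_j)`. -/
def obj (M N : Mat_ C) : Mat_ C := ⟨M.ι × N.ι, fun p => M.X p.1 ⊗ N.X p.2⟩

/-- The tensor product of matrices is the Kronecker product. -/
def hom {M M' N N' : Mat_ C} (f : M ⟶ M') (g : N ⟶ N') : obj M N ⟶ obj M' N' :=
  fun p q => f p.1 q.1 ⊗ₘ g p.2 q.2

variable [MonoidalPreadditive C]

theorem hom_id (M N : Mat_ C) : hom (𝟙 M) (𝟙 N) = 𝟙 (obj M N) := by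
  classical
  apply Mat_.hom_ext
  rintro ⟨i, j⟩ ⟨i', j'⟩
  change (𝟙 M : Mat_.Hom M M) i i' ⊗ₘ (𝟙 N : Mat_.Hom N N) j j' = _
  by_cases hi : i = i'
  · subst hi
    by_cases hj : j = j'
    · subst hj
      rw [Mat_.id_apply_self, Mat_.id_apply_self]
      erw [Mat_.id_apply_self]
      exact id_tensorHom_id _ _
    · rw [Mat_.id_apply_of_ne _ _ _ hj]
      erw [Mat_.id_apply_of_ne (obj M N) (i, j) (i, j') (fun h => hj (Prod.ext_iff.1 h).2)]
      exact MonoidalPreadditive.tensor_zero _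
  · rw [Mat_.id_apply_of_ne _ _ _ hi]
    erw [Mat_.id_apply_of_ne (obj M N) (i, j) (i', j') (fun h => hi (Prod.ext_iff.1 h).1)]
    exact MonoidalPreadditive.zero_tensor _

theorem hom_comp {M M' M'' N N' N'' : Mat_ C} (f : M ⟶ M') (f' : M' ⟶ M'') (g : N ⟶ N')
    (g' : N' ⟶ N'') : hom (f ≫ f') (g ≫ g') = hom f g ≫ hom f' g' := by
  apply Mat_.hom_ext
  rintro ⟨i, j⟩ ⟨i', j'⟩
  refine Eq.trans ?_ (Mat_.comp_apply _ _ _ _).symm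
  change (f ≫ f') i i' ⊗ₘ (g ≫ g') j j' = _
  rw [Mat_.comp_apply, Mat_.comp_apply, sum_tensor]
  simp only [tensor_sum]
  refine Eq.trans ?_ (Fintype.sum_prod_type _).symm
  refine Finset.sum_congr rfl fun _ _ => Finset.sum_congr rfl fun _ _ => ?_
  exact (tensorHom_comp_tensorHom _ _ _ _).symm

theorem add_hom {M M' N N' : Mat_ C} (f f' : M ⟶ M') (g : N ⟶ N') :
    hom (f + f') g = hom f g + hom f' g :=
  Mat_.hom_ext _ _ fun _ _ => MonoidalPreadditive.add_tensor _ _ _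

theorem hom_add {M M' N N' : Mat_ C} (f : M ⟶ M') (g g' : N ⟶ N') :
    hom f (g + g') = hom f g + hom f g' :=
  Mat_.hom_ext _ _ fun _ _ => MonoidalPreadditive.tensor_add _ _ _

end MatTensor

namespace KaroubiTensor

open Idempotents

variable {C : Type*} [Category C] [Preadditive C] [MonoidalCategory C] [MonoidalPreadditive C]

/-- `(X, e) ⊗ (Y, f) = (X ⊗ Y, e ⊗ f)`. -/
def obj (P Q : Karoubi (Mat_ C)) : Karoubi (Mat_ C) where
  X := MatTensor.obj P.X Q.X
  p := MatTensor.hom P.p Q.p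
  idem := by rw [← MatTensor.hom_comp, P.idem, Q.idem]

/-- The tensor product of morphisms between images of idempotents. -/
def hom {P P' Q Q' : Karoubi (Mat_ C)} (f : P ⟶ P') (g : Q ⟶ Q') : obj P Q ⟶ obj P' Q' where
  f := MatTensor.hom f.f g.f
  comm := by
    change MatTensor.hom P.p Q.p ≫ MatTensor.hom f.f g.f ≫ MatTensor.hom P'.p Q'.p = _
    rw [← MatTensor.hom_comp, ← MatTensor.hom_comp, f.comm, g.comm]

theorem hom_id (P Q : Karoubi (Mat_ C)) : hom (𝟙 P) (𝟙 Q) = 𝟙 (obj P Q) := rfl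

theorem hom_comp {P P' P'' Q Q' Q'' : Karoubi (Mat_ C)} (f : P ⟶ P') (f' : P' ⟶ P'')
    (g : Q ⟶ Q') (g' : Q' ⟶ Q'') : hom (f ≫ f') (g ≫ g') = hom f g ≫ hom f' g' :=
  Karoubi.hom_ext _ _ (MatTensor.hom_comp f.f f'.f g.f g'.f)

end KaroubiTensor

/-- The tensor product of the additive Karoubi envelope of a preadditive monoidal category, as a
functor in two variables. -/
noncomputable def karoubiTensor (C : Type*) [Category C] [Preadditive C] [MonoidalCategory C]
    [MonoidalPreadditive C] :
    Idempotents.Karoubi (Mat_ C) ⥤ Idempotents.Karoubi (Mat_ C) ⥤ Idempotents.Karoubi (Mat_ C) where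
  obj P :=
    { obj Q := KaroubiTensor.obj P Q
      map g := KaroubiTensor.hom (𝟙 P) g
      map_id Q := KaroubiTensor.hom_id P Q
      map_comp f g := by rw [← KaroubiTensor.hom_comp, Category.comp_id] }
  map {P P'} f :=
    { app Q := KaroubiTensor.hom f (𝟙 Q)
      naturality Q Q' g :=
        ((KaroubiTensor.hom_comp (𝟙 P) f g (𝟙 Q')).symm.trans (congrArg₂ KaroubiTensor.hom
          ((Category.id_comp f).trans (Category.comp_id f).symm)
          ((Category.comp_id g).trans (Category.id_comp g).symm))).trans
          (KaroubiTensor.hom_comp f (𝟙 P') (𝟙 Q) g) }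
  map_id P := NatTrans.ext (funext fun Q => KaroubiTensor.hom_id P Q)
  map_comp f g := NatTrans.ext (funext fun Q =>
    (congrArg (KaroubiTensor.hom (f ≫ g)) (Category.comp_id (𝟙 Q)).symm).trans
      (KaroubiTensor.hom_comp f g (𝟙 Q) (𝟙 Q)))

instance (C : Type*) [Category C] [Preadditive C] [MonoidalCategory C]
    [MonoidalPreadditive C] : (karoubiTensor C).Additive where
  map_add {_ _ f g} := NatTrans.ext (funext fun Q =>
    Idempotents.Karoubi.hom_ext _ _ (MatTensor.add_hom f.f g.f Q.p))

instance (C : Type*) [Category C] [Preadditive C] [MonoidalCategory C]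
    [MonoidalPreadditive C] (P : Idempotents.Karoubi (Mat_ C)) :
    ((karoubiTensor C).obj P).Additive where
  map_add {_ _ f g} := Idempotents.Karoubi.hom_ext _ _ (MatTensor.hom_add P.p f.f g.f)

end Envelopes

section Totals

variable {D : Type*} [Category D] [Preadditive D]

/-- A family which vanishes outside a finite set has a coproduct. -/
theorem hasCoproduct_of_finite_support [HasFiniteCoproducts D] {I : Type*} (X : I → D)
    (S : Set I) (hS : S.Finite) (h : ∀ i, i ∉ S → IsZero (X i)) : HasCoproduct X := by
  classical
  have := hS.to_subtype
  let c : Cofan X := Cofan.mk (∐ fun i : S => X i) fun i =>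
    if hi : i ∈ S then Sigma.ι (fun i : S => X i) ⟨i, hi⟩ else 0
  refine ⟨⟨c, Cofan.IsColimit.mk c (fun t => Limits.Sigma.desc (f := fun i : S => X i) fun i => t.inj i.1) ?_ ?_⟩⟩
  · intro t i
    by_cases hi : i ∈ S
    · simp [c, hi]
    · exact (h i hi).eq_of_src _ _
  · intro t m hm
    refine Limits.Sigma.hom_ext (f := fun i : S => X i) _ _ ?_
    rintro ⟨i, hi⟩
    have := hm i
    simpa [c, hi] using this

variable [HasFiniteBiproducts D] (F : D ⥤ D ⥤ D) [F.PreservesZeroMorphisms]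
  [∀ X, (F.obj X).PreservesZeroMorphisms]

theorem hasMapBifunctor_of_finite_support (K L : CochainComplex D ℤ)
    (h : ∀ n : ℤ, ∃ S : Set (ℤ × ℤ), S.Finite ∧
      ∀ i j, i + j = n → (i, j) ∉ S → IsZero (K.X i) ∨ IsZero (L.X j)) :
    HomologicalComplex.HasMapBifunctor K L F (ComplexShape.up ℤ) := by
  intro n
  obtain ⟨S, hS, hz⟩ := h n
  refine hasCoproduct_of_finite_support _ (Subtype.val ⁻¹' S)
    (hS.preimage Subtype.val_injective.injOn) ?_
  rintro ⟨⟨i, j⟩, hij⟩ hn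
  rcases hz i j hij hn with h | h
  · have := F.map_isZero h
    exact (Functor.isZero_iff _).1 this _
  · exact (F.obj (K.X i)).map_isZero h

/-- The total complex exists if both complexes are bounded above. -/
instance hasMapBifunctor_extend_LE (K L : ChainComplex D ℕ) (p q : ℤ) :
    HomologicalComplex.HasMapBifunctor (K.extend (ComplexShape.embeddingUpIntLE p))
      (L.extend (ComplexShape.embeddingUpIntLE q)) F (ComplexShape.up ℤ) := by
  apply hasMapBifunctor_of_finite_support
  intro n
  refine ⟨Set.Icc (n - q) p ×ˢ Set.Icc (n - p) q, (Set.finite_Icc _ _).prod (Set.finite_Icc _ _),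
    fun i j hij hn => ?_⟩
  by_cases hi : p < i
  · exact Or.inl (K.isZero_extend_X _ i
      ((ComplexShape.notMem_range_embeddingUpIntLE_iff p i).2 hi))
  · refine Or.inr (L.isZero_extend_X _ j
      ((ComplexShape.notMem_range_embeddingUpIntLE_iff q j).2 ?_))
    by_contra hj
    exact hn ⟨⟨by dsimp; lia, by dsimp; lia⟩, ⟨by dsimp; lia, by dsimp; lia⟩⟩

/-- The total complex exists if both complexes are bounded below. -/
instance hasMapBifunctor_extend_GE (K L : CochainComplex D ℕ) (p q : ℤ) :
    HomologicalComplex.HasMapBifunctor (K.extend (ComplexShape.embeddingUpIntGE p))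
      (L.extend (ComplexShape.embeddingUpIntGE q)) F (ComplexShape.up ℤ) := by
  apply hasMapBifunctor_of_finite_support
  intro n
  refine ⟨Set.Icc p (n - q) ×ˢ Set.Icc q (n - p), (Set.finite_Icc _ _).prod (Set.finite_Icc _ _),
    fun i j hij hn => ?_⟩
  by_cases hi : i < p
  · exact Or.inl (K.isZero_extend_X _ i
      ((ComplexShape.notMem_range_embeddingUpIntGE_iff p i).2 hi))
  · refine Or.inr (L.isZero_extend_X _ j
      ((ComplexShape.notMem_range_embeddingUpIntGE_iff q j).2 ?_))
    by_contra hj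
    exact hn ⟨⟨by dsimp; lia, by dsimp; lia⟩, ⟨by dsimp; lia, by dsimp; lia⟩⟩

end Totals

set_option linter.unusedSectionVars false

section Complexes

variable (k : Type u) [Field k] [CharZero k]

/-- The idempotent of `P^{(n)}`, on `Q_+^{⊗ n}`. -/
def symUp (n : ℕ) : upPow k n ⟶ upPow k n := symmetrizer k (addRight k) (crossRight k) n

/-- The idempotent of `P^{(n)^t}`, on `Q_+^{⊗ n}`. -/
def antiUp (n : ℕ) : upPow k n ⟶ upPow k n :=
  symmetrizer k (addRight k) (fun m => -crossRight k m) n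

/-- The idempotent of `Q^{(n)}`, on `Q_-^{⊗ n}`. -/
def symDown (n : ℕ) : downPow k n ⟶ downPow k n := symmetrizer k (addLeft k) (crossLeft k) n

/-- The idempotent of `Q^{(n)^t}`, on `Q_-^{⊗ n}`. -/
def antiDown (n : ℕ) : downPow k n ⟶ downPow k n :=
  symmetrizer k (addLeft k) (fun m => -crossLeft k m) n

/-- The idempotent of `P^{(x)} Q^{(y)^t}`, on `Q_+^{⊗ x} ⊗ Q_-^{⊗ y}`. -/
def idemB (x y : ℕ) : upPow k x ⊗ downPow k y ⟶ upPow k x ⊗ downPow k y :=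
  symUp k x ⊗ₘ antiDown k y

/-- The idempotent of `P^{(x)^t} Q^{(y)}`, on `Q_+^{⊗ x} ⊗ Q_-^{⊗ y}`. -/
def idemBstar (x y : ℕ) : upPow k x ⊗ downPow k y ⟶ upPow k x ⊗ downPow k y :=
  antiUp k x ⊗ₘ symDown k y

theorem idemB_idem (x y : ℕ) : idemB k x y ≫ idemB k x y = idemB k x y := by
  have h1 : symUp k x ≫ symUp k x = symUp k x := (tower_up k).symmetrizer_sq x
  have h2 : antiDown k y ≫ antiDown k y = antiDown k y := (tower_down k).neg.symmetrizer_sq y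
  rw [idemB, tensorHom_comp_tensorHom, h1, h2]

theorem idemBstar_idem (x y : ℕ) : idemBstar k x y ≫ idemBstar k x y = idemBstar k x y := by
  have h1 : antiUp k x ≫ antiUp k x = antiUp k x := (tower_up k).neg.symmetrizer_sq x
  have h2 : symDown k y ≫ symDown k y = symDown k y := (tower_down k).symmetrizer_sq y
  rw [idemBstar, tensorHom_comp_tensorHom, h1, h2]

/-- The cap joining the innermost strands of `Q_+^{⊗ (x + 1)} ⊗ Q_-^{⊗ (y + 1)}`. -/
def innerCap (x y : ℕ) :
    upPow k (x + 1) ⊗ downPow k (y + 1) ⟶ upPow k x ⊗ downPow k y :=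
  capIn (DiagCat.cap k) (upPow k x) (downPow k y)

/-- The cup inserted in the middle of `Q_+^{⊗ x} ⊗ Q_-^{⊗ y}`. -/
def innerCup (x y : ℕ) :
    upPow k x ⊗ downPow k y ⟶ upPow k (x + 1) ⊗ downPow k (y + 1) :=
  cupIn (DiagCat.cup k) (upPow k x) (downPow k y)

theorem innerCap_slide (x y : ℕ) :
    (crossRight k x ⊗ₘ 𝟙 (downPow k (y + 2))) ≫ innerCap k (x + 1) (y + 1) ≫ innerCap k x y =
      (𝟙 (upPow k (x + 2)) ⊗ₘ crossLeft k y) ≫ innerCap k (x + 1) (y + 1) ≫ innerCap k x y := by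
  have hc : DiagCat.crossDown k = rotL (DiagCat.cup' k) (DiagCat.cap k)
      (rotL (DiagCat.cup' k) (DiagCat.cap k) (DiagCat.crossUp k)) :=
    Quotient.sound Diagram.Rel.cyclicity
  have zz := DiagCat.zigzag_cup'_cap k
  have h2 := cap_slide _ _ zz (rotL (DiagCat.cup' k) (DiagCat.cap k) (DiagCat.crossUp k))
  rw [← hc] at h2
  exact capIn_slide _ (cap_slide _ _ zz (DiagCat.crossUp k)) h2 (upPow k x) (downPow k y)

theorem innerCup_slide (x y : ℕ) :
    innerCup k x y ≫ innerCup k (x + 1) (y + 1) ≫ (crossRight k x ⊗ₘ 𝟙 (downPow k (y + 2))) =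
      innerCup k x y ≫ innerCup k (x + 1) (y + 1) ≫ (𝟙 (upPow k (x + 2)) ⊗ₘ crossLeft k y) := by
  have hc : DiagCat.crossDown k = rotR (DiagCat.cup k) (DiagCat.cap' k)
      (rotR (DiagCat.cup k) (DiagCat.cap' k) (DiagCat.crossUp k)) := rfl
  have zz := DiagCat.zigzag_cup_cap'_up k
  have h2 := cup_slide _ _ zz (rotR (DiagCat.cup k) (DiagCat.cap' k) (DiagCat.crossUp k))
  rw [← hc] at h2
  exact cupIn_slide _ (cup_slide _ _ zz (DiagCat.crossUp k)) h2 (upPow k x) (downPow k y)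

theorem eq_zero_of_eq_neg {X Y : DiagCat k} {f : X ⟶ Y} (h : f = -f) : f = 0 := by
  have h2 : (2 : k) • f = 0 := by rw [two_smul]; nth_rw 1 [h]; exact neg_add_cancel f
  exact (smul_eq_zero.1 h2).resolve_left two_ne_zero

theorem tensor_neg {X Y X' Y' : DiagCat k} (f : X ⟶ Y) (g : X' ⟶ Y') :
    f ⊗ₘ (-g) = -(f ⊗ₘ g) := by
  rw [eq_neg_iff_add_eq_zero, ← MonoidalPreadditive.tensor_add, neg_add_cancel,
    MonoidalPreadditive.tensor_zero]

theorem neg_tensor {X Y X' Y' : DiagCat k} (f : X ⟶ Y) (g : X' ⟶ Y') :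
    (-f) ⊗ₘ g = -(f ⊗ₘ g) := by
  rw [eq_neg_iff_add_eq_zero, ← MonoidalPreadditive.add_tensor, neg_add_cancel,
    MonoidalPreadditive.zero_tensor]

theorem idemB_comp_innerCap_comp (x y : ℕ) :
    idemB k (x + 2) (y + 2) ≫ innerCap k (x + 1) (y + 1) ≫ idemB k (x + 1) (y + 1) ≫
      innerCap k x y = 0 := by
  have u1 : symUp k (x + 2) ≫ (symUp k (x + 1) ▷ DiagCat.Qp k) = symUp k (x + 2) :=
    ((tower_up k).absorb (x + 1)).2.1
  have d1 : antiDown k (y + 2) ≫ (DiagCat.Qm k ◁ antiDown k (y + 1)) = antiDown k (y + 2) :=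
    ((tower_down k).neg.absorb (y + 1)).2.1
  have u2 : symUp k (x + 2) ≫ crossRight k x = symUp k (x + 2) :=
    ((tower_up k).absorb x).2.2.2.1
  have d2' : antiDown k (y + 2) ≫ (-crossLeft k y) = antiDown k (y + 2) :=
    ((tower_down k).neg.absorb y).2.2.2.1
  have d2 : antiDown k (y + 2) ≫ crossLeft k y = -antiDown k (y + 2) := by
    rw [← neg_eq_iff_eq_neg, ← Preadditive.comp_neg]; exact d2'
  have e1 : idemB k (x + 2) (y + 2) ≫ innerCap k (x + 1) (y + 1) ≫ idemB k (x + 1) (y + 1) =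
      idemB k (x + 2) (y + 2) ≫ innerCap k (x + 1) (y + 1) := by
    have n := capIn_naturality (DiagCat.cap k) (symUp k (x + 1)) (antiDown k (y + 1))
    have m : idemB k (x + 2) (y + 2) ≫ ((symUp k (x + 1) ▷ DiagCat.Qp k) ⊗ₘ
        (DiagCat.Qm k ◁ antiDown k (y + 1))) = idemB k (x + 2) (y + 2) :=
      (tensorHom_comp_tensorHom _ _ _ _).trans (congrArg₂ _ u1 d1)
    refine (congrArg (idemB k (x + 2) (y + 2) ≫ ·) n.symm).trans ?_
    exact (Category.assoc _ _ _).symm.trans (congrArg (· ≫ innerCap k (x + 1) (y + 1)) m)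
  have e2 : idemB k (x + 2) (y + 2) ≫ (crossRight k x ⊗ₘ 𝟙 (downPow k (y + 2))) =
      idemB k (x + 2) (y + 2) := by
    rw [idemB, tensorHom_comp_tensorHom, u2, Category.comp_id]
  have e3 : idemB k (x + 2) (y + 2) ≫ (𝟙 (upPow k (x + 2)) ⊗ₘ crossLeft k y) =
      -idemB k (x + 2) (y + 2) := by
    rw [idemB, tensorHom_comp_tensorHom, d2, Category.comp_id, tensor_neg]
  have e4 := congrArg (idemB k (x + 2) (y + 2) ≫ ·) (innerCap_slide k x y)
  rw [← Category.assoc, e2, ← Category.assoc _ _ (innerCap k (x + 1) (y + 1) ≫ innerCap k x y), e3,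
    Preadditive.neg_comp] at e4
  rw [← Category.assoc (innerCap k (x + 1) (y + 1)), ← Category.assoc, e1, Category.assoc]
  exact eq_zero_of_eq_neg k e4

theorem innerCup_comp_idemBstar (x y : ℕ) :
    innerCup k x y ≫ idemBstar k (x + 1) (y + 1) ≫ innerCup k (x + 1) (y + 1) ≫
      idemBstar k (x + 2) (y + 2) = 0 := by
  have d1 : (DiagCat.Qm k ◁ symDown k (y + 1)) ≫ symDown k (y + 2) = symDown k (y + 2) :=
    ((tower_down k).absorb (y + 1)).2.2.1
  have u1 : (antiUp k (x + 1) ▷ DiagCat.Qp k) ≫ antiUp k (x + 2) = antiUp k (x + 2) :=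
    ((tower_up k).neg.absorb (x + 1)).2.2.1
  have d2 : crossLeft k y ≫ symDown k (y + 2) = symDown k (y + 2) :=
    ((tower_down k).absorb y).2.2.2.2
  have u2' : (-crossRight k x) ≫ antiUp k (x + 2) = antiUp k (x + 2) :=
    ((tower_up k).neg.absorb x).2.2.2.2
  have u2 : crossRight k x ≫ antiUp k (x + 2) = -antiUp k (x + 2) := by
    rw [← neg_eq_iff_eq_neg, ← Preadditive.neg_comp]; exact u2'
  have e1 : idemBstar k (x + 1) (y + 1) ≫ innerCup k (x + 1) (y + 1) ≫
      idemBstar k (x + 2) (y + 2) =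
      innerCup k (x + 1) (y + 1) ≫ idemBstar k (x + 2) (y + 2) := by
    have n := cupIn_naturality (DiagCat.cup k) (antiUp k (x + 1)) (symDown k (y + 1))
    have m : ((antiUp k (x + 1) ▷ DiagCat.Qp k) ⊗ₘ (DiagCat.Qm k ◁ symDown k (y + 1))) ≫
        idemBstar k (x + 2) (y + 2) = idemBstar k (x + 2) (y + 2) :=
      (tensorHom_comp_tensorHom _ _ _ _).trans (congrArg₂ _ u1 d1)
    refine (Category.assoc _ _ _).symm.trans ?_
    refine (congrArg (· ≫ idemBstar k (x + 2) (y + 2)) n.symm).trans ?_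
    exact (Category.assoc _ _ _).trans (congrArg (innerCup k (x + 1) (y + 1) ≫ ·) m)
  have e2 : (𝟙 (upPow k (x + 2)) ⊗ₘ crossLeft k y) ≫ idemBstar k (x + 2) (y + 2) =
      idemBstar k (x + 2) (y + 2) := by
    rw [idemBstar, tensorHom_comp_tensorHom, d2, Category.id_comp]
  have e3 : (crossRight k x ⊗ₘ 𝟙 (downPow k (y + 2))) ≫ idemBstar k (x + 2) (y + 2) =
      -idemBstar k (x + 2) (y + 2) := by
    rw [idemBstar, tensorHom_comp_tensorHom, u2, Category.id_comp, neg_tensor]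
  have e4 := congrArg (· ≫ idemBstar k (x + 2) (y + 2)) (innerCup_slide k x y)
  simp only [Category.assoc, e2, e3, Preadditive.comp_neg] at e4
  rw [e1]
  exact eq_zero_of_eq_neg k e4.symm

open Idempotents

/-- The category `H`: the Karoubi envelope of the additive envelope of the category of diagrams. -/
abbrev H := Karoubi (Mat_ (DiagCat k))

variable {k}

/-- The image of an idempotent of the category of diagrams, as an object of `H`. -/
def image {X : DiagCat k} (e : X ⟶ X) (he : e ≫ e = e) : H k where
  X := (Mat_.embedding _).obj X
  p := (Mat_.embedding _).map e
  idem := by rw [← Functor.map_comp, he]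

/-- The morphism `e ≫ g ≫ f` between the images of the idempotents `e` and `f`. -/
def imageHom {X Y : DiagCat k} {e : X ⟶ X} {f : Y ⟶ Y} (he : e ≫ e = e) (hf : f ≫ f = f)
    (g : X ⟶ Y) : image e he ⟶ image f hf where
  f := (Mat_.embedding _).map (e ≫ g ≫ f)
  comm := by
    change (Mat_.embedding _).map e ≫ (Mat_.embedding _).map (e ≫ g ≫ f) ≫
      (Mat_.embedding _).map f = _
    rw [← Functor.map_comp, ← Functor.map_comp]
    simp only [Category.assoc, hf]
    rw [← Category.assoc e e, he]

theorem imageHom_comp_eq_zero {X Y Z : DiagCat k} {e : X ⟶ X} {f : Y ⟶ Y} {h : Z ⟶ Z}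
    (he : e ≫ e = e) (hf : f ≫ f = f) (hh : h ≫ h = h) (g : X ⟶ Y) (g' : Y ⟶ Z)
    (w : e ≫ g ≫ f ≫ g' ≫ h = 0) : imageHom he hf g ≫ imageHom hf hh g' = 0 := by
  apply Karoubi.hom_ext
  change (Mat_.embedding _).map (e ≫ g ≫ f) ≫ (Mat_.embedding _).map (f ≫ g' ≫ h) = 0
  rw [← Functor.map_comp]
  have : (e ≫ g ≫ f) ≫ f ≫ g' ≫ h = 0 := by
    simp only [Category.assoc]
    rw [← Category.assoc f f, hf, w]
  rw [this, Functor.map_zero]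

variable (k)

/-- The object `P^{(x)} Q^{(y)^t}` of `H`: the tensor product of the images of the symmetrizer of
`Q_+^{⊗ x}` and of the antisymmetrizer of `Q_-^{⊗ y}`. -/
def PQt (x y : ℕ) : H k := image (idemB k x y) (idemB_idem k x y)

/-- The object `P^{(x)^t} Q^{(y)}` of `H`: the tensor product of the images of the antisymmetrizer
of `Q_+^{⊗ x}` and of the symmetrizer of `Q_-^{⊗ y}`. -/
def PtQ (x y : ℕ) : H k := image (idemBstar k x y) (idemBstar_idem k x y)

/-- The map `P^{(x + 1)} Q^{(y + 1)^t} ⟶ P^{(x)} Q^{(y)^t}` given by a cap. -/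
def dB (x y : ℕ) : PQt k (x + 1) (y + 1) ⟶ PQt k x y :=
  imageHom (idemB_idem k (x + 1) (y + 1)) (idemB_idem k x y) (innerCap k x y)

/-- The map `P^{(x)^t} Q^{(y)} ⟶ P^{(x + 1)^t} Q^{(y + 1)}` given by a cup. -/
def dBstar (x y : ℕ) : PtQ k x y ⟶ PtQ k (x + 1) (y + 1) :=
  imageHom (idemBstar_idem k x y) (idemBstar_idem k (x + 1) (y + 1)) (innerCup k x y)

theorem dB_comp (x y : ℕ) : dB k (x + 1) (y + 1) ≫ dB k x y = 0 := by
  apply imageHom_comp_eq_zero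
  have h := congrArg (· ≫ idemB k x y) (idemB_comp_innerCap_comp k x y)
  simpa only [Category.assoc, zero_comp] using h

theorem dBstar_comp (x y : ℕ) : dBstar k x y ≫ dBstar k (x + 1) (y + 1) = 0 := by
  apply imageHom_comp_eq_zero
  have h := congrArg (idemBstar k x y ≫ ·) (innerCup_comp_idemBstar k x y)
  simpa only [comp_zero] using h

/-- The complex `B_a`, a cochain complex indexed by `ℤ`: for `x - y = a`, its term in
degree `-y` (homological degree `y`) is `P^{(x)} Q^{(y)^t}`, and the other terms vanish.
Here `(x, y) = (a⁺ + n, a⁻ + n)` with `n = 0, 1, 2, …`. -/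
noncomputable def B (a : ℤ) : CochainComplex (H k) ℤ :=
  (ChainComplex.of (fun n => PQt k (a.toNat + n) ((-a).toNat + n))
    (fun n => dB k (a.toNat + n) ((-a).toNat + n))
    (fun n => dB_comp k (a.toNat + n) ((-a).toNat + n))).extend
      (ComplexShape.embeddingUpIntLE (-((-a).toNat : ℤ)))

/-- The complex `B_a^*`, a cochain complex indexed by `ℤ`: for `y - x = a`, its term in
degree `x` (homological degree `-x`) is `P^{(x)^t} Q^{(y)}`, and the other terms vanish.
Here `(x, y) = (a⁻ + n, a⁺ + n)` with `n = 0, 1, 2, …`. -/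
noncomputable def Bstar (a : ℤ) : CochainComplex (H k) ℤ :=
  (CochainComplex.of (fun n => PtQ k ((-a).toNat + n) (a.toNat + n))
    (fun n => dBstar k ((-a).toNat + n) (a.toNat + n))
    (fun n => dBstar_comp k ((-a).toNat + n) (a.toNat + n))).extend
      (ComplexShape.embeddingUpIntGE ((-a).toNat : ℤ))

variable {k} in
/-- The tensor product of complexes in `H`: the total complex, formed with direct sums, of the
double complex `K^p ⊗ L^q`, with differential `d ⊗ 1 + (-1)^p 1 ⊗ d`. -/
noncomputable def tensorComplex (K L : CochainComplex (H k) ℤ)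
    [HomologicalComplex.HasMapBifunctor K L (karoubiTensor (DiagCat k)) (ComplexShape.up ℤ)] :
    CochainComplex (H k) ℤ :=
  HomologicalComplex.mapBifunctor K L (karoubiTensor (DiagCat k)) (ComplexShape.up ℤ)

instance (a b : ℤ) : HomologicalComplex.HasMapBifunctor (B k a) (B k b)
    (karoubiTensor (DiagCat k)) (ComplexShape.up ℤ) := hasMapBifunctor_extend_LE _ _ _ _ _

instance (a b : ℤ) : HomologicalComplex.HasMapBifunctor (Bstar k a) (Bstar k b)
    (karoubiTensor (DiagCat k)) (ComplexShape.up ℤ) := hasMapBifunctor_extend_GE _ _ _ _ _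

variable {k} in
/-- The object of the homotopy category of unbounded complexes in `H` given by a complex. -/
noncomputable def toK (K : CochainComplex (H k) ℤ) :
    HomotopyCategory (H k) (ComplexShape.up ℤ) :=
  (HomotopyCategory.quotient (H k) (ComplexShape.up ℤ)).obj K

end Complexes

end Heis

/-!
Fix `s` and put `X c = B c ⊗ B (s - c)`. Its terms are the words `P_x Q_y P_x' Q_y'` with
`x - y = c` and `x' - y' = s - c`, and its differential is the sum, with signs, of the clockwise caps
between `P_x`, `Q_y` and between `P_x'`, `Q_y'`. The proof uses the two innermost factors
`Q_y P_x'`: the counterclockwise caps and cups between them give maps `κ : X c ⟶ X (c + 1)` of degree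
one and `κ'` in the opposite direction.

* The local relations imply that `κ` and `κ'` square to zero, that `κ' ≫ κ + κ ≫ κ' = 1`, and that
  `κ` anticommutes with the differential `d`. So the sequence formed by the maps `κ` is
  contractible, and `X c` is degreewise the extension of a shift of the kernel of `κ` on
  `X (c + 1)` by the kernel of `κ` on `X c`.
* The connecting map of this extension is the restriction of `F = κ' d + d κ' : X c ⟶ X (c - 1)`,
  which is computed diagrammatically: it moves a strand from `P_x` to `P_x'`, or from `Q_y'` to
  `Q_y`. Together with the map `E` moving strands back it satisfies, on the kernel of `κ`, the
  relation of `sl₂` in weight `2 c - t`, where `t = s`. These properties are the structure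
  `Koszul`.
* In each degree only finitely many `X c` are nonzero. Hence hard Lefschetz (`isIso_down`) holds on
  the kernel of `κ`: the power `F ^ m` from weight `m` to weight `-m` is invertible, in
  characteristic zero.
* Each `X c` is, up to a shift, the cone of a connecting map. If `2 c + 1 = t`, this map is
  invertible and `X c` vanishes (`Koszul.isZero`). If `b + c + 1 = t` and `b < c`, the cones that
  give `X b` and `X c` are those of the last and the first factor of an invertible power
  `F ^ (m + 2)` whose inner factor `F ^ m` is invertible as well; the octahedral axiom identifies them up to
  a shift (`Koszul.iso`).

The diagrammatic part is carried out for an arbitrary action of the local relations by two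
endofunctors on a category in which integers are invertible (`Action`), a word acting by nested
application. Strands are pulled across the symmetric and exterior powers (`Passing`,
`UpTower.exists_passing`, `DownTower.exists_passing`); the identities for the functors `Q_y P_x`
are collected in the namespace `Middle`, those for the words of four letters in `Quad`, and
`TotalOf.koszul` assembles them on total complexes. The action used is by tensoring on the left on
the Karoubi envelope of the category of diagrams.

For `Bstar`, the same results are applied in the opposite category (`Action.op`), after negating
all crossings (`Action.neg`), which exchanges symmetrizers and antisymmetrizers. Passing back
(`Quad.dual`) shifts the weights: here `t = s + 2`.
-/

namespace Heis

/-! ### Hard Lefschetz for `sl₂`-strings -/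

section Strings

/-- The composite `V c ⟶ V (c - 1) ⟶ ⋯ ⟶ V (c - m)` of the maps `F`. -/
def down {C : Type*} [Category C] {V : ℤ → C} (F : ∀ c c', c' + 1 = c → (V c ⟶ V c')) :
    ∀ (m : ℕ) (c c' : ℤ), c' + m = c → (V c ⟶ V c')
  | 0, c, c', h => eqToHom (congrArg V (by simpa using h.symm))
  | m + 1, c, c', h => down F m c (c' + 1) (by push_cast at h; lia) ≫ F (c' + 1) c' rfl

theorem map_down {C D : Type*} [Category C] [Category D] {V : ℤ → C}
    (F : ∀ c c', c' + 1 = c → (V c ⟶ V c')) (Φ : C ⥤ D) (m : ℕ) (c c' : ℤ) (h : c' + m = c) :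
    Φ.map (down F m c c' h) = down (V := fun c => Φ.obj (V c)) (fun c c' h => Φ.map (F c c' h))
      m c c' h := by
  induction m generalizing c' with
  | zero => simp [down, eqToHom_map]
  | succ m ih => simp [down, ih]

theorem down_succ {C : Type*} [Category C] {V : ℤ → C} (F : ∀ c c', c' + 1 = c → (V c ⟶ V c'))
    (m : ℕ) (c b c' : ℤ) (hb : b + 1 = c) (h : c' + (m + 1 : ℕ) = c) :
    down F (m + 1) c c' h = F c b hb ≫ down F m b c' (by push_cast at h; lia) := by
  induction m generalizing c' with
  | zero =>
    obtain rfl : b = c' := by push_cast at h; lia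
    subst hb
    simp [down]
  | succ m ih =>
    rw [down, ih (c' + 1) (by push_cast at h ⊢; lia), Category.assoc, down]

/-- The composite `V c ⟶ V (c + 1) ⟶ ⋯ ⟶ V (c + m)` of the maps `E`. -/
def up {C : Type*} [Category C] {V : ℤ → C} (E : ∀ c c', c + 1 = c' → (V c ⟶ V c')) :
    ∀ (m : ℕ) (c c' : ℤ), c + m = c' → (V c ⟶ V c')
  | 0, c, c', h => eqToHom (congrArg V (by simpa using h))
  | m + 1, c, c', h => E c (c + 1) rfl ≫ up E m (c + 1) c' (by push_cast at h; lia)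

theorem up_neg {C : Type*} [Category C] {V : ℤ → C} (F : ∀ c c', c' + 1 = c → (V c ⟶ V c'))
    (m : ℕ) (b c : ℤ) (h : b + m = c) :
    up (V := fun c => V (-c)) (fun c c' h => F (-c) (-c') (by lia)) m b c h =
      down F m (-b) (-c) (by lia) := by
  induction m generalizing b with
  | zero => rfl
  | succ m ih => rw [up, ih, ← down_succ]

variable {H : Type*} [Category H] [Preadditive H]

variable (H) in
/-- Nonzero integers act invertibly on all morphisms. -/
def Divisible : Prop := ∀ (X : H) (n : ℤ), n ≠ 0 → ∃ g : X ⟶ X, n • g = 𝟙 X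

theorem Divisible.eq_of_zsmul_eq (hH : Divisible H) {X Y : H} {n : ℤ} (hn : n ≠ 0) {f g : X ⟶ Y}
    (h : n • f = n • g) : f = g := by
  obtain ⟨e, he⟩ := hH X n hn
  rw [← Category.id_comp f, ← Category.id_comp g, ← he, Preadditive.zsmul_comp,
    Preadditive.zsmul_comp, ← Preadditive.comp_zsmul, h, Preadditive.comp_zsmul]

theorem Divisible.eq_zero_of_eq_neg (hH : Divisible H) {X Y : H} {f : X ⟶ Y} (h : f = -f) :
    f = 0 := by
  refine hH.eq_of_zsmul_eq (n := 2) (by norm_num) ?_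
  rw [two_smul, smul_zero]
  nth_rw 1 [h]
  exact neg_add_cancel f

theorem Divisible.isIso_zsmul_id (hH : Divisible H) (X : H) {n : ℤ} (hn : n ≠ 0) :
    IsIso (n • 𝟙 X) := by
  obtain ⟨g, hg⟩ := hH X n hn
  exact ⟨g, by simpa using hg, by simpa using hg⟩

/-- `n + f g` is invertible as soon as `n + g f` is. -/
theorem Divisible.isIso_add (hH : Divisible H) {X Y : H} (f : X ⟶ Y) (g : Y ⟶ X) {n : ℤ}
    (hn : n ≠ 0) (he : IsIso (n • 𝟙 Y + g ≫ f)) : IsIso (n • 𝟙 X + f ≫ g) := by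
  obtain ⟨e, h1, h2⟩ := he
  have := hH.isIso_zsmul_id X hn
  have b1 : (n • 𝟙 X + f ≫ g) ≫ (𝟙 X - f ≫ e ≫ g) = n • 𝟙 X := by
    have h3 : n • f ≫ e ≫ g + f ≫ g ≫ f ≫ e ≫ g = f ≫ g := by
      simpa using congrArg (fun t => f ≫ t ≫ g) h1
    simp only [Preadditive.add_comp, Preadditive.comp_sub, Category.comp_id, Category.id_comp,
      Preadditive.zsmul_comp, Category.assoc]
    rw [← sub_eq_zero, ← sub_eq_zero.2 h3.symm]
    abel
  have b2 : (𝟙 X - f ≫ e ≫ g) ≫ (n • 𝟙 X + f ≫ g) = n • 𝟙 X := by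
    have h3 : n • f ≫ e ≫ g + f ≫ e ≫ g ≫ f ≫ g = f ≫ g := by
      simpa using congrArg (fun t => f ≫ t ≫ g) h2
    simp only [Preadditive.comp_add, Preadditive.sub_comp, Category.comp_id, Category.id_comp,
      Preadditive.comp_zsmul, Category.assoc, smul_sub]
    rw [← sub_eq_zero, ← sub_eq_zero.2 h3.symm]
    abel
  refine ⟨(𝟙 X - f ≫ e ≫ g) ≫ inv (n • 𝟙 X), ?_, ?_⟩
  · rw [← Category.assoc, b1, IsIso.hom_inv_id]
  · have c : ∀ h : X ⟶ X, h ≫ inv (n • 𝟙 X) = inv (n • 𝟙 X) ≫ h := fun h => by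
      rw [IsIso.comp_inv_eq, Category.assoc, IsIso.eq_inv_comp]; simp
    rw [c, Category.assoc, b2, IsIso.inv_hom_id]

variable {V : ℤ → H} {t : ℤ} {F : ∀ c c', c' + 1 = c → (V c ⟶ V c')}
  {E : ∀ c c', c + 1 = c' → (V c ⟶ V c')}

/-- By descending induction on `c`, starting above the highest weight: the commutation relation
turns `z + F E` on `V c` into `z' + E F` with `z' = z + (2 c - t)`, and this is invertible if
`z' + F E` is so on `V (c + 1)`, by `Divisible.isIso_add`. -/
theorem isIso_string_step (hH : Divisible H)
    (comm : ∀ b c d (hb : b + 1 = c) (hd : c + 1 = d),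
      F c b hb ≫ E b c hb - E c d hd ≫ F d c hd = (2 * c - t) • 𝟙 (V c))
    {N : ℤ} (hN : ∀ c, N < c → IsZero (V c)) (b c : ℤ) (hb : b + 1 = c) (hc : 0 < 2 * c - t)
    (z : ℤ) (hz : 0 ≤ z) : IsIso (z • 𝟙 (V c) + F c b hb ≫ E b c hb) := by
  by_cases h : N < c
  · exact ⟨0, (hN c h).eq_of_src _ _, (hN c h).eq_of_src _ _⟩
  · obtain ⟨m, hm⟩ : ∃ m : ℕ, (m : ℤ) = N + 1 - c := ⟨(N + 1 - c).toNat, by lia⟩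
    clear h
    induction m generalizing b c z with
    | zero => exact ⟨0, (hN c (by lia)).eq_of_src _ _, (hN c (by lia)).eq_of_src _ _⟩
    | succ m ih =>
      have h1 := ih c (c + 1) rfl (by lia) (z + (2 * c - t)) (by lia) (by push_cast at hm; lia)
      have h2 := hH.isIso_add (E c (c + 1) rfl) (F (c + 1) c rfl) (n := z + (2 * c - t)) (by lia) h1
      convert h2 using 1
      rw [add_smul, ← comm b c (c + 1) hb rfl]
      abel

/-- The relation `F ^ m (F E) = (m (w - m - 1) + F E) F ^ m` on the weight space `w = 2 c - t`. -/
theorem down_comp_string (comm : ∀ b c d (hb : b + 1 = c) (hd : c + 1 = d),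
      F c b hb ≫ E b c hb - E c d hd ≫ F d c hd = (2 * c - t) • 𝟙 (V c))
    (m : ℕ) (b₀ b c c₀ : ℤ) (h₀ : b₀ + 1 = b) (h₁ : c₀ + 1 = c) (h : b + m = c) :
    down F m c b h ≫ F b b₀ h₀ ≫ E b₀ b h₀ =
      ((m * (2 * c - t) - m * (m + 1)) • 𝟙 _ + F c c₀ h₁ ≫ E c₀ c h₁) ≫ down F m c b h := by
  induction m generalizing b₀ b with
  | zero =>
    obtain rfl : b = c := by simpa using h
    obtain rfl : b₀ = c₀ := by lia
    simp [down]
  | succ m ih =>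
    have h2 := comm b₀ b (b + 1) h₀ rfl
    have h3 := ih b (b + 1) rfl (by push_cast at h; lia)
    rw [down, Category.assoc, sub_eq_iff_eq_add.1 h2, Preadditive.comp_add, Preadditive.comp_add,
      reassoc_of% h3]
    simp only [Preadditive.comp_zsmul, Category.comp_id, Preadditive.add_comp, Category.assoc,
      Preadditive.zsmul_comp, Category.id_comp]
    rw [← add_assoc, ← add_smul]
    congr 2
    have : b = c - (m + 1) := by push_cast at h; lia
    subst this
    push_cast
    ring

/-- As long as `m` does not exceed the weight `w = 2 c - t`, the composite `F ^ m E ^ m` is a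
product of factors `j (w - j - 1) + F E` with `j < m`, in which `j (w - j - 1)` is nonnegative. -/
theorem isIso_down_comp_up (hH : Divisible H)
    (comm : ∀ b c d (hb : b + 1 = c) (hd : c + 1 = d),
      F c b hb ≫ E b c hb - E c d hd ≫ F d c hd = (2 * c - t) • 𝟙 (V c))
    {N : ℤ} (hN : ∀ c, N < c → IsZero (V c)) (m : ℕ) (b c : ℤ) (h : b + m = c)
    (hm : (m : ℤ) ≤ 2 * c - t) : IsIso (down F m c b h ≫ up E m b c h) := by
  induction m generalizing b with
  | zero =>
    obtain rfl : b = c := by simpa using h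
    simp only [down, up, eqToHom_refl, Category.id_comp]
    infer_instance
  | succ m ih =>
    have h1 := ih (b + 1) (by push_cast at h; lia) (by push_cast at hm; lia)
    have h2 := isIso_string_step hH comm hN (c - 1) c (by lia) (by push_cast at hm; lia)
      (m * (2 * c - t) - m * (m + 1)) (by push_cast at hm; nlinarith)
    have h3 := down_comp_string comm m b (b + 1) c (c - 1) rfl (by lia) (by push_cast at h; lia)
    have h4 : down F (m + 1) c b h ≫ up E (m + 1) b c h =
      ((m * (2 * c - t) - m * (m + 1)) • 𝟙 _ + F c (c - 1) (by lia) ≫ E (c - 1) c (by lia)) ≫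
        (down F m c (b + 1) (by push_cast at h; lia) ≫
          up E m (b + 1) c (by push_cast at h; lia)) := by
      rw [down, up, ← Category.assoc _ (down F m c (b + 1) _), ← h3]
      simp only [Category.assoc]
    rw [h4]
    infer_instance

/-- The hard Lefschetz property: in an `sl₂`-string with highest and lowest weights, the power
`F ^ m` from weight `m` to weight `-m` is invertible. -/
theorem isIso_down (hH : Divisible H)
    (comm : ∀ b c d (hb : b + 1 = c) (hd : c + 1 = d),
      F c b hb ≫ E b c hb - E c d hd ≫ F d c hd = (2 * c - t) • 𝟙 (V c))
    {N N' : ℤ} (hN : ∀ c, N < c → IsZero (V c)) (hN' : ∀ c, c < N' → IsZero (V c))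
    (m : ℕ) (b c : ℤ) (h : b + m = c) (hm : (m : ℤ) = 2 * c - t) : IsIso (down F m c b h) := by
  have h1 := isIso_down_comp_up hH comm hN m b c h hm.le
  -- `F ^ m` has a right inverse; a left inverse comes from the same statement for the reversed
  -- string, in which `E` and `F` exchange their roles
  obtain ⟨x, rfl⟩ : ∃ x, c = -x := ⟨-c, by simp⟩
  obtain ⟨y, rfl⟩ : ∃ y, b = -y := ⟨-b, by simp⟩
  have h2 := isIso_down_comp_up (V := fun c => V (-c)) (t := -t)
    (F := fun c c' h => E (-c) (-c') (by lia)) (E := fun c c' h => F (-c) (-c') (by lia)) hH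
    (fun b c d hb hd => by
      have := comm (-d) (-c) (-b) (by lia) (by lia)
      rw [← neg_inj, neg_sub, this, ← neg_smul]
      congr 1
      ring) (N := -N') (fun c hc => hN' _ (by lia)) m x y (by lia) (by lia)
  rw [up_neg] at h2
  obtain ⟨g, hg, -⟩ := h1
  obtain ⟨g', -, hg'⟩ := h2
  rw [Category.assoc] at hg
  rw [← Category.assoc] at hg'
  have e : up E m (-y) (-x) h ≫ g =
      g' ≫ down (V := fun c => V (-c)) (fun c c' h => E (-c) (-c') (by lia)) m y x (by lia) := by
    rw [← Category.id_comp (up E m (-y) (-x) h ≫ g), ← hg', Category.assoc, hg, Category.comp_id]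
  exact ⟨up E m (-y) (-x) h ≫ g, hg, by rw [e, hg']⟩

end Strings
end Heis
namespace Heis

/-! ### Families of complexes with a contracting homotopy -/

section Koszul

open Pretriangulated

variable {H : Type*} [Category H] [Preadditive H]

/-- A family of complexes `X c` with maps `κ : X c ⟶ X (c + 1)` of degree `1` which anticommute
with the differentials and square to zero, a contracting homotopy `κ'` of `κ`, the maps
`F = d κ' + κ' d : X c ⟶ X (c - 1)`, and degreewise maps `E : X c ⟶ X (c + 1)` which, on the kernel
of `κ`, form together with `F` a representation of `sl₂` of weight `2 c - t`. -/
structure Koszul (X : ℤ → CochainComplex H ℤ) (t : ℤ) where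
  κ (c c' n n' : ℤ) (hc : c + 1 = c') (hn : n + 1 = n') : (X c).X n ⟶ (X c').X n'
  κ' (c c' n n' : ℤ) (hc : c + 1 = c') (hn : n + 1 = n') : (X c').X n' ⟶ (X c).X n
  F (n c c' : ℤ) (hc : c' + 1 = c) : (X c).X n ⟶ (X c').X n
  E (n c c' : ℤ) (hc : c + 1 = c') : (X c).X n ⟶ (X c').X n
  κ_κ (b c d m n o : ℤ) (hb : b + 1 = c) (hc : c + 1 = d) (hm : m + 1 = n) (hn : n + 1 = o) :
    κ b c m n hb hm ≫ κ c d n o hc hn = 0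
  κ'_κ' (b c d m n o : ℤ) (hb : b + 1 = c) (hc : c + 1 = d) (hm : m + 1 = n) (hn : n + 1 = o) :
    κ' c d n o hc hn ≫ κ' b c m n hb hm = 0
  homotopy (b c d m n o : ℤ) (hb : b + 1 = c) (hc : c + 1 = d) (hm : m + 1 = n) (hn : n + 1 = o) :
    κ' b c m n hb hm ≫ κ b c m n hb hm + κ c d n o hc hn ≫ κ' c d n o hc hn = 𝟙 _
  d_κ (c d m n o : ℤ) (hc : c + 1 = d) (hm : m + 1 = n) (hn : n + 1 = o) :
    (X c).d m n ≫ κ c d n o hc hn = -(κ c d m n hc hm ≫ (X d).d n o)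
  F_eq (b c m n o : ℤ) (hb : b + 1 = c) (hm : m + 1 = n) (hn : n + 1 = o) :
    F n c b hb = κ' b c m n hb hm ≫ (X b).d m n + (X c).d n o ≫ κ' b c n o hb hn
  comm (n o b c d : ℤ) (hb : b + 1 = c) (hc : c + 1 = d) (hn : n + 1 = o) :
    F n c b hb ≫ E n b c hb - E n c d hc ≫ F n d c hc =
      (2 * c - t) • 𝟙 _ + 2 • (κ c d n o hc hn ≫ κ' c d n o hc hn)
  isZero_above (n : ℤ) : ∃ N, ∀ c, N < c → IsZero ((X c).X n)
  isZero_below (n : ℤ) : ∃ N, ∀ c, c < N → IsZero ((X c).X n)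

namespace Koszul

variable {X : ℤ → CochainComplex H ℤ} {t : ℤ} (K : Koszul X t)

/-- The projection to the kernel of `κ`. -/
def p (c n : ℤ) : (X c).X n ⟶ (X c).X n :=
  K.κ' (c - 1) c (n - 1) n (by lia) (by lia) ≫ K.κ (c - 1) c (n - 1) n (by lia) (by lia)

theorem p_eq (c d n o : ℤ) (hc : c + 1 = d) (hn : n + 1 = o) :
    K.p c n = 𝟙 _ - K.κ c d n o hc hn ≫ K.κ' c d n o hc hn :=
  eq_sub_of_add_eq (K.homotopy _ _ _ _ _ _ (by lia) hc (by lia) hn)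

theorem p_κ (c d n o : ℤ) (hc : c + 1 = d) (hn : n + 1 = o) : K.p c n ≫ K.κ c d n o hc hn = 0 := by
  rw [p, Category.assoc, K.κ_κ, comp_zero]

theorem κ_p (c d n o : ℤ) (hc : c + 1 = d) (hn : n + 1 = o) :
    K.κ c d n o hc hn ≫ K.p d o = K.κ c d n o hc hn := by
  rw [K.p_eq d (d + 1) o (o + 1) rfl rfl, Preadditive.comp_sub, reassoc_of% K.κ_κ, zero_comp, sub_zero,
    Category.comp_id]

theorem κ'_p (c d n o : ℤ) (hc : c + 1 = d) (hn : n + 1 = o) :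
    K.κ' c d n o hc hn ≫ K.p c n = 0 := by
  rw [p, reassoc_of% K.κ'_κ', zero_comp]

theorem p_p (c n : ℤ) : K.p c n ≫ K.p c n = K.p c n := by
  conv_lhs => arg 1; rw [p]
  rw [Category.assoc, K.κ_p, p]

theorem p_d (c m n : ℤ) (hm : m + 1 = n) :
    K.p c m ≫ (X c).d m n ≫ K.p c n = K.p c m ≫ (X c).d m n := by
  rw [K.p_eq c (c + 1) n (n + 1) rfl rfl, Preadditive.comp_sub, Category.comp_id, reassoc_of% (K.d_κ c _ m
    n _ rfl hm rfl), Preadditive.comp_sub, Preadditive.neg_comp, Preadditive.comp_neg, Category.assoc,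
    reassoc_of% K.p_κ, zero_comp, neg_zero, sub_zero]

theorem p_eq' (b c m n : ℤ) (hb : b + 1 = c) (hm : m + 1 = n) :
    K.p c n = K.κ' b c m n hb hm ≫ K.κ b c m n hb hm := by
  obtain rfl : b = c - 1 := by lia
  obtain rfl : m = n - 1 := by lia
  rfl

theorem F_κ (b c d n o : ℤ) (hb : b + 1 = c) (hc : c + 1 = d) (hn : n + 1 = o) :
    K.F n c b hb ≫ K.κ b c n o hb hn = K.κ c d n o hc hn ≫ K.F o d c hc := by
  rw [K.F_eq b c (n - 1) n o hb (by lia) hn, K.F_eq c d n o (o + 1) hc hn rfl]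
  simp only [Preadditive.add_comp, Preadditive.comp_add, Category.assoc]
  rw [K.d_κ b c (n - 1) n o hb (by lia) hn, ← reassoc_of% (neg_eq_iff_eq_neg.2 (K.d_κ c d n o
    (o + 1) hc hn rfl))]
  have h1 := congrArg ((X c).d n o ≫ ·) (K.homotopy b c d n o (o + 1) hb hc hn rfl)
  have h2 := congrArg (· ≫ (X c).d n o) (K.homotopy b c d (n - 1) n o hb hc (by lia) hn)
  simp only [Preadditive.comp_add, Preadditive.add_comp, Category.assoc, Category.comp_id,
    Category.id_comp] at h1 h2
  simp only [Preadditive.comp_neg, Preadditive.neg_comp, Category.assoc]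
  rw [← sub_eq_zero, ← sub_eq_zero.2 (h1.trans h2.symm)]
  abel

theorem κ'_F (a b c n o : ℤ) (ha : a + 1 = b) (hb : b + 1 = c) (hn : n + 1 = o) :
    K.κ' b c n o hb hn ≫ K.F n b a ha = K.F o c b hb ≫ K.κ' a b n o ha hn := by
  rw [K.F_eq b c n o (o + 1) hb hn rfl, K.F_eq a b (n - 1) n o ha (by lia) hn]
  simp only [Preadditive.add_comp, Preadditive.comp_add, Category.assoc]
  rw [reassoc_of% K.κ'_κ' a b c (n - 1) n o, zero_comp, zero_add,
    K.κ'_κ' a b c n o (o + 1), comp_zero, add_zero]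

theorem F_p (b c n : ℤ) (hb : b + 1 = c) : K.F n c b hb ≫ K.p b n = K.p c n ≫ K.F n c b hb := by
  rw [p, K.p_eq' b c (n - 1) n hb (by lia), ← Category.assoc,
    ← K.κ'_F _ b c (n - 1) n _ hb, Category.assoc, K.F_κ _ b c, Category.assoc]

section Kernel

variable [IsIdempotentComplete H]

/-- The kernel of `κ`. -/
noncomputable def kerX (c n : ℤ) : H :=
  (IsIdempotentComplete.idempotents_split _ _ (K.p_p c n)).choose

/-- The inclusion of the kernel of `κ`. -/
noncomputable def i (c n : ℤ) : K.kerX c n ⟶ (X c).X n :=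
  (IsIdempotentComplete.idempotents_split _ _ (K.p_p c n)).choose_spec.choose

/-- The projection to the kernel of `κ`. -/
noncomputable def e (c n : ℤ) : (X c).X n ⟶ K.kerX c n :=
  (IsIdempotentComplete.idempotents_split _ _ (K.p_p c n)).choose_spec.choose_spec.choose

theorem i_e (c n : ℤ) : K.i c n ≫ K.e c n = 𝟙 _ :=
  (IsIdempotentComplete.idempotents_split _ _ (K.p_p c n)).choose_spec.choose_spec.choose_spec.1

theorem e_i (c n : ℤ) : K.e c n ≫ K.i c n = K.p c n :=
  (IsIdempotentComplete.idempotents_split _ _ (K.p_p c n)).choose_spec.choose_spec.choose_spec.2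

theorem i_p (c n : ℤ) : K.i c n ≫ K.p c n = K.i c n := by rw [← e_i, reassoc_of% K.i_e]

theorem p_e (c n : ℤ) : K.p c n ≫ K.e c n = K.e c n := by
  rw [← e_i, Category.assoc, i_e, Category.comp_id]

theorem i_κ (c d n o : ℤ) (hc : c + 1 = d) (hn : n + 1 = o) : K.i c n ≫ K.κ c d n o hc hn = 0 := by
  rw [← reassoc_of% K.i_p, p_κ, comp_zero]

theorem κ'_e (c d n o : ℤ) (hc : c + 1 = d) (hn : n + 1 = o) :
    K.κ' c d n o hc hn ≫ K.e c n = 0 := by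
  rw [← p_e, reassoc_of% K.κ'_p, zero_comp]

theorem i_d (c m n : ℤ) (hm : m + 1 = n) :
    K.i c m ≫ (X c).d m n ≫ K.p c n = K.i c m ≫ (X c).d m n := by
  rw [← reassoc_of% K.i_p, p_d _ _ _ _ hm, reassoc_of% K.i_p]

/-- The subcomplex of `X c` given by the kernel of `κ`. -/
noncomputable def ker (c : ℤ) : CochainComplex H ℤ where
  X n := K.kerX c n
  d m n := K.i c m ≫ (X c).d m n ≫ K.e c n
  shape m n h := by rw [(X c).shape _ _ h, zero_comp, comp_zero]
  d_comp_d' m n o hm hn := by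
    simp only [Category.assoc]
    rw [reassoc_of% K.e_i, reassoc_of% (K.i_d c m n hm), HomologicalComplex.d_comp_d_assoc, zero_comp, comp_zero]

/-- The exact sequence `ker κ ⟶ X c ⟶ (ker κ)[1]`. -/
noncomputable def seq (c d : ℤ) (hc : c + 1 = d) : ShortComplex (CochainComplex H ℤ) where
  X₁ := K.ker c
  X₂ := X c
  X₃ := (K.ker d)⟦(1 : ℤ)⟧
  f := { f := fun n => K.i c n
         comm' := fun m n hm => by
          change _ = (K.i c m ≫ (X c).d m n ≫ K.e c n) ≫ K.i c n
          simp only [Category.assoc, e_i]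
          exact (K.i_d _ _ _ hm).symm }
  g := { f := fun n => K.κ c d n (n + 1) hc rfl ≫ K.e d (n + 1)
         comm' := fun m n hm => by
          obtain rfl : m + 1 = n := hm
          rw [CochainComplex.shiftFunctor_obj_d']
          have h : (X c).d m (m + 1) ≫ K.κ c d (m + 1) (m + 1 + 1) hc rfl ≫ K.e d (m + 1 + 1) =
              -(K.κ c d m (m + 1) hc rfl ≫ (X d).d _ _ ≫ K.e d (m + 1 + 1)) := by
            rw [reassoc_of% (K.d_κ c d m (m + 1) _ hc rfl rfl), Preadditive.neg_comp, Category.assoc]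
          refine Eq.trans ?_ h.symm
          change (K.κ c d m (m + 1) hc rfl ≫ K.e d (m + 1)) ≫
            (Int.negOnePow 1 • (K.i d (m + 1) ≫ (X d).d _ _ ≫ K.e d (m + 1 + 1))) = _
          rw [Int.negOnePow_one, Units.neg_smul, one_smul, Preadditive.comp_neg, Category.assoc,
            reassoc_of% K.e_i, reassoc_of% K.κ_p] }
  zero := by
    ext n
    change K.i c n ≫ K.κ c d n (n + 1) hc rfl ≫ K.e d (n + 1) = 0
    rw [reassoc_of% K.i_κ, zero_comp]

/-- The degreewise splitting of the exact sequence `ker κ ⟶ X c ⟶ (ker κ)[1]`. -/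
noncomputable def split (c d : ℤ) (hc : c + 1 = d) (n : ℤ) :
    ((K.seq c d hc).map (HomologicalComplex.eval _ _ n)).Splitting where
  r := K.e c n
  s := K.i d (n + 1) ≫ K.κ' c d n (n + 1) hc rfl
  f_r := K.i_e c n
  s_g := by
    change (K.i d (n + 1) ≫ K.κ' c d n (n + 1) hc rfl) ≫ K.κ c d n (n + 1) hc rfl ≫
      K.e d (n + 1) = 𝟙 _
    have : K.κ' c d n (n + 1) hc rfl ≫ K.κ c d n (n + 1) hc rfl = K.p d (n + 1) := by
      obtain rfl : c = d - 1 := by lia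
      rw [p]
      congr <;> lia
    rw [Category.assoc, reassoc_of% this, reassoc_of% K.i_p, i_e]
  id := by
    change K.e c n ≫ K.i c n + (K.κ c d n (n + 1) hc rfl ≫ K.e d (n + 1)) ≫
      K.i d (n + 1) ≫ K.κ' c d n (n + 1) hc rfl = 𝟙 _
    rw [e_i, Category.assoc, reassoc_of% K.e_i, reassoc_of% K.κ_p, K.p_eq c d n (n + 1) hc rfl, sub_add_cancel]

/-- The connecting map of the exact sequence `ker κ ⟶ X c ⟶ (ker κ)[1]`. -/
noncomputable def δ (d c : ℤ) (hc : c + 1 = d) : (K.ker d)⟦(1 : ℤ)⟧ ⟶ (K.ker c)⟦(1 : ℤ)⟧ :=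
  CochainComplex.homOfDegreewiseSplit (K.seq c d hc) (K.split c d hc)

theorem δ_f (d c : ℤ) (hc : c + 1 = d) (n : ℤ) :
    (K.δ d c hc).f n = K.i d (n + 1) ≫ K.F (n + 1) d c hc ≫ K.e c (n + 1) := by
  refine (CochainComplex.homOfDegreewiseSplit_f _ _ n).trans ?_
  change (K.i d (n + 1) ≫ K.κ' c d n (n + 1) hc rfl) ≫ (X c).d n (n + 1) ≫ K.e c (n + 1) = _
  rw [K.F_eq c d n (n + 1) (n + 1 + 1) hc rfl rfl, Preadditive.add_comp, Category.assoc,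
    Category.assoc, Category.assoc, K.κ'_e, comp_zero, add_zero]

/-- The hard Lefschetz property of the maps `F` on the kernel of `κ`, in each degree. -/
theorem isIso_down_ker (hH : Divisible H) (n : ℤ) (m : ℕ) (b c : ℤ) (h : b + m = c)
    (hm : (m : ℤ) = 2 * c - t) :
    IsIso (down (V := fun c => K.kerX c n) (fun d c hc => K.i d n ≫ K.F n d c hc ≫ K.e c n)
      m c b h) := by
  obtain ⟨N, hN⟩ := K.isZero_above n
  obtain ⟨N', hN'⟩ := K.isZero_below n
  have hz : ∀ c, IsZero ((X c).X n) → IsZero (K.kerX c n) := fun c hc => by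
    rw [IsZero.iff_id_eq_zero, ← K.i_e, hc.eq_of_tgt (K.i c n) 0, zero_comp]
  refine isIso_down (V := fun c => K.kerX c n)
    (E := fun c d hc => K.i c n ≫ K.E n c d hc ≫ K.e d n) hH (fun b c d hb hd => ?_)
    (fun c hc => hz c (hN c hc)) (fun c hc => hz c (hN' c hc)) m b c h hm
  have h1 := K.comm n (n + 1) b c d hb hd rfl
  have h2 := congrArg (K.i c n ≫ · ≫ K.e c n) h1
  simp only [Preadditive.add_comp, Preadditive.comp_sub, Preadditive.sub_comp,
    Category.assoc, Preadditive.comp_zsmul, Preadditive.zsmul_comp,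
    Preadditive.nsmul_comp, Category.id_comp, K.i_e, K.κ'_e, comp_zero, smul_zero, add_zero] at h2
  simp only [Category.assoc]
  rw [reassoc_of% K.e_i, reassoc_of% K.F_p, reassoc_of% K.i_p, reassoc_of% K.e_i,
    ← reassoc_of% K.F_p, K.p_e]
  exact h2

/-- The hard Lefschetz property of the connecting maps. -/
theorem isIso_down_δ (hH : Divisible H) (m : ℕ) (b c : ℤ) (h : b + m = c)
    (hm : (m : ℤ) = 2 * c - t) :
    IsIso (down (V := fun c => (K.ker c)⟦(1 : ℤ)⟧) K.δ m c b h) := by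
  have (n : ℤ) : IsIso ((down (V := fun c => (K.ker c)⟦(1 : ℤ)⟧) K.δ m c b h).f n) := by
    have h1 := map_down (V := fun c => (K.ker c)⟦(1 : ℤ)⟧) K.δ (HomologicalComplex.eval _ _ n)
      m c b h
    have h2 : (fun d c hc => (HomologicalComplex.eval _ _ n).map (K.δ d c hc)) =
        (fun d c hc => K.i d (n + 1) ≫ K.F (n + 1) d c hc ≫ K.e c (n + 1)) := by
      funext d c hc
      exact K.δ_f d c hc n
    rw [h2] at h1
    change IsIso ((HomologicalComplex.eval _ _ n).map _)
    rw [h1]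
    exact K.isIso_down_ker hH (n + 1) m b c h hm
  exact HomologicalComplex.Hom.isIso_of_components _

variable [HasZeroObject H] [HasBinaryBiproducts H]

/-- The mapping cone of the connecting map is the shift of the complex in the middle. -/
noncomputable def coneIso (c d : ℤ) (hc : c + 1 = d) :
    (HomotopyCategory.quotient H (ComplexShape.up ℤ)).obj (CochainComplex.mappingCone (K.δ d c hc)) ≅
      ((HomotopyCategory.quotient H (ComplexShape.up ℤ)).obj (X c))⟦(1 : ℤ)⟧ :=
  (HomotopyCategory.quotient H (ComplexShape.up ℤ)).mapIso
    (CochainComplex.mappingConeHomOfDegreewiseSplitIso (K.seq c d hc) (K.split c d hc)) ≪≫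
  ((HomotopyCategory.quotient H (ComplexShape.up ℤ)).commShiftIso (1 : ℤ)).app _

/-- In weight `-1` the connecting map, which goes from weight `1` to weight `-1`, is invertible, so
that its cone vanishes. -/
theorem isZero (K : Koszul X t) (hH : Divisible H) (c : ℤ) (hc : 2 * c + 1 = t) :
    IsZero ((HomotopyCategory.quotient H (ComplexShape.up ℤ)).obj (X c)) := by
  have h1 := K.isIso_down_δ hH 1 c (c + 1) (by simp) (by lia)
  rw [down_succ _ 0 (c + 1) c c rfl] at h1
  have h0 : c + ((0 : ℕ) : ℤ) = c := by simp
  have h2 : IsIso (down (V := fun c => (K.ker c)⟦(1 : ℤ)⟧) K.δ 0 c c h0) := by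
    rw [down]; infer_instance
  have h2 : IsIso (K.δ (c + 1) c rfl) := IsIso.of_isIso_comp_right _
    (down (V := fun c => (K.ker c)⟦(1 : ℤ)⟧) K.δ 0 c c h0)
  have h3 := (Triangle.isZero₃_iff_isIso₁ _
    (HomotopyCategory.mappingCone_triangleh_distinguished (K.δ (c + 1) c rfl))).2 (by
      change IsIso ((HomotopyCategory.quotient H (ComplexShape.up ℤ)).map (K.δ (c + 1) c rfl))
      infer_instance)
  have h4 := h3.of_iso (K.coneIso c (c + 1) rfl).symm
  rw [IsZero.iff_id_eq_zero] at h4 ⊢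
  apply (shiftFunctor (HomotopyCategory H (ComplexShape.up ℤ)) (1 : ℤ)).map_injective
  rw [CategoryTheory.Functor.map_id, Functor.map_zero, h4]

/-- If a composite `f ≫ g ≫ h` is invertible with `g` invertible, then the cone of `h` is the
shift of the cone of `f`. -/
theorem cone_iso_shift {T : Type*} [Category T] [Preadditive T] [HasZeroObject T] [HasShift T ℤ]
    [∀ n : ℤ, (shiftFunctor T n).Additive] [Pretriangulated T] [IsTriangulated T]
    {A B C D Y Z : T} (f : A ⟶ B) (g : B ⟶ C) (h : C ⟶ D) [IsIso g] (hi : IsIso (f ≫ g ≫ h))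
    {v : B ⟶ Y} {w : Y ⟶ A⟦(1 : ℤ)⟧} (hf : Triangle.mk f v w ∈ distTriang T)
    {v' : D ⟶ Z} {w' : Z ⟶ C⟦(1 : ℤ)⟧} (hh : Triangle.mk h v' w' ∈ distTriang T) :
    Nonempty (Z ≅ Y⟦(1 : ℤ)⟧) := by
  let e : B ≅ C := asIso g
  have hgh : Triangle.mk (g ≫ h) v' (w' ≫ e.inv⟦(1 : ℤ)⟧') ∈ distTriang T := by
    refine isomorphic_distinguished _ hh _ (Triangle.isoMk (Triangle.mk (g ≫ h) v' _)
      (Triangle.mk h v' w') e (Iso.refl _) (Iso.refl _) ?_ ?_ ?_)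
    · exact Category.comp_id _
    · exact (Category.comp_id _).trans (Category.id_comp _).symm
    · change (w' ≫ e.inv⟦(1 : ℤ)⟧') ≫ e.hom⟦(1 : ℤ)⟧' = 𝟙 Z ≫ w'
      rw [Category.assoc, ← Functor.map_comp, e.inv_hom_id, CategoryTheory.Functor.map_id, Category.comp_id,
        Category.id_comp]
  obtain ⟨W, v'', w'', hW⟩ := distinguished_cocone_triangle (f ≫ g ≫ h)
  have o := Triangulated.someOctahedron rfl hf hgh hW
  have hz := (Triangle.isZero₃_iff_isIso₁ _ hW).2 hi
  have := (Triangle.isZero₂_iff_isIso₃ _ o.mem).1 hz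
  exact ⟨@asIso _ _ _ _ _ this⟩

/-- The complexes in weights `-(m + 2)` and `m` are, up to a shift, the cones of the last and of
the first factor of `F ^ (m + 2)`, which is invertible, as is the product `F ^ m` of the factors in
between. -/
theorem iso (K : Koszul X t) (hH : Divisible H) (b c : ℤ) (h : b < c) (ht : b + c + 1 = t) :
    Nonempty ((HomotopyCategory.quotient H (ComplexShape.up ℤ)).obj (X b) ≅
      ((HomotopyCategory.quotient H (ComplexShape.up ℤ)).obj (X c))⟦(1 : ℤ)⟧) := by
  obtain ⟨m, rfl⟩ : ∃ m : ℕ, c = b + 1 + m := ⟨(c - b - 1).toNat, by lia⟩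
  -- with `c - b = m + 1`, these are `F ^ m` from weight `m` to `-m` and `F ^ (m + 2)` from weight
  -- `m + 2` to `-(m + 2)`
  have h1 := K.isIso_down_δ hH m (b + 1) (b + 1 + m) rfl (by lia)
  have h2 := K.isIso_down_δ hH (m + 2) b (b + 1 + m + 1) (by push_cast; ring) (by push_cast; lia)
  rw [down_succ _ (m + 1) (b + 1 + m + 1) (b + 1 + m) b rfl, down] at h2
  have h3 : IsIso ((HomotopyCategory.quotient H (ComplexShape.up ℤ)).map
    (K.δ (b + 1 + m + 1) (b + 1 + m) rfl ≫
      down (V := fun c => (K.ker c)⟦(1 : ℤ)⟧) K.δ m (b + 1 + m) (b + 1) rfl ≫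
      K.δ (b + 1) b rfl)) := by infer_instance
  rw [Functor.map_comp, Functor.map_comp] at h3
  obtain ⟨e⟩ := cone_iso_shift _ _ _ h3
    (HomotopyCategory.mappingCone_triangleh_distinguished (K.δ (b + 1 + m + 1) (b + 1 + m) rfl))
    (HomotopyCategory.mappingCone_triangleh_distinguished (K.δ (b + 1) b rfl))
  exact ⟨(shiftFunctor _ (1 : ℤ)).preimageIso ((K.coneIso b (b + 1) rfl).symm ≪≫ e ≪≫
    (shiftFunctor _ (1 : ℤ)).mapIso (K.coneIso (b + 1 + m) (b + 1 + m + 1) rfl))⟩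

end Kernel

end Koszul

end Koszul
end Heis
namespace Heis

/-! ### The local relations as identities of natural transformations -/

section Action

variable {C : Type*} [Category C] [Preadditive C]

/-- An action of Khovanov's category on `C`: two endofunctors `u` and `d` (the upward and the
downward strand, a word acting by nested application), and natural transformations given by the
crossings `s`, `t`, `r`, `r'` and by the cups and caps (`cap'` and `cup'` are counterclockwise),
subject to the local relations. -/
structure Action (u d : C ⥤ C) where
  s (Z : C) : u.obj (u.obj Z) ⟶ u.obj (u.obj Z)
  t (Z : C) : d.obj (d.obj Z) ⟶ d.obj (d.obj Z)
  r (Z : C) : u.obj (d.obj Z) ⟶ d.obj (u.obj Z)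
  r' (Z : C) : d.obj (u.obj Z) ⟶ u.obj (d.obj Z)
  cap (Z : C) : u.obj (d.obj Z) ⟶ Z
  cup (Z : C) : Z ⟶ u.obj (d.obj Z)
  cap' (Z : C) : d.obj (u.obj Z) ⟶ Z
  cup' (Z : C) : Z ⟶ d.obj (u.obj Z)
  s_nat {Y Z : C} (f : Y ⟶ Z) : u.map (u.map f) ≫ s Z = s Y ≫ u.map (u.map f)
  t_nat {Y Z : C} (f : Y ⟶ Z) : d.map (d.map f) ≫ t Z = t Y ≫ d.map (d.map f)
  r_nat {Y Z : C} (f : Y ⟶ Z) : u.map (d.map f) ≫ r Z = r Y ≫ d.map (u.map f)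
  r'_nat {Y Z : C} (f : Y ⟶ Z) : d.map (u.map f) ≫ r' Z = r' Y ≫ u.map (d.map f)
  cap_nat {Y Z : C} (f : Y ⟶ Z) : u.map (d.map f) ≫ cap Z = cap Y ≫ f
  cup_nat {Y Z : C} (f : Y ⟶ Z) : f ≫ cup Z = cup Y ≫ u.map (d.map f)
  cap'_nat {Y Z : C} (f : Y ⟶ Z) : d.map (u.map f) ≫ cap' Z = cap' Y ≫ f
  cup'_nat {Y Z : C} (f : Y ⟶ Z) : f ≫ cup' Z = cup' Y ≫ d.map (u.map f)
  s_s (Z : C) : s Z ≫ s Z = 𝟙 _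
  t_t (Z : C) : t Z ≫ t Z = 𝟙 _
  braid_s (Z : C) : s (u.obj Z) ≫ u.map (s Z) ≫ s (u.obj Z) =
    u.map (s Z) ≫ s (u.obj Z) ≫ u.map (s Z)
  braid_t (Z : C) : t (d.obj Z) ≫ d.map (t Z) ≫ t (d.obj Z) =
    d.map (t Z) ≫ t (d.obj Z) ≫ d.map (t Z)
  r_r' (Z : C) : r Z ≫ r' Z = 𝟙 _
  r'_r (Z : C) : r' Z ≫ r Z = 𝟙 _ - cap' Z ≫ cup' Z
  bubble (Z : C) : cup' Z ≫ cap' Z = 𝟙 _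
  cup'_s (Z : C) : cup' (u.obj Z) ≫ d.map (s Z) = u.map (cup' Z) ≫ r (u.obj Z)
  cup'_r (Z : C) : cup' (d.obj Z) ≫ d.map (r Z) = d.map (cup' Z) ≫ t (u.obj Z)
  s_cap' (Z : C) : d.map (s Z) ≫ cap' (u.obj Z) = r' (u.obj Z) ≫ u.map (cap' Z)
  r'_cap' (Z : C) : d.map (r' Z) ≫ cap' (d.obj Z) = t (u.obj Z) ≫ d.map (cap' Z)
  cup'_cap_up (Z : C) : u.map (cup' Z) ≫ cap (u.obj Z) = 𝟙 _
  cup'_cap_down (Z : C) : cup' (d.obj Z) ≫ d.map (cap Z) = 𝟙 _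
  cup_cap'_up (Z : C) : cup (u.obj Z) ≫ u.map (cap' Z) = 𝟙 _
  cup_cap'_down (Z : C) : d.map (cup Z) ≫ cap' (d.obj Z) = 𝟙 _

namespace Action

variable {u d : C ⥤ C}

/-- The opposite action, given by reflecting diagrams in a horizontal line. -/
def op (T : Action u d) : Action u.op d.op where
  s Z := (T.s Z.unop).op
  t Z := (T.t Z.unop).op
  r Z := (T.r' Z.unop).op
  r' Z := (T.r Z.unop).op
  cap Z := (T.cup Z.unop).op
  cup Z := (T.cap Z.unop).op
  cap' Z := (T.cup' Z.unop).op
  cup' Z := (T.cap' Z.unop).op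
  s_nat f := Quiver.Hom.unop_inj (T.s_nat f.unop).symm
  t_nat f := Quiver.Hom.unop_inj (T.t_nat f.unop).symm
  r_nat f := Quiver.Hom.unop_inj (T.r'_nat f.unop).symm
  r'_nat f := Quiver.Hom.unop_inj (T.r_nat f.unop).symm
  cap_nat f := Quiver.Hom.unop_inj (T.cup_nat f.unop).symm
  cup_nat f := Quiver.Hom.unop_inj (T.cap_nat f.unop).symm
  cap'_nat f := Quiver.Hom.unop_inj (T.cup'_nat f.unop).symm
  cup'_nat f := Quiver.Hom.unop_inj (T.cap'_nat f.unop).symm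
  s_s Z := Quiver.Hom.unop_inj (T.s_s Z.unop)
  t_t Z := Quiver.Hom.unop_inj (T.t_t Z.unop)
  braid_s Z := Quiver.Hom.unop_inj (by simpa using T.braid_s Z.unop)
  braid_t Z := Quiver.Hom.unop_inj (by simpa using T.braid_t Z.unop)
  r_r' Z := Quiver.Hom.unop_inj (T.r_r' Z.unop)
  r'_r Z := Quiver.Hom.unop_inj (T.r'_r Z.unop)
  bubble Z := Quiver.Hom.unop_inj (T.bubble Z.unop)
  cup'_s Z := Quiver.Hom.unop_inj (T.s_cap' Z.unop)
  cup'_r Z := Quiver.Hom.unop_inj (T.r'_cap' Z.unop)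
  s_cap' Z := Quiver.Hom.unop_inj (T.cup'_s Z.unop)
  r'_cap' Z := Quiver.Hom.unop_inj (T.cup'_r Z.unop)
  cup'_cap_up Z := Quiver.Hom.unop_inj (T.cup_cap'_up Z.unop)
  cup'_cap_down Z := Quiver.Hom.unop_inj (T.cup_cap'_down Z.unop)
  cup_cap'_up Z := Quiver.Hom.unop_inj (T.cup'_cap_up Z.unop)
  cup_cap'_down Z := Quiver.Hom.unop_inj (T.cup'_cap_down Z.unop)

/-- The relations are preserved when all crossings are negated; this exchanges symmetrizers and
antisymmetrizers. -/
def neg [u.Additive] [d.Additive] (T : Action u d) : Action u d where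
  s Z := -T.s Z
  t Z := -T.t Z
  r Z := -T.r Z
  r' Z := -T.r' Z
  cap := T.cap
  cup := T.cup
  cap' := T.cap'
  cup' := T.cup'
  s_nat f := by simp [T.s_nat]
  t_nat f := by simp [T.t_nat]
  r_nat f := by simp [T.r_nat]
  r'_nat f := by simp [T.r'_nat]
  cap_nat := T.cap_nat
  cup_nat := T.cup_nat
  cap'_nat := T.cap'_nat
  cup'_nat := T.cup'_nat
  s_s Z := by simp [T.s_s]
  t_t Z := by simp [T.t_t]
  braid_s Z := by simp [T.braid_s, Functor.map_neg]
  braid_t Z := by simp [T.braid_t, Functor.map_neg]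
  r_r' Z := by simp [T.r_r']
  r'_r Z := by simp [T.r'_r]
  bubble := T.bubble
  cup'_s Z := by simp [T.cup'_s, Functor.map_neg]
  cup'_r Z := by simp [T.cup'_r, Functor.map_neg]
  s_cap' Z := by simp [T.s_cap', Functor.map_neg]
  r'_cap' Z := by simp [T.r'_cap', Functor.map_neg]
  cup'_cap_up := T.cup'_cap_up
  cup'_cap_down := T.cup'_cap_down
  cup_cap'_up := T.cup_cap'_up
  cup_cap'_down := T.cup_cap'_down

variable (T : Action u d)

/-- The left curl in its rotated form: it follows from the double crossings and the value of the
counterclockwise circle. -/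
theorem r_cap' (Z : C) : T.r Z ≫ T.cap' Z = 0 := by
  have h : T.r Z ≫ T.cap' Z ≫ T.cup' Z = 0 := by
    have := T.r Z ≫= T.r'_r Z
    rw [reassoc_of% T.r_r', Preadditive.comp_sub, Category.comp_id] at this
    exact sub_eq_self.1 this.symm
  have h' := congrArg (· ≫ T.cap' Z) h
  simpa only [Category.assoc, T.bubble, Category.comp_id, zero_comp] using h'

theorem cup'_r' (Z : C) : T.cup' Z ≫ T.r' Z = 0 := congrArg Quiver.Hom.unop (T.op.r_cap' (.op Z))

/-- A morphism `u W ⟶ W'` is determined by its mate `W ⟶ d W'`. -/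
theorem hom_ext_cup' {W W' : C} {f g : u.obj W ⟶ W'}
    (h : T.cup' W ≫ d.map f = T.cup' W ≫ d.map g) : f = g := by
  have (f : u.obj W ⟶ W') : f = u.map (T.cup' W ≫ d.map f) ≫ T.cap W' := by
    rw [Functor.map_comp, Category.assoc, T.cap_nat, reassoc_of% T.cup'_cap_up]
  rw [this f, h, ← this]

/-- A natural transformation `F d ⟶ G` is determined by its mate `F ⟶ G u`. -/
theorem ext_cup' {F G : C ⥤ C} {f g : ∀ Z, F.obj (d.obj Z) ⟶ G.obj Z}
    (hf : ∀ {Y Z : C} (w : Y ⟶ Z), F.map (d.map w) ≫ f Z = f Y ≫ G.map w)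
    (hg : ∀ {Y Z : C} (w : Y ⟶ Z), F.map (d.map w) ≫ g Z = g Y ≫ G.map w)
    (h : ∀ Z, F.map (T.cup' Z) ≫ f (u.obj Z) = F.map (T.cup' Z) ≫ g (u.obj Z)) (Z : C) :
    f Z = g Z := by
  have (f : ∀ Z, F.obj (d.obj Z) ⟶ G.obj Z)
      (hf : ∀ {Y Z : C} (w : Y ⟶ Z), F.map (d.map w) ≫ f Z = f Y ≫ G.map w) :
      f Z = (F.map (T.cup' (d.obj Z)) ≫ f (u.obj (d.obj Z))) ≫ G.map (T.cap Z) := by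
    rw [Category.assoc, ← hf, ← Functor.map_comp_assoc, T.cup'_cap_down, CategoryTheory.Functor.map_id,
      Category.id_comp]
  rw [this f hf, h, ← this g hg]

/-- The braid relation with one downward strand, by rotating the braid relation `braid_s`. -/
theorem s_r_r (Z : C) : T.s (d.obj Z) ≫ u.map (T.r Z) ≫ T.r (u.obj Z) =
    u.map (T.r Z) ≫ T.r (u.obj Z) ≫ d.map (T.s Z) := by
  refine T.ext_cup' (F := u ⋙ u) (G := u ⋙ u ⋙ d)
    (f := fun Z => T.s (d.obj Z) ≫ u.map (T.r Z) ≫ T.r (u.obj Z))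
    (g := fun Z => u.map (T.r Z) ≫ T.r (u.obj Z) ≫ d.map (T.s Z)) ?_ ?_ ?_ Z
  · intro Y Z w
    dsimp only [Functor.comp_map, Functor.comp_obj]
    rw [reassoc_of% T.s_nat, ← u.map_comp_assoc, T.r_nat, u.map_comp_assoc, T.r_nat]
    simp only [Category.assoc]
  · intro Y Z w
    dsimp only [Functor.comp_map, Functor.comp_obj]
    rw [← u.map_comp_assoc, T.r_nat, u.map_comp_assoc, reassoc_of% T.r_nat, ← d.map_comp, T.s_nat,
      d.map_comp]
    simp only [Category.assoc]
  · intro Z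
    dsimp only [Functor.comp_map, Functor.comp_obj]
    have h (W : C) (f : W ⟶ _) : f ≫ u.map (u.map (T.cup' Z)) ≫ u.map (T.r (u.obj Z)) ≫
        T.r (u.obj (u.obj Z)) = f ≫ T.cup' (u.obj (u.obj Z)) ≫ d.map (T.s (u.obj Z)) ≫
        d.map (u.map (T.s Z)) := by
      rw [← u.map_comp_assoc, ← T.cup'_s, u.map_comp_assoc, T.r_nat, reassoc_of% T.cup'_s]
    have h2 := h _ (T.s Z)
    have h3 := h _ (𝟙 _)
    rw [Category.id_comp, Category.id_comp] at h3
    rw [reassoc_of% T.s_nat, h2, reassoc_of% T.cup'_nat, reassoc_of% h3]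
    simp only [← Functor.map_comp, T.braid_s]

/-- The braid relation with two downward strands, by rotating the braid relation `braid_t`. -/
theorem t_r_r (Z : C) : u.map (T.t Z) ≫ T.r (d.obj Z) ≫ d.map (T.r Z) =
    T.r (d.obj Z) ≫ d.map (T.r Z) ≫ T.t (u.obj Z) := by
  apply T.hom_ext_cup'
  have h : T.cup' (d.obj (d.obj Z)) ≫ d.map (T.r (d.obj Z)) ≫ d.map (d.map (T.r Z)) =
      d.map (d.map (T.cup' Z)) ≫ d.map (T.t (u.obj Z)) ≫ T.t (d.obj (u.obj Z)) := by
    rw [reassoc_of% T.cup'_r, ← T.t_nat, ← d.map_comp_assoc, T.cup'_r, d.map_comp_assoc]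
  simp only [Functor.map_comp]
  rw [← reassoc_of% T.cup'_nat, h, reassoc_of% h, ← T.braid_t, ← reassoc_of% T.t_nat]

theorem s_r'_r' (Z : C) : d.map (T.s Z) ≫ T.r' (u.obj Z) ≫ u.map (T.r' Z) =
    T.r' (u.obj Z) ≫ u.map (T.r' Z) ≫ T.s (d.obj Z) := by
  simpa [op] using (congrArg Quiver.Hom.unop (T.op.s_r_r (.op Z))).symm

theorem t_r'_r' (Z : C) : T.t (u.obj Z) ≫ d.map (T.r' Z) ≫ T.r' (d.obj Z) =
    d.map (T.r' Z) ≫ T.r' (d.obj Z) ≫ u.map (T.t Z) := by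
  simpa [op] using (congrArg Quiver.Hom.unop (T.op.t_r_r (.op Z))).symm

/-- A braid relation in which the downward strand passes between the upward ones: the correction
term of the double crossing contains a curl and vanishes. -/
theorem r_s_r' [u.Additive] (Z : C) : T.r (u.obj Z) ≫ d.map (T.s Z) ≫ T.r' (u.obj Z) =
    u.map (T.r' Z) ≫ T.s (d.obj Z) ≫ u.map (T.r Z) := by
  have h1 := congrArg (u.map (T.r' Z) ≫ · ≫ T.r' (u.obj Z)) (T.s_r_r Z)
  simp only [Category.assoc, T.r_r', Category.comp_id] at h1
  rw [h1, ← u.map_comp_assoc, T.r'_r, Functor.map_sub, CategoryTheory.Functor.map_id, Preadditive.sub_comp,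
    Category.id_comp, u.map_comp, Category.assoc, ← reassoc_of% T.cup'_s, ← d.map_comp_assoc,
    T.s_s, d.map_id, Category.id_comp, T.cup'_r', comp_zero, sub_zero]

theorem r_t_r' [d.Additive] (Z : C) : d.map (T.r Z) ≫ T.t (u.obj Z) ≫ d.map (T.r' Z) =
    T.r' (d.obj Z) ≫ u.map (T.t Z) ≫ T.r (d.obj Z) := by
  have h1 := congrArg (T.r' (d.obj Z) ≫ · ≫ d.map (T.r' Z)) (T.t_r_r Z)
  simp only [Category.assoc, ← Functor.map_comp, T.r_r', CategoryTheory.Functor.map_id, Category.comp_id] at h1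
  rw [h1, reassoc_of% T.r'_r, Preadditive.sub_comp, Category.id_comp, Category.assoc,
    reassoc_of% T.cup'_r, reassoc_of% T.t_t, ← d.map_comp, T.cup'_r', Functor.map_zero, comp_zero,
    sub_zero]

end Action

end Action
end Heis
namespace Heis

/-! ### Functors across which strands can be pulled -/

section Passing

variable {C : Type*} [Category C] [Preadditive C] {u d : C ⥤ C}

/-- Crossings of an upward strand (`π`, `π'`) and of a downward strand (`χ`, `χ'`) with a functor
`W`, which behave like the crossings with a word in the two strands. As for words, `π ≫ π'` and
`χ ≫ χ'` are identities, but the opposite composites need not be. -/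
structure Passing (T : Action u d) (W : C ⥤ C) where
  π (Z : C) : u.obj (W.obj Z) ⟶ W.obj (u.obj Z)
  π' (Z : C) : W.obj (u.obj Z) ⟶ u.obj (W.obj Z)
  χ (Z : C) : W.obj (d.obj Z) ⟶ d.obj (W.obj Z)
  χ' (Z : C) : d.obj (W.obj Z) ⟶ W.obj (d.obj Z)
  π_nat {Y Z : C} (f : Y ⟶ Z) : u.map (W.map f) ≫ π Z = π Y ≫ W.map (u.map f)
  π'_nat {Y Z : C} (f : Y ⟶ Z) : W.map (u.map f) ≫ π' Z = π' Y ≫ u.map (W.map f)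
  χ_nat {Y Z : C} (f : Y ⟶ Z) : W.map (d.map f) ≫ χ Z = χ Y ≫ d.map (W.map f)
  χ'_nat {Y Z : C} (f : Y ⟶ Z) : d.map (W.map f) ≫ χ' Z = χ' Y ≫ W.map (d.map f)
  π_π' (Z : C) : π Z ≫ π' Z = 𝟙 _
  χ_χ' (Z : C) : χ Z ≫ χ' Z = 𝟙 _
  π_s_π' (Z : C) : π (u.obj Z) ≫ W.map (T.s Z) ≫ π' (u.obj Z) =
    u.map (π' Z) ≫ T.s (W.obj Z) ≫ u.map (π Z)
  χ'_t_χ (Z : C) : χ' (d.obj Z) ≫ W.map (T.t Z) ≫ χ (d.obj Z) =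
    d.map (χ Z) ≫ T.t (W.obj Z) ≫ d.map (χ' Z)
  r_χ_π' (Z : C) : W.map (T.r Z) ≫ χ (u.obj Z) ≫ d.map (π' Z) =
    π' (d.obj Z) ≫ u.map (χ Z) ≫ T.r (W.obj Z)
  χ'_π_r (Z : C) : u.map (χ' Z) ≫ π (d.obj Z) ≫ W.map (T.r Z) =
    T.r (W.obj Z) ≫ d.map (π Z) ≫ χ' (u.obj Z)
  π'_cap' (Z : C) : d.map (π' Z) ≫ T.cap' (W.obj Z) = χ' (u.obj Z) ≫ W.map (T.cap' Z)
  cup'_π (Z : C) : T.cup' (W.obj Z) ≫ d.map (π Z) = W.map (T.cup' Z) ≫ χ (u.obj Z)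
  s_π'_π' (Z : C) : W.map (T.s Z) ≫ π' (u.obj Z) ≫ u.map (π' Z) =
    π' (u.obj Z) ≫ u.map (π' Z) ≫ T.s (W.obj Z)
  π_π_s (Z : C) : u.map (π Z) ≫ π (u.obj Z) ≫ W.map (T.s Z) =
    T.s (W.obj Z) ≫ u.map (π Z) ≫ π (u.obj Z)

namespace Passing

variable {T : Action u d}

/-- Pulling strands across an upward strand. -/
def up (T : Action u d) [u.Additive] [d.Additive] : Passing T u where
  π := T.s
  π' := T.s
  χ := T.r
  χ' := T.r'
  π_nat := T.s_nat
  π'_nat := T.s_nat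
  χ_nat := T.r_nat
  χ'_nat := T.r'_nat
  π_π' := T.s_s
  χ_χ' := T.r_r'
  π_s_π' := T.braid_s
  χ'_t_χ Z := (T.r_t_r' Z).symm
  r_χ_π' Z := (T.s_r_r Z).symm
  χ'_π_r Z := (T.r_s_r' Z).symm
  π'_cap' := T.s_cap'
  cup'_π := T.cup'_s
  s_π'_π' Z := (T.braid_s Z).symm
  π_π_s Z := (T.braid_s Z).symm

/-- Pulling strands across a downward strand. -/
def down (T : Action u d) [u.Additive] [d.Additive] : Passing T d where
  π := T.r
  π' := T.r'
  χ := T.t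
  χ' := T.t
  π_nat := T.r_nat
  π'_nat := T.r'_nat
  χ_nat := T.t_nat
  χ'_nat := T.t_nat
  π_π' := T.r_r'
  χ_χ' := T.t_t
  π_s_π' := T.r_s_r'
  χ'_t_χ := T.braid_t
  r_χ_π' := T.r_t_r'
  χ'_π_r := T.t_r_r
  π'_cap' := T.r'_cap'
  cup'_π := T.cup'_r
  s_π'_π' := T.s_r'_r'
  π_π_s Z := (T.s_r_r Z).symm

/-- Pulling strands across a functor all of whose values vanish. -/
def ofIsZero {W : C ⥤ C} [u.Additive] [d.Additive] (hW : ∀ Z, IsZero (W.obj Z)) :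
    Passing T W where
  π _ := 0
  π' _ := 0
  χ _ := 0
  χ' _ := 0
  π_nat _ := (hW _).eq_of_tgt _ _
  π'_nat _ := (hW _).eq_of_src _ _
  χ_nat _ := (hW _).eq_of_src _ _
  χ'_nat _ := (hW _).eq_of_tgt _ _
  π_π' _ := (u.map_isZero (hW _)).eq_of_src _ _
  χ_χ' _ := (hW _).eq_of_src _ _
  π_s_π' _ := (u.map_isZero (hW _)).eq_of_src _ _
  χ'_t_χ _ := (d.map_isZero (hW _)).eq_of_src _ _
  r_χ_π' _ := (hW _).eq_of_src _ _
  χ'_π_r _ := (hW _).eq_of_tgt _ _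
  π'_cap' _ := (hW _).eq_of_tgt _ _
  cup'_π _ := (hW _).eq_of_src _ _
  s_π'_π' _ := (hW _).eq_of_src _ _
  π_π_s _ := (hW _).eq_of_tgt _ _

/-- Pulling strands across a composite of two functors. -/
def comp {V W : C ⥤ C} (pW : Passing T W) (pV : Passing T V) : Passing T (V ⋙ W) where
  π Z := pW.π (V.obj Z) ≫ W.map (pV.π Z)
  π' Z := W.map (pV.π' Z) ≫ pW.π' (V.obj Z)
  χ Z := W.map (pV.χ Z) ≫ pW.χ (V.obj Z)
  χ' Z := pW.χ' (V.obj Z) ≫ W.map (pV.χ' Z)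
  π_nat f := by
    dsimp only [Functor.comp_obj, Functor.comp_map]
    rw [reassoc_of% pW.π_nat, ← W.map_comp, pV.π_nat, W.map_comp, Category.assoc]
  π'_nat f := by
    dsimp only [Functor.comp_obj, Functor.comp_map]
    rw [← W.map_comp_assoc, pV.π'_nat, W.map_comp_assoc, pW.π'_nat, Category.assoc]
  χ_nat f := by
    dsimp only [Functor.comp_obj, Functor.comp_map]
    rw [← W.map_comp_assoc, pV.χ_nat, W.map_comp_assoc, pW.χ_nat, Category.assoc]
  χ'_nat f := by
    dsimp only [Functor.comp_obj, Functor.comp_map]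
    rw [reassoc_of% pW.χ'_nat, ← W.map_comp, pV.χ'_nat, W.map_comp, Category.assoc]
  π_π' Z := by
    dsimp only [Functor.comp_obj]
    rw [Category.assoc, ← W.map_comp_assoc, pV.π_π', W.map_id, Category.id_comp, pW.π_π']
  χ_χ' Z := by
    dsimp only [Functor.comp_obj]
    rw [Category.assoc, reassoc_of% pW.χ_χ', ← W.map_comp, pV.χ_χ', W.map_id]
  π_s_π' Z := by
    dsimp only [Functor.comp_obj, Functor.comp_map]
    have h := congrArg W.map (pV.π_s_π' Z)
    simp only [Functor.map_comp] at h
    simp only [Functor.map_comp, Category.assoc]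
    rw [reassoc_of% h, ← reassoc_of% pW.π_nat, pW.π'_nat, reassoc_of% pW.π_s_π']
  χ'_t_χ Z := by
    dsimp only [Functor.comp_obj, Functor.comp_map]
    have h := congrArg W.map (pV.χ'_t_χ Z)
    simp only [Functor.map_comp] at h
    simp only [Functor.map_comp, Category.assoc]
    rw [reassoc_of% h, ← reassoc_of% pW.χ'_nat, pW.χ_nat, reassoc_of% pW.χ'_t_χ]
  r_χ_π' Z := by
    dsimp only [Functor.comp_obj, Functor.comp_map]
    have h := congrArg W.map (pV.r_χ_π' Z)
    simp only [Functor.map_comp] at h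
    simp only [Functor.map_comp, Category.assoc]
    rw [← reassoc_of% pW.χ_nat, reassoc_of% h, pW.r_χ_π', reassoc_of% pW.π'_nat]
  χ'_π_r Z := by
    dsimp only [Functor.comp_obj, Functor.comp_map]
    have h := congrArg W.map (pV.χ'_π_r Z)
    simp only [Functor.map_comp] at h
    simp only [Functor.map_comp, Category.assoc]
    rw [reassoc_of% pW.π_nat, h, reassoc_of% pW.χ'_π_r, reassoc_of% pW.χ'_nat]
  π'_cap' Z := by
    dsimp only [Functor.comp_obj, Functor.comp_map]
    have h := congrArg W.map (pV.π'_cap' Z)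
    simp only [Functor.map_comp] at h
    simp only [Functor.map_comp, Category.assoc]
    rw [pW.π'_cap', reassoc_of% pW.χ'_nat, h]
  cup'_π Z := by
    dsimp only [Functor.comp_obj, Functor.comp_map]
    have h := congrArg W.map (pV.cup'_π Z)
    simp only [Functor.map_comp] at h
    simp only [Functor.map_comp]
    rw [reassoc_of% pW.cup'_π, ← pW.χ_nat, reassoc_of% h]
  s_π'_π' Z := by
    dsimp only [Functor.comp_obj, Functor.comp_map]
    have h := congrArg W.map (pV.s_π'_π' Z)
    simp only [Functor.map_comp] at h
    simp only [Functor.map_comp, Category.assoc]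
    rw [← reassoc_of% pW.π'_nat, reassoc_of% h, pW.s_π'_π', reassoc_of% pW.π'_nat]
  π_π_s Z := by
    dsimp only [Functor.comp_obj, Functor.comp_map]
    have h := congrArg W.map (pV.π_π_s Z)
    simp only [Functor.map_comp] at h
    simp only [Functor.map_comp, Category.assoc]
    rw [reassoc_of% pW.π_nat, h, reassoc_of% pW.π_π_s, reassoc_of% pW.π_nat]

end Passing

/-- A natural transformation which commutes with pulling strands across its source and target. -/
structure PassingHom {T : Action u d} {W V : C ⥤ C} (pW : Passing T W) (pV : Passing T V)
    (f : ∀ Z, W.obj Z ⟶ V.obj Z) : Prop where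
  nat {Y Z : C} (g : Y ⟶ Z) : W.map g ≫ f Z = f Y ≫ V.map g
  π (Z : C) : u.map (f Z) ≫ pV.π Z = pW.π Z ≫ f (u.obj Z)
  π' (Z : C) : f (u.obj Z) ≫ pV.π' Z = pW.π' Z ≫ u.map (f Z)
  χ (Z : C) : f (d.obj Z) ≫ pV.χ Z = pW.χ Z ≫ d.map (f Z)
  χ' (Z : C) : d.map (f Z) ≫ pV.χ' Z = pW.χ' Z ≫ f (d.obj Z)

namespace PassingHom

variable {T : Action u d} {U V W : C ⥤ C} {pU : Passing T U} {pV : Passing T V} {pW : Passing T W}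

theorem id (pW : Passing T W) : PassingHom pW pW (fun _ => 𝟙 _) := by
  constructor <;> intros <;> simp

theorem comp {f : ∀ Z, U.obj Z ⟶ V.obj Z} {g : ∀ Z, V.obj Z ⟶ W.obj Z} (hf : PassingHom pU pV f)
    (hg : PassingHom pV pW g) : PassingHom pU pW (fun Z => f Z ≫ g Z) where
  nat w := by rw [reassoc_of% hf.nat, hg.nat, Category.assoc]
  π Z := by rw [u.map_comp, Category.assoc, hg.π, reassoc_of% hf.π]
  π' Z := by rw [u.map_comp, Category.assoc, hg.π', reassoc_of% hf.π']
  χ Z := by rw [d.map_comp, Category.assoc, hg.χ, reassoc_of% hf.χ]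
  χ' Z := by rw [d.map_comp, Category.assoc, hg.χ', reassoc_of% hf.χ']

theorem add [u.Additive] [d.Additive] {f g : ∀ Z, U.obj Z ⟶ V.obj Z} (hf : PassingHom pU pV f)
    (hg : PassingHom pU pV g) : PassingHom pU pV (fun Z => f Z + g Z) where
  nat w := by rw [Preadditive.comp_add, Preadditive.add_comp, hf.nat, hg.nat]
  π Z := by rw [u.map_add, Preadditive.add_comp, Preadditive.comp_add, hf.π, hg.π]
  π' Z := by rw [u.map_add, Preadditive.add_comp, Preadditive.comp_add, hf.π', hg.π']
  χ Z := by rw [d.map_add, Preadditive.add_comp, Preadditive.comp_add, hf.χ, hg.χ]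
  χ' Z := by rw [d.map_add, Preadditive.add_comp, Preadditive.comp_add, hf.χ', hg.χ']

theorem zsmul [u.Additive] [d.Additive] {f : ∀ Z, U.obj Z ⟶ V.obj Z} (hf : PassingHom pU pV f)
    (n : ℤ) : PassingHom pU pV (fun Z => n • f Z) where
  nat w := by rw [Preadditive.comp_zsmul, Preadditive.zsmul_comp, hf.nat]
  π Z := by rw [u.map_zsmul, Preadditive.zsmul_comp, Preadditive.comp_zsmul, hf.π]
  π' Z := by rw [u.map_zsmul, Preadditive.zsmul_comp, Preadditive.comp_zsmul, hf.π']
  χ Z := by rw [d.map_zsmul, Preadditive.zsmul_comp, Preadditive.comp_zsmul, hf.χ]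
  χ' Z := by rw [d.map_zsmul, Preadditive.zsmul_comp, Preadditive.comp_zsmul, hf.χ']

/-- Needed for the idempotents of the symmetric powers, which are only known up to a factor. -/
theorem of_zsmul [u.Additive] [d.Additive] (hC : Divisible C) {f : ∀ Z, U.obj Z ⟶ V.obj Z} {n : ℤ}
    (hn : n ≠ 0) (hf : PassingHom pU pV (fun Z => n • f Z)) : PassingHom pU pV f where
  nat w := hC.eq_of_zsmul_eq hn (by
    simpa only [Preadditive.zsmul_comp, Preadditive.comp_zsmul] using hf.nat w)
  π Z := hC.eq_of_zsmul_eq hn (by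
    simpa only [u.map_zsmul, Preadditive.zsmul_comp, Preadditive.comp_zsmul] using hf.π Z)
  π' Z := hC.eq_of_zsmul_eq hn (by
    simpa only [u.map_zsmul, Preadditive.zsmul_comp, Preadditive.comp_zsmul] using hf.π' Z)
  χ Z := hC.eq_of_zsmul_eq hn (by
    simpa only [d.map_zsmul, Preadditive.zsmul_comp, Preadditive.comp_zsmul] using hf.χ Z)
  χ' Z := hC.eq_of_zsmul_eq hn (by
    simpa only [d.map_zsmul, Preadditive.zsmul_comp, Preadditive.comp_zsmul] using hf.χ' Z)

theorem of_isZero_src [u.Additive] [d.Additive] (h : ∀ Z, IsZero (U.obj Z))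
    (f : ∀ Z, U.obj Z ⟶ V.obj Z) : PassingHom pU pV f where
  nat _ := (h _).eq_of_src _ _
  π _ := (u.map_isZero (h _)).eq_of_src _ _
  π' _ := (h _).eq_of_src _ _
  χ _ := (h _).eq_of_src _ _
  χ' _ := (d.map_isZero (h _)).eq_of_src _ _

theorem of_isZero_tgt [u.Additive] [d.Additive] (h : ∀ Z, IsZero (V.obj Z))
    (f : ∀ Z, U.obj Z ⟶ V.obj Z) : PassingHom pU pV f where
  nat _ := (h _).eq_of_tgt _ _
  π _ := (h _).eq_of_tgt _ _
  π' _ := (u.map_isZero (h _)).eq_of_tgt _ _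
  χ _ := (d.map_isZero (h _)).eq_of_tgt _ _
  χ' _ := (h _).eq_of_tgt _ _

theorem whiskerLeft {f : ∀ Z, U.obj Z ⟶ V.obj Z} (hf : PassingHom pU pV f) (pW : Passing T W) :
    PassingHom (pW.comp pU) (pW.comp pV) (fun Z => W.map (f Z)) where
  nat w := by
    dsimp only [Functor.comp_obj, Functor.comp_map]
    rw [← W.map_comp, hf.nat, W.map_comp]
  π Z := by
    dsimp only [Passing.comp, Functor.comp_obj]
    rw [reassoc_of% pW.π_nat, ← W.map_comp, hf.π, W.map_comp, Category.assoc]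
  π' Z := by
    dsimp only [Passing.comp, Functor.comp_obj]
    rw [← W.map_comp_assoc, hf.π', W.map_comp_assoc, pW.π'_nat, Category.assoc]
  χ Z := by
    dsimp only [Passing.comp, Functor.comp_obj]
    rw [← W.map_comp_assoc, hf.χ, W.map_comp_assoc, pW.χ_nat, Category.assoc]
  χ' Z := by
    dsimp only [Passing.comp, Functor.comp_obj]
    rw [reassoc_of% pW.χ'_nat, ← W.map_comp, hf.χ', W.map_comp, Category.assoc]

theorem whiskerRight {f : ∀ Z, U.obj Z ⟶ V.obj Z} (hf : PassingHom pU pV f) (pW : Passing T W) :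
    PassingHom (pU.comp pW) (pV.comp pW) (fun Z => f (W.obj Z)) where
  nat w := hf.nat _
  π Z := by
    dsimp only [Passing.comp, Functor.comp_obj]
    rw [reassoc_of% hf.π, ← hf.nat, Category.assoc]
  π' Z := by
    dsimp only [Passing.comp, Functor.comp_obj]
    rw [← reassoc_of% hf.nat, hf.π', Category.assoc]
  χ Z := by
    dsimp only [Passing.comp, Functor.comp_obj]
    rw [← reassoc_of% hf.nat, hf.χ, Category.assoc]
  χ' Z := by
    dsimp only [Passing.comp, Functor.comp_obj]
    rw [reassoc_of% hf.χ', ← hf.nat, Category.assoc]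

theorem assoc (pU : Passing T U) (pV : Passing T V) (pW : Passing T W) :
    PassingHom ((pU.comp pV).comp pW) (pU.comp (pV.comp pW)) (fun _ => 𝟙 _) := by
  constructor <;> intros <;> simp [Passing.comp]

theorem assoc_inv (pU : Passing T U) (pV : Passing T V) (pW : Passing T W) :
    PassingHom (pU.comp (pV.comp pW)) ((pU.comp pV).comp pW) (fun _ => 𝟙 _) := by
  constructor <;> intros <;> simp [Passing.comp]

theorem crossing_up (T : Action u d) [u.Additive] [d.Additive] :
    PassingHom ((Passing.up T).comp (Passing.up T)) ((Passing.up T).comp (Passing.up T)) T.s where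
  nat w := T.s_nat w
  π Z := by simpa [Passing.comp, Passing.up] using (T.braid_s Z).symm
  π' Z := by simpa [Passing.comp, Passing.up] using T.braid_s Z
  χ Z := by simpa [Passing.comp, Passing.up] using T.s_r_r Z
  χ' Z := by simpa [Passing.comp, Passing.up] using T.s_r'_r' Z

theorem crossing_down (T : Action u d) [u.Additive] [d.Additive] :
    PassingHom ((Passing.down T).comp (Passing.down T)) ((Passing.down T).comp (Passing.down T))
      T.t where
  nat w := T.t_nat w
  π Z := by simpa [Passing.comp, Passing.down] using T.t_r_r Z
  π' Z := by simpa [Passing.comp, Passing.down] using T.t_r'_r' Z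
  χ Z := by simpa [Passing.comp, Passing.down] using T.braid_t Z
  χ' Z := by simpa [Passing.comp, Passing.down] using (T.braid_t Z).symm

end PassingHom

/-- Crossings with a direct summand `W` of `V` which are compatible with the inclusion `i` inherit
the relations. -/
def Passing.ofMono {T : Action u d} {V W : C ⥤ C} (pV : Passing T V) (i : ∀ Z, W.obj Z ⟶ V.obj Z)
    (hi : ∀ {Y Z : C} (g : Y ⟶ Z), W.map g ≫ i Z = i Y ≫ V.map g) [∀ Z, IsSplitMono (i Z)]
    (π : ∀ Z, u.obj (W.obj Z) ⟶ W.obj (u.obj Z)) (π' : ∀ Z, W.obj (u.obj Z) ⟶ u.obj (W.obj Z))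
    (χ : ∀ Z, W.obj (d.obj Z) ⟶ d.obj (W.obj Z)) (χ' : ∀ Z, d.obj (W.obj Z) ⟶ W.obj (d.obj Z))
    (hπ : ∀ Z, π Z ≫ i (u.obj Z) = u.map (i Z) ≫ pV.π Z)
    (hπ' : ∀ Z, π' Z ≫ u.map (i Z) = i (u.obj Z) ≫ pV.π' Z)
    (hχ : ∀ Z, χ Z ≫ d.map (i Z) = i (d.obj Z) ≫ pV.χ Z)
    (hχ' : ∀ Z, χ' Z ≫ i (d.obj Z) = d.map (i Z) ≫ pV.χ' Z) : Passing T W :=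
  have hm (F : C ⥤ C) {X Y Z : C} {f : X ⟶ Y} {g : Y ⟶ Z} {Y' : C} {f' : X ⟶ Y'} {g' : Y' ⟶ Z}
      (h : f ≫ g = f' ≫ g') : F.map f ≫ F.map g = F.map f' ≫ F.map g' := by
    rw [← F.map_comp, h, F.map_comp]
  have hπu Z := hm u (hπ Z)
  have hπ'u Z := hm u (hπ' Z)
  have hχu Z := hm u (hχ Z)
  have hχ'u Z := hm u (hχ' Z)
  have hπd Z := hm d (hπ Z)
  have hπ'd Z := hm d (hπ' Z)
  have hχd Z := hm d (hχ Z)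
  have hχ'd Z := hm d (hχ' Z)
  { π := π
    π' := π'
    χ := χ
    χ' := χ'
    π_nat {Y Z} f := by
      rw [← cancel_mono (i (u.obj Z)), Category.assoc, Category.assoc, hπ, hi, reassoc_of% hπ,
        reassoc_of% hm u (hi f), pV.π_nat]
    π'_nat {Y Z} f := by
      rw [← cancel_mono (u.map (i Z)), Category.assoc, Category.assoc, hπ', hm u (hi f),
        reassoc_of% hπ', reassoc_of% hi, pV.π'_nat]
    χ_nat {Y Z} f := by
      rw [← cancel_mono (d.map (i Z)), Category.assoc, Category.assoc, hχ, hm d (hi f),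
        reassoc_of% hχ, reassoc_of% hi, pV.χ_nat]
    χ'_nat {Y Z} f := by
      rw [← cancel_mono (i (d.obj Z)), Category.assoc, Category.assoc, hχ', hi, reassoc_of% hχ',
        reassoc_of% hm d (hi f), pV.χ'_nat]
    π_π' Z := by
      rw [← cancel_mono (u.map (i Z)), Category.assoc, hπ', reassoc_of% hπ, pV.π_π',
        Category.comp_id, Category.id_comp]
    χ_χ' Z := by
      rw [← cancel_mono (i (d.obj Z)), Category.assoc, hχ', reassoc_of% hχ, pV.χ_χ',
        Category.comp_id, Category.id_comp]
    π_s_π' Z := by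
      rw [← cancel_mono (u.map (i (u.obj Z)))]
      simp only [Category.assoc]
      rw [hπ', reassoc_of% hi, reassoc_of% hπ, hπu, ← reassoc_of% T.s_nat, reassoc_of% hπ'u,
        pV.π_s_π']
    χ'_t_χ Z := by
      rw [← cancel_mono (d.map (i (d.obj Z)))]
      simp only [Category.assoc]
      rw [hχ, reassoc_of% hi, reassoc_of% hχ', hχ'd, ← reassoc_of% T.t_nat, reassoc_of% hχd,
        pV.χ'_t_χ]
    r_χ_π' Z := by
      rw [← cancel_mono (d.map (u.map (i Z)))]
      simp only [Category.assoc]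
      rw [hπ'd, reassoc_of% hχ, reassoc_of% hi, ← T.r_nat, reassoc_of% hχu, reassoc_of% hπ',
        pV.r_χ_π']
    χ'_π_r Z := by
      rw [← cancel_mono (i (d.obj (u.obj Z)))]
      simp only [Category.assoc]
      rw [hi, reassoc_of% hπ, reassoc_of% hχ'u, hχ', reassoc_of% hπd, ← reassoc_of% T.r_nat,
        pV.χ'_π_r]
    π'_cap' Z := by
      rw [← cancel_mono (i Z), Category.assoc, Category.assoc, ← T.cap'_nat, hi,
        reassoc_of% hπ'd, reassoc_of% hχ', pV.π'_cap']
    cup'_π Z := by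
      rw [← cancel_mono (d.map (i (u.obj Z))), Category.assoc, Category.assoc, hπd, hχ,
        ← reassoc_of% T.cup'_nat, reassoc_of% hi, pV.cup'_π]
    s_π'_π' Z := by
      rw [← cancel_mono (u.map (u.map (i Z)))]
      simp only [Category.assoc]
      rw [hπ'u, reassoc_of% hπ', reassoc_of% hi, ← T.s_nat, reassoc_of% hπ'u, reassoc_of% hπ',
        pV.s_π'_π']
    π_π_s Z := by
      rw [← cancel_mono (i (u.obj (u.obj Z)))]
      simp only [Category.assoc]
      rw [hi, reassoc_of% hπ, reassoc_of% hπu, hπ, reassoc_of% hπu, ← reassoc_of% T.s_nat,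
        pV.π_π_s] }

/-- Strands can be pulled across a direct summand `W` of `V`, given by `i : W ⟶ V` and
`p : V ⟶ W`, as soon as they can be pulled across `V` in a way that commutes with the idempotent
`p ≫ i`. -/
theorem Passing.exists_retract {T : Action u d} {V W : C ⥤ C} (pV : Passing T V)
    (i : ∀ Z, W.obj Z ⟶ V.obj Z) (p : ∀ Z, V.obj Z ⟶ W.obj Z)
    (hi : ∀ {Y Z : C} (g : Y ⟶ Z), W.map g ≫ i Z = i Y ≫ V.map g) (hip : ∀ Z, i Z ≫ p Z = 𝟙 _)
    (he : PassingHom pV pV (fun Z => p Z ≫ i Z)) :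
    ∃ pW : Passing T W, PassingHom pW pV i ∧ PassingHom pV pW p := by
  have hp : ∀ {Y Z : C} (g : Y ⟶ Z), V.map g ≫ p Z = p Y ≫ W.map g := fun {Y Z} g => by
    rw [← Category.comp_id (V.map g ≫ p Z), ← hip, Category.assoc, reassoc_of% he.nat,
      ← reassoc_of% hi, hip, Category.comp_id]
  have hs (Z) : IsSplitMono (i Z) := ⟨⟨p Z, hip Z⟩⟩
  have hu (Z) : u.map (i Z) ≫ u.map (p Z) = 𝟙 _ := by rw [← u.map_comp, hip, u.map_id]
  have hd (Z) : d.map (i Z) ≫ d.map (p Z) = 𝟙 _ := by rw [← d.map_comp, hip, d.map_id]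
  have hπ (Z) := he.π Z
  have hπ' (Z) := he.π' Z
  have hχ (Z) := he.χ Z
  have hχ' (Z) := he.χ' Z
  simp only [Functor.map_comp, Category.assoc] at hπ hπ' hχ hχ'
  have e1 (Z) : (u.map (i Z) ≫ pV.π Z ≫ p (u.obj Z)) ≫ i (u.obj Z) = u.map (i Z) ≫ pV.π Z := by
    rw [Category.assoc, Category.assoc, ← hπ, reassoc_of% hu]
  have e2 (Z) : (i (u.obj Z) ≫ pV.π' Z ≫ u.map (p Z)) ≫ u.map (i Z) = i (u.obj Z) ≫ pV.π' Z := by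
    rw [Category.assoc, Category.assoc, ← hπ', reassoc_of% hip]
  have e3 (Z) : (i (d.obj Z) ≫ pV.χ Z ≫ d.map (p Z)) ≫ d.map (i Z) = i (d.obj Z) ≫ pV.χ Z := by
    rw [Category.assoc, Category.assoc, ← hχ, reassoc_of% hip]
  have e4 (Z) : (d.map (i Z) ≫ pV.χ' Z ≫ p (d.obj Z)) ≫ i (d.obj Z) = d.map (i Z) ≫ pV.χ' Z := by
    rw [Category.assoc, Category.assoc, ← hχ', reassoc_of% hd]
  refine ⟨Passing.ofMono pV i hi (fun Z => u.map (i Z) ≫ pV.π Z ≫ p (u.obj Z))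
    (fun Z => i (u.obj Z) ≫ pV.π' Z ≫ u.map (p Z)) (fun Z => i (d.obj Z) ≫ pV.χ Z ≫ d.map (p Z))
    (fun Z => d.map (i Z) ≫ pV.χ' Z ≫ p (d.obj Z)) e1 e2 e3 e4, ⟨hi, fun Z => (e1 Z).symm,
      fun Z => (e2 Z).symm, fun Z => (e3 Z).symm, fun Z => (e4 Z).symm⟩, ⟨hp, fun Z => ?_,
      fun Z => ?_, fun Z => ?_, fun Z => ?_⟩⟩
  · change u.map (p Z) ≫ u.map (i Z) ≫ pV.π Z ≫ p (u.obj Z) = _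
    rw [reassoc_of% hπ, hip, Category.comp_id]
  · change p (u.obj Z) ≫ i (u.obj Z) ≫ pV.π' Z ≫ u.map (p Z) = _
    rw [reassoc_of% hπ', hu, Category.comp_id]
  · change p (d.obj Z) ≫ i (d.obj Z) ≫ pV.χ Z ≫ d.map (p Z) = _
    rw [reassoc_of% hχ, hd, Category.comp_id]
  · change d.map (p Z) ≫ d.map (i Z) ≫ pV.χ' Z ≫ p (d.obj Z) = _
    rw [reassoc_of% hχ', hip, Category.comp_id]

end Passing
end Heis
namespace Heis

/-! ### Symmetric powers of the strands -/

section Towers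

variable {C : Type*} [Category C] [Preadditive C] {u d : C ⥤ C}

theorem Passing.π'_π_of_mono {T : Action u d} {V W : C ⥤ C} {pV : Passing T V} {pW : Passing T W}
    {i : ∀ Z, W.obj Z ⟶ V.obj Z} [∀ Z, Mono (i Z)] (hi : PassingHom pW pV i)
    (h : ∀ Z, pV.π' Z ≫ pV.π Z = 𝟙 _) (Z : C) : pW.π' Z ≫ pW.π Z = 𝟙 _ := by
  rw [← cancel_mono (i (u.obj Z)), Category.assoc, ← hi.π, ← reassoc_of% hi.π', h,
    Category.comp_id, Category.id_comp]

theorem Passing.χ'_χ_of_mono {T : Action u d} {V W : C ⥤ C} {pV : Passing T V} {pW : Passing T W}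
    {i : ∀ Z, W.obj Z ⟶ V.obj Z} [∀ Z, Mono (d.map (i Z))] (hi : PassingHom pW pV i)
    (h : ∀ Z, pV.χ' Z ≫ pV.χ Z = 𝟙 _) (Z : C) : pW.χ' Z ≫ pW.χ Z = 𝟙 _ := by
  rw [← cancel_mono (d.map (i Z)), Category.assoc, ← hi.χ, ← reassoc_of% hi.χ', h,
    Category.comp_id, Category.id_comp]

/-- Pulling strands across the identity functor. -/
def Passing.id (T : Action u d) : Passing T (𝟭 C) where
  π Z := 𝟙 (u.obj Z)
  π' Z := 𝟙 (u.obj Z)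
  χ Z := 𝟙 (d.obj Z)
  χ' Z := 𝟙 (d.obj Z)
  π_nat f := by simp
  π'_nat f := by simp
  χ_nat f := by simp
  χ'_nat f := by simp
  π_π' Z := by simp
  χ_χ' Z := by simp
  π_s_π' Z := by simp
  χ'_t_χ Z := by simp
  r_χ_π' Z := by simp
  χ'_π_r Z := by simp
  π'_cap' Z := by simp
  cup'_π Z := by simp
  s_π'_π' Z := by simp
  π_π_s Z := by simp

/-- The symmetric powers `P n` of the upward strand `u` with respect to the crossing `s`, zero for
`n < 0`: `P (m + 1)` is a direct summand of `P m u` with inclusion `a` and projection `c`, and the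
idempotents are given by the usual recursion. -/
structure UpTower (T : Action u d) (P : ℤ → C ⥤ C) where
  a (m n : ℤ) (h : m + 1 = n) (Z : C) : (P n).obj Z ⟶ (P m).obj (u.obj Z)
  c (m n : ℤ) (h : m + 1 = n) (Z : C) : (P m).obj (u.obj Z) ⟶ (P n).obj Z
  a_nat (m n : ℤ) (h : m + 1 = n) {Y Z : C} (f : Y ⟶ Z) :
    (P n).map f ≫ a m n h Z = a m n h Y ≫ (P m).map (u.map f)
  isZero (n : ℤ) (hn : n < 0) (Z : C) : IsZero ((P n).obj Z)
  unit : P 0 ≅ 𝟭 C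
  a_c (m n : ℤ) (h : m + 1 = n) (hm : 0 ≤ m) (Z : C) : a m n h Z ≫ c m n h Z = 𝟙 _
  c_a (l m n : ℤ) (hl : l + 1 = m) (hm : m + 1 = n) (h0 : 0 ≤ m) (Z : C) :
    n • (c m n hm Z ≫ a m n hm Z) =
      𝟙 _ + m • (a l m hl (u.obj Z) ≫ (P l).map (T.s Z) ≫ c l m hl (u.obj Z))
  a_a_s (l m n : ℤ) (hl : l + 1 = m) (hm : m + 1 = n) (Z : C) :
    a m n hm Z ≫ a l m hl (u.obj Z) ≫ (P l).map (T.s Z) = a m n hm Z ≫ a l m hl (u.obj Z)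
  s_c_c (l m n : ℤ) (hl : l + 1 = m) (hm : m + 1 = n) (Z : C) :
    (P l).map (T.s Z) ≫ c l m hl (u.obj Z) ≫ c m n hm Z = c l m hl (u.obj Z) ≫ c m n hm Z

/-- The exterior powers `Q n` of the downward strand `d` with respect to the crossing `t`, zero for
`n < 0`: `Q (m + 1)` is a direct summand of `d Q m` with inclusion `α` and projection `γ`, and the
idempotents are given by the usual recursion. -/
structure DownTower (T : Action u d) (Q : ℤ → C ⥤ C) where
  α (m n : ℤ) (h : m + 1 = n) (Z : C) : (Q n).obj Z ⟶ d.obj ((Q m).obj Z)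
  γ (m n : ℤ) (h : m + 1 = n) (Z : C) : d.obj ((Q m).obj Z) ⟶ (Q n).obj Z
  α_nat (m n : ℤ) (h : m + 1 = n) {Y Z : C} (f : Y ⟶ Z) :
    (Q n).map f ≫ α m n h Z = α m n h Y ≫ d.map ((Q m).map f)
  isZero (n : ℤ) (hn : n < 0) (Z : C) : IsZero ((Q n).obj Z)
  unit : Q 0 ≅ 𝟭 C
  α_γ (m n : ℤ) (h : m + 1 = n) (hm : 0 ≤ m) (Z : C) : α m n h Z ≫ γ m n h Z = 𝟙 _
  γ_α (l m n : ℤ) (hl : l + 1 = m) (hm : m + 1 = n) (h0 : 0 ≤ m) (Z : C) :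
    n • (γ m n hm Z ≫ α m n hm Z) =
      𝟙 _ - m • (d.map (α l m hl Z) ≫ T.t ((Q l).obj Z) ≫ d.map (γ l m hl Z))
  α_α_t (l m n : ℤ) (hl : l + 1 = m) (hm : m + 1 = n) (Z : C) :
    α m n hm Z ≫ d.map (α l m hl Z) ≫ T.t ((Q l).obj Z) = -(α m n hm Z ≫ d.map (α l m hl Z))
  t_γ_γ (l m n : ℤ) (hl : l + 1 = m) (hm : m + 1 = n) (Z : C) :
    T.t ((Q l).obj Z) ≫ d.map (γ l m hl Z) ≫ γ m n hm Z = -(d.map (γ l m hl Z) ≫ γ m n hm Z)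

variable {T : Action u d}

theorem exists_passing_of_iso {W : C ⥤ C} (e : W ≅ 𝟭 C) :
    ∃ p : Passing T W, (∀ Z, p.π' Z ≫ p.π Z = 𝟙 _) ∧ ∀ Z, p.χ' Z ≫ p.χ Z = 𝟙 _ := by
  obtain ⟨p, hp, -⟩ := (Passing.id T).exists_retract (W := W) (fun Z => e.hom.app Z)
    (fun Z => e.inv.app Z) (fun g => e.hom.naturality g) (fun Z => e.hom_inv_id_app Z) (by
      simp only [Iso.inv_hom_id_app]
      exact PassingHom.id _)
  exact ⟨p, Passing.π'_π_of_mono hp (fun Z => Category.id_comp _),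
    Passing.χ'_χ_of_mono hp (fun Z => Category.id_comp _)⟩

variable [u.Additive] [d.Additive]

/-- A recursive construction over the integers, starting from zero objects in negative degrees. -/
theorem exists_passing_int {P : ℤ → C ⥤ C} (hP : ∀ n < 0, ∀ Z, IsZero ((P n).obj Z))
    (E : ∀ n, Passing T (P n) → Prop) (R : ∀ m n, m + 1 = n → Passing T (P m) → Passing T (P n) → Prop)
    (h0 : ∃ p, E 0 p) (hE : ∀ n < 0, ∀ p, E n p) (hR : ∀ m n h, m < 0 → ∀ p q, R m n h p q)
    (step : ∀ m n h, 0 ≤ m → ∀ p, E m p → ∃ q, E n q ∧ R m n h p q) :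
    ∃ p : ∀ n, Passing T (P n), (∀ n, E n (p n)) ∧ ∀ m n h, R m n h (p m) (p n) := by
  have step' : ∀ (n : ℕ) (p : {p : Passing T (P n) // E n p}),
      ∃ q : {q : Passing T (P (n + 1 : ℕ)) // E (n + 1 : ℕ) q}, R n (n + 1 : ℕ) rfl p.1 q.1 := by
    rintro n ⟨p, hp⟩
    obtain ⟨q, hq, hr⟩ := step n (n + 1 : ℕ) rfl (by lia) p hp
    exact ⟨⟨q, hq⟩, hr⟩
  choose next hnext using step'
  obtain ⟨p0, hp0⟩ := h0
  let seq : ∀ n : ℕ, {p : Passing T (P n) // E n p} := fun n =>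
    Nat.rec (motive := fun n => {p : Passing T (P n) // E n p}) ⟨p0, hp0⟩ (fun n p => next n p) n
  refine ⟨fun n => match n with
    | Int.ofNat n => (seq n).1
    | Int.negSucc n => Passing.ofIsZero (hP _ (Int.negSucc_lt_zero n)), ?_, ?_⟩
  · rintro (n | n)
    · exact (seq n).2
    · exact hE _ (Int.negSucc_lt_zero n) _
  · rintro (n | n) m h
    · subst h
      exact hnext n (seq n)
    · exact hR _ _ _ (Int.negSucc_lt_zero n) _ _

/-- Strands can be pulled across the symmetric powers, compatibly with their inclusions and
projections. By induction on `m`: the recursion for the idempotent of `P (m + 1)` in `P m u` shows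
that it commutes with pulling strands across `P m u`. The double crossings of two upward strands
are identities, hence so is `π' ≫ π`. -/
theorem UpTower.exists_passing {P : ℤ → C ⥤ C} [∀ n, (P n).Additive] (hC : Divisible C)
    (t : UpTower T P) : ∃ p : ∀ n, Passing T (P n), (∀ n Z, (p n).π' Z ≫ (p n).π Z = 𝟙 _) ∧
      (∀ Z, (p 0).χ' Z ≫ (p 0).χ Z = 𝟙 _) ∧
      ∀ m n h, PassingHom (p n) ((p m).comp (Passing.up T)) (t.a m n h) ∧
        PassingHom ((p m).comp (Passing.up T)) (p n) (t.c m n h) := by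
  refine Exists.elim (exists_passing_int (T := T) t.isZero
    (fun m p => (∀ n h, PassingHom (p.comp (Passing.up T)) (p.comp (Passing.up T))
      (fun Z => t.c m n h Z ≫ t.a m n h Z)) ∧ (∀ Z, p.π' Z ≫ p.π Z = 𝟙 _) ∧
      (m = 0 → ∀ Z, p.χ' Z ≫ p.χ Z = 𝟙 _))
    (fun m n h p q => PassingHom q (p.comp (Passing.up T)) (t.a m n h) ∧
        PassingHom (p.comp (Passing.up T)) q (t.c m n h)) ?_ ?_ ?_ ?_)
    fun p ⟨hE, hR⟩ => ⟨p, fun n => (hE n).2.1, (hE 0).2.2 rfl, hR⟩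
  · obtain ⟨p, hp, hp'⟩ := exists_passing_of_iso (T := T) t.unit
    refine ⟨p, fun n h => ?_, hp, fun _ => hp'⟩
    obtain rfl : 1 = n := h
    convert PassingHom.id (p.comp (Passing.up T)) using 2 with Z
    simpa using t.c_a (-1) 0 1 rfl rfl le_rfl Z
  · exact fun n hn p => ⟨fun m h => PassingHom.of_isZero_src (U := u ⋙ P n) (fun Z => t.isZero n hn _) _,
      fun Z => (t.isZero n hn _).eq_of_src _ _, fun h => by lia⟩
  · exact fun m n h hm p q => ⟨PassingHom.of_isZero_tgt (V := u ⋙ P m) (fun Z => t.isZero m hm _) _,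
      PassingHom.of_isZero_src (U := u ⋙ P m) (fun Z => t.isZero m hm _) _⟩
  · rintro l m hl h0 p ⟨he, hp, -⟩
    obtain ⟨q, ha, hc⟩ := (p.comp (Passing.up T)).exists_retract (W := P m) (t.a l m hl)
      (t.c l m hl) (t.a_nat l m hl) (t.a_c l m hl h0) (he m hl)
    have (Z : C) : IsSplitMono (t.a l m hl Z) := ⟨⟨_, t.a_c l m hl h0 Z⟩⟩
    refine ⟨q, ⟨fun n hm => ?_, Passing.π'_π_of_mono ha fun Z => ?_, fun h => by lia⟩, ha, hc⟩
    · apply PassingHom.of_zsmul hC (n := n) (by lia)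
      have h1 := (((((ha.whiskerRight (Passing.up T)).comp (PassingHom.assoc _ _ _)).comp
        ((PassingHom.crossing_up T).whiskerLeft p)).comp (PassingHom.assoc_inv _ _ _)).comp
        (hc.whiskerRight (Passing.up T)))
      convert (PassingHom.id (q.comp (Passing.up T))).add (h1.zsmul m) using 2 with Z
      rw [t.c_a l m n hl hm (by lia)]
      simp
    · dsimp only [Passing.comp, Passing.up]
      rw [Category.assoc, reassoc_of% hp, ← (P l).map_comp, T.s_s, (P l).map_id]
      rfl

/-- Strands can be pulled across the exterior powers, compatibly with their inclusions and
projections, and the double crossings `χ' ≫ χ` of downward strands are identities. -/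
theorem DownTower.exists_passing {Q : ℤ → C ⥤ C} [∀ n, (Q n).Additive] (hC : Divisible C)
    (t : DownTower T Q) : ∃ p : ∀ n, Passing T (Q n), (∀ n Z, (p n).χ' Z ≫ (p n).χ Z = 𝟙 _) ∧
      (∀ Z, (p 0).π' Z ≫ (p 0).π Z = 𝟙 _) ∧
      ∀ m n h, PassingHom (p n) ((Passing.down T).comp (p m)) (t.α m n h) ∧
        PassingHom ((Passing.down T).comp (p m)) (p n) (t.γ m n h) := by
  refine Exists.elim (exists_passing_int (T := T) t.isZero
    (fun m p => (∀ n h, PassingHom ((Passing.down T).comp p) ((Passing.down T).comp p)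
      (fun Z => t.γ m n h Z ≫ t.α m n h Z)) ∧ (∀ Z, p.χ' Z ≫ p.χ Z = 𝟙 _) ∧
      (m = 0 → ∀ Z, p.π' Z ≫ p.π Z = 𝟙 _))
    (fun m n h p q => PassingHom q ((Passing.down T).comp p) (t.α m n h) ∧
        PassingHom ((Passing.down T).comp p) q (t.γ m n h)) ?_ ?_ ?_ ?_)
    fun p ⟨hE, hR⟩ => ⟨p, fun n => (hE n).2.1, (hE 0).2.2 rfl, hR⟩
  · obtain ⟨p, hp, hp'⟩ := exists_passing_of_iso (T := T) t.unit
    refine ⟨p, fun n h => ?_, hp', fun _ => hp⟩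
    obtain rfl : 1 = n := h
    convert PassingHom.id ((Passing.down T).comp p) using 2 with Z
    simpa using t.γ_α (-1) 0 1 rfl rfl le_rfl Z
  · exact fun n hn p => ⟨fun m h => PassingHom.of_isZero_src (U := Q n ⋙ d)
      (fun Z => d.map_isZero (t.isZero n hn Z)) _,
      fun Z => (d.map_isZero (t.isZero n hn _)).eq_of_src _ _, fun h => by lia⟩
  · exact fun m n h hm p q =>
      ⟨PassingHom.of_isZero_tgt (V := Q m ⋙ d) (fun Z => d.map_isZero (t.isZero m hm Z)) _,
      PassingHom.of_isZero_src (U := Q m ⋙ d) (fun Z => d.map_isZero (t.isZero m hm Z)) _⟩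
  · rintro l m hl h0 p ⟨he, hp, -⟩
    obtain ⟨q, hα, hγ⟩ := ((Passing.down T).comp p).exists_retract (W := Q m) (t.α l m hl)
      (t.γ l m hl) (t.α_nat l m hl) (t.α_γ l m hl h0) (he m hl)
    have (Z : C) : IsSplitMono (t.α l m hl Z) := ⟨⟨_, t.α_γ l m hl h0 Z⟩⟩
    refine ⟨q, ⟨fun n hm => ?_, Passing.χ'_χ_of_mono hα fun Z => ?_, fun h => by lia⟩, hα, hγ⟩
    · apply PassingHom.of_zsmul hC (n := n) (by lia)
      have h1 := (((((hα.whiskerLeft (Passing.down T)).comp (PassingHom.assoc_inv _ _ _)).comp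
        ((PassingHom.crossing_down T).whiskerRight p)).comp (PassingHom.assoc _ _ _)).comp
        (hγ.whiskerLeft (Passing.down T)))
      convert (PassingHom.id ((Passing.down T).comp q)).add (h1.zsmul (-m)) using 2 with Z
      rw [t.γ_α l m n hl hm (by lia)]
      simp [sub_eq_add_neg]
    · dsimp only [Passing.comp, Passing.down]
      rw [Category.assoc, ← d.map_comp_assoc, hp, d.map_id, Category.id_comp, T.t_t]
      rfl

end Towers
end Heis
namespace Heis

/-! ### The maps between the functors `Q_y P_x` -/

section Middle

variable {C : Type*} [Category C] [Preadditive C] {u d : C ⥤ C}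

namespace Action

variable (T : Action u d)

theorem map_s_s (F : C ⥤ C) (Z : C) : F.map (T.s Z) ≫ F.map (T.s Z) = 𝟙 _ := by
  rw [← F.map_comp, T.s_s, F.map_id]

/-- The left curl vanishes. -/
theorem curl (Z : C) : T.cup' (u.obj Z) ≫ d.map (T.s Z) ≫ T.cap' (u.obj Z) = 0 := by
  rw [reassoc_of% T.cup'_s, T.r_cap', comp_zero]

/-- A downward strand next to a closed loop which it crosses twice. -/
theorem loop_zero [d.Additive] (Z : C) : T.cup' (d.obj Z) ≫ d.map (T.r Z) ≫ T.t (u.obj Z) ≫ d.map (T.r' Z) ≫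
    T.cap' (d.obj Z) = 0 := by
  rw [reassoc_of% T.cup'_r, reassoc_of% T.t_t, ← d.map_comp_assoc, T.cup'_r', Functor.map_zero,
    zero_comp]

/-- A cup and a cap, exchanging their strands with the neighbouring pair of strands in between,
straighten to the cap and the cup of this pair. -/
theorem loop_eq (Z : C) : T.cup' (d.obj (u.obj Z)) ≫ d.map (T.r (u.obj Z)) ≫
    T.t (u.obj (u.obj Z)) ≫ d.map (d.map (T.s Z)) ≫ d.map (T.r' (u.obj Z)) ≫
    T.cap' (d.obj (u.obj Z)) = T.cap' Z ≫ T.cup' Z := by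
  rw [reassoc_of% T.cup'_r, reassoc_of% T.t_t, ← d.map_comp_assoc, T.cup'_s,
    ← d.map_comp_assoc, Category.assoc, T.r_r', Category.comp_id, T.cap'_nat]

/-- Two nested counterclockwise caps can be twisted on either side. -/
theorem s_cap'_cap' (Z : C) :
    d.map (d.map (T.s Z)) ≫ d.map (T.cap' (u.obj Z)) ≫ T.cap' Z =
      T.t (u.obj (u.obj Z)) ≫ d.map (T.cap' (u.obj Z)) ≫ T.cap' Z := by
  rw [← reassoc_of% T.r'_cap', ← T.cap'_nat, ← d.map_comp_assoc, T.s_cap', d.map_comp_assoc]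

theorem cup'_cup'_s (Z : C) :
    T.cup' Z ≫ d.map (T.cup' (u.obj Z)) ≫ d.map (d.map (T.s Z)) =
      T.cup' Z ≫ d.map (T.cup' (u.obj Z)) ≫ T.t (u.obj (u.obj Z)) := by
  rw [← T.cup'_r, ← d.map_comp, T.cup'_s, d.map_comp, reassoc_of% T.cup'_nat]

end Action

variable [u.Additive] [d.Additive]

/-- The properties of the functors `M y x = Q_y P_x`, the products of a downward tower `Q` and an
upward tower `P`. The maps `α`, `γ` split off and merge a downward strand on the left, the maps `a`,
`c` do so with an upward strand on the right; they are normalized so that `α ≫ γ` and `a ≫ c` are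
the multiplications by `y` and `x`. -/
structure Middle (T : Action u d) (M : ℤ → ℤ → C ⥤ C) where
  p (y x : ℤ) : Passing T (M y x)
  a (y m n : ℤ) (h : m + 1 = n) (Z : C) : (M y n).obj Z ⟶ (M y m).obj (u.obj Z)
  c (y m n : ℤ) (h : m + 1 = n) (Z : C) : (M y m).obj (u.obj Z) ⟶ (M y n).obj Z
  α (m n : ℤ) (h : m + 1 = n) (x : ℤ) (Z : C) : (M n x).obj Z ⟶ d.obj ((M m x).obj Z)
  γ (m n : ℤ) (h : m + 1 = n) (x : ℤ) (Z : C) : d.obj ((M m x).obj Z) ⟶ (M n x).obj Z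
  a_hom (y m n : ℤ) (h : m + 1 = n) :
    PassingHom (p y n) ((p y m).comp (Passing.up T)) (a y m n h)
  c_hom (y m n : ℤ) (h : m + 1 = n) :
    PassingHom ((p y m).comp (Passing.up T)) (p y n) (c y m n h)
  α_hom (m n : ℤ) (h : m + 1 = n) (x : ℤ) :
    PassingHom (p n x) ((Passing.down T).comp (p m x)) (α m n h x)
  γ_hom (m n : ℤ) (h : m + 1 = n) (x : ℤ) :
    PassingHom ((Passing.down T).comp (p m x)) (p n x) (γ m n h x)
  isZero_left (y x : ℤ) (hy : y < 0) (Z : C) : IsZero ((M y x).obj Z)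
  isZero_right (y x : ℤ) (hx : x < 0) (Z : C) : IsZero ((M y x).obj Z)
  π'_π_zero (x : ℤ) (Z : C) : (p 0 x).π' Z ≫ (p 0 x).π Z = 𝟙 _
  χ'_χ_zero (y : ℤ) (Z : C) : (p y 0).χ' Z ≫ (p y 0).χ Z = 𝟙 _
  a_c (y m n : ℤ) (h : m + 1 = n) (Z : C) : a y m n h Z ≫ c y m n h Z = n • 𝟙 _
  c_a (y l m n : ℤ) (hl : l + 1 = m) (hm : m + 1 = n) (Z : C) : c y m n hm Z ≫ a y m n hm Z =
    𝟙 _ + a y l m hl (u.obj Z) ≫ (M y l).map (T.s Z) ≫ c y l m hl (u.obj Z)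
  a_a_s (y l m n : ℤ) (hl : l + 1 = m) (hm : m + 1 = n) (Z : C) :
    a y m n hm Z ≫ a y l m hl (u.obj Z) ≫ (M y l).map (T.s Z) =
      a y m n hm Z ≫ a y l m hl (u.obj Z)
  s_c_c (y l m n : ℤ) (hl : l + 1 = m) (hm : m + 1 = n) (Z : C) :
    (M y l).map (T.s Z) ≫ c y l m hl (u.obj Z) ≫ c y m n hm Z =
      c y l m hl (u.obj Z) ≫ c y m n hm Z
  α_γ (m n : ℤ) (h : m + 1 = n) (x : ℤ) (Z : C) : α m n h x Z ≫ γ m n h x Z = n • 𝟙 _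
  γ_α (l m n : ℤ) (hl : l + 1 = m) (hm : m + 1 = n) (x : ℤ) (Z : C) :
    γ m n hm x Z ≫ α m n hm x Z =
      𝟙 _ - d.map (α l m hl x Z) ≫ T.t ((M l x).obj Z) ≫ d.map (γ l m hl x Z)
  α_α_t (l m n : ℤ) (hl : l + 1 = m) (hm : m + 1 = n) (x : ℤ) (Z : C) :
    α m n hm x Z ≫ d.map (α l m hl x Z) ≫ T.t ((M l x).obj Z) =
      -(α m n hm x Z ≫ d.map (α l m hl x Z))
  t_γ_γ (l m n : ℤ) (hl : l + 1 = m) (hm : m + 1 = n) (x : ℤ) (Z : C) :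
    T.t ((M l x).obj Z) ≫ d.map (γ l m hl x Z) ≫ γ m n hm x Z =
      -(d.map (γ l m hl x Z) ≫ γ m n hm x Z)
  α_a (y Y : ℤ) (hy : y + 1 = Y) (x X : ℤ) (hx : x + 1 = X) (Z : C) :
    α y Y hy X Z ≫ d.map (a y x X hx Z) = a Y x X hx Z ≫ α y Y hy x (u.obj Z)
  γ_a (y Y : ℤ) (hy : y + 1 = Y) (x X : ℤ) (hx : x + 1 = X) (Z : C) :
    γ y Y hy X Z ≫ a Y x X hx Z = d.map (a y x X hx Z) ≫ γ y Y hy x (u.obj Z)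
  c_α (y Y : ℤ) (hy : y + 1 = Y) (x X : ℤ) (hx : x + 1 = X) (Z : C) :
    c Y x X hx Z ≫ α y Y hy X Z = α y Y hy x (u.obj Z) ≫ d.map (c y x X hx Z)
  c_γ (y Y : ℤ) (hy : y + 1 = Y) (x X : ℤ) (hx : x + 1 = X) (Z : C) :
    d.map (c y x X hx Z) ≫ γ y Y hy X Z = γ y Y hy x (u.obj Z) ≫ c Y x X hx Z

namespace Middle

variable {T : Action u d} {M : ℤ → ℤ → C ⥤ C} (K : Middle T M)

section Slides

variable (y Y : ℤ) (hy : y + 1 = Y) (x X : ℤ) (hx : x + 1 = X) (Z : C)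

theorem α_π : u.map (K.α y Y hy x Z) ≫ T.r _ ≫ d.map ((K.p y x).π Z) =
    (K.p Y x).π Z ≫ K.α y Y hy x (u.obj Z) := (K.α_hom y Y hy x).π Z

theorem α_π' : K.α y Y hy x (u.obj Z) ≫ d.map ((K.p y x).π' Z) ≫ T.r' _ =
    (K.p Y x).π' Z ≫ u.map (K.α y Y hy x Z) := (K.α_hom y Y hy x).π' Z

theorem α_χ : K.α y Y hy x (d.obj Z) ≫ d.map ((K.p y x).χ Z) ≫ T.t _ =
    (K.p Y x).χ Z ≫ d.map (K.α y Y hy x Z) := (K.α_hom y Y hy x).χ Z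

theorem γ_π : u.map (K.γ y Y hy x Z) ≫ (K.p Y x).π Z =
    T.r _ ≫ d.map ((K.p y x).π Z) ≫ K.γ y Y hy x (u.obj Z) :=
  ((K.γ_hom y Y hy x).π Z).trans (Category.assoc _ _ _)

theorem γ_π' : K.γ y Y hy x (u.obj Z) ≫ (K.p Y x).π' Z =
    d.map ((K.p y x).π' Z) ≫ T.r' _ ≫ u.map (K.γ y Y hy x Z) :=
  ((K.γ_hom y Y hy x).π' Z).trans (Category.assoc _ _ _)

theorem γ_χ' : d.map (K.γ y Y hy x Z) ≫ (K.p Y x).χ' Z =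
    T.t _ ≫ d.map ((K.p y x).χ' Z) ≫ K.γ y Y hy x (d.obj Z) :=
  ((K.γ_hom y Y hy x).χ' Z).trans (Category.assoc _ _ _)

theorem a_π : u.map (K.a y x X hx Z) ≫ (K.p y x).π (u.obj Z) ≫ (M y x).map (T.s Z) =
    (K.p y X).π Z ≫ K.a y x X hx (u.obj Z) := (K.a_hom y x X hx).π Z

theorem a_π' : K.a y x X hx (u.obj Z) ≫ (M y x).map (T.s Z) ≫ (K.p y x).π' (u.obj Z) =
    (K.p y X).π' Z ≫ u.map (K.a y x X hx Z) := (K.a_hom y x X hx).π' Z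

theorem a_χ : K.a y x X hx (d.obj Z) ≫ (M y x).map (T.r Z) ≫ (K.p y x).χ (u.obj Z) =
    (K.p y X).χ Z ≫ d.map (K.a y x X hx Z) := (K.a_hom y x X hx).χ Z

theorem a_χ' : d.map (K.a y x X hx Z) ≫ (K.p y x).χ' (u.obj Z) ≫ (M y x).map (T.r' Z) =
    (K.p y X).χ' Z ≫ K.a y x X hx (d.obj Z) := (K.a_hom y x X hx).χ' Z

theorem c_π : u.map (K.c y x X hx Z) ≫ (K.p y X).π Z =
    (K.p y x).π (u.obj Z) ≫ (M y x).map (T.s Z) ≫ K.c y x X hx (u.obj Z) :=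
  ((K.c_hom y x X hx).π Z).trans (Category.assoc _ _ _)

theorem c_π' : K.c y x X hx (u.obj Z) ≫ (K.p y X).π' Z =
    (M y x).map (T.s Z) ≫ (K.p y x).π' (u.obj Z) ≫ u.map (K.c y x X hx Z) :=
  ((K.c_hom y x X hx).π' Z).trans (Category.assoc _ _ _)

theorem c_χ : K.c y x X hx (d.obj Z) ≫ (K.p y X).χ Z =
    (M y x).map (T.r Z) ≫ (K.p y x).χ (u.obj Z) ≫ d.map (K.c y x X hx Z) :=
  ((K.c_hom y x X hx).χ Z).trans (Category.assoc _ _ _)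

theorem c_χ' : d.map (K.c y x X hx Z) ≫ (K.p y X).χ' Z =
    (K.p y x).χ' (u.obj Z) ≫ (M y x).map (T.r' Z) ≫ K.c y x X hx (d.obj Z) :=
  ((K.c_hom y x X hx).χ' Z).trans (Category.assoc _ _ _)

variable {Z} {Z' : C} (f : Z ⟶ Z')

theorem a_nat : (M y X).map f ≫ K.a y x X hx Z' = K.a y x X hx Z ≫ (M y x).map (u.map f) :=
  (K.a_hom y x X hx).nat f

theorem c_nat : (M y x).map (u.map f) ≫ K.c y x X hx Z' = K.c y x X hx Z ≫ (M y X).map f :=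
  (K.c_hom y x X hx).nat f

theorem α_nat : (M Y x).map f ≫ K.α y Y hy x Z' = K.α y Y hy x Z ≫ d.map ((M y x).map f) :=
  (K.α_hom y Y hy x).nat f

theorem γ_nat : d.map ((M y x).map f) ≫ K.γ y Y hy x Z' = K.γ y Y hy x Z ≫ (M Y x).map f :=
  (K.γ_hom y Y hy x).nat f

end Slides

section Operators

variable (y Y : ℤ) (hy : y + 1 = Y) (x X : ℤ) (hx : x + 1 = X) (Z : C)

/-- Merging an upward strand from the left into `P`. -/
def φ : u.obj ((M y x).obj Z) ⟶ (M y X).obj Z := (K.p y x).π Z ≫ K.c y x X hx Z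

/-- Splitting off from `P` an upward strand, pulled to the left. -/
def φ' : (M y X).obj Z ⟶ u.obj ((M y x).obj Z) := K.a y x X hx Z ≫ (K.p y x).π' Z

/-- Merging a downward strand from the right into `Q`. -/
def ψ : (M y x).obj (d.obj Z) ⟶ (M Y x).obj Z := (K.p y x).χ Z ≫ K.γ y Y hy x Z

/-- Splitting off from `Q` a downward strand, pulled to the right. -/
def ψ' : (M Y x).obj Z ⟶ (M y x).obj (d.obj Z) := K.α y Y hy x Z ≫ (K.p y x).χ' Z

/-- The counterclockwise cap between `Q` and `P`. -/
def κ : (M Y X).obj Z ⟶ (M y x).obj Z :=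
  K.α y Y hy X Z ≫ d.map (K.φ' y x X hx Z) ≫ T.cap' _

/-- The counterclockwise cup between `Q` and `P`. -/
def κ' : (M y x).obj Z ⟶ (M Y X).obj Z :=
  T.cup' _ ≫ d.map (K.φ y x X hx Z) ≫ K.γ y Y hy X Z

/-- The clockwise cap between a strand on the left and `Q`. -/
def ε : u.obj ((M Y x).obj Z) ⟶ (M y x).obj Z := u.map (K.α y Y hy x Z) ≫ T.cap _

/-- The clockwise cap between `P` and a strand on the right. -/
def η : (M y X).obj (d.obj Z) ⟶ (M y x).obj Z := K.a y x X hx (d.obj Z) ≫ (M y x).map (T.cap Z)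

theorem φ_α : K.φ Y x X hx Z ≫ K.α y Y hy X Z =
    u.map (K.α y Y hy x Z) ≫ T.r _ ≫ d.map (K.φ y x X hx Z) := by
  simp only [φ, Category.assoc, Functor.map_comp]
  rw [K.c_α, reassoc_of% K.α_π]

theorem φ'_α : K.φ' Y x X hx Z ≫ u.map (K.α y Y hy x Z) =
    K.α y Y hy X Z ≫ d.map (K.φ' y x X hx Z) ≫ T.r' _ := by
  simp only [φ', Category.assoc, Functor.map_comp]
  rw [reassoc_of% K.α_a, K.α_π']

theorem γ_φ' : K.γ y Y hy X Z ≫ K.φ' Y x X hx Z =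
    d.map (K.φ' y x X hx Z) ≫ T.r' _ ≫ u.map (K.γ y Y hy x Z) := by
  simp only [φ', Category.assoc, Functor.map_comp]
  rw [reassoc_of% K.γ_a, K.γ_π']

theorem γ_φ : u.map (K.γ y Y hy x Z) ≫ K.φ Y x X hx Z =
    T.r _ ≫ d.map (K.φ y x X hx Z) ≫ K.γ y Y hy X Z := by
  simp only [φ, Category.assoc, Functor.map_comp]
  rw [reassoc_of% K.γ_π, K.c_γ]

variable {Z} {Z' : C} (f : Z ⟶ Z')

theorem φ_nat : u.map ((M y x).map f) ≫ K.φ y x X hx Z' = K.φ y x X hx Z ≫ (M y X).map f := by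
  rw [φ, φ, reassoc_of% (K.p y x).π_nat, K.c_nat, Category.assoc]

theorem φ'_nat : (M y X).map f ≫ K.φ' y x X hx Z' = K.φ' y x X hx Z ≫ u.map ((M y x).map f) := by
  rw [φ', φ', reassoc_of% K.a_nat, (K.p y x).π'_nat, Category.assoc]

theorem ψ_nat : (M y x).map (d.map f) ≫ K.ψ y Y hy x Z' = K.ψ y Y hy x Z ≫ (M Y x).map f := by
  rw [ψ, ψ, reassoc_of% (K.p y x).χ_nat, K.γ_nat, Category.assoc]

theorem ψ'_nat : (M Y x).map f ≫ K.ψ' y Y hy x Z' = K.ψ' y Y hy x Z ≫ (M y x).map (d.map f) := by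
  rw [ψ', ψ', reassoc_of% K.α_nat, (K.p y x).χ'_nat, Category.assoc]

theorem κ_nat : (M Y X).map f ≫ K.κ y Y hy x X hx Z' = K.κ y Y hy x X hx Z ≫ (M y x).map f := by
  simp only [κ, Category.assoc]
  rw [reassoc_of% K.α_nat, ← d.map_comp_assoc, K.φ'_nat, d.map_comp_assoc, T.cap'_nat]

theorem κ'_nat : (M y x).map f ≫ K.κ' y Y hy x X hx Z' = K.κ' y Y hy x X hx Z ≫ (M Y X).map f := by
  simp only [κ', Category.assoc]
  rw [reassoc_of% T.cup'_nat, ← d.map_comp_assoc, K.φ_nat, d.map_comp_assoc, K.γ_nat]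

end Operators

section Identities

variable (y₁ y₂ y₃ : ℤ) (hy₁ : y₁ + 1 = y₂) (hy₂ : y₂ + 1 = y₃)
  (x₁ x₂ x₃ : ℤ) (hx₁ : x₁ + 1 = x₂) (hx₂ : x₂ + 1 = x₃) (y Y : ℤ) (hy : y + 1 = Y)
  (x X : ℤ) (hx : x + 1 = X) (Z : C)

theorem φ'_φ' : K.φ' y x₂ x₃ hx₂ Z ≫ u.map (K.φ' y x₁ x₂ hx₁ Z) =
    K.a y x₂ x₃ hx₂ Z ≫ K.a y x₁ x₂ hx₁ (u.obj Z) ≫ (K.p y x₁).π' (u.obj Z) ≫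
      u.map ((K.p y x₁).π' Z) := by
  simp only [φ', Category.assoc, Functor.map_comp]
  rw [← reassoc_of% K.a_π', reassoc_of% K.a_a_s]

theorem φ'_φ'_s : K.φ' y x₂ x₃ hx₂ Z ≫ u.map (K.φ' y x₁ x₂ hx₁ Z) ≫ T.s _ =
    K.φ' y x₂ x₃ hx₂ Z ≫ u.map (K.φ' y x₁ x₂ hx₁ Z) := by
  rw [reassoc_of% K.φ'_φ', K.φ'_φ', ← (K.p y x₁).s_π'_π', reassoc_of% K.a_a_s]

theorem s_φ_φ : T.s _ ≫ u.map (K.φ y x₁ x₂ hx₁ Z) ≫ K.φ y x₂ x₃ hx₂ Z =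
    u.map (K.φ y x₁ x₂ hx₁ Z) ≫ K.φ y x₂ x₃ hx₂ Z := by
  simp only [φ, Category.assoc, Functor.map_comp]
  rw [reassoc_of% K.c_π, K.s_c_c, ← reassoc_of% (K.p y x₁).π_π_s, K.s_c_c]

/-- Merging and splitting off an upward strand: either the same strand returns or another one does.
-/
theorem φ_φ' : K.φ y x₂ x₃ hx₂ Z ≫ K.φ' y x₂ x₃ hx₂ Z =
    𝟙 _ + u.map (K.φ' y x₁ x₂ hx₁ Z) ≫ T.s _ ≫ u.map (K.φ y x₁ x₂ hx₁ Z) := by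
  simp only [φ, φ', Category.assoc, Functor.map_comp]
  rw [reassoc_of% K.c_a y x₁ x₂ x₃ hx₁ hx₂, Preadditive.add_comp, Category.id_comp,
    Preadditive.comp_add, (K.p y x₂).π_π']
  simp only [Category.assoc]
  rw [← reassoc_of% K.a_π, K.c_π', reassoc_of% T.map_s_s,
    reassoc_of% (K.p y x₁).π_s_π']

/-- The analogue of `φ_φ'` for downward strands, where the exchange of strands carries a sign. -/
theorem ψ_ψ' : K.ψ y₂ y₃ hy₂ x Z ≫ K.ψ' y₂ y₃ hy₂ x Z =
    𝟙 _ - K.ψ' y₁ y₂ hy₁ x (d.obj Z) ≫ (M y₁ x).map (T.t Z) ≫ K.ψ y₁ y₂ hy₁ x (d.obj Z) := by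
  simp only [ψ, ψ', Category.assoc]
  rw [reassoc_of% K.γ_α y₁ y₂ y₃ hy₁ hy₂, Preadditive.sub_comp, Category.id_comp,
    Preadditive.comp_sub, (K.p y₂ x).χ_χ']
  simp only [Category.assoc]
  rw [← reassoc_of% K.α_χ, K.γ_χ', reassoc_of% T.t_t,
    ← reassoc_of% (K.p y₁ x).χ'_t_χ]

theorem φ_ψ' : K.φ Y x X hx Z ≫ K.ψ' y Y hy X Z =
    u.map (K.ψ' y Y hy x Z) ≫ K.φ y x X hx (d.obj Z) := by
  simp only [φ, ψ', Category.assoc, Functor.map_comp]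
  rw [reassoc_of% K.c_α, ← reassoc_of% K.α_π, K.c_χ', ← reassoc_of% (K.p y x).χ'_π_r,
    ← (M y x).map_comp_assoc, T.r_r', (M y x).map_id, Category.id_comp]

theorem ψ_φ' : K.ψ y Y hy X Z ≫ K.φ' Y x X hx Z =
    K.φ' y x X hx (d.obj Z) ≫ u.map (K.ψ y Y hy x Z) := by
  simp only [φ', ψ, Category.assoc, Functor.map_comp]
  rw [reassoc_of% K.γ_a, ← reassoc_of% K.a_χ, K.γ_π', reassoc_of% (K.p y x).r_χ_π',
    reassoc_of% T.r_r']

theorem φ_a : K.φ y x₂ x₃ hx₂ Z ≫ K.a y x₂ x₃ hx₂ Z =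
    (K.p y x₂).π Z + u.map (K.a y x₁ x₂ hx₁ Z) ≫ K.φ y x₁ x₂ hx₁ (u.obj Z) := by
  simp only [φ, Category.assoc]
  rw [K.c_a y x₁ x₂ x₃ hx₁ hx₂, Preadditive.comp_add, Category.comp_id, ← reassoc_of% K.a_π,
    reassoc_of% T.map_s_s]

theorem φ'_a : K.φ' y x₂ x₃ hx₂ Z ≫ u.map (K.a y x₁ x₂ hx₁ Z) =
    K.a y x₂ x₃ hx₂ Z ≫ K.φ' y x₁ x₂ hx₁ (u.obj Z) := by
  simp only [φ', Category.assoc]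
  rw [← K.a_π', reassoc_of% K.a_a_s]

theorem κ_a : K.κ y Y hy x₂ x₃ hx₂ Z ≫ K.a y x₁ x₂ hx₁ Z =
    K.a Y x₂ x₃ hx₂ Z ≫ K.κ y Y hy x₁ x₂ hx₁ (u.obj Z) := by
  simp only [κ, Category.assoc]
  rw [← T.cap'_nat, ← d.map_comp_assoc, K.φ'_a, d.map_comp_assoc, reassoc_of% K.α_a]

theorem κ'_a : K.κ' y Y hy x₂ x₃ hx₂ Z ≫ K.a Y x₂ x₃ hx₂ Z =
    T.cup' _ ≫ d.map ((K.p y x₂).π Z) ≫ K.γ y Y hy x₂ (u.obj Z) +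
      K.a y x₁ x₂ hx₁ Z ≫ K.κ' y Y hy x₁ x₂ hx₁ (u.obj Z) := by
  simp only [κ', Category.assoc]
  rw [K.γ_a, ← d.map_comp_assoc, K.φ_a x₁ x₂ x₃ hx₁ hx₂ y, d.map_add, Preadditive.add_comp,
    Preadditive.comp_add, d.map_comp_assoc, reassoc_of% T.cup'_nat]

/-- The two caps on the sides of `P` commute. -/
theorem κ_η : K.κ y Y hy x₂ x₃ hx₂ (d.obj Z) ≫ K.η y x₁ x₂ hx₁ Z =
    K.η Y x₂ x₃ hx₂ Z ≫ K.κ y Y hy x₁ x₂ hx₁ Z := by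
  simp only [η, Category.assoc]
  rw [reassoc_of% K.κ_a, K.κ_nat]

/-- The clockwise cap on the right of `P` meets either another strand of `P` or the cup `κ'`, which
it straightens. -/
theorem κ'_η : K.κ' y Y hy x₂ x₃ hx₂ (d.obj Z) ≫ K.η Y x₂ x₃ hx₂ Z =
    K.η y x₁ x₂ hx₁ Z ≫ K.κ' y Y hy x₁ x₂ hx₁ Z + K.ψ y Y hy x₂ Z := by
  simp only [η, Category.assoc]
  rw [reassoc_of% K.κ'_a x₁ x₂ x₃ hx₁ hx₂ y Y hy, Preadditive.add_comp, add_comm]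
  simp only [Category.assoc]
  rw [K.κ'_nat, reassoc_of% (K.p y x₂).cup'_π, ← K.γ_nat, ← reassoc_of% (K.p y x₂).χ_nat,
    ← (M y x₂).map_comp_assoc, T.cup'_cap_down, (M y x₂).map_id, Category.id_comp, ψ]

theorem κ_α : K.κ y₂ y₃ hy₂ x X hx Z ≫ K.α y₁ y₂ hy₁ x Z =
    -(K.α y₂ y₃ hy₂ X Z ≫ d.map (K.α y₁ y₂ hy₁ X Z) ≫ d.map (d.map (K.φ' y₁ x X hx Z)) ≫
      d.map (T.cap' _)) := by
  simp only [κ, Category.assoc]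
  rw [← T.cap'_nat, ← d.map_comp_assoc, K.φ'_α]
  simp only [Functor.map_comp, Category.assoc]
  rw [T.r'_cap', reassoc_of% T.t_nat, reassoc_of% K.α_α_t]
  simp only [Preadditive.neg_comp, Category.assoc]

theorem γ_κ' : K.γ y₁ y₂ hy₁ x Z ≫ K.κ' y₂ y₃ hy₂ x X hx Z =
    -(d.map (T.cup' _) ≫ d.map (d.map (K.φ y₁ x X hx Z)) ≫ d.map (K.γ y₁ y₂ hy₁ X Z) ≫
      K.γ y₂ y₃ hy₂ X Z) := by
  simp only [κ']
  rw [reassoc_of% T.cup'_nat, ← d.map_comp_assoc, K.γ_φ]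
  simp only [Functor.map_comp, Category.assoc]
  rw [reassoc_of% T.cup'_r, ← reassoc_of% T.t_nat, K.t_γ_γ]
  simp only [Preadditive.comp_neg]

/-- The two caps on the sides of `Q` anticommute. -/
theorem κ_ε : u.map (K.κ y₂ y₃ hy₂ x X hx Z) ≫ K.ε y₁ y₂ hy₁ x Z =
    -(K.ε y₂ y₃ hy₂ X Z ≫ K.κ y₁ y₂ hy₁ x X hx Z) := by
  simp only [ε, Category.assoc]
  rw [← u.map_comp_assoc, K.κ_α]
  simp only [Functor.map_neg, Functor.map_comp, Category.assoc, Preadditive.neg_comp, κ]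
  rw [T.cap_nat, reassoc_of% T.cap_nat, reassoc_of% T.cap_nat]

/-- The clockwise cap on the left of `Q` meets either another strand of `Q` or the cup `κ'`, which
it straightens. -/
theorem κ'_ε : u.map (K.κ' y₂ y₃ hy₂ x X hx Z) ≫ K.ε y₂ y₃ hy₂ X Z =
    -(K.ε y₁ y₂ hy₁ x Z ≫ K.κ' y₁ y₂ hy₁ x X hx Z) + K.φ y₂ x X hx Z := by
  have h1 : K.κ' y₂ y₃ hy₂ x X hx Z ≫ K.α y₂ y₃ hy₂ X Z = T.cup' _ ≫ d.map (K.φ y₂ x X hx Z) -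
      K.α y₁ y₂ hy₁ x Z ≫ d.map (T.cup' _ ≫ d.map (K.φ y₁ x X hx Z) ≫ K.γ y₁ y₂ hy₁ X Z) := by
    simp only [κ', Category.assoc]
    rw [K.γ_α y₁ y₂ y₃ hy₁ hy₂, Preadditive.comp_sub, Preadditive.comp_sub, Category.comp_id,
      ← d.map_comp_assoc, K.φ_α]
    simp only [Functor.map_comp, Category.assoc]
    rw [reassoc_of% T.t_nat, ← reassoc_of% T.cup'_nat, reassoc_of% T.cup'_r, reassoc_of% T.t_t]
  simp only [ε, Category.assoc]
  rw [← u.map_comp_assoc, h1, u.map_sub, Preadditive.sub_comp, u.map_comp, u.map_comp,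
    Category.assoc, Category.assoc, T.cap_nat, T.cap_nat, reassoc_of% T.cup'_cap_up, sub_eq_neg_add,
    κ']

/-- Two counterclockwise caps between symmetrized and antisymmetrized strands: twisting them on
either side shows that the composite is its own negative. -/
theorem κ_κ (hC : Divisible C) :
    K.κ y₂ y₃ hy₂ x₂ x₃ hx₂ Z ≫ K.κ y₁ y₂ hy₁ x₁ x₂ hx₁ Z = 0 := by
  have h : K.κ y₂ y₃ hy₂ x₂ x₃ hx₂ Z ≫ K.κ y₁ y₂ hy₁ x₁ x₂ hx₁ Z =
      -(K.α y₂ y₃ hy₂ x₃ Z ≫ d.map (K.α y₁ y₂ hy₁ x₃ Z) ≫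
        d.map (d.map (K.φ' y₁ x₂ x₃ hx₂ Z ≫ u.map (K.φ' y₁ x₁ x₂ hx₁ Z))) ≫
        d.map (T.cap' _) ≫ T.cap' _) := by
    conv_lhs => rw [κ.eq_def K y₁]
    rw [reassoc_of% K.κ_α y₁ y₂ y₃ hy₁ hy₂]
    simp only [Functor.map_comp, Category.assoc, Preadditive.neg_comp]
    rw [← d.map_comp_assoc (d.map (u.map _)), T.cap'_nat, d.map_comp_assoc]
  refine hC.eq_zero_of_eq_neg ?_
  conv_lhs => rw [h, ← K.φ'_φ'_s]
  rw [h]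
  simp only [Functor.map_comp, Category.assoc]
  rw [T.s_cap'_cap', reassoc_of% T.t_nat, reassoc_of% T.t_nat, reassoc_of% K.α_α_t]
  simp only [Preadditive.neg_comp, Category.assoc]

/-- The composite of two counterclockwise cups is its own negative, for the same reason as in
`κ_κ`. -/
theorem κ'_κ' (hC : Divisible C) :
    K.κ' y₁ y₂ hy₁ x₁ x₂ hx₁ Z ≫ K.κ' y₂ y₃ hy₂ x₂ x₃ hx₂ Z = 0 := by
  have h : K.κ' y₁ y₂ hy₁ x₁ x₂ hx₁ Z ≫ K.κ' y₂ y₃ hy₂ x₂ x₃ hx₂ Z =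
      -(T.cup' _ ≫ d.map (T.cup' _) ≫
        d.map (d.map (u.map (K.φ y₁ x₁ x₂ hx₁ Z) ≫ K.φ y₁ x₂ x₃ hx₂ Z)) ≫
        d.map (K.γ y₁ y₂ hy₁ x₃ Z) ≫ K.γ y₂ y₃ hy₂ x₃ Z) := by
    conv_lhs => rw [κ'.eq_def K y₁]
    simp only [Category.assoc]
    rw [K.γ_κ' y₁ y₂ y₃ hy₁ hy₂]
    simp only [Functor.map_comp, Category.assoc, Preadditive.comp_neg]
    rw [← d.map_comp_assoc (K.φ _ _ _ _ _), T.cup'_nat, d.map_comp_assoc]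
  refine hC.eq_zero_of_eq_neg ?_
  conv_lhs => rw [h, ← K.s_φ_φ]
  rw [h]
  simp only [Functor.map_comp, Category.assoc]
  rw [reassoc_of% T.cup'_cup'_s, ← reassoc_of% T.t_nat, ← reassoc_of% T.t_nat, K.t_γ_γ]
  simp only [Preadditive.comp_neg]

/-- In `κ' ≫ κ` the cap meets either the strand of `Q` coming from the cup or another one. The
first case gives a circle, equal to the identity, and a left curl, equal to zero; the second one
gives `κ ≫ κ'` with the sign of `Q` and a loop that vanishes. -/
theorem homotopy : K.κ' y₂ y₃ hy₂ x₂ x₃ hx₂ Z ≫ K.κ y₂ y₃ hy₂ x₂ x₃ hx₂ Z +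
    K.κ y₁ y₂ hy₁ x₁ x₂ hx₁ Z ≫ K.κ' y₁ y₂ hy₁ x₁ x₂ hx₁ Z = 𝟙 _ := by
  have h1 : T.cup' _ ≫ d.map (K.φ y₂ x₂ x₃ hx₂ Z) ≫ d.map (K.φ' y₂ x₂ x₃ hx₂ Z) ≫ T.cap' _ =
      𝟙 _ := by
    rw [← d.map_comp_assoc, K.φ_φ' x₁ x₂ x₃ hx₁ hx₂, d.map_add, d.map_id, Preadditive.add_comp,
      Preadditive.comp_add, Category.id_comp, T.bubble]
    simp only [Functor.map_comp, Category.assoc]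
    rw [T.cap'_nat, ← reassoc_of% T.cup'_nat, reassoc_of% T.curl, zero_comp, comp_zero, add_zero]
  have h2 : T.cup' _ ≫ d.map (T.r _) ≫ d.map (d.map (K.φ y₁ x₂ x₃ hx₂ Z)) ≫ T.t _ ≫
      d.map (d.map (K.φ' y₁ x₂ x₃ hx₂ Z)) ≫ d.map (T.r' _) ≫ T.cap' _ =
      d.map (K.φ' y₁ x₁ x₂ hx₁ Z) ≫ T.cap' _ ≫ T.cup' _ ≫ d.map (K.φ y₁ x₁ x₂ hx₁ Z) := by
    rw [reassoc_of% T.t_nat, ← d.map_comp_assoc (d.map _), ← d.map_comp,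
      K.φ_φ' x₁ x₂ x₃ hx₁ hx₂]
    simp only [Functor.map_add, CategoryTheory.Functor.map_id, Preadditive.add_comp,
      Preadditive.comp_add, Category.id_comp, T.loop_zero, zero_add, Functor.map_comp,
      Category.assoc]
    rw [← d.map_comp_assoc (d.map (u.map (K.φ _ _ _ _ _))), T.r'_nat, d.map_comp_assoc, T.cap'_nat,
      ← reassoc_of% T.t_nat, ← d.map_comp_assoc (T.r _), ← T.r_nat, d.map_comp_assoc,
      ← reassoc_of% T.cup'_nat, reassoc_of% T.loop_eq]
  have h3 : K.κ' y₂ y₃ hy₂ x₂ x₃ hx₂ Z ≫ K.κ y₂ y₃ hy₂ x₂ x₃ hx₂ Z =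
      𝟙 _ - K.α y₁ y₂ hy₁ x₂ Z ≫ (T.cup' _ ≫ d.map (T.r _) ≫
        d.map (d.map (K.φ y₁ x₂ x₃ hx₂ Z)) ≫ T.t _ ≫ d.map (d.map (K.φ' y₁ x₂ x₃ hx₂ Z)) ≫
        d.map (T.r' _) ≫ T.cap' _) ≫ K.γ y₁ y₂ hy₁ x₂ Z := by
    simp only [κ, κ', Category.assoc]
    rw [reassoc_of% K.γ_α y₁ y₂ y₃ hy₁ hy₂, Preadditive.sub_comp, Preadditive.comp_sub,
      Preadditive.comp_sub, Category.id_comp, h1]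
    simp only [Category.assoc]
    rw [← d.map_comp_assoc (K.φ _ _ _ _ _), K.φ_α, ← d.map_comp_assoc (K.γ _ _ _ _ _), K.γ_φ']
    simp only [Functor.map_comp, Category.assoc]
    rw [T.cap'_nat, reassoc_of% T.cup'_nat]
  rw [h3, h2, sub_add_eq_add_sub, add_sub_assoc]
  simp only [κ, κ', Category.assoc, sub_self, add_zero]

end Identities

/-! ### Strands crossing `Q_y P_x` and returning -/

section Crossings

variable (y Y : ℤ) (hy : y + 1 = Y) (x X : ℤ) (hx : x + 1 = X) (Z : C)

/-- The counterclockwise cap between `Q` and a strand on the right of `P`. -/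
def ρ : (M Y x).obj (u.obj Z) ⟶ (M y x).obj Z :=
  K.α y Y hy x (u.obj Z) ≫ d.map ((K.p y x).π' Z) ≫ T.cap' _

/-- The counterclockwise cup between `Q` and a strand on the right of `P`. -/
def ρ' : (M y x).obj Z ⟶ (M Y x).obj (u.obj Z) :=
  T.cup' _ ≫ d.map ((K.p y x).π Z) ≫ K.γ y Y hy x (u.obj Z)

/-- The counterclockwise cap between a strand on the left of `Q` and `P`. -/
def σ : d.obj ((M y X).obj Z) ⟶ (M y x).obj Z :=
  d.map (K.a y x X hx Z) ≫ (K.p y x).χ' (u.obj Z) ≫ (M y x).map (T.cap' Z)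

/-- The counterclockwise cup between a strand on the left of `Q` and `P`. -/
def σ' : (M y x).obj Z ⟶ d.obj ((M y X).obj Z) :=
  (M y x).map (T.cup' Z) ≫ (K.p y x).χ (u.obj Z) ≫ d.map (K.c y x X hx Z)

variable (y₁ y₂ y₃ : ℤ) (hy₁ : y₁ + 1 = y₂) (hy₂ : y₂ + 1 = y₃)
  (x₁ x₂ x₃ : ℤ) (hx₁ : x₁ + 1 = x₂) (hx₂ : x₂ + 1 = x₃)

theorem α_ρ : K.α y₂ y₃ hy₂ x (u.obj Z) ≫ d.map (K.ρ y₁ y₂ hy₁ x Z) =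
    -(K.ρ y₂ y₃ hy₂ x Z ≫ K.α y₁ y₂ hy₁ x Z) := by
  have h : K.ρ y₂ y₃ hy₂ x Z ≫ K.α y₁ y₂ hy₁ x Z = K.α y₂ y₃ hy₂ x (u.obj Z) ≫
      d.map (K.α y₁ y₂ hy₁ x (u.obj Z)) ≫ T.t _ ≫ d.map (d.map ((K.p y₁ x).π' Z)) ≫
        d.map (T.cap' _) := by
    simp only [ρ, Category.assoc]
    rw [← T.cap'_nat, ← d.map_comp_assoc (Passing.π' _ _), ← K.α_π']
    simp only [Functor.map_comp, Category.assoc]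
    rw [T.r'_cap', reassoc_of% T.t_nat]
  rw [h, reassoc_of% K.α_α_t]
  simp only [ρ, Functor.map_comp, Preadditive.neg_comp, Category.assoc, neg_neg]

theorem γ_ρ' : d.map (K.ρ' y₁ y₂ hy₁ x Z) ≫ K.γ y₂ y₃ hy₂ x (u.obj Z) =
    -(K.γ y₁ y₂ hy₁ x Z ≫ K.ρ' y₂ y₃ hy₂ x Z) := by
  have h : K.γ y₁ y₂ hy₁ x Z ≫ K.ρ' y₂ y₃ hy₂ x Z = d.map (T.cup' _) ≫
      d.map (d.map ((K.p y₁ x).π Z)) ≫ T.t _ ≫ d.map (K.γ y₁ y₂ hy₁ x (u.obj Z)) ≫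
        K.γ y₂ y₃ hy₂ x (u.obj Z) := by
    simp only [ρ']
    rw [reassoc_of% T.cup'_nat, ← d.map_comp_assoc (u.map _), K.γ_π]
    simp only [Functor.map_comp, Category.assoc]
    rw [reassoc_of% T.cup'_r, ← reassoc_of% T.t_nat]
  rw [h, K.t_γ_γ]
  simp only [ρ', Functor.map_comp, Preadditive.comp_neg, Category.assoc, neg_neg]

theorem a_σ : d.map (K.a y x₂ x₃ hx₂ Z) ≫ K.σ y x₁ x₂ hx₁ (u.obj Z) =
    K.σ y x₂ x₃ hx₂ Z ≫ K.a y x₁ x₂ hx₁ Z := by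
  simp only [σ, Category.assoc]
  rw [K.a_nat, ← reassoc_of% K.a_χ', ← (M y x₁).map_comp, ← T.s_cap', (M y x₁).map_comp,
    ← reassoc_of% (K.p y x₁).χ'_nat]
  simp only [← d.map_comp_assoc, K.a_a_s]

theorem c_σ' : K.σ' y x₁ x₂ hx₁ (u.obj Z) ≫ d.map (K.c y x₂ x₃ hx₂ Z) =
    K.c y x₁ x₂ hx₁ Z ≫ K.σ' y x₂ x₃ hx₂ Z := by
  simp only [σ', Category.assoc]
  rw [← reassoc_of% K.c_nat, reassoc_of% K.c_χ, ← (M y x₁).map_comp_assoc, ← T.cup'_s,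
    (M y x₁).map_comp_assoc, reassoc_of% (K.p y x₁).χ_nat]
  simp only [← d.map_comp]
  rw [K.s_c_c]

/-- An upward strand pulled to the left across `Q_Y P_x` and back. By induction on `Y`, each
downward strand contributes the correction term of the relation `Action.r'_r`. -/
theorem π'_π (hC : Divisible C) (h0 : 0 ≤ Y) : (K.p Y x).π' Z ≫ (K.p Y x).π Z =
    𝟙 _ - K.ρ y Y hy x Z ≫ K.ρ' y Y hy x Z := by
  obtain ⟨n, rfl⟩ := Int.eq_ofNat_of_zero_le h0
  induction n generalizing y with
  | zero =>
    have h : K.ρ y _ hy x Z = 0 := (K.isZero_left y x (by omega) Z).eq_of_tgt _ _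
    rw [h, zero_comp, sub_zero]
    exact K.π'_π_zero x Z
  | succ n ih =>
    obtain rfl : y = n := by push_cast at hy; omega
    refine hC.eq_of_zsmul_eq (n := ((n + 1 : ℕ) : ℤ)) (by omega) ?_
    have h1 : ((n + 1 : ℕ) : ℤ) • ((K.p (n + 1 : ℕ) x).π' Z ≫ (K.p (n + 1 : ℕ) x).π Z) =
        K.α n (n + 1 : ℕ) hy x (u.obj Z) ≫ d.map ((K.p n x).π' Z ≫ (K.p n x).π Z) ≫
          K.γ n (n + 1 : ℕ) hy x (u.obj Z) - K.ρ n _ hy x Z ≫ K.ρ' n _ hy x Z := by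
      rw [← Category.id_comp (Passing.π' _ _ ≫ _), ← Preadditive.zsmul_comp,
        ← K.α_γ n (n + 1 : ℕ) hy]
      simp only [Category.assoc]
      rw [reassoc_of% K.γ_π', K.γ_π, reassoc_of% T.r'_r]
      simp only [ρ, ρ', Category.assoc, Functor.map_comp, Preadditive.sub_comp,
        Preadditive.comp_sub, Category.id_comp]
    rw [h1, ih (n - 1) (by omega) (by omega), d.map_sub, Preadditive.sub_comp,
      Preadditive.comp_sub, d.map_id, Category.id_comp, d.map_comp_assoc, K.γ_ρ',
      reassoc_of% K.α_ρ]
    simp only [Preadditive.comp_neg, Preadditive.neg_comp, Category.assoc, neg_neg]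
    rw [reassoc_of% K.α_γ, K.α_γ]
    simp only [Preadditive.zsmul_comp, Preadditive.comp_zsmul, Category.id_comp, smul_sub]
    push_cast
    rw [add_smul, add_smul, one_smul, one_smul]
    abel

/-- A downward strand pulled to the right across `Q_y P_X` and back, by induction on `X`. -/
theorem χ'_χ [∀ y x, (M y x).Additive] (hC : Divisible C) (h0 : 0 ≤ X) : (K.p y X).χ' Z ≫ (K.p y X).χ Z =
    𝟙 _ - K.σ y x X hx Z ≫ K.σ' y x X hx Z := by
  obtain ⟨n, rfl⟩ := Int.eq_ofNat_of_zero_le h0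
  induction n generalizing x Z with
  | zero =>
    have h : K.σ y x _ hx Z = 0 := (K.isZero_right y x (by omega) Z).eq_of_tgt _ _
    rw [h, zero_comp, sub_zero]
    exact K.χ'_χ_zero y Z
  | succ n ih =>
    obtain rfl : x = n := by push_cast at hx; omega
    refine hC.eq_of_zsmul_eq (n := ((n + 1 : ℕ) : ℤ)) (by omega) ?_
    have h1 : ((n + 1 : ℕ) : ℤ) • ((K.p y (n + 1 : ℕ)).χ' Z ≫ (K.p y (n + 1 : ℕ)).χ Z) =
        d.map (K.a y n (n + 1 : ℕ) hx Z) ≫ ((K.p y n).χ' (u.obj Z) ≫ (K.p y n).χ (u.obj Z)) ≫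
          d.map (K.c y n (n + 1 : ℕ) hx Z) - K.σ y n _ hx Z ≫ K.σ' y n _ hx Z := by
      rw [← Category.id_comp (Passing.χ' _ _ ≫ _), ← Preadditive.zsmul_comp, ← d.map_id,
        ← d.map_zsmul, ← K.a_c y n (n + 1 : ℕ) hx, d.map_comp]
      simp only [Category.assoc]
      rw [reassoc_of% K.c_χ', K.c_χ, ← (M y n).map_comp_assoc, T.r'_r]
      simp only [σ, σ', Category.assoc, Functor.map_comp, Functor.map_sub, Preadditive.sub_comp,
        Preadditive.comp_sub, CategoryTheory.Functor.map_id, Category.id_comp]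
    rw [h1, ih (n - 1) (u.obj Z) (by omega) (by omega), Preadditive.sub_comp,
      Preadditive.comp_sub, Category.id_comp, Category.assoc, K.c_σ', reassoc_of% K.a_σ,
      reassoc_of% K.a_c, ← d.map_comp, K.a_c, d.map_zsmul, d.map_id]
    simp only [Preadditive.zsmul_comp, Preadditive.comp_zsmul, Category.id_comp, smul_sub]
    push_cast
    rw [add_smul, add_smul, one_smul, one_smul]
    abel

/-- Splitting off an upward strand, pulling it to the left of `Q` and back, and merging it again. -/
theorem φ'_φ (hC : Divisible C) : K.φ' Y x X hx Z ≫ K.φ Y x X hx Z =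
    X • 𝟙 _ - K.κ y Y hy x X hx Z ≫ K.κ' y Y hy x X hx Z := by
  rcases lt_or_ge Y 0 with h | h
  · exact (K.isZero_left Y X h Z).eq_of_src _ _
  have h1 : K.κ y Y hy x X hx Z = K.a Y x X hx Z ≫ K.ρ y Y hy x Z := by
    simp only [κ, ρ, φ', Functor.map_comp, Category.assoc]
    rw [reassoc_of% K.α_a]
  have h2 : K.κ' y Y hy x X hx Z = K.ρ' y Y hy x Z ≫ K.c Y x X hx Z := by
    simp only [κ', ρ', φ, Functor.map_comp, Category.assoc]
    rw [K.c_γ]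
  simp only [φ, φ', Category.assoc]
  rw [reassoc_of% K.π'_π y Y hy x Z hC h, Preadditive.sub_comp, Preadditive.comp_sub,
    Category.id_comp, K.a_c, h1, h2]
  simp only [Category.assoc]

/-- Splitting off a downward strand, pulling it to the right of `P` and back, and merging it again.
-/
theorem ψ'_ψ [∀ y x, (M y x).Additive] (hC : Divisible C) : K.ψ' y Y hy X Z ≫ K.ψ y Y hy X Z =
    Y • 𝟙 _ - K.κ y Y hy x X hx Z ≫ K.κ' y Y hy x X hx Z := by
  rcases lt_or_ge X 0 with h | h
  · exact (K.isZero_right Y X h Z).eq_of_src _ _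
  have h1 : K.κ y Y hy x X hx Z = K.α y Y hy X Z ≫ K.σ y x X hx Z := by
    simp only [κ, σ, φ', Functor.map_comp, Category.assoc]
    rw [(K.p y x).π'_cap']
  have h2 : K.κ' y Y hy x X hx Z = K.σ' y x X hx Z ≫ K.γ y Y hy X Z := by
    simp only [κ', σ', φ, Functor.map_comp, Category.assoc]
    rw [reassoc_of% (K.p y x).cup'_π]
  simp only [ψ, ψ', Category.assoc]
  rw [reassoc_of% K.χ'_χ y x X hx Z hC h, Preadditive.sub_comp, Preadditive.comp_sub,
    Category.id_comp, K.α_γ, h1, h2]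
  simp only [Category.assoc]

end Crossings

end Middle

end Middle
end Heis
namespace Heis

/-! ### The maps between the functors `P_x Q_y P_x' Q_y'` -/

section Quad

variable {C : Type*} [Category C] [Preadditive C] {u d : C ⥤ C} {T : Action u d}
  {P Q : ℤ → C ⥤ C}

namespace UpTower

variable (t : UpTower T P)

/-- The merging of a strand into `P m`, normalized such that `a ≫ e` is the multiplication by
`m + 1`. -/
def e (m n : ℤ) (h : m + 1 = n) (Z : C) : (P m).obj (u.obj Z) ⟶ (P n).obj Z := n • t.c m n h Z

theorem a_e (m n : ℤ) (h : m + 1 = n) (Z : C) : t.a m n h Z ≫ t.e m n h Z = n • 𝟙 _ := by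
  rcases lt_or_ge m 0 with hm | hm
  · rcases lt_or_ge n 0 with hn | hn
    · exact (t.isZero n hn Z).eq_of_src _ _
    · obtain rfl : n = 0 := by lia
      simp [e]
  · rw [e, Preadditive.comp_zsmul, t.a_c m n h hm]

theorem e_a (l m n : ℤ) (hl : l + 1 = m) (hm : m + 1 = n) (Z : C) :
    t.e m n hm Z ≫ t.a m n hm Z =
      𝟙 _ + t.a l m hl (u.obj Z) ≫ (P l).map (T.s Z) ≫ t.e l m hl (u.obj Z) := by
  rcases lt_or_ge m 0 with h | h
  · exact (t.isZero m h _).eq_of_src _ _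
  · rw [e, Preadditive.zsmul_comp, t.c_a l m n hl hm h, e, Preadditive.comp_zsmul,
      Preadditive.comp_zsmul]

theorem s_e_e (l m n : ℤ) (hl : l + 1 = m) (hm : m + 1 = n) (Z : C) :
    (P l).map (T.s Z) ≫ t.e l m hl (u.obj Z) ≫ t.e m n hm Z =
      t.e l m hl (u.obj Z) ≫ t.e m n hm Z := by
  simp only [e, Preadditive.zsmul_comp, Preadditive.comp_zsmul, t.s_c_c]

end UpTower

namespace DownTower

variable (t : DownTower T Q)

/-- The merging of a strand into `Q m`, normalized such that `α ≫ e` is the multiplication by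
`m + 1`. -/
def e (m n : ℤ) (h : m + 1 = n) (Z : C) : d.obj ((Q m).obj Z) ⟶ (Q n).obj Z := n • t.γ m n h Z

theorem α_e (m n : ℤ) (h : m + 1 = n) (Z : C) : t.α m n h Z ≫ t.e m n h Z = n • 𝟙 _ := by
  rcases lt_or_ge m 0 with hm | hm
  · rcases lt_or_ge n 0 with hn | hn
    · exact (t.isZero n hn Z).eq_of_src _ _
    · obtain rfl : n = 0 := by lia
      simp [e]
  · rw [e, Preadditive.comp_zsmul, t.α_γ m n h hm]

variable [d.Additive]

theorem e_α (l m n : ℤ) (hl : l + 1 = m) (hm : m + 1 = n) (Z : C) :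
    t.e m n hm Z ≫ t.α m n hm Z =
      𝟙 _ - d.map (t.α l m hl Z) ≫ T.t ((Q l).obj Z) ≫ d.map (t.e l m hl Z) := by
  rcases lt_or_ge m 0 with h | h
  · exact (d.map_isZero (t.isZero m h _)).eq_of_src _ _
  · rw [e, Preadditive.zsmul_comp, t.γ_α l m n hl hm h, e, d.map_zsmul, Preadditive.comp_zsmul,
      Preadditive.comp_zsmul]

theorem t_e_e (l m n : ℤ) (hl : l + 1 = m) (hm : m + 1 = n) (Z : C) :
    T.t ((Q l).obj Z) ≫ d.map (t.e l m hl Z) ≫ t.e m n hm Z =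
      -(d.map (t.e l m hl Z) ≫ t.e m n hm Z) := by
  simp only [e, d.map_zsmul, Preadditive.zsmul_comp, Preadditive.comp_zsmul, t.t_γ_γ, smul_neg]

end DownTower

variable [u.Additive] [d.Additive]

/-- The functors `Q_y P_x` given by an upward and a downward tower. -/
def Middle.ofTowers [∀ n, (P n).Additive] [∀ n, (Q n).Additive] (tP : UpTower T P)
    (tQ : DownTower T Q) (pP : ∀ n, Passing T (P n)) (pQ : ∀ n, Passing T (Q n))
    (hP : ∀ n Z, (pP n).π' Z ≫ (pP n).π Z = 𝟙 _) (hP0 : ∀ Z, (pP 0).χ' Z ≫ (pP 0).χ Z = 𝟙 _)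
    (ha : ∀ m n h, PassingHom (pP n) ((pP m).comp (Passing.up T)) (tP.a m n h))
    (hc : ∀ m n h, PassingHom ((pP m).comp (Passing.up T)) (pP n) (tP.c m n h))
    (hQ : ∀ n Z, (pQ n).χ' Z ≫ (pQ n).χ Z = 𝟙 _) (hQ0 : ∀ Z, (pQ 0).π' Z ≫ (pQ 0).π Z = 𝟙 _)
    (hα : ∀ m n h, PassingHom (pQ n) ((Passing.down T).comp (pQ m)) (tQ.α m n h))
    (hγ : ∀ m n h, PassingHom ((Passing.down T).comp (pQ m)) (pQ n) (tQ.γ m n h)) :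
    Middle T (fun y x => P x ⋙ Q y) where
  p y x := (pQ y).comp (pP x)
  a y m n h Z := (Q y).map (tP.a m n h Z)
  c y m n h Z := (Q y).map (tP.e m n h Z)
  α m n h x Z := tQ.α m n h ((P x).obj Z)
  γ m n h x Z := tQ.e m n h ((P x).obj Z)
  a_hom y m n h := by
    simpa using ((ha m n h).whiskerLeft (pQ y)).comp (PassingHom.assoc_inv _ _ _)
  c_hom y m n h := by
    simpa [UpTower.e] using (PassingHom.assoc _ _ _).comp (((hc m n h).zsmul n).whiskerLeft (pQ y))
  α_hom m n h x := by
    simpa using ((hα m n h).whiskerRight (pP x)).comp (PassingHom.assoc _ _ _)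
  γ_hom m n h x := by
    simpa [DownTower.e] using (PassingHom.assoc_inv _ _ _).comp (((hγ m n h).zsmul n).whiskerRight (pP x))
  isZero_left y x hy Z := tQ.isZero y hy _
  isZero_right y x hx Z := (Q y).map_isZero (tP.isZero x hx Z)
  π'_π_zero x Z := by
    dsimp only [Passing.comp]
    rw [Category.assoc, reassoc_of% hQ0, ← (Q 0).map_comp, hP, (Q 0).map_id]
    rfl
  χ'_χ_zero y Z := by
    dsimp only [Passing.comp]
    rw [Category.assoc, ← (Q y).map_comp_assoc, hP0, (Q y).map_id, Category.id_comp, hQ]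
    rfl
  a_c y m n h Z := by
    rw [← (Q y).map_comp, tP.a_e, (Q y).map_zsmul, (Q y).map_id]
    rfl
  c_a y l m n hl hm Z := by
    rw [← (Q y).map_comp, tP.e_a l m n hl hm, (Q y).map_add, (Q y).map_comp, (Q y).map_comp,
      (Q y).map_id]
    rfl
  a_a_s y l m n hl hm Z := by
    dsimp only [Functor.comp_map]
    rw [← (Q y).map_comp, ← (Q y).map_comp, tP.a_a_s, (Q y).map_comp]
  s_c_c y l m n hl hm Z := by
    dsimp only [Functor.comp_map]
    rw [← (Q y).map_comp, ← (Q y).map_comp, tP.s_e_e]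
  α_γ m n h x Z := tQ.α_e m n h _
  γ_α l m n hl hm x Z := tQ.e_α l m n hl hm _
  α_α_t l m n hl hm x Z := tQ.α_α_t l m n hl hm _
  t_γ_γ l m n hl hm x Z := tQ.t_e_e l m n hl hm _
  α_a y Y hy x X hx Z := ((hα y Y hy).nat _).symm
  γ_a y Y hy x X hx Z := (((hγ y Y hy).zsmul Y).nat (tP.a x X hx Z)).symm
  c_α y Y hy x X hx Z := (hα y Y hy).nat _
  c_γ y Y hy x X hx Z := ((hγ y Y hy).zsmul Y).nat (tP.e x X hx Z)

/-- The structure on a family of objects `W x y x' y'`, playing the role of `P_x Q_y P_x' Q_y'`,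
which is given by the clockwise caps `d₁` and `d₂` between `P_x`, `Q_y` and between `P_x'`, `Q_y'`:
the counterclockwise caps `κ` and cups `κ'` between `Q_y` and `P_x'`, the maps `fP`, `eP` which
move a strand between `P_x` and `P_x'`, and the maps `fQ`, `eQ` which move a strand between `Q_y'`
and `Q_y`. The number `δ` is the shift of the weights by which a family differs from its dual. -/
structure Quad (W : ℤ → ℤ → ℤ → ℤ → C)
    (d₁ : ∀ x X (_ : x + 1 = X) y Y (_ : y + 1 = Y) x' y', W X Y x' y' ⟶ W x y x' y')
    (d₂ : ∀ x y x' X' (_ : x' + 1 = X') y' Y' (_ : y' + 1 = Y'), W x y X' Y' ⟶ W x y x' y') (δ : ℤ) where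
  κ (x y Y : ℤ) (hy : y + 1 = Y) (x' X' : ℤ) (hx' : x' + 1 = X') (y' : ℤ) :
    W x Y X' y' ⟶ W x y x' y'
  κ' (x y Y : ℤ) (hy : y + 1 = Y) (x' X' : ℤ) (hx' : x' + 1 = X') (y' : ℤ) :
    W x y x' y' ⟶ W x Y X' y'
  fP (x X : ℤ) (hx : x + 1 = X) (y x' X' : ℤ) (hx' : x' + 1 = X') (y' : ℤ) :
    W X y x' y' ⟶ W x y X' y'
  eP (x X : ℤ) (hx : x + 1 = X) (y x' X' : ℤ) (hx' : x' + 1 = X') (y' : ℤ) :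
    W x y X' y' ⟶ W X y x' y'
  fQ (x y Y : ℤ) (hy : y + 1 = Y) (x' y' Y' : ℤ) (hy' : y' + 1 = Y') :
    W x y x' Y' ⟶ W x Y x' y'
  eQ (x y Y : ℤ) (hy : y + 1 = Y) (x' y' Y' : ℤ) (hy' : y' + 1 = Y') :
    W x Y x' y' ⟶ W x y x' Y'
  κ_κ (x : ℤ) (y₁ y₂ y₃ : ℤ) (hy₁ : y₁ + 1 = y₂) (hy₂ : y₂ + 1 = y₃)
    (x₁ x₂ x₃ : ℤ) (hx₁ : x₁ + 1 = x₂) (hx₂ : x₂ + 1 = x₃) (y' : ℤ) :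
    κ x y₂ y₃ hy₂ x₂ x₃ hx₂ y' ≫ κ x y₁ y₂ hy₁ x₁ x₂ hx₁ y' = 0
  κ'_κ' (x : ℤ) (y₁ y₂ y₃ : ℤ) (hy₁ : y₁ + 1 = y₂) (hy₂ : y₂ + 1 = y₃)
    (x₁ x₂ x₃ : ℤ) (hx₁ : x₁ + 1 = x₂) (hx₂ : x₂ + 1 = x₃) (y' : ℤ) :
    κ' x y₁ y₂ hy₁ x₁ x₂ hx₁ y' ≫ κ' x y₂ y₃ hy₂ x₂ x₃ hx₂ y' = 0
  homotopy (x : ℤ) (y₁ y₂ y₃ : ℤ) (hy₁ : y₁ + 1 = y₂) (hy₂ : y₂ + 1 = y₃)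
    (x₁ x₂ x₃ : ℤ) (hx₁ : x₁ + 1 = x₂) (hx₂ : x₂ + 1 = x₃) (y' : ℤ) :
    κ' x y₂ y₃ hy₂ x₂ x₃ hx₂ y' ≫ κ x y₂ y₃ hy₂ x₂ x₃ hx₂ y' +
      κ x y₁ y₂ hy₁ x₁ x₂ hx₁ y' ≫ κ' x y₁ y₂ hy₁ x₁ x₂ hx₁ y' = 𝟙 _
  κ_d₁ (w x : ℤ) (hw : w + 1 = x) (y₁ y₂ y₃ : ℤ) (hy₁ : y₁ + 1 = y₂) (hy₂ : y₂ + 1 = y₃)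
    (x' X' : ℤ) (hx' : x' + 1 = X') (y' : ℤ) :
    κ x y₂ y₃ hy₂ x' X' hx' y' ≫ d₁ w x hw y₁ y₂ hy₁ x' y' =
      -(d₁ w x hw y₂ y₃ hy₂ X' y' ≫ κ w y₁ y₂ hy₁ x' X' hx' y')
  κ_d₂ (x y Y : ℤ) (hy : y + 1 = Y) (x₁ x₂ x₃ : ℤ) (hx₁ : x₁ + 1 = x₂) (hx₂ : x₂ + 1 = x₃)
    (y' Y' : ℤ) (hy' : y' + 1 = Y') :
    κ x y Y hy x₂ x₃ hx₂ Y' ≫ d₂ x y x₁ x₂ hx₁ y' Y' hy' =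
      d₂ x Y x₂ x₃ hx₂ y' Y' hy' ≫ κ x y Y hy x₁ x₂ hx₁ y'
  κ'_d₁ (w x : ℤ) (hw : w + 1 = x) (y₁ y₂ y₃ : ℤ) (hy₁ : y₁ + 1 = y₂) (hy₂ : y₂ + 1 = y₃)
    (x' X' : ℤ) (hx' : x' + 1 = X') (y' : ℤ) :
    κ' x y₂ y₃ hy₂ x' X' hx' y' ≫ d₁ w x hw y₂ y₃ hy₂ X' y' =
      -(d₁ w x hw y₁ y₂ hy₁ x' y' ≫ κ' w y₁ y₂ hy₁ x' X' hx' y') + fP w x hw y₂ x' X' hx' y'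
  κ'_d₂ (x y Y : ℤ) (hy : y + 1 = Y) (x₁ x₂ x₃ : ℤ) (hx₁ : x₁ + 1 = x₂) (hx₂ : x₂ + 1 = x₃)
    (y' Y' : ℤ) (hy' : y' + 1 = Y') :
    κ' x y Y hy x₂ x₃ hx₂ Y' ≫ d₂ x Y x₂ x₃ hx₂ y' Y' hy' =
      d₂ x y x₁ x₂ hx₁ y' Y' hy' ≫ κ' x y Y hy x₁ x₂ hx₁ y' + fQ x y Y hy x₂ y' Y' hy'
  fP_eP (w x X : ℤ) (hw : w + 1 = x) (hx : x + 1 = X) (y Y : ℤ) (hy : y + 1 = Y) (x₁ x₂ x₃ : ℤ)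
    (hx₁ : x₁ + 1 = x₂) (hx₂ : x₂ + 1 = x₃) (y' : ℤ) :
    fP w x hw Y x₂ x₃ hx₂ y' ≫ eP w x hw Y x₂ x₃ hx₂ y' -
      eP x X hx Y x₁ x₂ hx₁ y' ≫ fP x X hx Y x₁ x₂ hx₁ y' =
      (x - x₂ - δ) • 𝟙 _ + κ x y Y hy x₁ x₂ hx₁ y' ≫ κ' x y Y hy x₁ x₂ hx₁ y'
  fQ_eQ (x y₁ y₂ y₃ : ℤ) (hy₁ : y₁ + 1 = y₂) (hy₂ : y₂ + 1 = y₃) (x' X' : ℤ)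
    (hx' : x' + 1 = X') (w' y' Y' : ℤ) (hw' : w' + 1 = y') (hy' : y' + 1 = Y') :
    fQ x y₂ y₃ hy₂ X' w' y' hw' ≫ eQ x y₂ y₃ hy₂ X' w' y' hw' -
      eQ x y₁ y₂ hy₁ X' y' Y' hy' ≫ fQ x y₁ y₂ hy₁ X' y' Y' hy' =
      (y' - y₂ - δ) • 𝟙 _ + κ x y₁ y₂ hy₁ x' X' hx' y' ≫ κ' x y₁ y₂ hy₁ x' X' hx' y'
  fP_eQ (x X : ℤ) (hx : x + 1 = X) (y Y : ℤ) (hy : y + 1 = Y) (x' X' : ℤ) (hx' : x' + 1 = X')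
    (y' Y' : ℤ) (hy' : y' + 1 = Y') :
    fP x X hx Y x' X' hx' y' ≫ eQ x y Y hy X' y' Y' hy' =
      eQ X y Y hy x' y' Y' hy' ≫ fP x X hx y x' X' hx' Y'
  fQ_eP (x X : ℤ) (hx : x + 1 = X) (y Y : ℤ) (hy : y + 1 = Y) (x' X' : ℤ) (hx' : x' + 1 = X')
    (y' Y' : ℤ) (hy' : y' + 1 = Y') :
    fQ x y Y hy X' y' Y' hy' ≫ eP x X hx Y x' X' hx' y' =
      eP x X hx y x' X' hx' Y' ≫ fQ X y Y hy x' y' Y' hy'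

/-- The structure on the words `P_x M_{y, x'} Q_y'`, where `M` plays the role of `Q_y P_x'`. -/
def Middle.quad [∀ n, (P n).Additive] {M : ℤ → ℤ → C ⥤ C} [∀ y x, (M y x).Additive]
    (hC : Divisible C) (K : Middle T M) (tP : UpTower T P)
    (e_nat : ∀ (m n : ℤ) (h : m + 1 = n) {X Y : C} (f : X ⟶ Y),
      (P m).map (u.map f) ≫ tP.e m n h Y = tP.e m n h X ≫ (P n).map f)
    (tQ : DownTower T Q) (Z : C) :
    Quad (fun x y x' y' => (P x).obj ((M y x').obj ((Q y').obj Z)))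
      (fun x X hx y Y hy x' _ => tP.a x X hx _ ≫ (P x).map (K.ε y Y hy x' _))
      (fun x y x' X' hx' y' Y' hy' =>
        (P x).map ((M y X').map (tQ.α y' Y' hy' Z) ≫ K.η y x' X' hx' _)) 0 := by
  refine {
    κ := fun x y Y hy x' X' hx' y' => (P x).map (K.κ y Y hy x' X' hx' _)
    κ' := fun x y Y hy x' X' hx' y' => (P x).map (K.κ' y Y hy x' X' hx' _)
    fP := fun x X hx y x' X' hx' y' => tP.a x X hx _ ≫ (P x).map (K.φ y x' X' hx' _)
    eP := fun x X hx y x' X' hx' y' => (P x).map (K.φ' y x' X' hx' _) ≫ tP.e x X hx _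
    fQ := fun x y Y hy x' y' Y' hy' =>
      (P x).map ((M y x').map (tQ.α y' Y' hy' Z) ≫ K.ψ y Y hy x' _)
    eQ := fun x y Y hy x' y' Y' hy' =>
      (P x).map (K.ψ' y Y hy x' _ ≫ (M y x').map (tQ.e y' Y' hy' Z))
    κ_κ := ?_
    κ'_κ' := ?_
    homotopy := ?_
    κ_d₁ := ?_
    κ_d₂ := ?_
    κ'_d₁ := ?_
    κ'_d₂ := ?_
    fP_eP := ?_
    fQ_eQ := ?_
    fP_eQ := ?_
    fQ_eP := ?_ }
  · intro x y₁ y₂ y₃ hy₁ hy₂ x₁ x₂ x₃ hx₁ hx₂ y'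
    rw [← (P x).map_comp, K.κ_κ _ _ _ _ _ _ _ _ _ _ _ hC, (P x).map_zero]
  · intro x y₁ y₂ y₃ hy₁ hy₂ x₁ x₂ x₃ hx₁ hx₂ y'
    rw [← (P x).map_comp, K.κ'_κ' _ _ _ _ _ _ _ _ _ _ _ hC, (P x).map_zero]
  · intro x y₁ y₂ y₃ hy₁ hy₂ x₁ x₂ x₃ hx₁ hx₂ y'
    rw [← (P x).map_comp, ← (P x).map_comp, ← (P x).map_add, K.homotopy, (P x).map_id]
  · intro w x hw y₁ y₂ y₃ hy₁ hy₂ x' X' hx' y'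
    have h := congrArg (P w).map (K.κ_ε y₁ y₂ y₃ hy₁ hy₂ x' X' hx' ((Q y').obj Z))
    simp only [(P w).map_comp, (P w).map_neg] at h
    simp only [Category.assoc]
    rw [reassoc_of% tP.a_nat]
    exact (congrArg (tP.a w x hw _ ≫ ·) h).trans (Preadditive.comp_neg _ _)
  · intro x y Y hy x₁ x₂ x₃ hx₁ hx₂ y' Y' hy'
    rw [← (P x).map_comp, ← (P x).map_comp, Category.assoc, ← K.κ_η]
    rw [reassoc_of% K.κ_nat]
  · intro w x hw y₁ y₂ y₃ hy₁ hy₂ x' X' hx' y'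
    have h := congrArg (P w).map (K.κ'_ε y₁ y₂ y₃ hy₁ hy₂ x' X' hx' ((Q y').obj Z))
    simp only [(P w).map_comp, (P w).map_neg, (P w).map_add] at h
    simp only [Category.assoc]
    rw [reassoc_of% tP.a_nat]
    refine (congrArg (tP.a w x hw _ ≫ ·) h).trans ?_
    rw [Preadditive.comp_add, Preadditive.comp_neg]
  · intro x y Y hy x₁ x₂ x₃ hx₁ hx₂ y' Y' hy'
    rw [← (P x).map_comp, ← (P x).map_comp, Category.assoc, ← (P x).map_add,
      ← reassoc_of% K.κ'_nat, K.κ'_η x₁ x₂ x₃ hx₁ hx₂ y Y hy, Preadditive.comp_add]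
  · intro w x X hw hx y Y hy x₁ x₂ x₃ hx₁ hx₂ y'
    simp only [Category.assoc]
    rw [← (P w).map_comp_assoc, K.φ_φ' x₁ x₂ x₃ hx₁ hx₂, reassoc_of% (tP.e_a w x X hw hx),
      (P w).map_add, (P w).map_id, Preadditive.add_comp, Preadditive.comp_add, Category.id_comp,
      tP.a_e, Preadditive.add_comp, Preadditive.comp_add, Category.id_comp, ← (P x).map_comp,
      K.φ'_φ y Y hy x₁ x₂ hx₁ _ hC]
    simp only [Functor.map_comp, Category.assoc]
    rw [reassoc_of% tP.a_nat, ← e_nat]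
    simp only [(P x).map_sub, (P x).map_comp, (P x).map_zsmul, (P x).map_id, sub_smul, sub_zero]
    abel
  · intro x y₁ y₂ y₃ hy₁ hy₂ x' X' hx' w' y' Y' hw' hy'
    rw [← (P x).map_comp, ← (P x).map_comp, ← (P x).map_comp, ← (P x).map_sub]
    have h1 : ((M y₂ X').map (tQ.α w' y' hw' Z) ≫ K.ψ y₂ y₃ hy₂ X' ((Q w').obj Z)) ≫
        K.ψ' y₂ y₃ hy₂ X' ((Q w').obj Z) ≫ (M y₂ X').map (tQ.e w' y' hw' Z) -
        (K.ψ' y₁ y₂ hy₁ X' _ ≫ (M y₁ X').map (tQ.e y' Y' hy' Z)) ≫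
          (M y₁ X').map (tQ.α y' Y' hy' Z) ≫ K.ψ y₁ y₂ hy₁ X' _ =
        (y' - y₂) • 𝟙 _ + K.κ y₁ y₂ hy₁ x' X' hx' _ ≫ K.κ' y₁ y₂ hy₁ x' X' hx' _ := by
      simp only [Category.assoc]
      rw [reassoc_of% K.ψ_ψ' y₁ y₂ y₃ hy₁ hy₂, Preadditive.sub_comp, Preadditive.comp_sub,
        Category.id_comp, ← (M y₂ X').map_comp, tQ.α_e, ← (M y₁ X').map_comp_assoc,
        tQ.e_α w' y' Y' hw' hy', Functor.map_sub, Preadditive.sub_comp, Preadditive.comp_sub,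
        CategoryTheory.Functor.map_id, Category.id_comp, K.ψ'_ψ y₁ y₂ hy₁ x' X' hx' _ hC]
      simp only [Functor.map_comp, Category.assoc]
      rw [← K.ψ_nat, ← reassoc_of% K.ψ'_nat]
      simp only [(M y₂ X').map_zsmul, CategoryTheory.Functor.map_id, sub_smul]
      abel
    rw [h1, sub_zero, (P x).map_add, (P x).map_zsmul, (P x).map_id, (P x).map_comp]
  · intro x X hx y Y hy x' X' hx' y' Y' hy'
    rw [Category.assoc, ← (P x).map_comp, reassoc_of% K.φ_ψ', ← K.φ_nat, ← u.map_comp_assoc,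
      reassoc_of% tP.a_nat, ← (P x).map_comp]
  · intro x X hx y Y hy x' X' hx' y' Y' hy'
    rw [← Category.assoc, ← (P x).map_comp, Category.assoc, Category.assoc, K.ψ_φ',
      reassoc_of% K.φ'_nat, ← e_nat, ← (P x).map_comp_assoc, ← u.map_comp]

/-- The clockwise cap between `P_x` and `Q_y`. -/
def capLeft (tP : UpTower T P) (tQ : DownTower T Q) (x X : ℤ) (hx : x + 1 = X) (y Y : ℤ)
    (hy : y + 1 = Y) (Z : C) : (P X).obj ((Q Y).obj Z) ⟶ (P x).obj ((Q y).obj Z) :=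
  tP.a x X hx _ ≫ (P x).map (u.map (tQ.α y Y hy Z) ≫ T.cap _)

/-- The words in the symmetric powers `P` and the exterior powers `Q` carry the structure `Quad`,
with `M = Q_y P_x'` in the middle. -/
theorem exists_quad [∀ n, (P n).Additive] [∀ n, (Q n).Additive] (hC : Divisible C)
    (tP : UpTower T P) (tQ : DownTower T Q) (Z : C) :
    Nonempty (Quad (fun x y x' y' => (P x).obj ((Q y).obj ((P x').obj ((Q y').obj Z))))
      (fun x X hx y Y hy _ _ => capLeft tP tQ x X hx y Y hy _)
      (fun x y x' X' hx' y' Y' hy' => (P x).map ((Q y).map (capLeft tP tQ x' X' hx' y' Y' hy' Z))) 0) := by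
  obtain ⟨pP, hP, hP0, hac⟩ := tP.exists_passing hC
  obtain ⟨pQ, hQ, hQ0, hαγ⟩ := tQ.exists_passing hC
  have e_nat (m n : ℤ) (h : m + 1 = n) {X Y : C} (f : X ⟶ Y) :
      (P m).map (u.map f) ≫ tP.e m n h Y = tP.e m n h X ≫ (P n).map f :=
    ((hac m n h).2.zsmul n).nat f
  let K := Middle.ofTowers tP tQ pP pQ hP hP0 (fun m n h => (hac m n h).1)
    (fun m n h => (hac m n h).2) hQ hQ0 (fun m n h => (hαγ m n h).1) (fun m n h => (hαγ m n h).2)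
  have hη (y x' X' : ℤ) (hx' : x' + 1 = X') (y' Y' : ℤ) (hy' : y' + 1 = Y') :
      (Q y).map (capLeft tP tQ x' X' hx' y' Y' hy' Z) =
        (P X' ⋙ Q y).map (tQ.α y' Y' hy' Z) ≫ K.η y x' X' hx' _ := by
    simp only [capLeft, Functor.map_comp, Functor.comp_map]
    rw [← (Q y).map_comp_assoc, ← tP.a_nat, (Q y).map_comp_assoc]
    rfl
  have h : (fun x y _ _ hx' _ _ hy' =>
      (P x).map ((Q y).map (capLeft tP tQ _ _ hx' _ _ hy' Z))) =
      fun x y x' X' hx' y' Y' hy' =>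
        (P x).map ((P X' ⋙ Q y).map (tQ.α y' Y' hy' Z) ≫ K.η y x' X' hx' _) := by
    funext x y x' X' hx' y' Y' hy'
    rw [hη]
  rw [h]
  exact ⟨K.quad hC tP e_nat tQ Z⟩

theorem eq_neg_add_of_eq_neg_add {G : Type*} [AddCommGroup G] {a b f : G} (h : a = -b + f) :
    b = -a + f := by
  rw [h]
  abel

theorem sub_eq_of_sub_eq {G : Type*} [AddCommGroup G] {a b p q i : G} {m n : ℤ}
    (h : b - a = m • i + q) (hi : p + q = i) (hn : n = -m - 1) : a - b = n • i + p := by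
  rw [← neg_sub, h, hn, sub_smul, neg_smul, one_smul]
  nth_rw 3 [← hi]
  abel

/-- The same structure on the opposite category, with all indices negated. -/
def Quad.dual {C : Type*} [Category C] [Preadditive C] {W : ℤ → ℤ → ℤ → ℤ → Cᵒᵖ}
    {d₁ : ∀ x X (_ : x + 1 = X) y Y (_ : y + 1 = Y) x' y', W X Y x' y' ⟶ W x y x' y'}
    {d₂ : ∀ x y x' X' (_ : x' + 1 = X') y' Y' (_ : y' + 1 = Y'), W x y X' Y' ⟶ W x y x' y'}
    (K : Quad W d₁ d₂ 0) :
    Quad (fun x y x' y' => (W (-x) (-y) (-x') (-y')).unop)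
      (fun x X hx y Y hy x' y' => (d₁ (-X) (-x) (by lia) (-Y) (-y) (by lia) (-x') (-y')).unop)
      (fun x y x' X' hx' y' Y' hy' =>
        (d₂ (-x) (-y) (-X') (-x') (by lia) (-Y') (-y') (by lia)).unop) 1 where
  κ x y Y hy x' X' hx' y' := (K.κ (-x) (-Y) (-y) (by lia) (-X') (-x') (by lia) (-y')).unop
  κ' x y Y hy x' X' hx' y' := (K.κ' (-x) (-Y) (-y) (by lia) (-X') (-x') (by lia) (-y')).unop
  fP x X hx y x' X' hx' y' := (K.fP (-X) (-x) (by lia) (-y) (-X') (-x') (by lia) (-y')).unop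
  eP x X hx y x' X' hx' y' := (K.eP (-X) (-x) (by lia) (-y) (-X') (-x') (by lia) (-y')).unop
  fQ x y Y hy x' y' Y' hy' := -(K.fQ (-x) (-Y) (-y) (by lia) (-x') (-Y') (-y') (by lia)).unop
  eQ x y Y hy x' y' Y' hy' := -(K.eQ (-x) (-Y) (-y) (by lia) (-x') (-Y') (-y') (by lia)).unop
  κ_κ _ _ _ _ _ _ _ _ _ _ _ _ := congrArg Quiver.Hom.unop (K.κ_κ _ _ _ _ _ _ _ _ _ _ _ _)
  κ'_κ' _ _ _ _ _ _ _ _ _ _ _ _ :=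
    congrArg Quiver.Hom.unop (K.κ'_κ' _ _ _ _ _ _ _ _ _ _ _ _)
  homotopy _ _ _ _ _ _ _ _ _ _ _ _ := (add_comm _ _).trans
    (congrArg Quiver.Hom.unop (K.homotopy _ _ _ _ _ _ _ _ _ _ _ _))
  κ_d₁ _ _ _ _ _ _ _ _ _ _ _ _ := by
    rw [← neg_eq_iff_eq_neg]
    exact (congrArg Quiver.Hom.unop (K.κ_d₁ _ _ _ _ _ _ _ _ _ _ _ _)).symm
  κ_d₂ _ _ _ _ _ _ _ _ _ _ _ _ := (congrArg Quiver.Hom.unop (K.κ_d₂ _ _ _ _ _ _ _ _ _ _ _ _)).symm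
  κ'_d₁ _ _ _ _ _ _ _ _ _ _ _ _ := eq_neg_add_of_eq_neg_add
    (congrArg Quiver.Hom.unop (K.κ'_d₁ _ _ _ _ _ _ _ _ _ _ _ _))
  κ'_d₂ _ _ _ _ _ _ _ _ _ _ _ _ := by
    rw [eq_add_neg_iff_add_eq]
    exact (congrArg Quiver.Hom.unop (K.κ'_d₂ _ _ _ _ _ _ _ _ _ _ _ _)).symm
  fP_eP w x X hw hx y Y hy x₁ x₂ x₃ hx₁ hx₂ y' := sub_eq_of_sub_eq
    (congrArg Quiver.Hom.unop (K.fP_eP (-X) (-x) (-w) (by lia) (by lia) (-(Y + 1)) (-Y) (by lia)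
      (-x₃) (-x₂) (-x₁) (by lia) (by lia) (-y')))
    (congrArg Quiver.Hom.unop (K.homotopy (-x) (-(Y + 1)) (-Y) (-y) (by lia) (by lia)
      (-x₃) (-x₂) (-x₁) (by lia) (by lia) (-y'))) (by lia)
  fQ_eQ x y₁ y₂ y₃ hy₁ hy₂ x' X' hx' w' y' Y' hw' hy' := by
    simp only [Preadditive.comp_neg, Preadditive.neg_comp, neg_neg]
    exact sub_eq_of_sub_eq
      (congrArg Quiver.Hom.unop (K.fQ_eQ (-x) (-y₃) (-y₂) (-y₁) (by lia) (by lia) (-(X' + 1)) (-X')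
        (by lia) (-Y') (-y') (-w') (by lia) (by lia)))
      (congrArg Quiver.Hom.unop (K.homotopy (-x) (-y₃) (-y₂) (-y₁) (by lia) (by lia)
        (-(X' + 1)) (-X') (-x') (by lia) (by lia) (-y'))) (by lia)
  fP_eQ _ _ _ _ _ _ _ _ _ _ _ _ := by
    simp only [Preadditive.comp_neg, Preadditive.neg_comp, neg_inj]
    exact (congrArg Quiver.Hom.unop (K.fP_eQ _ _ _ _ _ _ _ _ _ _ _ _)).symm
  fQ_eP _ _ _ _ _ _ _ _ _ _ _ _ := by
    simp only [Preadditive.comp_neg, Preadditive.neg_comp, neg_inj]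
    exact (congrArg Quiver.Hom.unop (K.fQ_eP _ _ _ _ _ _ _ _ _ _ _ _)).symm

end Quad
end Heis
namespace Heis

/-! ### From words to total complexes -/

section Totals

variable {H : Type*} [Category H] [Preadditive H] {W : ℤ → ℤ → ℤ → ℤ → H}
  {d₁ : ∀ x X (_ : x + 1 = X) y Y (_ : y + 1 = Y) x' y', W X Y x' y' ⟶ W x y x' y'}
  {d₂ : ∀ x y x' X' (_ : x' + 1 = X') y' Y' (_ : y' + 1 = Y'), W x y X' Y' ⟶ W x y x' y'}

/-- The image of the structure under an additive functor. -/
def Quad.map {δ : ℤ} (K : Quad W d₁ d₂ δ) {D : Type*} [Category D] [Preadditive D] (J : H ⥤ D)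
    [J.Additive] : Quad (fun x y x' y' => J.obj (W x y x' y'))
      (fun x X hx y Y hy x' y' => J.map (d₁ x X hx y Y hy x' y'))
      (fun x y x' X' hx' y' Y' hy' => J.map (d₂ x y x' X' hx' y' Y' hy')) δ where
  κ x y Y hy x' X' hx' y' := J.map (K.κ x y Y hy x' X' hx' y')
  κ' x y Y hy x' X' hx' y' := J.map (K.κ' x y Y hy x' X' hx' y')
  fP x X hx y x' X' hx' y' := J.map (K.fP x X hx y x' X' hx' y')
  eP x X hx y x' X' hx' y' := J.map (K.eP x X hx y x' X' hx' y')
  fQ x y Y hy x' y' Y' hy' := J.map (K.fQ x y Y hy x' y' Y' hy')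
  eQ x y Y hy x' y' Y' hy' := J.map (K.eQ x y Y hy x' y' Y' hy')
  κ_κ _ _ _ _ _ _ _ _ _ _ _ _ := by rw [← J.map_comp, K.κ_κ, J.map_zero]
  κ'_κ' _ _ _ _ _ _ _ _ _ _ _ _ := by rw [← J.map_comp, K.κ'_κ', J.map_zero]
  homotopy _ _ _ _ _ _ _ _ _ _ _ _ := by
    rw [← J.map_comp, ← J.map_comp, ← J.map_add, K.homotopy, J.map_id]
  κ_d₁ _ _ _ _ _ _ _ _ _ _ _ _ := by rw [← J.map_comp, K.κ_d₁, J.map_neg, J.map_comp]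
  κ_d₂ _ _ _ _ _ _ _ _ _ _ _ _ := by rw [← J.map_comp, K.κ_d₂, J.map_comp]
  κ'_d₁ _ _ _ _ _ _ _ _ _ _ _ _ := by
    rw [← J.map_comp, K.κ'_d₁, J.map_add, J.map_neg, J.map_comp]
  κ'_d₂ _ _ _ _ _ _ _ _ _ _ _ _ := by rw [← J.map_comp, K.κ'_d₂, J.map_add, J.map_comp]
  fP_eP _ _ _ _ _ y Y hy _ _ _ _ _ _ := by
    rw [← J.map_comp, ← J.map_comp, ← J.map_sub, K.fP_eP _ _ _ _ _ y Y hy, J.map_add, J.map_zsmul,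
      J.map_id, J.map_comp]
  fQ_eQ _ _ _ _ _ _ x' X' hx' _ _ _ _ _ := by
    rw [← J.map_comp, ← J.map_comp, ← J.map_sub, K.fQ_eQ _ _ _ _ _ _ x' X' hx', J.map_add,
      J.map_zsmul, J.map_id, J.map_comp]
  fP_eQ _ _ _ _ _ _ _ _ _ _ _ _ := by rw [← J.map_comp, K.fP_eQ, J.map_comp]
  fQ_eP _ _ _ _ _ _ _ _ _ _ _ _ := by rw [← J.map_comp, K.fQ_eP, J.map_comp]

/-- The property that, for all `c`, the complex `L c` is the direct sum of the objects `W x y x' y'`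
with `x - y = c` and `x' - y' = s - c`, placed in degree `-(y + y' + m)`, with differential
`d₁ + (-1) ^ y d₂`. -/
structure TotalOf (d₁ : ∀ x X (_ : x + 1 = X) y Y (_ : y + 1 = Y) x' y', W X Y x' y' ⟶ W x y x' y')
    (d₂ : ∀ x y x' X' (_ : x' + 1 = X') y' Y' (_ : y' + 1 = Y'), W x y X' Y' ⟶ W x y x' y')
    (s m : ℤ) (L : ℤ → CochainComplex H ℤ) where
  ι (x y x' y' c n : ℤ) (h : x - y = c ∧ x' - y' = s - c ∧ n + y + y' + m = 0) :
    W x y x' y' ⟶ (L c).X n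
  desc (c n : ℤ) {A : H} (f : ∀ x y x' y', (x - y = c ∧ x' - y' = s - c ∧ n + y + y' + m = 0) →
    (W x y x' y' ⟶ A)) : (L c).X n ⟶ A
  ι_desc (c n : ℤ) {A : H} (f : ∀ x y x' y', (x - y = c ∧ x' - y' = s - c ∧ n + y + y' + m = 0) →
    (W x y x' y' ⟶ A)) (x y x' y' : ℤ) (h) : ι x y x' y' c n h ≫ desc c n f = f x y x' y' h
  hom_ext (c n : ℤ) {A : H} {f g : (L c).X n ⟶ A}
    (h : ∀ x y x' y' h, ι x y x' y' c n h ≫ f = ι x y x' y' c n h ≫ g) : f = g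
  ι_d (x X y Y x' X' y' Y' c n o : ℤ) (hx : x + 1 = X) (hy : y + 1 = Y) (hx' : x' + 1 = X')
    (hy' : y' + 1 = Y') (hn : n + 1 = o) (h) : ι X Y X' Y' c n h ≫ (L c).d n o =
      d₁ x X hx y Y hy X' Y' ≫ ι x y X' Y' c o (by lia) +
        Y.negOnePow • (d₂ X Y x' X' hx' y' Y' hy' ≫ ι X Y x' y' c o (by lia))

namespace TotalOf

variable {δ : ℤ} {s m : ℤ} {L : ℤ → CochainComplex H ℤ} (T : TotalOf d₁ d₂ s m L)
  (K : Quad W d₁ d₂ δ)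

/-- The sum of the caps `κ`. -/
def κ (c c' n n' : ℤ) (hc : c + 1 = c') (hn : n + 1 = n') : (L c).X n ⟶ (L c').X n' :=
  T.desc c n fun x y x' y' h => K.κ x (y - 1) y (by lia) (x' - 1) x' (by lia) y' ≫
    T.ι x (y - 1) (x' - 1) y' c' n' (by lia)

/-- The sum of the cups `κ'`. -/
def κ' (c c' n n' : ℤ) (hc : c + 1 = c') (hn : n + 1 = n') : (L c').X n' ⟶ (L c).X n :=
  T.desc c' n' fun x y x' y' h => K.κ' x y (y + 1) rfl x' (x' + 1) rfl y' ≫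
    T.ι x (y + 1) (x' + 1) y' c n (by lia)

/-- The signed sum of the maps `fP` and `fQ`. -/
def F (n c c' : ℤ) (hc : c' + 1 = c) : (L c).X n ⟶ (L c').X n :=
  T.desc c n fun x y x' y' h => K.fP (x - 1) x (by lia) y x' (x' + 1) rfl y' ≫
    T.ι (x - 1) y (x' + 1) y' c' n (by lia) + (y + 1).negOnePow •
      (K.fQ x y (y + 1) rfl x' (y' - 1) y' (by lia) ≫ T.ι x (y + 1) x' (y' - 1) c' n (by lia))

/-- The signed sum of the maps `eP` and `eQ`. -/
def E (n c c' : ℤ) (hc : c + 1 = c') : (L c).X n ⟶ (L c').X n :=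
  T.desc c n fun x y x' y' h => K.eP x (x + 1) rfl y (x' - 1) x' (by lia) y' ≫
    T.ι (x + 1) y (x' - 1) y' c' n (by lia) + y.negOnePow •
      (K.eQ x (y - 1) y (by lia) x' y' (y' + 1) rfl ≫ T.ι x (y - 1) x' (y' + 1) c' n (by lia))

theorem ι_κ (x y Y x' X' y' c c' n n' : ℤ) (hc : c + 1 = c') (hn : n + 1 = n') (hy : y + 1 = Y)
    (hx' : x' + 1 = X') (h) : T.ι x Y X' y' c n h ≫ T.κ K c c' n n' hc hn =
      K.κ x y Y hy x' X' hx' y' ≫ T.ι x y x' y' c' n' (by lia) := by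
  obtain rfl : y = Y - 1 := by lia
  obtain rfl : x' = X' - 1 := by lia
  exact T.ι_desc _ _ _ _ _ _ _ _

theorem ι_κ' (x y Y x' X' y' c c' n n' : ℤ) (hc : c + 1 = c') (hn : n + 1 = n') (hy : y + 1 = Y)
    (hx' : x' + 1 = X') (h) : T.ι x y x' y' c' n' h ≫ T.κ' K c c' n n' hc hn =
      K.κ' x y Y hy x' X' hx' y' ≫ T.ι x Y X' y' c n (by lia) := by
  subst hy hx'
  exact T.ι_desc _ _ _ _ _ _ _ _

theorem ι_F (w x y Y x' X' v' y' n c c' : ℤ) (hc : c' + 1 = c) (hw : w + 1 = x) (hy : y + 1 = Y)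
    (hx' : x' + 1 = X') (hv' : v' + 1 = y') (h) : T.ι x y x' y' c n h ≫ T.F K n c c' hc =
      K.fP w x hw y x' X' hx' y' ≫ T.ι w y X' y' c' n (by lia) + Y.negOnePow •
        (K.fQ x y Y hy x' v' y' hv' ≫ T.ι x Y x' v' c' n (by lia)) := by
  obtain rfl : w = x - 1 := by lia
  obtain rfl : v' = y' - 1 := by lia
  subst hy hx'
  exact T.ι_desc _ _ _ _ _ _ _ _

theorem ι_E (x X w y w' x' y' Y' n c c' : ℤ) (hc : c + 1 = c') (hx : x + 1 = X) (hw : w + 1 = y)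
    (hw' : w' + 1 = x') (hy' : y' + 1 = Y') (h) : T.ι x y x' y' c n h ≫ T.E K n c c' hc =
      K.eP x X hx y w' x' hw' y' ≫ T.ι X y w' y' c' n (by lia) + y.negOnePow •
        (K.eQ x w y hw x' y' Y' hy' ≫ T.ι x w x' Y' c' n (by lia)) := by
  obtain rfl : w = y - 1 := by lia
  obtain rfl : w' = x' - 1 := by lia
  subst hx hy'
  exact T.ι_desc _ _ _ _ _ _ _ _

theorem exists_pred (x : ℤ) : ∃ w, w + 1 = x := ⟨x - 1, by lia⟩

/-- The maps between the words give the total complexes the structure of a Koszul family. -/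
def koszul (ha : ∀ n, ∃ N, ∀ c, N < c → IsZero ((L c).X n))
    (hb : ∀ n, ∃ N, ∀ c, c < N → IsZero ((L c).X n)) : Koszul L (s + 2 * δ) where
  κ := T.κ K
  κ' := T.κ' K
  F := T.F K
  E := T.E K
  κ_κ a b c l m n ha hb hl hm := by
    refine T.hom_ext _ _ fun x y x' y' h => ?_
    obtain ⟨y₁, hy₁⟩ := exists_pred y
    obtain ⟨y₂, hy₂⟩ := exists_pred y₁
    obtain ⟨x₁, hx₁⟩ := exists_pred x'
    obtain ⟨x₂, hx₂⟩ := exists_pred x₁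
    rw [reassoc_of% T.ι_κ K x y₁ y x₁ x' y' _ _ _ _ ha hl hy₁ hx₁,
      T.ι_κ K x y₂ y₁ x₂ x₁ y' _ _ _ _ hb hm hy₂ hx₂, reassoc_of% K.κ_κ, zero_comp, comp_zero]
  κ'_κ' a b c l m n ha hb hl hm := by
    refine T.hom_ext _ _ fun x y x' y' h => ?_
    rw [reassoc_of% T.ι_κ' K x y _ x' _ y' _ _ _ _ hb hm rfl rfl,
      T.ι_κ' K x _ _ _ _ y' _ _ _ _ ha hl rfl rfl, reassoc_of% K.κ'_κ', zero_comp, comp_zero]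
  homotopy a b c l m n ha hb hl hm := by
    refine T.hom_ext _ _ fun x y x' y' h => ?_
    obtain ⟨y₁, hy₁⟩ := exists_pred y
    obtain ⟨x₁, hx₁⟩ := exists_pred x'
    rw [Preadditive.comp_add, reassoc_of% T.ι_κ K x y₁ y x₁ x' y' _ _ _ _ hb hm hy₁ hx₁,
      T.ι_κ' K x y₁ y x₁ x' y' _ _ _ _ hb hm hy₁ hx₁,
      reassoc_of% T.ι_κ' K x y _ x' _ y' _ _ _ _ ha hl rfl rfl,
      T.ι_κ K x y _ x' _ y' _ _ _ _ ha hl rfl rfl, ← Category.assoc, ← Category.assoc,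
      ← Preadditive.add_comp, K.homotopy, Category.id_comp, Category.comp_id]
  d_κ b c l m n hb hl hm := by
    refine T.hom_ext _ _ fun x y x' y' h => ?_
    obtain ⟨w, hw⟩ := exists_pred x
    obtain ⟨y₁, hy₁⟩ := exists_pred y
    obtain ⟨y₂, hy₂⟩ := exists_pred y₁
    obtain ⟨x₁, hx₁⟩ := exists_pred x'
    obtain ⟨x₂, hx₂⟩ := exists_pred x₁
    obtain ⟨w', hw'⟩ := exists_pred y'
    rw [reassoc_of% T.ι_d w x y₁ y x₁ x' w' y' _ _ _ hw hy₁ hx₁ hw' hl, Preadditive.comp_neg,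
      reassoc_of% T.ι_κ K x y₁ y x₁ x' y' _ _ _ _ hb hl hy₁ hx₁,
      T.ι_d w x y₂ y₁ x₂ x₁ w' y' _ _ _ hw hy₂ hx₂ hw' hm]
    simp only [Preadditive.add_comp, Linear.units_smul_comp, Category.assoc, Preadditive.comp_add,
      Linear.comp_units_smul]
    rw [T.ι_κ K w y₂ y₁ x₁ x' y' _ _ _ _ hb hm hy₂ hx₁, T.ι_κ K x y₁ y x₂ x₁ w' _ _ _ _ hb hm hy₁ hx₂,
      reassoc_of% K.κ_d₁, reassoc_of% K.κ_d₂,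
      show y.negOnePow = -y₁.negOnePow by rw [← hy₁, Int.negOnePow_succ]]
    simp only [Preadditive.neg_comp, Category.assoc, Units.neg_smul]
    abel
  F_eq a b l m n ha hl hm := by
    refine T.hom_ext _ _ fun x y x' y' h => ?_
    obtain ⟨w, hw⟩ := exists_pred x
    obtain ⟨y₁, hy₁⟩ := exists_pred y
    obtain ⟨x₁, hx₁⟩ := exists_pred x'
    obtain ⟨w', hw'⟩ := exists_pred y'
    rw [T.ι_F K w x y (y + 1) x' (x' + 1) w' y' _ _ _ ha hw rfl rfl hw', Preadditive.comp_add,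
      reassoc_of% T.ι_d w x y₁ y x₁ x' w' y' _ _ _ hw hy₁ hx₁ hw' hm,
      reassoc_of% T.ι_κ' K x y (y + 1) x' (x' + 1) y' _ _ _ _ ha hl rfl rfl,
      T.ι_d w x y (y + 1) x' (x' + 1) w' y' _ _ _ hw rfl rfl hw' hl]
    simp only [Preadditive.add_comp, Linear.units_smul_comp, Category.assoc, Preadditive.comp_add,
      Linear.comp_units_smul]
    rw [T.ι_κ' K w y₁ y x' (x' + 1) y' _ _ _ _ ha hm hy₁ rfl,
      T.ι_κ' K x y (y + 1) x₁ x' w' _ _ _ _ ha hm rfl hx₁,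
      reassoc_of% K.κ'_d₁ w x hw y₁ y (y + 1) hy₁ rfl,
      reassoc_of% K.κ'_d₂ x y (y + 1) rfl x₁ x' (x' + 1) hx₁ rfl, Int.negOnePow_succ]
    simp only [Preadditive.add_comp, Preadditive.neg_comp, Category.assoc, Units.neg_smul, smul_add]
    abel
  comm m n a b c ha hb hm := by
    refine T.hom_ext _ _ fun x y x' y' h => ?_
    obtain ⟨w, hw⟩ := exists_pred x
    obtain ⟨y₁, hy₁⟩ := exists_pred y
    obtain ⟨x₁, hx₁⟩ := exists_pred x'
    obtain ⟨w', hw'⟩ := exists_pred y'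
    rw [Preadditive.comp_sub, reassoc_of% T.ι_F K w x y (y + 1) x' (x' + 1) w' y' _ _ _ ha hw rfl
        rfl hw', reassoc_of% T.ι_E K x (x + 1) y₁ y x₁ x' y' (y' + 1) _ _ _ hb rfl hy₁ hx₁ rfl,
      Preadditive.comp_add, Preadditive.comp_nsmul,
      reassoc_of% T.ι_κ K x y₁ y x₁ x' y' _ _ _ _ hb hm hy₁ hx₁,
      T.ι_κ' K x y₁ y x₁ x' y' _ _ _ _ hb hm hy₁ hx₁]
    simp only [Preadditive.add_comp, Linear.units_smul_comp, Category.assoc]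
    rw [T.ι_E K w x y₁ y x' (x' + 1) y' (y' + 1) _ _ _ ha hw hy₁ rfl rfl,
      T.ι_E K x (x + 1) y (y + 1) x₁ x' w' y' _ _ _ ha rfl rfl hx₁ hw',
      T.ι_F K x (x + 1) y (y + 1) x₁ x' w' y' _ _ _ hb rfl rfl hx₁ hw',
      T.ι_F K w x y₁ y x' (x' + 1) y' (y' + 1) _ _ _ hb hw hy₁ rfl rfl]
    have h1 := congrArg (· ≫ T.ι x y x' y' b m h)
      (K.fP_eP w x (x + 1) hw rfl y₁ y hy₁ x₁ x' (x' + 1) hx₁ rfl y')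
    have h2 := congrArg (· ≫ T.ι x y x' y' b m h)
      (K.fQ_eQ x y₁ y (y + 1) hy₁ rfl x₁ x' hx₁ w' y' (y' + 1) hw' rfl)
    simp only [Preadditive.sub_comp, Preadditive.add_comp, Preadditive.zsmul_comp, Category.assoc,
      Category.id_comp, sub_eq_iff_eq_add] at h1 h2
    simp only [Preadditive.comp_add, Linear.comp_units_smul, smul_add, smul_smul,
      Int.units_mul_self, one_smul]
    rw [h1, h2, reassoc_of% K.fP_eQ w x hw y₁ y hy₁ x' (x' + 1) rfl y' (y' + 1) rfl,
      reassoc_of% K.fQ_eP x (x + 1) rfl y (y + 1) rfl x₁ x' hx₁ w' y' hw',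
      Preadditive.comp_zsmul, Category.comp_id,
      show 2 * b - (s + 2 * δ) = (x - x' - δ) + (y' - y - δ) by lia, add_smul (x - x' - δ), two_smul ℕ]
    abel
  isZero_above := ha
  isZero_below := hb

end TotalOf

end Totals
end Heis
namespace Heis

/-! ### The Karoubi envelope of a monoidal category -/

section KaroubiMonoidal

open Idempotents

variable {C : Type*} [Category C] [MonoidalCategory C]

/-- `(X, e) ⊗ (Y, f) = (X ⊗ Y, e ⊗ f)`; the associator and the unitors are composed with the
idempotents. -/
instance : MonoidalCategoryStruct (Karoubi C) where
  tensorObj P Q := ⟨P.X ⊗ Q.X, P.p ⊗ₘ Q.p, by rw [tensorHom_comp_tensorHom, P.idem, Q.idem]⟩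
  tensorUnit := ⟨𝟙_ C, 𝟙 _, Category.comp_id _⟩
  tensorHom f g := ⟨f.f ⊗ₘ g.f, by simp only [tensorHom_comp_tensorHom, f.comm, g.comm]⟩
  whiskerLeft P _ _ g := ⟨P.p ⊗ₘ g.f, by simp only [tensorHom_comp_tensorHom, g.comm, P.idem]⟩
  whiskerRight f P := ⟨f.f ⊗ₘ P.p, by simp only [tensorHom_comp_tensorHom, f.comm, P.idem]⟩
  associator P Q R :=
    { hom := ⟨(α_ _ _ _).hom ≫ (P.p ⊗ₘ (Q.p ⊗ₘ R.p)), by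
        simp only [Category.assoc, associator_naturality_assoc, tensorHom_comp_tensorHom,
          Karoubi.idem]⟩
      inv := ⟨(α_ _ _ _).inv ≫ ((P.p ⊗ₘ Q.p) ⊗ₘ R.p), by
        simp only [Category.assoc, associator_inv_naturality_assoc, tensorHom_comp_tensorHom,
          Karoubi.idem]⟩
      hom_inv_id := Karoubi.hom_ext _ _ (by
        simp only [Karoubi.comp_f, Karoubi.id_f, Category.assoc, associator_inv_naturality_assoc,
          tensorHom_comp_tensorHom, Karoubi.idem, Iso.hom_inv_id_assoc])
      inv_hom_id := Karoubi.hom_ext _ _ (by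
        simp only [Karoubi.comp_f, Karoubi.id_f, Category.assoc, associator_naturality_assoc,
          tensorHom_comp_tensorHom, Karoubi.idem, Iso.inv_hom_id_assoc]) }
  leftUnitor P :=
    { hom := ⟨(λ_ P.X).hom ≫ P.p, by simp⟩
      inv := ⟨P.p ≫ (λ_ P.X).inv, by simp⟩
      hom_inv_id := by ext; simp
      inv_hom_id := by ext; simp }
  rightUnitor P :=
    { hom := ⟨(ρ_ P.X).hom ≫ P.p, by simp⟩
      inv := ⟨P.p ≫ (ρ_ P.X).inv, by simp⟩
      hom_inv_id := by ext; simp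
      inv_hom_id := by ext; simp }

@[simp]
theorem karoubi_tensorObj_X (P Q : Karoubi C) : (P ⊗ Q).X = (P.X ⊗ Q.X : C) := rfl

@[simp]
theorem karoubi_tensorObj_p (P Q : Karoubi C) : (P ⊗ Q).p = (P.p ⊗ₘ Q.p) := rfl

@[simp]
theorem karoubi_tensorUnit_X : (𝟙_ (Karoubi C)).X = 𝟙_ C := rfl

@[simp]
theorem karoubi_tensorUnit_p : (𝟙_ (Karoubi C)).p = 𝟙 (𝟙_ C) := rfl

@[simp]
theorem karoubi_tensorHom_f {P Q P' Q' : Karoubi C} (f : P ⟶ Q) (g : P' ⟶ Q') :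
    (f ⊗ₘ g).f = (f.f ⊗ₘ g.f) := rfl

@[simp]
theorem karoubi_whiskerLeft_f (P : Karoubi C) {Q R : Karoubi C} (f : Q ⟶ R) :
    (P ◁ f).f = (P.p ⊗ₘ f.f) := rfl

@[simp]
theorem karoubi_whiskerRight_f {Q R : Karoubi C} (f : Q ⟶ R) (P : Karoubi C) :
    (f ▷ P).f = (f.f ⊗ₘ P.p) := rfl

@[simp]
theorem karoubi_associator_hom_f (P Q R : Karoubi C) :
    (α_ P Q R).hom.f = (α_ P.X Q.X R.X).hom ≫ (P.p ⊗ₘ (Q.p ⊗ₘ R.p)) := rfl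

@[simp]
theorem karoubi_associator_inv_f (P Q R : Karoubi C) :
    (α_ P Q R).inv.f = (α_ P.X Q.X R.X).inv ≫ ((P.p ⊗ₘ Q.p) ⊗ₘ R.p) := rfl

@[simp]
theorem karoubi_leftUnitor_hom_f (P : Karoubi C) : (λ_ P).hom.f = (λ_ P.X).hom ≫ P.p := rfl

@[simp]
theorem karoubi_leftUnitor_inv_f (P : Karoubi C) : (λ_ P).inv.f = P.p ≫ (λ_ P.X).inv := rfl

@[simp]
theorem karoubi_rightUnitor_hom_f (P : Karoubi C) : (ρ_ P).hom.f = (ρ_ P.X).hom ≫ P.p := rfl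

@[simp]
theorem karoubi_rightUnitor_inv_f (P : Karoubi C) : (ρ_ P).inv.f = P.p ≫ (ρ_ P.X).inv := rfl

instance : MonoidalCategory (Karoubi C) :=
  MonoidalCategory.ofTensorHom
    (id_tensorHom_id := fun _ _ => rfl)
    (id_tensorHom := fun _ _ _ _ => rfl)
    (tensorHom_id := fun _ _ => rfl)
    (tensorHom_comp_tensorHom := fun _ _ _ _ => Karoubi.hom_ext _ _
      (tensorHom_comp_tensorHom _ _ _ _))
    (associator_naturality := fun f g h => by
      ext
      simp only [Karoubi.comp_f, karoubi_tensorHom_f, karoubi_associator_hom_f, Category.assoc,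
        associator_naturality_assoc, tensorHom_comp_tensorHom, Karoubi.p_comp, Karoubi.comp_p])
    (leftUnitor_naturality := fun f => by ext; simp)
    (rightUnitor_naturality := fun f => by ext; simp)
    (pentagon := fun W X Y Z => by
      have h1 : ((α_ W.X X.X Y.X).hom ≫ (W.p ⊗ₘ (X.p ⊗ₘ Y.p))) ⊗ₘ Z.p =
          (α_ W.X X.X Y.X).hom ▷ Z.X ≫ ((W.p ⊗ₘ (X.p ⊗ₘ Y.p)) ⊗ₘ Z.p) := by
        rw [← tensorHom_id, tensorHom_comp_tensorHom, Category.id_comp]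
      have h2 : W.p ⊗ₘ ((α_ X.X Y.X Z.X).hom ≫ (X.p ⊗ₘ (Y.p ⊗ₘ Z.p))) =
          W.X ◁ (α_ X.X Y.X Z.X).hom ≫ (W.p ⊗ₘ (X.p ⊗ₘ (Y.p ⊗ₘ Z.p))) := by
        rw [← id_tensorHom, tensorHom_comp_tensorHom, Category.id_comp]
      have h3 : (W.p ⊗ₘ ((X.p ⊗ₘ Y.p) ⊗ₘ Z.p)) ≫ W.X ◁ (α_ X.X Y.X Z.X).hom =
          W.X ◁ (α_ X.X Y.X Z.X).hom ≫ (W.p ⊗ₘ (X.p ⊗ₘ (Y.p ⊗ₘ Z.p))) := by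
        rw [← id_tensorHom, tensorHom_comp_tensorHom, tensorHom_comp_tensorHom, Category.id_comp,
          Category.comp_id, associator_naturality]
      ext
      simp only [Karoubi.comp_f, karoubi_tensorHom_f, Karoubi.id_f,
        karoubi_associator_hom_f, karoubi_tensorObj_X, karoubi_tensorObj_p, h1, h2,
        Category.assoc, associator_naturality_assoc,
        tensorHom_comp_tensorHom, Karoubi.idem, reassoc_of% h3, pentagon_assoc])
    (triangle := fun X Y => by
      have h1 : X.p ⊗ₘ ((λ_ Y.X).hom ≫ Y.p) = X.X ◁ (λ_ Y.X).hom ≫ (X.p ⊗ₘ Y.p) := by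
        rw [← id_tensorHom, tensorHom_comp_tensorHom, Category.id_comp]
      have h2 : ((ρ_ X.X).hom ≫ X.p) ⊗ₘ Y.p = (ρ_ X.X).hom ▷ Y.X ≫ (X.p ⊗ₘ Y.p) := by
        rw [← tensorHom_id, tensorHom_comp_tensorHom, Category.id_comp]
      have h3 : (X.p ⊗ₘ (𝟙 (𝟙_ C) ⊗ₘ Y.p)) ≫ X.X ◁ (λ_ Y.X).hom =
          X.X ◁ (λ_ Y.X).hom ≫ (X.p ⊗ₘ Y.p) := by
        rw [← id_tensorHom, tensorHom_comp_tensorHom, tensorHom_comp_tensorHom, Category.id_comp,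
          Category.comp_id, id_tensorHom, leftUnitor_naturality]
      ext
      simp only [Karoubi.comp_f, karoubi_tensorHom_f, Karoubi.id_f,
        karoubi_associator_hom_f, karoubi_leftUnitor_hom_f, karoubi_rightUnitor_hom_f,
        karoubi_tensorUnit_p, karoubi_tensorUnit_X, h1, h2, Category.assoc, reassoc_of% h3,
        tensorHom_comp_tensorHom, Karoubi.idem, triangle_assoc])

variable [Preadditive C] [MonoidalPreadditive C]

instance : MonoidalPreadditive (Karoubi C) where
  whiskerLeft_zero := Karoubi.hom_ext _ _ (MonoidalPreadditive.tensor_zero _)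
  zero_whiskerRight := Karoubi.hom_ext _ _ (MonoidalPreadditive.zero_tensor _)
  whiskerLeft_add _ _ := Karoubi.hom_ext _ _ (MonoidalPreadditive.tensor_add _ _ _)
  add_whiskerRight _ _ := Karoubi.hom_ext _ _ (MonoidalPreadditive.add_tensor _ _ _)

end KaroubiMonoidal

end Heis
namespace Heis

/-! ### The action of Khovanov's category by tensoring on the left -/

section Front

variable {C : Type*} [Category C] [MonoidalCategory C]

/-- The morphism `f` applied to the two leftmost strands. -/
def onFront {A B A' B' : C} (f : A ⊗ B ⟶ A' ⊗ B') (Z : C) : A ⊗ (B ⊗ Z) ⟶ A' ⊗ (B' ⊗ Z) :=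
  (α_ A B Z).inv ≫ f ▷ Z ≫ (α_ A' B' Z).hom

/-- A cap on the two leftmost strands. -/
def capFront {A B : C} (f : A ⊗ B ⟶ 𝟙_ C) (Z : C) : A ⊗ (B ⊗ Z) ⟶ Z :=
  (α_ A B Z).inv ≫ f ▷ Z ≫ (λ_ Z).hom

/-- A cup to the left of all strands. -/
def cupFront {A B : C} (f : 𝟙_ C ⟶ A ⊗ B) (Z : C) : Z ⟶ A ⊗ (B ⊗ Z) :=
  (λ_ Z).inv ≫ f ▷ Z ≫ (α_ A B Z).hom

theorem onFront_naturality {A B A' B' : C} (f : A ⊗ B ⟶ A' ⊗ B') {Y Z : C} (g : Y ⟶ Z) :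
    A ◁ (B ◁ g) ≫ onFront f Z = onFront f Y ≫ A' ◁ (B' ◁ g) := by
  simp only [onFront, Category.assoc]
  rw [associator_inv_naturality_right_assoc, whisker_exchange_assoc,
    ← associator_naturality_right]

theorem capFront_naturality {A B : C} (f : A ⊗ B ⟶ 𝟙_ C) {Y Z : C} (g : Y ⟶ Z) :
    A ◁ (B ◁ g) ≫ capFront f Z = capFront f Y ≫ g := by
  simp only [capFront, Category.assoc]
  rw [associator_inv_naturality_right_assoc, whisker_exchange_assoc, leftUnitor_naturality]

theorem cupFront_naturality {A B : C} (f : 𝟙_ C ⟶ A ⊗ B) {Y Z : C} (g : Y ⟶ Z) :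
    g ≫ cupFront f Z = cupFront f Y ≫ A ◁ (B ◁ g) := by
  simp only [cupFront, Category.assoc]
  rw [leftUnitor_inv_naturality_assoc, whisker_exchange_assoc, ← associator_naturality_right]

theorem onFront_comp {A B A' B' A'' B'' : C} (f : A ⊗ B ⟶ A' ⊗ B') (g : A' ⊗ B' ⟶ A'' ⊗ B'')
    (Z : C) : onFront f Z ≫ onFront g Z = onFront (f ≫ g) Z := by
  simp [onFront]

theorem onFront_id {A B : C} (Z : C) : onFront (𝟙 (A ⊗ B)) Z = 𝟙 _ := by
  simp [onFront]

theorem onFront_braid {A : C} {s : A ⊗ A ⟶ A ⊗ A} (h : DiagCat.Braid s) (Z : C) :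
    onFront s (A ⊗ Z) ≫ A ◁ onFront s Z ≫ onFront s (A ⊗ Z) =
      A ◁ onFront s Z ≫ onFront s (A ⊗ Z) ≫ A ◁ onFront s Z :=
  onFirstTwo_braid Z h

theorem capFront_cupFront {A B : C} (f : A ⊗ B ⟶ 𝟙_ C) (g : 𝟙_ C ⟶ A ⊗ B) (Z : C) :
    capFront f Z ≫ cupFront g Z = onFront (f ≫ g) Z := by
  simp [capFront, cupFront, onFront]

theorem cupFront_capFront {A B : C} {f : A ⊗ B ⟶ 𝟙_ C} {g : 𝟙_ C ⟶ A ⊗ B} (h : g ≫ f = 𝟙 _)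
    (Z : C) : cupFront g Z ≫ capFront f Z = 𝟙 _ := by
  simp only [capFront, cupFront, Category.assoc, Iso.hom_inv_id_assoc]
  rw [← comp_whiskerRight_assoc, h]
  simp

variable {u d : C}

theorem cupFront_zigzag {coev : 𝟙_ C ⟶ d ⊗ u} {ev : u ⊗ d ⟶ 𝟙_ C}
    (zz : (ρ_ u).inv ≫ u ◁ coev ≫ (α_ _ _ _).inv ≫ ev ▷ u ≫ (λ_ u).hom = 𝟙 _) (Z : C) :
    u ◁ cupFront coev Z ≫ capFront ev (u ⊗ Z) = 𝟙 _ := by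
  calc _ = 𝟙 _ ⊗≫ ((ρ_ u).inv ≫ u ◁ coev ≫ (α_ _ _ _).inv ≫ ev ▷ u ≫ (λ_ u).hom) ▷ Z ⊗≫ 𝟙 _ := by
        simp only [cupFront, capFront]; monoidal
    _ = _ := by rw [zz]; monoidal

theorem cupFront_zigzag' {coev : 𝟙_ C ⟶ d ⊗ u} {ev : u ⊗ d ⟶ 𝟙_ C}
    (zz : (λ_ d).inv ≫ coev ▷ d ≫ (α_ _ _ _).hom ≫ d ◁ ev ≫ (ρ_ d).hom = 𝟙 _) (Z : C) :
    cupFront coev (d ⊗ Z) ≫ d ◁ capFront ev Z = 𝟙 _ := by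
  calc _ = 𝟙 _ ⊗≫ ((λ_ d).inv ≫ coev ▷ d ≫ (α_ _ _ _).hom ≫ d ◁ ev ≫ (ρ_ d).hom) ▷ Z ⊗≫ 𝟙 _ := by
        simp only [cupFront, capFront]; monoidal
    _ = _ := by rw [zz]; monoidal

/-- A strand slides through a cup: a crossing `f` of `u` and `x` above the cup can be replaced by
its rotation on the other side. -/
theorem cupFront_slide (coev : 𝟙_ C ⟶ d ⊗ u) (ev : u ⊗ d ⟶ 𝟙_ C)
    (zz : (ρ_ u).inv ≫ u ◁ coev ≫ (α_ _ _ _).inv ≫ ev ▷ u ≫ (λ_ u).hom = 𝟙 _)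
    {x y : C} (f : u ⊗ x ⟶ y ⊗ u) (Z : C) :
    cupFront coev (x ⊗ Z) ≫ d ◁ onFront f Z =
      x ◁ cupFront coev Z ≫ onFront (rotL coev ev f) (u ⊗ Z) := by
  have h : x ◁ cupFront coev Z ≫ onFront (rotL coev ev f) (u ⊗ Z) =
      𝟙 _ ⊗≫ (coev ▷ x ⊗≫ d ◁ f ⊗≫ (d ⊗ y) ◁ ((ρ_ u).inv ≫ u ◁ coev ≫ (α_ _ _ _).inv ≫ ev ▷ u ≫
        (λ_ u).hom)) ▷ Z ⊗≫ 𝟙 _ := by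
    simp only [cupFront, onFront, rotL]
    calc _ = 𝟙 _ ⊗≫ (𝟙_ C ◁ (x ◁ coev) ≫ coev ▷ _) ▷ Z ⊗≫ (d ◁ (f ▷ d)) ▷ u ▷ Z ⊗≫
          (d ◁ (y ◁ ev)) ▷ u ▷ Z ⊗≫ 𝟙 _ := by monoidal
      _ = 𝟙 _ ⊗≫ coev ▷ x ▷ Z ⊗≫ (d ◁ ((u ⊗ x) ◁ coev ≫ f ▷ (d ⊗ u))) ▷ Z ⊗≫
          (d ◁ (y ◁ ev)) ▷ u ▷ Z ⊗≫ 𝟙 _ := by rw [whisker_exchange]; monoidal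
      _ = _ := by rw [whisker_exchange]; monoidal
  rw [h, zz]
  simp only [cupFront, onFront]
  monoidal

/-- A strand slides through a cap: a crossing `f` of `x` and `u` below the cap can be replaced by
its rotation on the other side. -/
theorem capFront_slide (coev : 𝟙_ C ⟶ u ⊗ d) (ev : d ⊗ u ⟶ 𝟙_ C)
    (zz : (λ_ u).inv ≫ coev ▷ u ≫ (α_ _ _ _).hom ≫ u ◁ ev ≫ (ρ_ u).hom = 𝟙 _)
    {x y : C} (f : x ⊗ u ⟶ u ⊗ y) (Z : C) :
    d ◁ onFront f Z ≫ capFront ev (y ⊗ Z) =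
      onFront (rotR coev ev f) (u ⊗ Z) ≫ y ◁ capFront ev Z := by
  have h : onFront (rotR coev ev f) (u ⊗ Z) ≫ y ◁ capFront ev Z =
      𝟙 _ ⊗≫ (d ◁ (x ◁ ((λ_ u).inv ≫ coev ▷ u ≫ (α_ _ _ _).hom ≫ u ◁ ev ≫ (ρ_ u).hom)) ⊗≫ d ◁ f ⊗≫
        ev ▷ y) ▷ Z ⊗≫ 𝟙 _ := by
    simp only [capFront, onFront, rotR]
    calc _ = 𝟙 _ ⊗≫ (d ◁ (x ◁ coev)) ▷ u ▷ Z ⊗≫ (d ◁ (f ▷ d)) ▷ u ▷ Z ⊗≫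
          (ev ▷ (y ⊗ (d ⊗ u)) ≫ 𝟙_ C ◁ (y ◁ ev)) ▷ Z ⊗≫ 𝟙 _ := by monoidal
      _ = 𝟙 _ ⊗≫ (d ◁ (x ◁ coev)) ▷ u ▷ Z ⊗≫ (d ◁ (f ▷ (d ⊗ u) ≫ (u ⊗ y) ◁ ev)) ▷ Z ⊗≫
          ev ▷ y ▷ Z ⊗≫ 𝟙 _ := by rw [← whisker_exchange]; monoidal
      _ = _ := by rw [← whisker_exchange]; monoidal
  rw [h, zz]
  simp only [capFront, onFront]
  monoidal

variable [Preadditive C]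

/-- Two objects of a monoidal category with morphisms satisfying the local relations. -/
structure LocalRelations (u d : C) where
  s : u ⊗ u ⟶ u ⊗ u
  cap : u ⊗ d ⟶ 𝟙_ C
  cup : 𝟙_ C ⟶ u ⊗ d
  cap' : d ⊗ u ⟶ 𝟙_ C
  cup' : 𝟙_ C ⟶ d ⊗ u
  r : u ⊗ d ⟶ d ⊗ u
  r' : d ⊗ u ⟶ u ⊗ d
  t : d ⊗ d ⟶ d ⊗ d
  r_eq : r = rotL cup' cap s
  r'_eq : r' = rotR cup cap' s
  t_eq_rotR : t = rotR cup cap' r'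
  t_eq_rotL : t = rotL cup' cap r
  s_s : s ≫ s = 𝟙 _
  t_t : t ≫ t = 𝟙 _
  braid_s : DiagCat.Braid s
  braid_t : DiagCat.Braid t
  r_r' : r ≫ r' = 𝟙 _
  r'_r : r' ≫ r = 𝟙 _ - cap' ≫ cup'
  bubble : cup' ≫ cap' = 𝟙 _
  zigzag_up : (λ_ u).inv ≫ cup ▷ u ≫ (α_ _ _ _).hom ≫ u ◁ cap' ≫ (ρ_ u).hom = 𝟙 _
  zigzag_up' : (ρ_ u).inv ≫ u ◁ cup' ≫ (α_ _ _ _).inv ≫ cap ▷ u ≫ (λ_ u).hom = 𝟙 _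
  zigzag_down : (ρ_ d).inv ≫ d ◁ cup ≫ (α_ _ _ _).inv ≫ cap' ▷ d ≫ (λ_ d).hom = 𝟙 _
  zigzag_down' : (λ_ d).inv ≫ cup' ▷ d ≫ (α_ _ _ _).hom ≫ d ◁ cap ≫ (ρ_ d).hom = 𝟙 _

variable [MonoidalPreadditive C]

/-- The action by tensoring on the left. -/
def LocalRelations.action (R : LocalRelations u d) : Action (tensorLeft u) (tensorLeft d) where
  s := onFront R.s
  t := onFront R.t
  r := onFront R.r
  r' := onFront R.r'
  cap := capFront R.cap
  cup := cupFront R.cup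
  cap' := capFront R.cap'
  cup' := cupFront R.cup'
  s_nat := onFront_naturality _
  t_nat := onFront_naturality _
  r_nat := onFront_naturality _
  r'_nat := onFront_naturality _
  cap_nat := capFront_naturality _
  cup_nat := cupFront_naturality _
  cap'_nat := capFront_naturality _
  cup'_nat := cupFront_naturality _
  s_s Z := by rw [onFront_comp, R.s_s]; exact onFront_id Z
  t_t Z := by rw [onFront_comp, R.t_t]; exact onFront_id Z
  braid_s := onFront_braid R.braid_s
  braid_t := onFront_braid R.braid_t
  r_r' Z := by rw [onFront_comp, R.r_r']; exact onFront_id Z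
  r'_r Z := by
    rw [onFront_comp, R.r'_r, capFront_cupFront]
    have h : (𝟙 (d ⊗ u) - R.cap' ≫ R.cup') ▷ Z = 𝟙 (d ⊗ u) ▷ Z - (R.cap' ≫ R.cup') ▷ Z :=
      (tensorRight Z).map_sub
    simp only [onFront, h, Preadditive.sub_comp, Preadditive.comp_sub]
    simp
  bubble := cupFront_capFront R.bubble
  cup'_s Z := by rw [R.r_eq]; exact cupFront_slide _ _ R.zigzag_up' R.s Z
  cup'_r Z := by rw [R.t_eq_rotL]; exact cupFront_slide _ _ R.zigzag_up' R.r Z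
  s_cap' Z := by rw [R.r'_eq]; exact capFront_slide _ _ R.zigzag_up R.s Z
  r'_cap' Z := by rw [R.t_eq_rotR]; exact capFront_slide _ _ R.zigzag_up R.r' Z
  cup'_cap_up := cupFront_zigzag R.zigzag_up'
  cup'_cap_down := cupFront_zigzag' R.zigzag_down'
  cup_cap'_up := cupFront_zigzag' R.zigzag_up
  cup_cap'_down := cupFront_zigzag R.zigzag_down

end Front

section Khovanov

variable (k : Type u) [Field k]

/-- The local relations in Khovanov's category. -/
def khovanov : LocalRelations (DiagCat.Qp k) (DiagCat.Qm k) where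
  s := DiagCat.crossUp k
  cap := DiagCat.cap k
  cup := DiagCat.cup k
  cap' := DiagCat.cap' k
  cup' := DiagCat.cup' k
  r := DiagCat.mk Diagram.crossingUpDown
  r' := DiagCat.mk Diagram.crossingDownUp
  t := DiagCat.crossDown k
  r_eq := rfl
  r'_eq := rfl
  t_eq_rotR := rfl
  t_eq_rotL := Quotient.sound Diagram.Rel.cyclicity
  s_s := DiagCat.crossUp_sq k
  t_t := DiagCat.crossDown_sq k
  braid_s := DiagCat.crossUp_braid k
  braid_t := DiagCat.crossDown_braid k
  r_r' := Quotient.sound Diagram.Rel.double_upDown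
  r'_r := by
    rw [sub_eq_add_neg]
    exact Quotient.sound Diagram.Rel.double_downUp
  bubble := Quotient.sound Diagram.Rel.bubble
  zigzag_up := DiagCat.zigzag_cup_cap'_up k
  zigzag_up' := DiagCat.zigzag_cup'_cap k
  zigzag_down := DiagCat.zigzag_cup_cap' k
  zigzag_down' := Quotient.sound Diagram.Rel.zigzag_down'

end Khovanov

section KaroubiRelations

open Idempotents

variable {C : Type*} [Category C] [Preadditive C] [MonoidalCategory C] {u d : C}

/-- Images of the local relations in the Karoubi envelope. -/
def LocalRelations.karoubi (R : LocalRelations u d) :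
    LocalRelations ((toKaroubi C).obj u) ((toKaroubi C).obj d) where
  s := ⟨R.s, by simp⟩
  cap := ⟨R.cap, by simp⟩
  cup := ⟨R.cup, by simp⟩
  cap' := ⟨R.cap', by simp⟩
  cup' := ⟨R.cup', by simp⟩
  r := ⟨R.r, by simp⟩
  r' := ⟨R.r', by simp⟩
  t := ⟨R.t, by simp⟩
  r_eq := Karoubi.hom_ext _ _ (by simpa [rotL] using R.r_eq)
  r'_eq := Karoubi.hom_ext _ _ (by simpa [rotR] using R.r'_eq)
  t_eq_rotR := Karoubi.hom_ext _ _ (by simpa [rotR] using R.t_eq_rotR)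
  t_eq_rotL := Karoubi.hom_ext _ _ (by simpa [rotL] using R.t_eq_rotL)
  s_s := Karoubi.hom_ext _ _ (by simp [R.s_s])
  t_t := Karoubi.hom_ext _ _ (by simp [R.t_t])
  braid_s := Karoubi.hom_ext _ _ (by simpa [DiagCat.Braid] using R.braid_s)
  braid_t := Karoubi.hom_ext _ _ (by simpa [DiagCat.Braid] using R.braid_t)
  r_r' := Karoubi.hom_ext _ _ (by simp [R.r_r'])
  r'_r := Karoubi.hom_ext _ _ (R.r'_r.trans (by
    rw [sub_eq_add_neg, sub_eq_add_neg]
    simp))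
  bubble := Karoubi.hom_ext _ _ (by simp [R.bubble])
  zigzag_up := Karoubi.hom_ext _ _ (by simpa using R.zigzag_up)
  zigzag_up' := Karoubi.hom_ext _ _ (by simpa using R.zigzag_up')
  zigzag_down := Karoubi.hom_ext _ _ (by simpa using R.zigzag_down)
  zigzag_down' := Karoubi.hom_ext _ _ (by simpa using R.zigzag_down')

end KaroubiRelations

end Heis
namespace Heis

/-! ### Symmetric and exterior powers of the strands -/

section Towers

variable {C : Type*} [Category C] [Preadditive C] [MonoidalCategory C] [MonoidalPreadditive C]
  {u d : C} {T : Action (tensorLeft u) (tensorLeft d)}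

theorem zsmul_whiskerRight {X Y : C} (n : ℤ) (f : X ⟶ Y) (Z : C) : (n • f) ▷ Z = n • (f ▷ Z) :=
  (tensorRight Z).map_zsmul

theorem neg_whiskerRight {X Y : C} (f : X ⟶ Y) (Z : C) : (-f) ▷ Z = -(f ▷ Z) :=
  (tensorRight Z).map_neg

theorem isZero_tensor {X : C} (h : IsZero X) (Z : C) : IsZero (X ⊗ Z) :=
  (tensorRight Z).map_isZero h

/-- Symmetric powers of `u` as objects give symmetric powers of the functor `u ⊗ -`. -/
def UpTower.ofObjects {s : u ⊗ u ⟶ u ⊗ u} (hT : ∀ Z, T.s Z = onFront s Z) (X : ℤ → C)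
    (a : ∀ m n : ℤ, m + 1 = n → (X n ⟶ X m ⊗ u)) (c : ∀ m n : ℤ, m + 1 = n → (X m ⊗ u ⟶ X n))
    (hX : ∀ n < 0, IsZero (X n)) (e : X 0 ≅ 𝟙_ C)
    (a_c : ∀ m n h, 0 ≤ m → a m n h ≫ c m n h = 𝟙 _)
    (c_a : ∀ l m n (hl : l + 1 = m) (hm : m + 1 = n), 0 ≤ m → n • (c m n hm ≫ a m n hm) =
      𝟙 _ + m • (a l m hl ▷ u ≫ onLastTwo (X l) s ≫ c l m hl ▷ u))
    (a_a_s : ∀ l m n (hl : l + 1 = m) (hm : m + 1 = n),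
      a m n hm ≫ a l m hl ▷ u ≫ onLastTwo (X l) s = a m n hm ≫ a l m hl ▷ u)
    (s_c_c : ∀ l m n (hl : l + 1 = m) (hm : m + 1 = n),
      onLastTwo (X l) s ≫ c l m hl ▷ u ≫ c m n hm = c l m hl ▷ u ≫ c m n hm) :
    UpTower T (fun n => tensorLeft (X n)) where
  a m n h Z := a m n h ▷ Z ≫ (α_ _ _ _).hom
  c m n h Z := (α_ _ _ _).inv ≫ c m n h ▷ Z
  a_nat m n h Y Z f := by
    dsimp
    rw [whisker_exchange_assoc, Category.assoc, ← associator_naturality_right]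
  isZero n hn Z := isZero_tensor (hX n hn) Z
  unit := (tensoringLeft C).mapIso e ≪≫ leftUnitorNatIso C
  a_c m n h hm Z := by
    dsimp
    rw [Category.assoc, Iso.hom_inv_id_assoc, ← comp_whiskerRight, a_c m n h hm, id_whiskerRight]
  c_a l m n hl hm h0 Z := by
    have h := congrArg (fun f => (α_ _ _ _).inv ≫ f ▷ Z ≫ (α_ _ _ _).hom) (c_a l m n hl hm h0)
    simp only [zsmul_whiskerRight, MonoidalPreadditive.add_whiskerRight, Preadditive.comp_add,
      Preadditive.add_comp, Preadditive.comp_zsmul, Preadditive.zsmul_comp] at h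
    dsimp
    rw [hT]
    convert h using 2
    · simp
    · simp
    · refine congrArg (m • ·) ?_
      simp only [onFront, onLastTwo]
      monoidal
  a_a_s l m n hl hm Z := by
    dsimp
    rw [hT]
    calc _ = (a m n hm ≫ a l m hl ▷ u ≫ onLastTwo (X l) s) ▷ Z ⊗≫ 𝟙 _ := by
          simp only [onFront, onLastTwo]; monoidal
      _ = _ := by rw [a_a_s]; monoidal
  s_c_c l m n hl hm Z := by
    dsimp
    rw [hT]
    calc _ = 𝟙 _ ⊗≫ (onLastTwo (X l) s ≫ c l m hl ▷ u ≫ c m n hm) ▷ Z := by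
          simp only [onFront, onLastTwo]; monoidal
      _ = _ := by rw [s_c_c]; monoidal

/-- Exterior powers of `d` as objects give exterior powers of the functor `d ⊗ -`. The sign is
absorbed in the crossing `t`. -/
def DownTower.ofObjects {t : d ⊗ d ⟶ d ⊗ d} (hT : ∀ Z, T.t Z = -onFront t Z) (X : ℤ → C)
    (a : ∀ m n : ℤ, m + 1 = n → (X n ⟶ d ⊗ X m)) (c : ∀ m n : ℤ, m + 1 = n → (d ⊗ X m ⟶ X n))
    (hX : ∀ n < 0, IsZero (X n)) (e : X 0 ≅ 𝟙_ C)
    (a_c : ∀ m n h, 0 ≤ m → a m n h ≫ c m n h = 𝟙 _)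
    (c_a : ∀ l m n (hl : l + 1 = m) (hm : m + 1 = n), 0 ≤ m → n • (c m n hm ≫ a m n hm) =
      𝟙 _ + m • (d ◁ a l m hl ≫ onFirstTwo (X l) t ≫ d ◁ c l m hl))
    (a_a_t : ∀ l m n (hl : l + 1 = m) (hm : m + 1 = n),
      a m n hm ≫ d ◁ a l m hl ≫ onFirstTwo (X l) t = a m n hm ≫ d ◁ a l m hl)
    (t_c_c : ∀ l m n (hl : l + 1 = m) (hm : m + 1 = n),
      onFirstTwo (X l) t ≫ d ◁ c l m hl ≫ c m n hm = d ◁ c l m hl ≫ c m n hm) :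
    DownTower T (fun n => tensorLeft (X n)) where
  α m n h Z := a m n h ▷ Z ≫ (α_ _ _ _).hom
  γ m n h Z := (α_ _ _ _).inv ≫ c m n h ▷ Z
  α_nat m n h Y Z f := by
    dsimp
    rw [whisker_exchange_assoc, Category.assoc, ← associator_naturality_right]
  isZero n hn Z := isZero_tensor (hX n hn) Z
  unit := (tensoringLeft C).mapIso e ≪≫ leftUnitorNatIso C
  α_γ m n h hm Z := by
    dsimp
    rw [Category.assoc, Iso.hom_inv_id_assoc, ← comp_whiskerRight, a_c m n h hm, id_whiskerRight]
  γ_α l m n hl hm h0 Z := by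
    have h := congrArg (fun f => (α_ _ _ _).inv ≫ f ▷ Z ≫ (α_ _ _ _).hom) (c_a l m n hl hm h0)
    simp only [zsmul_whiskerRight, MonoidalPreadditive.add_whiskerRight, Preadditive.comp_add,
      Preadditive.add_comp, Preadditive.comp_zsmul, Preadditive.zsmul_comp] at h
    dsimp
    rw [hT, Preadditive.neg_comp, Preadditive.comp_neg, smul_neg, sub_neg_eq_add]
    convert h using 2
    · simp
    · simp
    · refine congrArg (m • ·) ?_
      simp only [onFront, onFirstTwo]
      monoidal
  α_α_t l m n hl hm Z := by
    dsimp
    rw [hT, Preadditive.comp_neg, Preadditive.comp_neg]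
    congr 1
    calc _ = (a m n hm ≫ d ◁ a l m hl ≫ onFirstTwo (X l) t) ▷ Z ⊗≫ 𝟙 _ := by
          simp only [onFront, onFirstTwo]; monoidal
      _ = _ := by rw [a_a_t]; monoidal
  t_γ_γ l m n hl hm Z := by
    dsimp
    rw [hT, Preadditive.neg_comp]
    congr 1
    calc _ = 𝟙 _ ⊗≫ (onFirstTwo (X l) t ≫ d ◁ c l m hl ≫ c m n hm) ▷ Z := by
          simp only [onFront, onFirstTwo]; monoidal
      _ = _ := by rw [t_c_c]; monoidal

end Towers

section Opposite

variable {C : Type*} [Category C] [Preadditive C] {u d : C ⥤ C} {T : Action u d}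

/-- The opposite of the symmetric powers, with inclusions and projections exchanged. -/
def UpTower.op {P : ℤ → C ⥤ C} (tP : UpTower T P)
    (c_nat : ∀ (m n : ℤ) (h : m + 1 = n) {Y Z : C} (f : Y ⟶ Z),
      (P m).map (u.map f) ≫ tP.c m n h Z = tP.c m n h Y ≫ (P n).map f) :
    UpTower T.op (fun n => (P n).op) where
  a m n h Z := (tP.c m n h Z.unop).op
  c m n h Z := (tP.a m n h Z.unop).op
  a_nat m n h _ _ f := Quiver.Hom.unop_inj (c_nat m n h f.unop).symm
  isZero n hn Z := (tP.isZero n hn Z.unop).op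
  unit := (NatIso.op tP.unit).symm
  a_c m n h hm Z := Quiver.Hom.unop_inj (tP.a_c m n h hm Z.unop)
  c_a l m n hl hm h0 Z := Quiver.Hom.unop_inj
    ((tP.c_a l m n hl hm h0 Z.unop).trans (by simp [Action.op]))
  a_a_s l m n hl hm Z := Quiver.Hom.unop_inj
    (by simpa [Action.op] using tP.s_c_c l m n hl hm Z.unop)
  s_c_c l m n hl hm Z := Quiver.Hom.unop_inj
    (by simpa [Action.op] using tP.a_a_s l m n hl hm Z.unop)

/-- The opposite of the exterior powers, with inclusions and projections exchanged. -/
def DownTower.op {Q : ℤ → C ⥤ C} (tQ : DownTower T Q)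
    (γ_nat : ∀ (m n : ℤ) (h : m + 1 = n) {Y Z : C} (f : Y ⟶ Z),
      d.map ((Q m).map f) ≫ tQ.γ m n h Z = tQ.γ m n h Y ≫ (Q n).map f) :
    DownTower T.op (fun n => (Q n).op) where
  α m n h Z := (tQ.γ m n h Z.unop).op
  γ m n h Z := (tQ.α m n h Z.unop).op
  α_nat m n h _ _ f := Quiver.Hom.unop_inj (γ_nat m n h f.unop).symm
  isZero n hn Z := (tQ.isZero n hn Z.unop).op
  unit := (NatIso.op tQ.unit).symm
  α_γ m n h hm Z := Quiver.Hom.unop_inj (tQ.α_γ m n h hm Z.unop)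
  γ_α l m n hl hm h0 Z := Quiver.Hom.unop_inj
    ((tQ.γ_α l m n hl hm h0 Z.unop).trans (by simp [Action.op]))
  α_α_t l m n hl hm Z := Quiver.Hom.unop_inj
    (by simpa [Action.op] using tQ.t_γ_γ l m n hl hm Z.unop)
  t_γ_γ l m n hl hm Z := Quiver.Hom.unop_inj
    (by simpa [Action.op] using tQ.α_α_t l m n hl hm Z.unop)

end Opposite

end Heis
namespace Heis

/-! ### Images of symmetrizers and antisymmetrizers -/

theorem isZero_tensor' {C : Type*} [Category C] [Preadditive C] [MonoidalCategory C]
    [MonoidalPreadditive C] {X : C} (h : IsZero X) (Z : C) : IsZero (Z ⊗ X) :=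
  (tensorLeft Z).map_isZero h

section Powers

open Idempotents

variable {k : Type u} [Field k]

/-- The images of the idempotents `e n` of `X n`, indexed by all integers: zero for `n < 0`. -/
def powObj {X : ℕ → DiagCat k} {e : ∀ n, X n ⟶ X n} (he : ∀ n, e n ≫ e n = e n) :
    ℤ → Karoubi (DiagCat k)
  | Int.ofNat n => ⟨X n, e n, he n⟩
  | Int.negSucc _ => ⟨X 0, 0, zero_comp⟩

theorem isZero_powObj {X : ℕ → DiagCat k} {e : ∀ n, X n ⟶ X n} (he : ∀ n, e n ≫ e n = e n) :
    ∀ n < 0, IsZero (powObj he n)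
  | Int.ofNat n, h => absurd h (by simp)
  | Int.negSucc n, _ => (IsZero.iff_id_eq_zero _).2 rfl

theorem karoubi_zsmul_f {C : Type*} [Category C] [Preadditive C] {P Q : Karoubi C} (n : ℤ)
    (f : P ⟶ Q) : (n • f).f = n • f.f :=
  map_zsmul (Karoubi.inclusionHom P Q) n f

/-- `e n` is the symmetrizer of `Q_+^{⊗ n}` with respect to the crossing `s`. -/
structure UpIdempotents (s : DiagCat.Qp k ⊗ DiagCat.Qp k ⟶ DiagCat.Qp k ⊗ DiagCat.Qp k)
    (e : ∀ n, upPow k n ⟶ upPow k n) : Prop where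
  idem n : e n ≫ e n = e n
  zero : e 0 = 𝟙 _
  one : e 1 = 𝟙 _
  whisker_comp n : e n ▷ DiagCat.Qp k ≫ e (n + 1) = e (n + 1)
  comp_whisker n : e (n + 1) ≫ e n ▷ DiagCat.Qp k = e (n + 1)
  cross_comp n : onLastTwo (upPow k n) s ≫ e (n + 2) = e (n + 2)
  comp_cross n : e (n + 2) ≫ onLastTwo (upPow k n) s = e (n + 2)
  recursion (n : ℕ) : (n + 2 : ℤ) • e (n + 2) = e (n + 1) ▷ DiagCat.Qp k +
    (n + 1 : ℤ) • (e (n + 1) ▷ DiagCat.Qp k ≫ onLastTwo (upPow k n) s ≫ e (n + 1) ▷ DiagCat.Qp k)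

/-- `e n` is the symmetrizer of `Q_-^{⊗ n}` with respect to the crossing `t`. -/
structure DownIdempotents (t : DiagCat.Qm k ⊗ DiagCat.Qm k ⟶ DiagCat.Qm k ⊗ DiagCat.Qm k)
    (e : ∀ n, downPow k n ⟶ downPow k n) : Prop where
  idem n : e n ≫ e n = e n
  zero : e 0 = 𝟙 _
  one : e 1 = 𝟙 _
  whisker_comp n : DiagCat.Qm k ◁ e n ≫ e (n + 1) = e (n + 1)
  comp_whisker n : e (n + 1) ≫ DiagCat.Qm k ◁ e n = e (n + 1)
  cross_comp n : onFirstTwo (downPow k n) t ≫ e (n + 2) = e (n + 2)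
  comp_cross n : e (n + 2) ≫ onFirstTwo (downPow k n) t = e (n + 2)
  recursion (n : ℕ) : (n + 2 : ℤ) • e (n + 2) = DiagCat.Qm k ◁ e (n + 1) +
    (n + 1 : ℤ) • (DiagCat.Qm k ◁ e (n + 1) ≫ onFirstTwo (downPow k n) t ≫ DiagCat.Qm k ◁ e (n + 1))

section

variable [CharZero k]

theorem UpIdempotents.of_tower {x : ∀ n, End (upPow k (n + 2))}
    (hx : CoxeterTower k (addRight k) x) {s : DiagCat.Qp k ⊗ DiagCat.Qp k ⟶ DiagCat.Qp k ⊗ DiagCat.Qp k}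
    (hs : ∀ n, x n = onLastTwo (upPow k n) s) {e : ∀ n, upPow k n ⟶ upPow k n}
    (h : ∀ n, e n = symmetrizer k (addRight k) x n) : UpIdempotents s e where
  idem n := by rw [h]; exact hx.symmetrizer_sq n
  zero := (h 0).trans symmetrizer_zero
  one := (h 1).trans symmetrizer_one
  whisker_comp n := by rw [h, h]; exact (hx.absorb n).2.2.1
  comp_whisker n := by rw [h, h]; exact (hx.absorb n).2.1
  cross_comp n := by rw [h, ← hs]; exact (hx.absorb n).2.2.2.2
  comp_cross n := by rw [h, ← hs]; exact (hx.absorb n).2.2.2.1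
  recursion n := by
    rw [← Int.cast_smul_eq_zsmul k, ← Int.cast_smul_eq_zsmul k, h, h, ← hs]
    push_cast
    exact hx.rec_symmetrizer n (hx.absorb n).2.2.1

theorem DownIdempotents.of_tower {x : ∀ n, End (downPow k (n + 2))}
    (hx : CoxeterTower k (addLeft k) x) {t : DiagCat.Qm k ⊗ DiagCat.Qm k ⟶ DiagCat.Qm k ⊗ DiagCat.Qm k}
    (hs : ∀ n, x n = onFirstTwo (downPow k n) t) {e : ∀ n, downPow k n ⟶ downPow k n}
    (h : ∀ n, e n = symmetrizer k (addLeft k) x n) : DownIdempotents t e where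
  idem n := by rw [h]; exact hx.symmetrizer_sq n
  zero := (h 0).trans symmetrizer_zero
  one := (h 1).trans symmetrizer_one
  whisker_comp n := by rw [h, h]; exact (hx.absorb n).2.2.1
  comp_whisker n := by rw [h, h]; exact (hx.absorb n).2.1
  cross_comp n := by rw [h, ← hs]; exact (hx.absorb n).2.2.2.2
  comp_cross n := by rw [h, ← hs]; exact (hx.absorb n).2.2.2.1
  recursion n := by
    rw [← Int.cast_smul_eq_zsmul k, ← Int.cast_smul_eq_zsmul k, h, h, ← hs]
    push_cast
    exact hx.rec_symmetrizer n (hx.absorb n).2.2.1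

end

theorem karoubi_onLastTwo_f {C : Type*} [Category C] [MonoidalCategory C] {u : C}
    (P : Karoubi C) (s : (toKaroubi C).obj u ⊗ (toKaroubi C).obj u ⟶
      (toKaroubi C).obj u ⊗ (toKaroubi C).obj u) {s₀ : u ⊗ u ⟶ u ⊗ u} (hs : s.f = s₀) :
    (onLastTwo P s).f = P.p ▷ u ▷ u ≫ onLastTwo P.X s₀ := by
  have h : (P.p ⊗ₘ s₀) ≫ (α_ P.X u u).inv ≫ ((P.p ⊗ₘ 𝟙 u) ⊗ₘ 𝟙 u) =
      (P.p ⊗ₘ s₀) ≫ (α_ P.X u u).inv := by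
    rw [← associator_inv_naturality, tensorHom_comp_tensorHom_assoc, P.idem, id_tensorHom_id,
      Category.comp_id]
  have h' : (α_ P.X u u).hom ≫ (P.p ⊗ₘ (𝟙 u ⊗ₘ 𝟙 u)) ≫ (P.p ⊗ₘ s₀) =
      P.p ▷ u ▷ u ≫ (α_ P.X u u).hom ≫ P.X ◁ s₀ := by
    rw [tensorHom_comp_tensorHom, P.idem, id_tensorHom_id, Category.id_comp, MonoidalCategory.tensorHom_def,
      associator_naturality_left_assoc]
  calc _ = (α_ P.X u u).hom ≫ (P.p ⊗ₘ (𝟙 u ⊗ₘ 𝟙 u)) ≫ (P.p ⊗ₘ s₀) ≫ (α_ P.X u u).inv ≫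
        ((P.p ⊗ₘ 𝟙 u) ⊗ₘ 𝟙 u) := by
        simp only [onLastTwo, Karoubi.comp_f, karoubi_associator_hom_f, karoubi_associator_inv_f,
          karoubi_whiskerLeft_f, hs, Category.assoc]
        rfl
    _ = _ := by rw [h, reassoc_of% h', onLastTwo]

theorem karoubi_onFirstTwo_f {C : Type*} [Category C] [MonoidalCategory C] {u : C}
    (P : Karoubi C) (s : (toKaroubi C).obj u ⊗ (toKaroubi C).obj u ⟶
      (toKaroubi C).obj u ⊗ (toKaroubi C).obj u) {s₀ : u ⊗ u ⟶ u ⊗ u} (hs : s.f = s₀) :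
    (onFirstTwo P s).f = u ◁ u ◁ P.p ≫ onFirstTwo P.X s₀ := by
  have h : (s₀ ⊗ₘ P.p) ≫ (α_ u u P.X).hom ≫ (𝟙 u ⊗ₘ (𝟙 u ⊗ₘ P.p)) =
      (s₀ ⊗ₘ P.p) ≫ (α_ u u P.X).hom := by
    rw [← associator_naturality, tensorHom_comp_tensorHom_assoc, P.idem, id_tensorHom_id,
      Category.comp_id]
  have h' : (α_ u u P.X).inv ≫ ((𝟙 u ⊗ₘ 𝟙 u) ⊗ₘ P.p) ≫ (s₀ ⊗ₘ P.p) =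
      u ◁ u ◁ P.p ≫ (α_ u u P.X).inv ≫ s₀ ▷ P.X := by
    rw [tensorHom_comp_tensorHom, P.idem, id_tensorHom_id, Category.id_comp, MonoidalCategory.tensorHom_def',
      associator_inv_naturality_right_assoc]
  calc _ = (α_ u u P.X).inv ≫ ((𝟙 u ⊗ₘ 𝟙 u) ⊗ₘ P.p) ≫ (s₀ ⊗ₘ P.p) ≫ (α_ u u P.X).hom ≫
        (𝟙 u ⊗ₘ (𝟙 u ⊗ₘ P.p)) := by
        simp only [onFirstTwo, Karoubi.comp_f, karoubi_associator_hom_f, karoubi_associator_inv_f,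
          karoubi_whiskerRight_f, hs, Category.assoc]
        rfl
    _ = _ := by rw [h, reassoc_of% h', onFirstTwo]

section

variable {s₀ : DiagCat.Qp k ⊗ DiagCat.Qp k ⟶ DiagCat.Qp k ⊗ DiagCat.Qp k}
  {s : (toKaroubi _).obj (DiagCat.Qp k) ⊗ (toKaroubi _).obj (DiagCat.Qp k) ⟶
    (toKaroubi _).obj (DiagCat.Qp k) ⊗ (toKaroubi _).obj (DiagCat.Qp k)}
  {e : ∀ n, upPow k n ⟶ upPow k n} (he : UpIdempotents s₀ e)

namespace UpIdempotents

/-- The inclusion `P^{(m + 1)} ⟶ P^{(m)} Q_+`. -/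
def incl : ∀ m n : ℤ, m + 1 = n →
    (powObj he.idem n ⟶ powObj he.idem m ⊗ (toKaroubi _).obj (DiagCat.Qp k))
  | Int.ofNat m, _, rfl => ⟨e (m + 1),
    (congrArg (e (m + 1) ≫ ·) ((congrArg (e (m + 1) ≫ ·) (tensorHom_id _ _)).trans
      (he.comp_whisker m))).trans (he.idem (m + 1))⟩
  | Int.negSucc _, _, _ => 0

/-- The projection `P^{(m)} Q_+ ⟶ P^{(m + 1)}`. -/
def proj : ∀ m n : ℤ, m + 1 = n →
    (powObj he.idem m ⊗ (toKaroubi _).obj (DiagCat.Qp k) ⟶ powObj he.idem n)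
  | Int.ofNat m, _, rfl => ⟨e (m + 1),
    (congrArg₂ (· ≫ ·) (tensorHom_id (e m) _) (he.idem (m + 1))).trans (he.whisker_comp m)⟩
  | Int.negSucc _, _, _ => 0

theorem incl_comp_proj (m n : ℤ) (h : m + 1 = n) (h0 : 0 ≤ m) :
    he.incl m n h ≫ he.proj m n h = 𝟙 _ := by
  subst h
  match m, h0 with
  | Int.ofNat j, _ => exact Karoubi.hom_ext _ _ (he.idem (j + 1))

theorem proj_comp_incl (hs : s.f = s₀) (l m n : ℤ) (hl : l + 1 = m) (hm : m + 1 = n) (h0 : 0 ≤ m) :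
    n • (he.proj m n hm ≫ he.incl m n hm) = 𝟙 _ +
      m • (he.incl l m hl ▷ _ ≫ onLastTwo (powObj he.idem l) s ≫ he.proj l m hl ▷ _) := by
  subst hl hm
  match l, h0 with
  | Int.ofNat j, _ =>
    apply Karoubi.hom_ext
    rw [karoubi_zsmul_f]
    have h1 : (he.proj (Int.ofNat j + 1) (Int.ofNat j + 1 + 1) rfl ≫
      he.incl (Int.ofNat j + 1) (Int.ofNat j + 1 + 1) rfl).f = e (j + 2) := he.idem (j + 2)
    rw [h1]
    refine (he.recursion j).trans ?_
    refine congrArg₂ (· + ·) (tensorHom_id _ _).symm ?_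
    rw [karoubi_zsmul_f]
    refine congrArg ((j + 1 : ℤ) • ·) ?_
    rw [Karoubi.comp_f, Karoubi.comp_f, karoubi_onLastTwo_f _ s hs, Category.assoc]
    change _ = (e (j + 1) ⊗ₘ 𝟙 _) ≫ e j ▷ DiagCat.Qp k ▷ DiagCat.Qp k ≫
      onLastTwo (upPow k j) s₀ ≫ (e (j + 1) ⊗ₘ 𝟙 (DiagCat.Qp k))
    rw [tensorHom_id]
    have h : e (j + 1) ▷ DiagCat.Qp k ≫ e j ▷ DiagCat.Qp k ▷ DiagCat.Qp k =
        e (j + 1) ▷ DiagCat.Qp k :=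
      (comp_whiskerRight _ _ _).symm.trans (congrArg (· ▷ DiagCat.Qp k) (he.comp_whisker j))
    exact ((Category.assoc _ _ _).symm.trans
      (congrArg (· ≫ onLastTwo (upPow k j) s₀ ≫ e (j + 1) ▷ DiagCat.Qp k) h)).symm
  | Int.negSucc 0, _ =>
    apply Karoubi.hom_ext
    rw [karoubi_zsmul_f]
    have h1 : (he.proj 0 1 rfl ≫ he.incl 0 1 rfl).f = e 1 := he.idem 1
    have h2 : e 1 = e 0 ▷ DiagCat.Qp k := by
      rw [he.one, he.zero]
      exact (id_whiskerRight _ _).symm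
    have h3 (f : powObj he.idem 0 ⊗ (toKaroubi _).obj (DiagCat.Qp k) ⟶
      powObj he.idem 0 ⊗ (toKaroubi _).obj (DiagCat.Qp k)) : 𝟙 _ + (0 : ℤ) • f = 𝟙 _ := by
      rw [zero_smul, add_zero]
    refine (one_smul ℤ _).trans (h1.trans (h2.trans ?_))
    exact (tensorHom_id _ _).symm.trans (congrArg Karoubi.Hom.f (h3 _)).symm

theorem incl_incl_cross (hs : s.f = s₀) (l m n : ℤ) (hl : l + 1 = m) (hm : m + 1 = n) :
    he.incl m n hm ≫ he.incl l m hl ▷ _ ≫ onLastTwo (powObj he.idem l) s =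
      he.incl m n hm ≫ he.incl l m hl ▷ _ := by
  subst hl hm
  match l with
  | Int.ofNat j =>
    apply Karoubi.hom_ext
    rw [Karoubi.comp_f, Karoubi.comp_f, Karoubi.comp_f, karoubi_onLastTwo_f _ s hs]
    change e (j + 2) ≫ (e (j + 1) ⊗ₘ 𝟙 _) ≫ e j ▷ DiagCat.Qp k ▷ DiagCat.Qp k ≫
      onLastTwo (upPow k j) s₀ = e (j + 2) ≫ (e (j + 1) ⊗ₘ 𝟙 (DiagCat.Qp k))
    rw [tensorHom_id]
    have h : e (j + 1) ▷ DiagCat.Qp k ≫ e j ▷ DiagCat.Qp k ▷ DiagCat.Qp k =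
        e (j + 1) ▷ DiagCat.Qp k :=
      (comp_whiskerRight _ _ _).symm.trans (congrArg (· ▷ DiagCat.Qp k) (he.comp_whisker j))
    refine (congrArg (e (j + 2) ≫ ·) ((Category.assoc _ _ _).symm.trans
      (congrArg (· ≫ onLastTwo (upPow k j) s₀) h))).trans ?_
    refine (Category.assoc _ _ _).symm.trans ?_
    exact (congrArg (· ≫ onLastTwo (upPow k j) s₀) (he.comp_whisker (j + 1))).trans
      ((he.comp_cross j).trans (he.comp_whisker (j + 1)).symm)
  | Int.negSucc j => exact (isZero_tensor (isZero_tensor (isZero_powObj he.idem _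
      (Int.negSucc_lt_zero j)) _) _).eq_of_tgt _ _

theorem cross_proj_proj (hs : s.f = s₀) (l m n : ℤ) (hl : l + 1 = m) (hm : m + 1 = n) :
    onLastTwo (powObj he.idem l) s ≫ he.proj l m hl ▷ _ ≫ he.proj m n hm =
      he.proj l m hl ▷ _ ≫ he.proj m n hm := by
  subst hl hm
  match l with
  | Int.ofNat j =>
    apply Karoubi.hom_ext
    rw [Karoubi.comp_f, Karoubi.comp_f, karoubi_onLastTwo_f _ s hs]
    change (e j ▷ DiagCat.Qp k ▷ DiagCat.Qp k ≫ onLastTwo (upPow k j) s₀) ≫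
      (e (j + 1) ⊗ₘ 𝟙 _) ≫ e (j + 2) = (e (j + 1) ⊗ₘ 𝟙 _) ≫ e (j + 2)
    rw [tensorHom_id]
    have h : e j ▷ DiagCat.Qp k ▷ DiagCat.Qp k ≫ e (j + 1) ▷ DiagCat.Qp k =
        e (j + 1) ▷ DiagCat.Qp k :=
      (comp_whiskerRight _ _ _).symm.trans (congrArg (· ▷ DiagCat.Qp k) (he.whisker_comp j))
    have h2 : e (j + 1) ▷ DiagCat.Qp k ≫ e (j + 2) = e (j + 2) := he.whisker_comp (j + 1)
    refine (congrArg (_ ≫ ·) h2).trans ((Category.assoc _ _ _).trans ?_)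
    refine (congrArg (_ ≫ ·) (he.cross_comp j)).trans ?_
    refine (congrArg (e j ▷ DiagCat.Qp k ▷ DiagCat.Qp k ≫ ·) h2.symm).trans ?_
    exact (Category.assoc _ _ _).symm.trans (congrArg (· ≫ e (j + 2)) h)
  | Int.negSucc j => exact (isZero_tensor (isZero_tensor (isZero_powObj he.idem _
      (Int.negSucc_lt_zero j)) _) _).eq_of_src _ _

/-- The objects `P^{(n)}` act as symmetric powers. -/
def tower {d : Karoubi (DiagCat k)} {T : Action (tensorLeft ((toKaroubi _).obj (DiagCat.Qp k)))
    (tensorLeft d)} (hs : s.f = s₀) (hT : ∀ Z, T.s Z = onFront s Z) :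
    UpTower T (fun n => tensorLeft (powObj he.idem n)) :=
  UpTower.ofObjects hT (powObj he.idem) he.incl he.proj (isZero_powObj he.idem)
    (eqToIso (Karoubi.ext rfl ((Category.comp_id (e 0)).trans
      (he.zero.trans (Category.comp_id _).symm))))
    he.incl_comp_proj (he.proj_comp_incl hs) (he.incl_incl_cross hs) (he.cross_proj_proj hs)

end UpIdempotents

end

section

variable {t₀ : DiagCat.Qm k ⊗ DiagCat.Qm k ⟶ DiagCat.Qm k ⊗ DiagCat.Qm k}
  {t : (toKaroubi _).obj (DiagCat.Qm k) ⊗ (toKaroubi _).obj (DiagCat.Qm k) ⟶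
    (toKaroubi _).obj (DiagCat.Qm k) ⊗ (toKaroubi _).obj (DiagCat.Qm k)}
  {e : ∀ n, downPow k n ⟶ downPow k n} (he : DownIdempotents t₀ e)

namespace DownIdempotents

/-- The inclusion `Q^{(m + 1)} ⟶ Q_- Q^{(m)}`. -/
def incl : ∀ m n : ℤ, m + 1 = n →
    (powObj he.idem n ⟶ (toKaroubi _).obj (DiagCat.Qm k) ⊗ powObj he.idem m)
  | Int.ofNat m, _, rfl => ⟨e (m + 1),
    (congrArg (e (m + 1) ≫ ·) ((congrArg (e (m + 1) ≫ ·) (id_tensorHom _ _)).trans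
      (he.comp_whisker m))).trans (he.idem (m + 1))⟩
  | Int.negSucc _, _, _ => 0

/-- The projection `Q_- Q^{(m)} ⟶ Q^{(m + 1)}`. -/
def proj : ∀ m n : ℤ, m + 1 = n →
    ((toKaroubi _).obj (DiagCat.Qm k) ⊗ powObj he.idem m ⟶ powObj he.idem n)
  | Int.ofNat m, _, rfl => ⟨e (m + 1),
    (congrArg₂ (· ≫ ·) (id_tensorHom _ (e m)) (he.idem (m + 1))).trans (he.whisker_comp m)⟩
  | Int.negSucc _, _, _ => 0

theorem incl_comp_proj (m n : ℤ) (h : m + 1 = n) (h0 : 0 ≤ m) :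
    he.incl m n h ≫ he.proj m n h = 𝟙 _ := by
  subst h
  match m, h0 with
  | Int.ofNat j, _ => exact Karoubi.hom_ext _ _ (he.idem (j + 1))

theorem proj_comp_incl (hs : t.f = t₀) (l m n : ℤ) (hl : l + 1 = m) (hm : m + 1 = n) (h0 : 0 ≤ m) :
    n • (he.proj m n hm ≫ he.incl m n hm) = 𝟙 _ +
      m • (_ ◁ he.incl l m hl ≫ onFirstTwo (powObj he.idem l) t ≫ _ ◁ he.proj l m hl) := by
  subst hl hm
  match l, h0 with
  | Int.ofNat j, _ =>
    apply Karoubi.hom_ext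
    rw [karoubi_zsmul_f]
    have h1 : (he.proj (Int.ofNat j + 1) (Int.ofNat j + 1 + 1) rfl ≫
      he.incl (Int.ofNat j + 1) (Int.ofNat j + 1 + 1) rfl).f = e (j + 2) := he.idem (j + 2)
    rw [h1]
    refine (he.recursion j).trans ?_
    refine congrArg₂ (· + ·) (id_tensorHom _ _).symm ?_
    rw [karoubi_zsmul_f]
    refine congrArg ((j + 1 : ℤ) • ·) ?_
    rw [Karoubi.comp_f, Karoubi.comp_f, karoubi_onFirstTwo_f _ t hs, Category.assoc]
    change _ = (𝟙 _ ⊗ₘ e (j + 1)) ≫ DiagCat.Qm k ◁ DiagCat.Qm k ◁ e j ≫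
      onFirstTwo (downPow k j) t₀ ≫ (𝟙 (DiagCat.Qm k) ⊗ₘ e (j + 1))
    rw [id_tensorHom]
    have h : DiagCat.Qm k ◁ e (j + 1) ≫ DiagCat.Qm k ◁ DiagCat.Qm k ◁ e j =
        DiagCat.Qm k ◁ e (j + 1) :=
      (whiskerLeft_comp _ _ _).symm.trans (congrArg (DiagCat.Qm k ◁ ·) (he.comp_whisker j))
    exact ((Category.assoc _ _ _).symm.trans
      (congrArg (· ≫ onFirstTwo (downPow k j) t₀ ≫ DiagCat.Qm k ◁ e (j + 1)) h)).symm
  | Int.negSucc 0, _ =>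
    apply Karoubi.hom_ext
    rw [karoubi_zsmul_f]
    have h1 : (he.proj 0 1 rfl ≫ he.incl 0 1 rfl).f = e 1 := he.idem 1
    have h2 : e 1 = DiagCat.Qm k ◁ e 0 := by
      rw [he.one, he.zero]
      exact (whiskerLeft_id _ _).symm
    have h3 (f : (toKaroubi _).obj (DiagCat.Qm k) ⊗ powObj he.idem 0 ⟶
      (toKaroubi _).obj (DiagCat.Qm k) ⊗ powObj he.idem 0) : 𝟙 _ + (0 : ℤ) • f = 𝟙 _ := by
      rw [zero_smul, add_zero]
    refine (one_smul ℤ _).trans (h1.trans (h2.trans ?_))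
    exact (id_tensorHom _ _).symm.trans (congrArg Karoubi.Hom.f (h3 _)).symm

theorem incl_incl_cross (hs : t.f = t₀) (l m n : ℤ) (hl : l + 1 = m) (hm : m + 1 = n) :
    he.incl m n hm ≫ _ ◁ he.incl l m hl ≫ onFirstTwo (powObj he.idem l) t =
      he.incl m n hm ≫ _ ◁ he.incl l m hl := by
  subst hl hm
  match l with
  | Int.ofNat j =>
    apply Karoubi.hom_ext
    rw [Karoubi.comp_f, Karoubi.comp_f, Karoubi.comp_f, karoubi_onFirstTwo_f _ t hs]
    change e (j + 2) ≫ (𝟙 _ ⊗ₘ e (j + 1)) ≫ DiagCat.Qm k ◁ DiagCat.Qm k ◁ e j ≫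
      onFirstTwo (downPow k j) t₀ = e (j + 2) ≫ (𝟙 (DiagCat.Qm k) ⊗ₘ e (j + 1))
    rw [id_tensorHom]
    have h : DiagCat.Qm k ◁ e (j + 1) ≫ DiagCat.Qm k ◁ DiagCat.Qm k ◁ e j =
        DiagCat.Qm k ◁ e (j + 1) :=
      (whiskerLeft_comp _ _ _).symm.trans (congrArg (DiagCat.Qm k ◁ ·) (he.comp_whisker j))
    refine (congrArg (e (j + 2) ≫ ·) ((Category.assoc _ _ _).symm.trans
      (congrArg (· ≫ onFirstTwo (downPow k j) t₀) h))).trans ?_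
    refine (Category.assoc _ _ _).symm.trans ?_
    exact (congrArg (· ≫ onFirstTwo (downPow k j) t₀) (he.comp_whisker (j + 1))).trans
      ((he.comp_cross j).trans (he.comp_whisker (j + 1)).symm)
  | Int.negSucc j => exact (isZero_tensor' (isZero_tensor' (isZero_powObj he.idem _
      (Int.negSucc_lt_zero j)) _) _).eq_of_tgt _ _

theorem cross_proj_proj (hs : t.f = t₀) (l m n : ℤ) (hl : l + 1 = m) (hm : m + 1 = n) :
    onFirstTwo (powObj he.idem l) t ≫ _ ◁ he.proj l m hl ≫ he.proj m n hm =
      _ ◁ he.proj l m hl ≫ he.proj m n hm := by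
  subst hl hm
  match l with
  | Int.ofNat j =>
    apply Karoubi.hom_ext
    rw [Karoubi.comp_f, Karoubi.comp_f, karoubi_onFirstTwo_f _ t hs]
    change (DiagCat.Qm k ◁ DiagCat.Qm k ◁ e j ≫ onFirstTwo (downPow k j) t₀) ≫
      (𝟙 _ ⊗ₘ e (j + 1)) ≫ e (j + 2) = (𝟙 _ ⊗ₘ e (j + 1)) ≫ e (j + 2)
    rw [id_tensorHom]
    have h : DiagCat.Qm k ◁ DiagCat.Qm k ◁ e j ≫ DiagCat.Qm k ◁ e (j + 1) =
        DiagCat.Qm k ◁ e (j + 1) :=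
      (whiskerLeft_comp _ _ _).symm.trans (congrArg (DiagCat.Qm k ◁ ·) (he.whisker_comp j))
    have h2 : DiagCat.Qm k ◁ e (j + 1) ≫ e (j + 2) = e (j + 2) := he.whisker_comp (j + 1)
    refine (congrArg (_ ≫ ·) h2).trans ((Category.assoc _ _ _).trans ?_)
    refine (congrArg (_ ≫ ·) (he.cross_comp j)).trans ?_
    refine (congrArg (DiagCat.Qm k ◁ DiagCat.Qm k ◁ e j ≫ ·) h2.symm).trans ?_
    exact (Category.assoc _ _ _).symm.trans (congrArg (· ≫ e (j + 2)) h)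
  | Int.negSucc j => exact (isZero_tensor' (isZero_tensor' (isZero_powObj he.idem _
      (Int.negSucc_lt_zero j)) _) _).eq_of_src _ _

/-- The objects `Q^{(n)}` act as exterior powers. -/
def tower {u : Karoubi (DiagCat k)} {T : Action (tensorLeft u)
    (tensorLeft ((toKaroubi _).obj (DiagCat.Qm k)))} (hs : t.f = t₀) (hT : ∀ Z, T.t Z = -onFront t Z) :
    DownTower T (fun n => tensorLeft (powObj he.idem n)) :=
  DownTower.ofObjects hT (powObj he.idem) he.incl he.proj (isZero_powObj he.idem)
    (eqToIso (Karoubi.ext rfl ((Category.comp_id (e 0)).trans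
      (he.zero.trans (Category.comp_id _).symm))))
    he.incl_comp_proj (he.proj_comp_incl hs) (he.incl_incl_cross hs) (he.cross_proj_proj hs)

end DownIdempotents

end

end Powers

end Heis
namespace Heis

/-! ### Tensor products of complexes as total complexes of words -/

section Diagonals

variable {H : Type*} [Category H] [Preadditive H]

/-- The complexes `K c` are the diagonals `x - y = c` of the family `A`, where `A x y` is placed in
degree `-(y + m c)`. -/
structure Diagonals (A : ℤ → ℤ → H)
    (dA : ∀ x X (_ : x + 1 = X) y Y (_ : y + 1 = Y), A X Y ⟶ A x y) (m : ℤ → ℤ)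
    (K : ℤ → CochainComplex H ℤ) where
  iso (c x y n : ℤ) (h : x - y = c ∧ n + y + m c = 0) : A x y ≅ (K c).X n
  iso_d (c x X y Y n o : ℤ) (hx : x + 1 = X) (hy : y + 1 = Y) (hn : n + 1 = o) (h) :
    (iso c X Y n h).hom ≫ (K c).d n o = dA x X hx y Y hy ≫ (iso c x y o (by lia)).hom

variable {A : ℤ → ℤ → H} {dA : ∀ x X (_ : x + 1 = X) y Y (_ : y + 1 = Y), A X Y ⟶ A x y}
  {m : ℤ → ℤ} {K : ℤ → CochainComplex H ℤ} (S : Diagonals A dA m K)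
  (F : H ⥤ H ⥤ H) [F.Additive] [∀ X, (F.obj X).Additive]
  [∀ c c', HomologicalComplex.HasMapBifunctor (K c) (K c') F (ComplexShape.up ℤ)]

namespace Diagonals

/-- The inclusion of a tensor product of two objects in the total complex, without sign. -/
noncomputable def incl (s x y x' y' c n : ℤ) (h : x - y = c ∧ x' - y' = s - c ∧
    n + y + y' + (m c + m (s - c)) = 0) : (F.obj (A x y)).obj (A x' y') ⟶
      (HomologicalComplex.mapBifunctor (K c) (K (s - c)) F (ComplexShape.up ℤ)).X n :=
  (F.map (S.iso c x y (-y - m c) (by lia)).hom).app _ ≫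
    (F.obj _).map (S.iso (s - c) x' y' (-y' - m (s - c)) (by lia)).hom ≫
      HomologicalComplex.ιMapBifunctor (K c) (K (s - c)) F (ComplexShape.up ℤ) _ _ n
        (by change (_ : ℤ) + _ = n; lia)

theorem incl_eq (s x y x' y' c n p q : ℤ) (h : x - y = c ∧ x' - y' = s - c ∧
    n + y + y' + (m c + m (s - c)) = 0) (hp : p + y + m c = 0) (hq : q + y' + m (s - c) = 0) :
    S.incl F s x y x' y' c n h = (F.map (S.iso c x y p (by lia)).hom).app _ ≫
      (F.obj _).map (S.iso (s - c) x' y' q (by lia)).hom ≫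
        HomologicalComplex.ιMapBifunctor (K c) (K (s - c)) F (ComplexShape.up ℤ) p q n
          (by change (_ : ℤ) + _ = n; lia) := by
  obtain rfl : p = -y - m c := by lia
  obtain rfl : q = -y' - m (s - c) := by lia
  rfl

theorem incl_d (s x X y Y x' X' y' Y' c n o : ℤ) (hx : x + 1 = X) (hy : y + 1 = Y)
    (hx' : x' + 1 = X') (hy' : y' + 1 = Y') (hn : n + 1 = o) (h) :
    S.incl F s X Y X' Y' c n h ≫
      (HomologicalComplex.mapBifunctor (K c) (K (s - c)) F (ComplexShape.up ℤ)).d n o =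
      (F.map (dA x X hx y Y hy)).app _ ≫ S.incl F s x y X' Y' c o (by lia) +
        (Y + m c).negOnePow • ((F.obj _).map (dA x' X' hx' y' Y' hy') ≫
          S.incl F s X Y x' y' c o (by lia)) := by
  obtain ⟨p, hp⟩ : ∃ p, p + Y + m c = 0 := ⟨-Y - m c, by lia⟩
  obtain ⟨q, hq⟩ : ∃ q, q + Y' + m (s - c) = 0 := ⟨-Y' - m (s - c), by lia⟩
  rw [S.incl_eq F s X Y X' Y' c n p q h hp hq,
    S.incl_eq F s x y X' Y' c o (p + 1) q (by lia) (by lia) hq,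
    S.incl_eq F s X Y x' y' c o p (q + 1) (by lia) hp (by lia)]
  have hpY : (Y + m c).negOnePow = p.negOnePow := by
    rw [show Y + m c = -p by lia, Int.negOnePow_neg]
  rw [HomologicalComplex.mapBifunctor.d_eq, hpY]
  simp only [Category.assoc, Preadditive.comp_add, HomologicalComplex.mapBifunctor.ι_D₁,
    HomologicalComplex.mapBifunctor.ι_D₂]
  rw [HomologicalComplex.mapBifunctor.d₁_eq (K c) (K (s - c)) F (ComplexShape.up ℤ)
    (show (ComplexShape.up ℤ).Rel p (p + 1) from rfl) q o (by change (_ : ℤ) + _ = o; lia),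
    HomologicalComplex.mapBifunctor.d₂_eq (K c) (K (s - c)) F (ComplexShape.up ℤ) p
    (show (ComplexShape.up ℤ).Rel q (q + 1) from rfl) o (by change (_ : ℤ) + _ = o; lia)]
  have e1 := congrArg (fun f => (F.map f).app (A X' Y')) (S.iso_d c x X y Y p (p + 1) hx hy rfl (by lia))
  have e2 := congrArg (F.obj (A X Y)).map (S.iso_d (s - c) x' X' y' Y' q (q + 1) hx' hy' rfl (by lia))
  simp only [Functor.map_comp, NatTrans.comp_app] at e1 e2
  have hε₁ : ComplexShape.ε₁ (ComplexShape.up ℤ) (ComplexShape.up ℤ) (ComplexShape.up ℤ) (p, q) =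
    1 := rfl
  have hε₂ : ComplexShape.ε₂ (ComplexShape.up ℤ) (ComplexShape.up ℤ) (ComplexShape.up ℤ) (p, q) =
    p.negOnePow := rfl
  rw [hε₁, hε₂]
  congr 1
  · rw [one_smul, NatTrans.naturality_assoc, reassoc_of% e1]
  · rw [Linear.comp_units_smul, Linear.comp_units_smul]
    congr 1
    rw [← NatTrans.naturality_assoc, ← NatTrans.naturality_assoc, reassoc_of% e2,
      NatTrans.naturality_assoc]

/-- The tensor products `K c ⊗ K (s - c)` are total complexes of the tensor products of the
family `A`. The sign makes the differential independent of the shift `m`. -/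
noncomputable def totalOf (s M : ℤ) (hM : ∀ c, m c + m (s - c) = M) :
    TotalOf (W := fun x y x' y' => (F.obj (A x y)).obj (A x' y'))
      (fun x X hx y Y hy _ _ => (F.map (dA x X hx y Y hy)).app _)
      (fun _ _ x' X' hx' y' Y' hy' => (F.obj _).map (dA x' X' hx' y' Y' hy')) s M
      (fun c => HomologicalComplex.mapBifunctor (K c) (K (s - c)) F (ComplexShape.up ℤ)) where
  ι x y x' y' c n h := (m c * y').negOnePow • S.incl F s x y x' y' c n (by rw [hM]; exact h)
  desc c n _ f := HomologicalComplex.mapBifunctorDesc fun p q h =>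
    (F.map (S.iso c (c + (-p - m c)) (-p - m c) p (by lia)).inv).app _ ≫
      (F.obj _).map (S.iso (s - c) (s - c + (-q - m (s - c))) (-q - m (s - c)) q (by lia)).inv ≫
        ((m c * (-q - m (s - c))).negOnePow • f (c + (-p - m c)) (-p - m c)
          (s - c + (-q - m (s - c))) (-q - m (s - c)) (by
          have : p + q = n := h
          have := hM c
          lia))
  ι_desc c n _ f x y x' y' h := by
    obtain ⟨p, hp⟩ : ∃ p, p + y + m c = 0 := ⟨-y - m c, by lia⟩
    obtain ⟨q, hq⟩ : ∃ q, q + y' + m (s - c) = 0 := ⟨-y' - m (s - c), by lia⟩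
    obtain rfl : y = -p - m c := by lia
    obtain rfl : y' = -q - m (s - c) := by lia
    obtain rfl : x = c + (-p - m c) := by lia
    obtain rfl : x' = s - c + (-q - m (s - c)) := by lia
    rw [S.incl_eq F s _ _ _ _ c n p q _ hp hq, Linear.units_smul_comp]
    simp only [Category.assoc, HomologicalComplex.ι_mapBifunctorDesc, Linear.comp_units_smul,
      smul_smul, Int.units_mul_self, one_smul]
    rw [← NatTrans.naturality_assoc, ← NatTrans.comp_app_assoc, ← F.map_comp, Iso.hom_inv_id,
      F.map_id, NatTrans.id_app, Category.id_comp, ← (F.obj _).map_comp_assoc, Iso.hom_inv_id,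
      (F.obj _).map_id, Category.id_comp]
  hom_ext c n A' f g h := by
    apply HomologicalComplex.mapBifunctor.hom_ext
    intro p q hpq
    have hpq' : p + q = n := hpq
    have := hM c
    have h := h (c + (-p - m c)) (-p - m c) (s - c + (-q - m (s - c))) (-q - m (s - c)) (by lia)
    rw [Linear.units_smul_comp, Linear.units_smul_comp,
      S.incl_eq F s _ _ _ _ c n p q _ (by lia) (by lia)] at h
    replace h := (MulAction.injective _) h
    simp only [Category.assoc] at h
    rw [← cancel_epi ((F.obj ((K c).X p)).mapIso (S.iso (s - c) _ _ q _)).hom,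
      ← cancel_epi ((F.mapIso (S.iso c _ _ p _)).app _).hom]
    exact h
  ι_d x X y Y x' X' y' Y' c n o hx hy hx' hy' hn h := by
    rw [Linear.units_smul_comp, S.incl_d F s x X y Y x' X' y' Y' c n o hx hy hx' hy' hn, smul_add,
      Linear.comp_units_smul, Linear.comp_units_smul, smul_smul, smul_smul]
    have h2 : (m c * Y').negOnePow * (Y + m c).negOnePow =
        Y.negOnePow * (m c * y').negOnePow := by
      rw [← Int.negOnePow_add, ← Int.negOnePow_add, ← hy',
        show m c * (y' + 1) + (Y + m c) = Y + m c * y' + 2 * m c by ring, Int.negOnePow_add _ (2 * _),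
        Int.negOnePow_two_mul, mul_one]
    rw [h2]

end Diagonals

variable {W W' : ℤ → ℤ → ℤ → ℤ → H}
  {d₁ : ∀ x X (_ : x + 1 = X) y Y (_ : y + 1 = Y) x' y', W X Y x' y' ⟶ W x y x' y'}
  {d₂ : ∀ x y x' X' (_ : x' + 1 = X') y' Y' (_ : y' + 1 = Y'), W x y X' Y' ⟶ W x y x' y'}
  {d₁' : ∀ x X (_ : x + 1 = X) y Y (_ : y + 1 = Y) x' y', W' X Y x' y' ⟶ W' x y x' y'}
  {d₂' : ∀ x y x' X' (_ : x' + 1 = X') y' Y' (_ : y' + 1 = Y'), W' x y X' Y' ⟶ W' x y x' y'}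
  {s M : ℤ} {L : ℤ → CochainComplex H ℤ}

/-- Transport along isomorphisms of the words. -/
def TotalOf.ofIso (T : TotalOf d₁ d₂ s M L) (θ : ∀ x y x' y', W' x y x' y' ≅ W x y x' y')
    (h₁ : ∀ x X hx y Y hy x' y', d₁' x X hx y Y hy x' y' ≫ (θ _ _ _ _).hom =
      (θ _ _ _ _).hom ≫ d₁ x X hx y Y hy x' y')
    (h₂ : ∀ x y x' X' hx' y' Y' hy', d₂' x y x' X' hx' y' Y' hy' ≫ (θ _ _ _ _).hom =
      (θ _ _ _ _).hom ≫ d₂ x y x' X' hx' y' Y' hy') : TotalOf d₁' d₂' s M L where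
  ι x y x' y' c n h := (θ x y x' y').hom ≫ T.ι x y x' y' c n h
  desc c n _ f := T.desc c n fun x y x' y' h => (θ x y x' y').inv ≫ f x y x' y' h
  ι_desc c n _ f x y x' y' h := by rw [Category.assoc, T.ι_desc, Iso.hom_inv_id_assoc]
  hom_ext c n _ f g h := T.hom_ext c n fun x y x' y' hh => by
    have := h x y x' y' hh
    rwa [Category.assoc, Category.assoc, cancel_epi] at this
  ι_d x X y Y x' X' y' Y' c n o hx hy hx' hy' hn h := by
    rw [Category.assoc, T.ι_d x X y Y x' X' y' Y' c n o hx hy hx' hy' hn, Preadditive.comp_add,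
      Linear.comp_units_smul, ← reassoc_of% h₁, ← reassoc_of% h₂]

end Diagonals

end Heis
namespace Heis

/-! ### Words in the Karoubi envelope and in its additive version -/

section Words

variable {C : Type*} [Category C] [MonoidalCategory C] {u d : C}

/-- The clockwise cap between two letters, between inclusions `a` and `b`, in nested form and as a
morphism of tensor products. -/
theorem cap_word (ev : u ⊗ d ⟶ 𝟙_ C) {X X' Y Y' : C} (a : X' ⟶ X ⊗ u) (b : Y' ⟶ d ⊗ Y) (Z : C) :
    (a ▷ (Y' ⊗ Z) ≫ (α_ _ _ _).hom) ≫ X ◁ (u ◁ (b ▷ Z ≫ (α_ _ _ _).hom) ≫ capFront ev (Y ⊗ Z)) =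
      (α_ _ _ _).inv ≫ ((a ⊗ₘ b) ≫ capIn ev X Y) ▷ Z ≫ (α_ _ _ _).hom := by
  rw [MonoidalCategory.tensorHom_def]
  simp only [capFront, capIn]
  monoidal

/-- The clockwise cup between two letters, between projections `a` and `b`, in nested form and as a
morphism of tensor products. -/
theorem cup_word (coev : 𝟙_ C ⟶ u ⊗ d) {X X' Y Y' : C} (a : X ⊗ u ⟶ X') (b : d ⊗ Y ⟶ Y') (Z : C) :
    X ◁ (cupFront coev (Y ⊗ Z) ≫ u ◁ ((α_ _ _ _).inv ≫ b ▷ Z)) ≫ (α_ _ _ _).inv ≫ a ▷ (Y' ⊗ Z) =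
      (α_ _ _ _).inv ≫ (cupIn coev X Y ≫ (a ⊗ₘ b)) ▷ Z ≫ (α_ _ _ _).hom := by
  rw [MonoidalCategory.tensorHom_def']
  simp only [cupFront, cupIn]
  monoidal

/-- The isomorphism between the right-bracketed word in four letters and the tensor product of two
words in two letters. -/
def wordIso (X Y X' Y' : C) : X ⊗ (Y ⊗ (X' ⊗ (Y' ⊗ 𝟙_ C))) ≅ (X ⊗ Y) ⊗ (X' ⊗ Y') :=
  whiskerLeftIso X (whiskerLeftIso Y (whiskerLeftIso X' (ρ_ Y'))) ≪≫ (α_ X Y (X' ⊗ Y')).symm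

theorem wordIso_naturality_left {X₁ Y₁ X₂ Y₂ : C} (f : X₁ ⊗ Y₁ ⟶ X₂ ⊗ Y₂) (X' Y' : C) :
    ((α_ _ _ _).inv ≫ f ▷ (X' ⊗ (Y' ⊗ 𝟙_ C)) ≫ (α_ _ _ _).hom) ≫ (wordIso X₂ Y₂ X' Y').hom =
      (wordIso X₁ Y₁ X' Y').hom ≫ f ▷ (X' ⊗ Y') := by
  simp only [wordIso, Iso.trans_hom, whiskerLeftIso_hom, Iso.symm_hom, Category.assoc]
  monoidal

theorem wordIso_naturality_right {X₁ Y₁ X₂ Y₂ : C} (f : X₁ ⊗ Y₁ ⟶ X₂ ⊗ Y₂) (X Y : C) :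
    X ◁ (Y ◁ ((α_ _ _ _).inv ≫ f ▷ 𝟙_ C ≫ (α_ _ _ _).hom)) ≫ (wordIso X Y X₂ Y₂).hom =
      (wordIso X Y X₁ Y₁).hom ≫ (X ⊗ Y) ◁ f := by
  simp only [wordIso, Iso.trans_hom, whiskerLeftIso_hom, Iso.symm_hom, Category.assoc]
  monoidal

end Words

section KaroubiWords

open Idempotents

variable {C : Type*} [Category C] [MonoidalCategory C] {u d : C}

theorem karoubi_capIn_f {ev₀ : u ⊗ d ⟶ 𝟙_ C}
    {ev : (toKaroubi C).obj u ⊗ (toKaroubi C).obj d ⟶ 𝟙_ _} (h : ev.f = ev₀) (P Q : Karoubi C) :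
    (capIn ev P Q).f = capIn ev₀ P.X Q.X ≫ (P.p ⊗ₘ Q.p) := by
  have hg : (capFront ev Q).f = capFront ev₀ Q.X ≫ Q.p := by
    have e1 : (capFront ev Q).f = ((α_ u d Q.X).inv ≫ ((𝟙 u ⊗ₘ 𝟙 d) ⊗ₘ Q.p)) ≫ (ev₀ ⊗ₘ Q.p) ≫
        (λ_ Q.X).hom ≫ Q.p := h ▸ rfl
    rw [e1, Category.assoc, tensorHom_comp_tensorHom_assoc, Q.idem, id_tensorHom_id,
      Category.id_comp, MonoidalCategory.tensorHom_def, Category.assoc,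
      leftUnitor_naturality_assoc, Q.idem, capFront, Category.assoc, Category.assoc]
  have e2 : (capIn ev P Q).f = (α_ P.X u (d ⊗ Q.X)).hom ≫ (P.p ⊗ₘ (𝟙 u ⊗ₘ (𝟙 d ⊗ₘ Q.p))) ≫
      (P.p ⊗ₘ (capFront ev Q).f) := Category.assoc _ _ _
  have e3 : (P.p ⊗ₘ (𝟙 u ⊗ₘ (𝟙 d ⊗ₘ Q.p))) ≫ (P.p ⊗ₘ (capFront ev Q).f) =
      P.p ⊗ₘ (capFront ev Q).f := Karoubi.p_comp (P ◁ capFront ev Q)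
  have e4 : P.p ⊗ₘ (capFront ev₀ Q.X ≫ Q.p) = P.X ◁ capFront ev₀ Q.X ≫ (P.p ⊗ₘ Q.p) := by
    rw [← id_tensorHom, tensorHom_comp_tensorHom, Category.id_comp]
  rw [e2, e3, hg, e4]
  exact (Category.assoc _ _ _).symm

theorem karoubi_cupIn_f {coev₀ : 𝟙_ C ⟶ u ⊗ d}
    {coev : 𝟙_ _ ⟶ (toKaroubi C).obj u ⊗ (toKaroubi C).obj d} (h : coev.f = coev₀)
    (P Q : Karoubi C) :
    (cupIn coev P Q).f = (P.p ⊗ₘ Q.p) ≫ cupIn coev₀ P.X Q.X := by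
  have hg : (cupFront coev Q).f = Q.p ≫ cupFront coev₀ Q.X := by
    have e1 : (cupFront coev Q).f = (Q.p ≫ (λ_ Q.X).inv) ≫ (coev₀ ⊗ₘ Q.p) ≫
        ((α_ u d Q.X).hom ≫ (𝟙 u ⊗ₘ (𝟙 d ⊗ₘ Q.p))) := h ▸ rfl
    have e2 : Q.p ≫ (λ_ Q.X).inv ≫ (coev₀ ⊗ₘ Q.p) = Q.p ≫ (λ_ Q.X).inv ≫ coev₀ ▷ Q.X := by
      rw [MonoidalCategory.tensorHom_def', ← leftUnitor_inv_naturality_assoc,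
        reassoc_of% Q.idem]
    rw [e1, ← associator_naturality, tensorHom_comp_tensorHom_assoc, Q.idem, id_tensorHom_id,
      Category.comp_id, Category.assoc, reassoc_of% e2]
    rfl
  have e2 : (cupIn coev P Q).f = (P.p ⊗ₘ (cupFront coev Q).f) ≫ (α_ P.X u (d ⊗ Q.X)).inv ≫
      ((P.p ⊗ₘ 𝟙 u) ⊗ₘ (𝟙 d ⊗ₘ Q.p)) := rfl
  have e3 : (P.p ⊗ₘ (cupFront coev Q).f) ≫ (P.p ⊗ₘ (𝟙 u ⊗ₘ (𝟙 d ⊗ₘ Q.p))) =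
      P.p ⊗ₘ (cupFront coev Q).f := Karoubi.comp_p (P ◁ cupFront coev Q)
  have e4 : P.p ⊗ₘ (Q.p ≫ cupFront coev₀ Q.X) = (P.p ⊗ₘ Q.p) ≫ P.X ◁ cupFront coev₀ Q.X := by
    rw [← id_tensorHom, tensorHom_comp_tensorHom, Category.comp_id]
  rw [e2, ← associator_inv_naturality, reassoc_of% e3, hg, e4]
  exact Category.assoc _ _ _

end KaroubiWords

section Envelope

open Idempotents

variable {C : Type*} [Category C] [Preadditive C]

/-- The embedding of the Karoubi envelope in the additive Karoubi envelope. -/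
def karoubiEmbedding (C : Type*) [Category C] [Preadditive C] : Karoubi C ⥤ Karoubi (Mat_ C) where
  obj P := ⟨(Mat_.embedding C).obj P.X, (Mat_.embedding C).map P.p, by
    rw [← Functor.map_comp, P.idem]⟩
  map {P Q} f := ⟨(Mat_.embedding C).map f.f, by
    have h := congrArg (Mat_.embedding C).map f.comm
    rwa [Functor.map_comp, Functor.map_comp] at h⟩
  map_id _ := rfl
  map_comp f g := Karoubi.hom_ext _ _ ((Mat_.embedding C).map_comp f.f g.f)

instance : (karoubiEmbedding C).Additive where
  map_add := Karoubi.hom_ext _ _ ((Mat_.embedding C).map_add)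

theorem mat_comp_of_unique {M N K : Mat_ C} [Unique N.ι] (f : M ⟶ N) (g : N ⟶ K) (i : M.ι)
    (j : K.ι) : (f ≫ g) i j = f i default ≫ g default j :=
  (Mat_.comp_apply _ _ _ _).trans (Fintype.sum_unique _)

/-- The index set of a tensor product of two objects of the category. -/
@[reducible] def uniquePUnitProd : Unique (PUnit.{1} × PUnit.{1}) where
  default := (PUnit.unit, PUnit.unit)
  uniq _ := rfl

variable [MonoidalCategory C] [MonoidalPreadditive C]

/-- The embedding is compatible with tensor products. -/
def karoubiEmbeddingTensor (P Q : Karoubi C) :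
    ((karoubiTensor C).obj ((karoubiEmbedding C).obj P)).obj ((karoubiEmbedding C).obj Q) ≅
      (karoubiEmbedding C).obj (P ⊗ Q) where
  hom := ⟨fun _ _ => P.p ⊗ₘ Q.p, by
    apply Mat_.hom_ext
    intro i j
    have : Unique ((karoubiEmbedding C).obj (P ⊗ Q)).X.ι := inferInstanceAs (Unique PUnit)
    have : Unique (((karoubiTensor C).obj ((karoubiEmbedding C).obj P)).obj
      ((karoubiEmbedding C).obj Q)).X.ι := uniquePUnitProd
    refine (mat_comp_of_unique _ _ _ _).trans ?_
    refine (congrArg (_ ≫ ·) (mat_comp_of_unique _ _ _ _)).trans ?_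
    exact (congrArg ((P ⊗ Q).p ≫ ·) (P ⊗ Q).idem).trans (P ⊗ Q).idem⟩
  inv := ⟨fun _ _ => P.p ⊗ₘ Q.p, by
    apply Mat_.hom_ext
    intro i j
    have : Unique ((karoubiEmbedding C).obj (P ⊗ Q)).X.ι := inferInstanceAs (Unique PUnit)
    have : Unique (((karoubiTensor C).obj ((karoubiEmbedding C).obj P)).obj
      ((karoubiEmbedding C).obj Q)).X.ι := uniquePUnitProd
    refine (mat_comp_of_unique _ _ _ _).trans ?_
    refine (congrArg (_ ≫ ·) (mat_comp_of_unique _ _ _ _)).trans ?_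
    exact (congrArg ((P ⊗ Q).p ≫ ·) (P ⊗ Q).idem).trans (P ⊗ Q).idem⟩
  hom_inv_id := by
    apply Karoubi.hom_ext
    apply Mat_.hom_ext
    intro i j
    have : Unique ((karoubiEmbedding C).obj (P ⊗ Q)).X.ι := inferInstanceAs (Unique PUnit)
    exact (mat_comp_of_unique _ _ _ _).trans (P ⊗ Q).idem
  inv_hom_id := by
    apply Karoubi.hom_ext
    apply Mat_.hom_ext
    intro i j
    have : Unique (((karoubiTensor C).obj ((karoubiEmbedding C).obj P)).obj
      ((karoubiEmbedding C).obj Q)).X.ι := uniquePUnitProd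
    exact (mat_comp_of_unique _ _ _ _).trans (P ⊗ Q).idem

theorem karoubiEmbeddingTensor_naturality_left {P P' : Karoubi C} (f : P ⟶ P') (Q : Karoubi C) :
    ((karoubiTensor C).map ((karoubiEmbedding C).map f)).app _ ≫ (karoubiEmbeddingTensor P' Q).hom =
      (karoubiEmbeddingTensor P Q).hom ≫ (karoubiEmbedding C).map (f ▷ Q) := by
  apply Karoubi.hom_ext
  apply Mat_.hom_ext
  intro i j
  have : Unique ((karoubiEmbedding C).obj (P ⊗ Q)).X.ι := inferInstanceAs (Unique PUnit)
  have : Unique (((karoubiTensor C).obj ((karoubiEmbedding C).obj P')).obj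
    ((karoubiEmbedding C).obj Q)).X.ι := uniquePUnitProd
  refine (mat_comp_of_unique _ _ _ _).trans (Eq.trans ?_ (mat_comp_of_unique _ _ _ _).symm)
  exact (Karoubi.p_comm (f ▷ Q)).symm

theorem karoubiEmbeddingTensor_naturality_right (P : Karoubi C) {Q Q' : Karoubi C} (f : Q ⟶ Q') :
    ((karoubiTensor C).obj _).map ((karoubiEmbedding C).map f) ≫ (karoubiEmbeddingTensor P Q').hom =
      (karoubiEmbeddingTensor P Q).hom ≫ (karoubiEmbedding C).map (P ◁ f) := by
  apply Karoubi.hom_ext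
  apply Mat_.hom_ext
  intro i j
  have : Unique ((karoubiEmbedding C).obj (P ⊗ Q)).X.ι := inferInstanceAs (Unique PUnit)
  have : Unique (((karoubiTensor C).obj ((karoubiEmbedding C).obj P)).obj
    ((karoubiEmbedding C).obj Q')).X.ι := uniquePUnitProd
  refine (mat_comp_of_unique _ _ _ _).trans (Eq.trans ?_ (mat_comp_of_unique _ _ _ _).symm)
  exact (Karoubi.p_comm (P ◁ f)).symm

end Envelope

end Heis
namespace Heis

/-! ### Koszul families from complexes of words -/

section

open Idempotents

variable {C : Type*} [Category C] [Preadditive C] [MonoidalCategory C] [MonoidalPreadditive C]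

/-- A compatible system of contractions on the words `P x ⊗ Q y ⊗ P x' ⊗ Q y'` makes the tensor
products of the complexes of words into a Koszul family. The last hypothesis says that in each
degree only finitely many of these tensor products are nonzero. -/
noncomputable def koszulOfQuad {P Q : ℤ → Karoubi C}
    {δ : ∀ x X (_ : x + 1 = X) y Y (_ : y + 1 = Y), P X ⊗ Q Y ⟶ P x ⊗ Q y} {ε : ℤ}
    (q : Quad (fun x y x' y' => P x ⊗ (Q y ⊗ (P x' ⊗ (Q y' ⊗ 𝟙_ _))))
      (fun x X hx y Y hy _ _ => (α_ _ _ _).inv ≫ δ x X hx y Y hy ▷ _ ≫ (α_ _ _ _).hom)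
      (fun x y x' X' hx' y' Y' hy' =>
        P x ◁ (Q y ◁ ((α_ _ _ _).inv ≫ δ x' X' hx' y' Y' hy' ▷ 𝟙_ _ ≫ (α_ _ _ _).hom))) ε)
    {m : ℤ → ℤ} {K : ℤ → CochainComplex (Karoubi (Mat_ C)) ℤ}
    (S : Diagonals (fun x y => (karoubiEmbedding C).obj (P x ⊗ Q y))
      (fun x X hx y Y hy => (karoubiEmbedding C).map (δ x X hx y Y hy)) m K)
    [∀ c c', HomologicalComplex.HasMapBifunctor (K c) (K c') (karoubiTensor C) (ComplexShape.up ℤ)]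
    (s M : ℤ) (hM : ∀ c, m c + m (s - c) = M)
    (h0 : ∀ n, ∃ N, ∀ c x y x' y', x - y = c → x' - y' = s - c → n + y + y' + M = 0 →
      (c < -N ∨ N < c) → IsZero (P x) ∨ IsZero (Q y) ∨ IsZero (P x') ∨ IsZero (Q y')) :
    Koszul (fun c => HomologicalComplex.mapBifunctor (K c) (K (s - c)) (karoubiTensor C)
      (ComplexShape.up ℤ)) (s + 2 * ε) := by
  let T := (S.totalOf (karoubiTensor C) s M hM).ofIso
    (d₁' := fun x X hx y Y hy x' y' => (karoubiEmbedding C).map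
      ((α_ _ _ _).inv ≫ δ x X hx y Y hy ▷ (P x' ⊗ (Q y' ⊗ 𝟙_ _)) ≫ (α_ _ _ _).hom))
    (d₂' := fun x y x' X' hx' y' Y' hy' => (karoubiEmbedding C).map
        (P x ◁ (Q y ◁ ((α_ _ _ _).inv ≫ δ x' X' hx' y' Y' hy' ▷ 𝟙_ _ ≫ (α_ _ _ _).hom))))
    (fun x y x' y' => (karoubiEmbedding C).mapIso (wordIso (P x) (Q y) (P x') (Q y')) ≪≫
      (karoubiEmbeddingTensor (P x ⊗ Q y) (P x' ⊗ Q y')).symm)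
    (fun x X hx y Y hy x' y' => by
      simp only [Iso.trans_hom, Functor.mapIso_hom, Iso.symm_hom]
      rw [← Functor.map_comp_assoc, wordIso_naturality_left, Functor.map_comp_assoc,
        Category.assoc]
      congr 1
      rw [Iso.comp_inv_eq, Category.assoc, Iso.eq_inv_comp]
      exact (karoubiEmbeddingTensor_naturality_left _ _).symm)
    (fun x y x' X' hx' y' Y' hy' => by
      simp only [Iso.trans_hom, Functor.mapIso_hom, Iso.symm_hom]
      rw [← Functor.map_comp_assoc, wordIso_naturality_right, Functor.map_comp_assoc,
        Category.assoc]
      congr 1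
      rw [Iso.comp_inv_eq, Category.assoc, Iso.eq_inv_comp]
      exact (karoubiEmbeddingTensor_naturality_right _ _).symm)
  have hz : ∀ n, ∃ N, ∀ c, (c < -N ∨ N < c) → IsZero ((HomologicalComplex.mapBifunctor (K c)
      (K (s - c)) (karoubiTensor C) (ComplexShape.up ℤ)).X n) := fun n => by
    obtain ⟨N, hN⟩ := h0 n
    refine ⟨N, fun c hc => (IsZero.iff_id_eq_zero _).2 (T.hom_ext c n fun x y x' y' h => ?_)⟩
    refine ((karoubiEmbedding C).map_isZero ?_).eq_of_src _ _
    rcases hN c x y x' y' h.1 h.2.1 h.2.2 hc with h | h | h | h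
    · exact isZero_tensor h _
    · exact isZero_tensor' (isZero_tensor h _) _
    · exact isZero_tensor' (isZero_tensor' (isZero_tensor h _) _) _
    · exact isZero_tensor' (isZero_tensor' (isZero_tensor' (isZero_tensor h _) _) _) _
  refine T.koszul (q.map (karoubiEmbedding C)) (fun n => ?_) fun n => ?_
  · obtain ⟨N, hN⟩ := hz n
    exact ⟨N, fun c hc => hN c (Or.inr hc)⟩
  · obtain ⟨N, hN⟩ := hz n
    exact ⟨-N, fun c hc => hN c (Or.inl hc)⟩

end

section

open Idempotents

theorem divisible_karoubi {C : Type*} [Category C] [Preadditive C] (hC : Divisible C) :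
    Divisible (Karoubi C) := fun X n hn => by
  obtain ⟨g, hg⟩ := hC X.X n hn
  refine ⟨⟨X.p ≫ g ≫ X.p, by simp [reassoc_of% X.idem, X.idem]⟩, Karoubi.hom_ext _ _ ?_⟩
  rw [karoubi_zsmul_f]
  change n • (X.p ≫ g ≫ X.p) = X.p
  rw [← Preadditive.comp_zsmul, ← Preadditive.zsmul_comp, hg, Category.id_comp, X.idem]

theorem divisible_mat {C : Type*} [Category C] [Preadditive C] (hC : Divisible C) :
    Divisible (Mat_ C) := fun X n hn => by
  classical
  choose g hg using fun i => hC (X.X i) n hn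
  refine ⟨fun i j => if h : i = j then g i ≫ eqToHom (by rw [h]) else 0, ?_⟩
  apply Mat_.hom_ext
  intro i j
  change n • (if h : i = j then g i ≫ eqToHom (by rw [h]) else 0 : X.X i ⟶ X.X j) = _
  by_cases h : i = j
  · subst h
    rw [Mat_.id_apply_self, dif_pos rfl, eqToHom_refl, Category.comp_id, hg]
  · rw [dif_neg h, Mat_.id_apply_of_ne _ _ _ h, smul_zero]

theorem divisible_diagCat (k : Type u) [Field k] [CharZero k] : Divisible (DiagCat k) :=
  fun X n hn => ⟨(n : k)⁻¹ • 𝟙 X, by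
    rw [← Int.cast_smul_eq_zsmul k, smul_smul, mul_inv_cancel₀ (Int.cast_ne_zero.2 hn), one_smul]⟩

end

section

theorem onLastTwo_neg {C : Type*} [Category C] [Preadditive C] [MonoidalCategory C]
    [MonoidalPreadditive C] (A : C) {u : C} (s : u ⊗ u ⟶ u ⊗ u) :
    onLastTwo A (-s) = -onLastTwo A s := by
  have h : A ◁ (-s) = -(A ◁ s) := (tensorLeft A).map_neg
  rw [onLastTwo, onLastTwo, h, Preadditive.neg_comp, Preadditive.comp_neg]

theorem onFirstTwo_neg {C : Type*} [Category C] [Preadditive C] [MonoidalCategory C]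
    [MonoidalPreadditive C] (A : C) {u : C} (s : u ⊗ u ⟶ u ⊗ u) :
    onFirstTwo A (-s) = -onFirstTwo A s := by
  rw [onFirstTwo, onFirstTwo, neg_whiskerRight, Preadditive.neg_comp, Preadditive.comp_neg]

theorem onFront_neg {C : Type*} [Category C] [Preadditive C] [MonoidalCategory C]
    [MonoidalPreadditive C] {A B A' B' : C} (f : A ⊗ B ⟶ A' ⊗ B') (Z : C) :
    onFront (-f) Z = -onFront f Z := by
  rw [onFront, onFront, neg_whiskerRight, Preadditive.neg_comp, Preadditive.comp_neg]

variable (k : Type u) [Field k] [CharZero k]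

theorem symUp_idempotents : UpIdempotents (DiagCat.crossUp k) (symUp k) :=
  .of_tower (tower_up k) (fun _ => rfl) fun _ => rfl

theorem antiUp_idempotents : UpIdempotents (-DiagCat.crossUp k) (antiUp k) :=
  .of_tower (tower_up k).neg (fun _ => (onLastTwo_neg _ _).symm) fun _ => rfl

theorem symDown_idempotents : DownIdempotents (DiagCat.crossDown k) (symDown k) :=
  .of_tower (tower_down k) (fun _ => rfl) fun _ => rfl

theorem antiDown_idempotents : DownIdempotents (-DiagCat.crossDown k) (antiDown k) :=
  .of_tower (tower_down k).neg (fun _ => (onFirstTwo_neg _ _).symm) fun _ => rfl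

end
end Heis
namespace Heis

/-! ### The complexes `B` and `Bstar` as complexes of words -/

theorem whisker_whisker_comp {C : Type*} [Category C] [MonoidalCategory C] {A B D : C}
    (p : A ⊗ B ⟶ D) {Y Z : C} (f : Y ⟶ Z) : A ◁ (B ◁ f) ≫ (α_ A B Z).inv ≫ p ▷ Z =
      ((α_ A B Y).inv ≫ p ▷ Y) ≫ D ◁ f := by
  rw [associator_inv_naturality_right_assoc, whisker_exchange, Category.assoc]

/-- Replacement of the differentials by equal ones. -/
def Quad.congr {H : Type*} [Category H] [Preadditive H] {W : ℤ → ℤ → ℤ → ℤ → H}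
    {d₁ d₁' : ∀ x X (_ : x + 1 = X) y Y (_ : y + 1 = Y) x' y', W X Y x' y' ⟶ W x y x' y'}
    {d₂ d₂' : ∀ x y x' X' (_ : x' + 1 = X') y' Y' (_ : y' + 1 = Y'), W x y X' Y' ⟶ W x y x' y'}
    {δ : ℤ} (q : Quad W d₁ d₂ δ)
    (h₁ : ∀ x X hx y Y hy x' y', d₁ x X hx y Y hy x' y' = d₁' x X hx y Y hy x' y')
    (h₂ : ∀ x y x' X' hx' y' Y' hy', d₂ x y x' X' hx' y' Y' hy' = d₂' x y x' X' hx' y' Y' hy') :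
    Quad W d₁' d₂' δ := by
  obtain rfl : d₁ = d₁' := by funext; apply h₁
  obtain rfl : d₂ = d₂' := by funext; apply h₂
  exact q

section

open Idempotents

variable (k : Type u) [Field k] [CharZero k]

/-- The action of Khovanov's category on the Karoubi envelope of the category of diagrams. -/
def karoubiAction : Action (tensorLeft ((toKaroubi (DiagCat k)).obj (DiagCat.Qp k)))
    (tensorLeft ((toKaroubi (DiagCat k)).obj (DiagCat.Qm k))) :=
  ((khovanov k).karoubi).action

/-- The clockwise cap, in the Karoubi envelope. -/
def capK : (toKaroubi (DiagCat k)).obj (DiagCat.Qp k) ⊗ (toKaroubi (DiagCat k)).obj (DiagCat.Qm k) ⟶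
    𝟙_ _ := (khovanov k).karoubi.cap

/-- The clockwise cup, in the Karoubi envelope. -/
def cupK : 𝟙_ _ ⟶
    (toKaroubi (DiagCat k)).obj (DiagCat.Qp k) ⊗ (toKaroubi (DiagCat k)).obj (DiagCat.Qm k) :=
  (khovanov k).karoubi.cup

/-- The differential of the complexes `B`, in the Karoubi envelope. -/
def capDiff (x X : ℤ) (hx : x + 1 = X) (y Y : ℤ) (hy : y + 1 = Y) :
    powObj (symUp_idempotents k).idem X ⊗ powObj (antiDown_idempotents k).idem Y ⟶
      powObj (symUp_idempotents k).idem x ⊗ powObj (antiDown_idempotents k).idem y :=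
  ((symUp_idempotents k).incl x X hx ⊗ₘ (antiDown_idempotents k).incl y Y hy) ≫
    capIn (capK k) _ _

/-- The differential of the complexes `Bstar`, in the Karoubi envelope. -/
def cupDiff (x X : ℤ) (hx : x + 1 = X) (y Y : ℤ) (hy : y + 1 = Y) :
    powObj (antiUp_idempotents k).idem x ⊗ powObj (symDown_idempotents k).idem y ⟶
      powObj (antiUp_idempotents k).idem X ⊗ powObj (symDown_idempotents k).idem Y :=
  cupIn (cupK k) _ _ ≫
    ((antiUp_idempotents k).proj x X hx ⊗ₘ (symDown_idempotents k).proj y Y hy)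

theorem karoubiEmbedding_map_capDiff (x y : ℕ) (hx hy) :
    (karoubiEmbedding _).map (capDiff k x (x + 1 : ℕ) hx y (y + 1 : ℕ) hy) = dB k x y := by
  apply Karoubi.hom_ext
  refine congrArg (Mat_.embedding (DiagCat k)).map ?_
  exact congrArg (idemB k (x + 1) (y + 1) ≫ ·) (karoubi_capIn_f (ev := capK k) rfl _ _)

theorem karoubiEmbedding_map_cupDiff (x y : ℕ) (hx hy) :
    (karoubiEmbedding _).map (cupDiff k x (x + 1 : ℕ) hx y (y + 1 : ℕ) hy) = dBstar k x y := by
  apply Karoubi.hom_ext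
  refine congrArg (Mat_.embedding (DiagCat k)).map ?_
  exact (congrArg (· ≫ idemBstar k (x + 1) (y + 1))
    (karoubi_cupIn_f (coev := cupK k) rfl _ _)).trans (Category.assoc _ _ _)

/-- In this action the sign of the antisymmetrizer of the downward strands is absorbed in the
crossing. -/
theorem exists_quad_capDiff : Nonempty (Quad
    (fun x y x' y' => powObj (symUp_idempotents k).idem x ⊗ (powObj (antiDown_idempotents k).idem y ⊗
      (powObj (symUp_idempotents k).idem x' ⊗
        (powObj (antiDown_idempotents k).idem y' ⊗ 𝟙_ (Karoubi (DiagCat k))))))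
    (fun x X hx y Y hy _ _ => (α_ _ _ _).inv ≫ capDiff k x X hx y Y hy ▷ _ ≫ (α_ _ _ _).hom)
    (fun x y x' X' hx' y' Y' hy' => powObj (symUp_idempotents k).idem x ◁
      (powObj (antiDown_idempotents k).idem y ◁
        ((α_ _ _ _).inv ≫ capDiff k x' X' hx' y' Y' hy' ▷ 𝟙_ _ ≫ (α_ _ _ _).hom))) 0) := by
  let tP := (symUp_idempotents k).tower (T := karoubiAction k) (s := (khovanov k).karoubi.s) rfl
    fun _ => rfl
  let tQ := (antiDown_idempotents k).tower (T := karoubiAction k) (t := -(khovanov k).karoubi.t) rfl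
    fun _ => by rw [onFront_neg, neg_neg]; rfl
  have h x X hx y Y hy Z : capLeft tP tQ x X hx y Y hy Z =
      (α_ _ _ _).inv ≫ capDiff k x X hx y Y hy ▷ Z ≫ (α_ _ _ _).hom :=
    cap_word (capK k) ((symUp_idempotents k).incl x X hx) ((antiDown_idempotents k).incl y Y hy) Z
  have q := exists_quad (divisible_karoubi (divisible_diagCat k)) tP tQ (𝟙_ _)
  simp only [h] at q
  exact q

/-- The cups become caps in the opposite category. When all crossings are negated, the upward
strands are symmetrized and the downward ones antisymmetrized, as they are for the caps. The
indices are negated, since the differential raises them. -/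
theorem exists_quad_cupDiff : Nonempty (Quad
    (fun x y x' y' => powObj (antiUp_idempotents k).idem (-x) ⊗
      (powObj (symDown_idempotents k).idem (-y) ⊗ (powObj (antiUp_idempotents k).idem (-x') ⊗
        (powObj (symDown_idempotents k).idem (-y') ⊗ 𝟙_ (Karoubi (DiagCat k))))))
    (fun x X hx y Y hy _ _ => (α_ _ _ _).inv ≫
      cupDiff k (-X) (-x) (by lia) (-Y) (-y) (by lia) ▷ _ ≫ (α_ _ _ _).hom)
    (fun x y x' X' hx' y' Y' hy' => powObj (antiUp_idempotents k).idem (-x) ◁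
      (powObj (symDown_idempotents k).idem (-y) ◁ ((α_ _ _ _).inv ≫
        cupDiff k (-X') (-x') (by lia) (-Y') (-y') (by lia) ▷ 𝟙_ _ ≫ (α_ _ _ _).hom))) 1) := by
  let tP := ((antiUp_idempotents k).tower (T := (karoubiAction k).neg)
    (s := -(khovanov k).karoubi.s) rfl fun _ => (onFront_neg _ _).symm).op
      fun _ _ _ _ _ _ => whisker_whisker_comp _ _
  let tQ := ((symDown_idempotents k).tower (T := (karoubiAction k).neg)
    (t := (khovanov k).karoubi.t) rfl fun _ => rfl).op fun _ _ _ _ _ _ => whisker_whisker_comp _ _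
  have hC : Divisible (Karoubi (DiagCat k))ᵒᵖ := fun X n hn => by
    obtain ⟨g, hg⟩ := divisible_karoubi (divisible_diagCat k) X.unop n hn
    exact ⟨g.op, Quiver.Hom.unop_inj (by simpa using hg)⟩
  have h x X hx y Y hy Z : (capLeft tP tQ x X hx y Y hy Z).unop =
      (α_ _ _ _).inv ≫ cupDiff k x X hx y Y hy ▷ Z.unop ≫ (α_ _ _ _).hom :=
    cup_word (cupK k) ((antiUp_idempotents k).proj x X hx) ((symDown_idempotents k).proj y Y hy) _
  obtain ⟨q⟩ := exists_quad hC tP tQ (Opposite.op (𝟙_ _))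
  exact ⟨q.dual.congr (fun _ _ _ _ _ _ _ _ => h _ _ _ _ _ _ _) fun x y _ _ _ _ _ _ =>
    congrArg (fun f => powObj (antiUp_idempotents k).idem (-x) ◁
      (powObj (symDown_idempotents k).idem (-y) ◁ f)) (h _ _ _ _ _ _ _)⟩

end
end Heis
namespace Heis

/-! ### The tensor products as Koszul families -/

section

open Idempotents

variable (k : Type u) [Field k] [CharZero k]

/-- The word `P^{(x)} Q^{(y)^t}`, zero unless `x` and `y` are nonnegative. -/
abbrev wordB (x y : ℤ) : Karoubi (DiagCat k) :=
  powObj (symUp_idempotents k).idem x ⊗ powObj (antiDown_idempotents k).idem y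

/-- The word `P^{(x)^t} Q^{(y)}`, zero unless `x` and `y` are nonnegative. -/
abbrev wordBstar (x y : ℤ) : Karoubi (DiagCat k) :=
  powObj (antiUp_idempotents k).idem x ⊗ powObj (symDown_idempotents k).idem y

theorem isZero_wordB (x y : ℤ) (h : ¬(0 ≤ x ∧ 0 ≤ y)) : IsZero (wordB k x y) := by
  rw [not_and_or, not_le, not_le] at h
  obtain h | h := h
  · exact isZero_tensor (isZero_powObj _ _ h) _
  · exact isZero_tensor' (isZero_powObj _ _ h) _

theorem isZero_wordBstar (x y : ℤ) (h : ¬(0 ≤ x ∧ 0 ≤ y)) : IsZero (wordBstar k x y) := by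
  rw [not_and_or, not_le, not_le] at h
  obtain h | h := h
  · exact isZero_tensor (isZero_powObj _ _ h) _
  · exact isZero_tensor' (isZero_powObj _ _ h) _

variable {k}

/-- The `j`-th nonzero term of the complex `B k c`. -/
noncomputable def isoBNat (c x y n : ℤ) (j : ℕ) (hx : x = (c.toNat + j : ℕ))
    (hy : y = ((-c).toNat + j : ℕ)) (hn : n = -y) :
    (karoubiEmbedding _).obj (wordB k x y) ≅ (B k c).X n :=
  eqToIso (by subst hx hy; rfl) ≪≫ (HomologicalComplex.extendXIso _ _
    (show (ComplexShape.embeddingUpIntLE (-((-c).toNat : ℤ))).f j = n by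
      change -((-c).toNat : ℤ) - (j : ℤ) = n; lia)).symm

theorem isoBNat_hom (c n : ℤ) (j : ℕ) (hn : n = -(((-c).toNat + j : ℕ) : ℤ)) :
    (isoBNat (k := k) c (c.toNat + j : ℕ) ((-c).toNat + j : ℕ) n j rfl rfl hn).hom =
      (HomologicalComplex.extendXIso (ChainComplex.of
        (fun n => PQt k (c.toNat + n) ((-c).toNat + n))
        (fun n => dB k (c.toNat + n) ((-c).toNat + n))
        (fun n => dB_comp k (c.toNat + n) ((-c).toNat + n)))
          (ComplexShape.embeddingUpIntLE (-((-c).toNat : ℤ))) (i := j) (by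
            change -((-c).toNat : ℤ) - (j : ℤ) = n; lia)).inv :=
  Category.id_comp _

/-- The terms of the complex `B k c`. -/
noncomputable def isoB (c x y n : ℤ) (hc : x - y = c) (hn : n = -y) :
    (karoubiEmbedding _).obj (wordB k x y) ≅ (B k c).X n :=
  if h : 0 ≤ x ∧ 0 ≤ y then
    isoBNat c x y n (x - c.toNat).toNat (by lia) (by lia) hn
  else ((karoubiEmbedding _).map_isZero (isZero_wordB k x y h)).iso
    (HomologicalComplex.isZero_extend_X _ _ _ fun j hj => h (by
      change -((-c).toNat : ℤ) - (j : ℤ) = n at hj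
      lia))

theorem isoB_eq (c x y n : ℤ) (hc : x - y = c) (hn : n = -y) (j : ℕ) (hx : x = (c.toNat + j : ℕ))
    (hy : y = ((-c).toNat + j : ℕ)) :
    isoB (k := k) c x y n hc hn = isoBNat c x y n j hx hy hn := by
  obtain rfl : j = (x - c.toNat).toNat := by lia
  exact dif_pos (by lia)

theorem isoB_d (c x X y Y n o : ℤ) (hx : x + 1 = X) (hy : y + 1 = Y) (hc : x - y = c)
    (hn : n = -Y) (ho : o = -y) :
    (isoB (k := k) c X Y n (by lia) hn).hom ≫ (B k c).d n o =
      (karoubiEmbedding _).map (capDiff k x X hx y Y hy) ≫ (isoB c x y o hc ho).hom := by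
  by_cases h : 0 ≤ x ∧ 0 ≤ y
  · obtain ⟨j, hj⟩ : ∃ j : ℕ, x = (c.toNat + j : ℕ) := ⟨(x - c.toNat).toNat, by lia⟩
    obtain hj' : y = ((-c).toNat + j : ℕ) := by lia
    rw [isoB_eq c X Y n _ hn (j + 1) (by lia) (by lia), isoB_eq c x y o hc ho j hj hj']
    obtain rfl : X = (c.toNat + j + 1 : ℕ) := by lia
    obtain rfl : Y = ((-c).toNat + j + 1 : ℕ) := by lia
    subst hj hj'
    have hn' : (ComplexShape.embeddingUpIntLE (-((-c).toNat : ℤ))).f (j + 1) = n := by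
      change -((-c).toNat : ℤ) - ((j + 1 : ℕ) : ℤ) = n
      lia
    have ho' : (ComplexShape.embeddingUpIntLE (-((-c).toNat : ℤ))).f j = o := by
      change -((-c).toNat : ℤ) - (j : ℤ) = o
      lia
    have e := HomologicalComplex.extend_d_eq
      (ChainComplex.of (fun n => PQt k (c.toNat + n) ((-c).toNat + n))
        (fun n => dB k (c.toNat + n) ((-c).toNat + n))
        (fun n => dB_comp k (c.toNat + n) ((-c).toNat + n))) _ hn' ho'
    have e' := ChainComplex.of_d (fun n => PQt k (c.toNat + n) ((-c).toNat + n))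
        (fun n => dB k (c.toNat + n) ((-c).toNat + n)) j
    refine (congrArg (· ≫ _) (isoBNat_hom c n (j + 1) hn)).trans (Eq.trans ?_ (congrArg₂ (· ≫ ·)
      (karoubiEmbedding_map_capDiff k _ _ hx hy) (isoBNat_hom c o j ho)).symm)
    exact (Iso.inv_comp_eq _).2 (e.trans (congrArg (fun f => _ ≫ f ≫ _) e'))
  · exact (((karoubiEmbedding _).map_isZero (isZero_wordB k x y h)).of_iso
      (isoB c x y o hc ho).symm).eq_of_tgt _ _

/-- The `j`-th nonzero term of the complex `Bstar k c`. -/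
noncomputable def isoBstarNat (c x y n : ℤ) (j : ℕ) (hx : x = ((-c).toNat + j : ℕ))
    (hy : y = (c.toNat + j : ℕ)) (hn : n = x) :
    (karoubiEmbedding _).obj (wordBstar k x y) ≅ (Bstar k c).X n :=
  eqToIso (by subst hx hy; rfl) ≪≫ (HomologicalComplex.extendXIso _ _
    (show (ComplexShape.embeddingUpIntGE ((-c).toNat : ℤ)).f j = n by
      change ((-c).toNat : ℤ) + (j : ℤ) = n; lia)).symm

theorem isoBstarNat_hom (c n : ℤ) (j : ℕ) (hn : n = (((-c).toNat + j : ℕ) : ℤ)) :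
    (isoBstarNat (k := k) c ((-c).toNat + j : ℕ) (c.toNat + j : ℕ) n j rfl rfl hn).hom =
      (HomologicalComplex.extendXIso (CochainComplex.of
        (fun n => PtQ k ((-c).toNat + n) (c.toNat + n))
        (fun n => dBstar k ((-c).toNat + n) (c.toNat + n))
        (fun n => dBstar_comp k ((-c).toNat + n) (c.toNat + n)))
          (ComplexShape.embeddingUpIntGE ((-c).toNat : ℤ)) (i := j) (by
            change ((-c).toNat : ℤ) + (j : ℤ) = n; lia)).inv :=
  Category.id_comp _

/-- The terms of the complex `Bstar k c`. -/
noncomputable def isoBstar (c x y n : ℤ) (hc : y - x = c) (hn : n = x) :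
    (karoubiEmbedding _).obj (wordBstar k x y) ≅ (Bstar k c).X n :=
  if h : 0 ≤ x ∧ 0 ≤ y then
    isoBstarNat c x y n (x - (-c).toNat).toNat (by lia) (by lia) hn
  else ((karoubiEmbedding _).map_isZero (isZero_wordBstar k x y h)).iso
    (HomologicalComplex.isZero_extend_X _ _ _ fun j hj => h (by
      change ((-c).toNat : ℤ) + (j : ℤ) = n at hj
      lia))

theorem isoBstar_eq (c x y n : ℤ) (hc : y - x = c) (hn : n = x) (j : ℕ) (hx : x = ((-c).toNat + j : ℕ))
    (hy : y = (c.toNat + j : ℕ)) :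
    isoBstar (k := k) c x y n hc hn = isoBstarNat c x y n j hx hy hn := by
  obtain rfl : j = (x - (-c).toNat).toNat := by lia
  exact dif_pos (by lia)

theorem isoBstar_d (c x X y Y n o : ℤ) (hx : x + 1 = X) (hy : y + 1 = Y) (hc : y - x = c)
    (hn : n = x) (ho : o = X) :
    (isoBstar (k := k) c x y n hc hn).hom ≫ (Bstar k c).d n o =
      (karoubiEmbedding _).map (cupDiff k x X hx y Y hy) ≫
        (isoBstar c X Y o (by lia) ho).hom := by
  by_cases h : 0 ≤ x ∧ 0 ≤ y
  · obtain ⟨j, hj⟩ : ∃ j : ℕ, x = ((-c).toNat + j : ℕ) := ⟨(x - (-c).toNat).toNat, by lia⟩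
    obtain hj' : y = (c.toNat + j : ℕ) := by lia
    rw [isoBstar_eq c X Y o _ ho (j + 1) (by lia) (by lia), isoBstar_eq c x y n hc hn j hj hj']
    obtain rfl : X = ((-c).toNat + j + 1 : ℕ) := by lia
    obtain rfl : Y = (c.toNat + j + 1 : ℕ) := by lia
    subst hj hj'
    have hn' : (ComplexShape.embeddingUpIntGE ((-c).toNat : ℤ)).f j = n := by
      change ((-c).toNat : ℤ) + (j : ℤ) = n
      lia
    have ho' : (ComplexShape.embeddingUpIntGE ((-c).toNat : ℤ)).f (j + 1) = o := by
      change ((-c).toNat : ℤ) + ((j + 1 : ℕ) : ℤ) = o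
      lia
    have e := HomologicalComplex.extend_d_eq
      (CochainComplex.of (fun n => PtQ k ((-c).toNat + n) (c.toNat + n))
        (fun n => dBstar k ((-c).toNat + n) (c.toNat + n))
        (fun n => dBstar_comp k ((-c).toNat + n) (c.toNat + n))) _ hn' ho'
    have e' := CochainComplex.of_d (fun n => PtQ k ((-c).toNat + n) (c.toNat + n))
        (fun n => dBstar k ((-c).toNat + n) (c.toNat + n)) j
    refine (congrArg (· ≫ _) (isoBstarNat_hom c n j hn)).trans (Eq.trans ?_ (congrArg₂ (· ≫ ·)
      (karoubiEmbedding_map_cupDiff k _ _ hx hy) (isoBstarNat_hom c o (j + 1) ho)).symm)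
    exact (Iso.inv_comp_eq _).2 (e.trans (congrArg (fun f => _ ≫ f ≫ _) e'))
  · exact ((karoubiEmbedding _).map_isZero (isZero_wordBstar k x y h)).eq_of_src _ _

/-- The complexes `B` are the diagonals of the words `wordB`. -/
noncomputable def diagonalsB : Diagonals
    (fun x y => (karoubiEmbedding (DiagCat k)).obj (wordB k x y))
    (fun x X hx y Y hy => (karoubiEmbedding _).map (capDiff k x X hx y Y hy)) (fun _ => 0) (B k) where
  iso c x y n h := isoB c x y n h.1 (by lia)
  iso_d c x X y Y n o hx hy hn h := isoB_d c x X y Y n o hx hy (by lia) (by lia) (by lia)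

/-- The complexes `Bstar` are the diagonals of the words `wordBstar`, with reversed indices. -/
noncomputable def diagonalsBstar : Diagonals
    (fun x y => (karoubiEmbedding (DiagCat k)).obj (wordBstar k (-x) (-y)))
    (fun x X hx y Y hy => (karoubiEmbedding _).map
      (cupDiff k (-X) (-x) (by lia) (-Y) (-y) (by lia))) (fun c => c) (Bstar k) where
  iso c x y n h := isoBstar c (-x) (-y) n (by lia) (by lia)
  iso_d c x X y Y n o hx hy hn h :=
    isoBstar_d c (-X) (-x) (-Y) (-y) n o (by lia) (by lia) (by lia) (by lia) (by lia)

/-- The tensor products `B c ⊗ B (s - c)` form a Koszul family. -/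
theorem koszul_tensorComplex_B (s : ℤ) :
    Nonempty (Koszul (fun c => tensorComplex (B k c) (B k (s - c))) s) := by
  obtain ⟨q⟩ := exists_quad_capDiff k
  have K := koszulOfQuad q (diagonalsB (k := k)) s 0 (fun _ => rfl) fun n =>
    ⟨|n| + |s|, fun c x y x' y' h1 h2 h3 h4 => by
      by_contra! h
      have hx := le_of_not_gt (mt (isZero_powObj _ x) h.1)
      have hy := le_of_not_gt (mt (isZero_powObj _ y) h.2.1)
      have hx' := le_of_not_gt (mt (isZero_powObj _ x') h.2.2.1)
      have hy' := le_of_not_gt (mt (isZero_powObj _ y') h.2.2.2)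
      have := neg_abs_le n
      have := le_abs_self s
      have := abs_nonneg s
      lia⟩
  rw [mul_zero, add_zero] at K
  exact ⟨K⟩

/-- The tensor products `Bstar c ⊗ Bstar (s - c)` form a Koszul family. -/
theorem koszul_tensorComplex_Bstar (s : ℤ) :
    Nonempty (Koszul (fun c => tensorComplex (Bstar k c) (Bstar k (s - c))) (s + 2)) := by
  obtain ⟨q⟩ := exists_quad_cupDiff k
  have K := koszulOfQuad (P := fun x => powObj (antiUp_idempotents k).idem (-x))
      (Q := fun y => powObj (symDown_idempotents k).idem (-y)) q (diagonalsBstar (k := k)) s s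
      (fun c => by lia) fun n =>
    ⟨|n| + |s|, fun c x y x' y' h1 h2 h3 h4 => by
      by_contra! h
      have hx := le_of_not_gt (mt (isZero_powObj _ (-x)) h.1)
      have hy := le_of_not_gt (mt (isZero_powObj _ (-y)) h.2.1)
      have hx' := le_of_not_gt (mt (isZero_powObj _ (-x')) h.2.2.1)
      have hy' := le_of_not_gt (mt (isZero_powObj _ (-y')) h.2.2.2)
      have := le_abs_self n
      have := le_abs_self s
      have := abs_nonneg s
      lia⟩
  exact ⟨K⟩

end
end Heis
namespace Heis

/-! ### Null objects and isomorphisms in the homotopy category -/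

theorem divisible_H (k : Type u) [Field k] [CharZero k] : Divisible (H k) :=
  divisible_karoubi (divisible_mat (divisible_diagCat k))

theorem nonempty_iso_shift_neg_one {D : Type*} [Category D] [HasShift D ℤ] {X Y : D}
    (h : Nonempty (Y ≅ X⟦(1 : ℤ)⟧)) : Nonempty (X ≅ Y⟦(-1 : ℤ)⟧) :=
  h.map fun e => (shiftShiftNeg X (1 : ℤ)).symm ≪≫ (shiftFunctor D (-1 : ℤ)).mapIso e.symm

variable (k : Type u) [Field k] [CharZero k] (a b : ℤ)

instance : HasBinaryBiproducts (H k) := hasBinaryBiproducts_of_finite_biproducts _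

theorem isZero_tensorComplex_B : IsZero (toK (tensorComplex (B k (a - 1)) (B k a))) := by
  obtain ⟨K⟩ := koszul_tensorComplex_B (k := k) (a + a - 1)
  have h := K.isZero (divisible_H k) (a - 1) (by lia)
  rw [show a + a - 1 - (a - 1) = a by lia] at h
  exact h

theorem isZero_tensorComplex_Bstar :
    IsZero (toK (tensorComplex (Bstar k (a + 1)) (Bstar k a))) := by
  obtain ⟨K⟩ := koszul_tensorComplex_Bstar (k := k) (a + a + 1)
  have h := K.isZero (divisible_H k) (a + 1) (by lia)
  rw [show a + a + 1 - (a + 1) = a by lia] at h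
  exact h

theorem tensorComplex_B_iso (hab : a < b) :
    Nonempty (toK (tensorComplex (B k (a - 1)) (B k b)) ≅
      (toK (tensorComplex (B k (b - 1)) (B k a)))⟦(1 : ℤ)⟧) := by
  obtain ⟨K⟩ := koszul_tensorComplex_B (k := k) (a + b - 1)
  have h := K.iso (divisible_H k) (a - 1) (b - 1) (by lia) (by lia)
  rw [show a + b - 1 - (a - 1) = b by lia, show a + b - 1 - (b - 1) = a by lia] at h
  exact h

theorem tensorComplex_Bstar_iso (hab : a < b) :
    Nonempty (toK (tensorComplex (Bstar k (a + 1)) (Bstar k b)) ≅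
      (toK (tensorComplex (Bstar k (b + 1)) (Bstar k a)))⟦(1 : ℤ)⟧) := by
  obtain ⟨K⟩ := koszul_tensorComplex_Bstar (k := k) (a + b + 1)
  have h := K.iso (divisible_H k) (a + 1) (b + 1) (by lia) (by lia)
  rw [show a + b + 1 - (a + 1) = b by lia, show a + b + 1 - (b + 1) = a by lia] at h
  exact h

end Heis

theorem mainTheorem2 (k : Type*) [Field k] [CharZero k] (a b : ℤ) :
    IsZero (Heis.toK (Heis.tensorComplex (Heis.B k (a - 1)) (Heis.B k a))) ∧
    (a < b → Nonempty (Heis.toK (Heis.tensorComplex (Heis.B k (a - 1)) (Heis.B k b)) ≅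
      (Heis.toK (Heis.tensorComplex (Heis.B k (b - 1)) (Heis.B k a)))⟦(1 : ℤ)⟧)) ∧
    (b < a → Nonempty (Heis.toK (Heis.tensorComplex (Heis.B k (a - 1)) (Heis.B k b)) ≅
      (Heis.toK (Heis.tensorComplex (Heis.B k (b - 1)) (Heis.B k a)))⟦(-1 : ℤ)⟧)) ∧
    IsZero (Heis.toK (Heis.tensorComplex (Heis.Bstar k (a + 1)) (Heis.Bstar k a))) ∧
    (a < b → Nonempty (Heis.toK (Heis.tensorComplex (Heis.Bstar k (a + 1)) (Heis.Bstar k b)) ≅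
      (Heis.toK (Heis.tensorComplex (Heis.Bstar k (b + 1)) (Heis.Bstar k a)))⟦(1 : ℤ)⟧)) ∧
    (b < a → Nonempty (Heis.toK (Heis.tensorComplex (Heis.Bstar k (a + 1)) (Heis.Bstar k b)) ≅
      (Heis.toK (Heis.tensorComplex (Heis.Bstar k (b + 1)) (Heis.Bstar k a)))⟦(-1 : ℤ)⟧)) :=
  ⟨Heis.isZero_tensorComplex_B k a, Heis.tensorComplex_B_iso k a b,
    fun h => Heis.nonempty_iso_shift_neg_one (Heis.tensorComplex_B_iso k b a h),
    Heis.isZero_tensorComplex_Bstar k a, Heis.tensorComplex_Bstar_iso k a b,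
    fun h => Heis.nonempty_iso_shift_neg_one (Heis.tensorComplex_Bstar_iso k b a h)⟩
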